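/- \textbf{Setting.} Let $V=\mathbb C^2$ be the standard module of $\mathrm{SL}_2(\mathbb C)$ and let $N\unlhd G\le \mathrm{SL}_2(\mathbb C)$ be finite groups such that either $N=G$, or $(N,G)$ is, up to conjugation in $\mathrm{SL}_2(\mathbb C)$, one of the McKay--Slodowy pairs $D_n\lhd D_{2n}$ $(n\ge2)$, $C_{2n}\lhd D_n$ $(n\ge 2)$, $C_{2n}\lhd D_{2n}$ $(n\ge1)$, $T\lhd O$, $D_2\lhd T$; here $C_m$ is cyclic of order $m$, $D_n$ is binary dihedral of order $4n$, and $T$, $O$ are the binary tetrahedral and octahedral groups. Let $\{\phi_i\}$ be the irreducible $N$-modules, $\{\check\rho_i\}$ the pairwise inequivalent restrictions to $N$ of the irreducible $G$-modules, and $\{\hat\phi_i\}$ the pairwise inequivalent $G$-modules induced by the irreducible $N$-modules. Consider either the restricted realization, with $V|_N\otimes\check\rho_j=\bigoplus_i\check\rho_i^{\,b_{ji}}$, affine Cartan matrix $A=(A_{ij})=2I-(b_{ij})^T$, special index $0$ given by the trivial module, and multiplicities $x_k^j$ defined by $S^k(V)|_N=\bigoplus_j\check\rho_j^{\,x_k^j}$;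 or the induced realization, with $V\otimes\hat\phi_j=\bigoplus_i\hat\phi_i^{\,d_{ji}}$, $A=2I-(d_{ij})^T$, index $0$ given by $\mathrm{Ind}_N^G 1$, and $x_k^j$ defined by $\mathrm{Ind}_N^G(S^k(V)|_N)=\bigoplus_j\hat\phi_j^{\,x_k^j}$. (For $N=G$ both are the McKay realization.) Let $\alpha_i$ be the simple roots, $s_i\alpha_j=\alpha_j-A_{ij}\alpha_i$, and let $X(t)=\sum_{k\ge0}\big(\sum_j x_k^j\alpha_j\big)t^k$. Let $\mathfrak g$ be the simple Lie algebra whose Cartan matrix is $A$ with row and column $0$ removed, $h$ its Coxeter number (the order of a Coxeter element; $h=1$ if $N=G=1$), and put $a=2\max_i\dim\phi_i$, $b=h+2-a$. \textbf{Proposition.} (1) $h=\sum_i\dim\check\rho_i$, except for the pairs $C_{2n}\lhd D_{2n}$ (those with $|G:N|=4$), where $\sum_i\dim\check\rho_i=h+1$. (2) $b$ is a nonnegative integer and $ab=2|N|$; in particular $ab=2|G|$ if $N=G$. (3) Assume that $|N|$ is even (that is, exclude $N=G$ cyclic of odd order). Then $g=h/2$ is an integer, the simple roots $\alpha_i$,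 $i\ne 0$, can be divided into two sets $\Pi_1,\Pi_2$ of mutually orthogonal roots with $\alpha_0$ orthogonal to $\Pi_2$, and $A$ is symmetrizable. For any such $\Pi_1,\Pi_2$ let $\mathcal C_r$ be the product of the reflections in the roots of $\Pi_r$, $\mathcal C=\mathcal C_2\mathcal C_1$, and $\mathcal C^{(k)}=\mathcal C_k\cdots\mathcal C_2\mathcal C_1$, where $\mathcal C_i=\mathcal C_1$ for odd $i$ and $\mathcal C_i=\mathcal C_2$ for even $i$. Put $c_0=1$, $c_i=2(\mathcal C^i\alpha_0,\alpha_0)/(\alpha_0,\alpha_0)$ for $0<i<g$, where $(\cdot,\cdot)$ is any symmetric bilinear form with $(\alpha_i,\alpha_i)>0$ and $2(\alpha_i,\alpha_j)=A_{ij}(\alpha_i,\alpha_i)$, and $c_g=-1$, $c_{-1}=c_{g+1}=0$. Put $z_0=z_h=\alpha_0$, $z_k=\mathcal C^{(k)}\alpha_0-\mathcal C^{(k-1)}\alpha_0$ for $0<k<h$, and $z(t)=\sum_{k=0}^h z_kt^k$. Then $$\sum_{i=0}^{g+1}(c_i-c_{i-1})t^{2i}=(1-t^a)(1-t^b)\qquad\text{and}\qquad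 X(t)=\frac{z(t)}{(1-t^a)(1-t^b)}.$$ -/

import Mathlib

noncomputable section

namespace McKaySlodowy

/-! ### Finite subgroups of `SL₂(ℂ)` -/

/-- The group `SL₂(ℂ)`. -/
abbrev SL2 : Type := Matrix.SpecialLinearGroup (Fin 2) ℂ

/-- The diagonal matrix `diag(e^{iθ}, e^{-iθ})`. -/
def rot (θ : ℝ) : SL2 :=
  ⟨!![Complex.exp (θ * Complex.I), 0; 0, Complex.exp (-(θ * Complex.I))], by
    rw [Matrix.det_fin_two_of, ← Complex.exp_add]
    simp⟩

/-- The quaternion `j`. -/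
def quatJ : SL2 := ⟨!![0, 1; -1, 0], by simp [Matrix.det_fin_two_of]⟩

/-- The quaternion `(1 + i + j + k) / 2`, where `i = diag(√-1, -√-1)` and `k = i j`. -/
def quatW : SL2 :=
  ⟨!![(1 + Complex.I) / 2, (1 + Complex.I) / 2; (-1 + Complex.I) / 2, (1 - Complex.I) / 2], by
    rw [Matrix.det_fin_two_of]
    ring_nf
    rw [Complex.I_sq]
    norm_num⟩

/-- The cyclic group `C_m` of order `m`. -/
def cyclicSubgroup (m : ℕ) : Subgroup SL2 := Subgroup.zpowers (rot (2 * Real.pi / m))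

/-- The binary dihedral group `D_n` of order `4n`. -/
def binaryDihedral (n : ℕ) : Subgroup SL2 := Subgroup.closure {rot (Real.pi / n), quatJ}

/-- The binary tetrahedral group `T` of order `24`. -/
def binaryTetrahedral : Subgroup SL2 := Subgroup.closure {rot (Real.pi / 2), quatJ, quatW}

/-- The binary octahedral group `O` of order `48`. -/
def binaryOctahedral : Subgroup SL2 := Subgroup.closure {rot (Real.pi / 4), quatJ, quatW}

/-- The pair `N ≤ G` is conjugate in `SL₂(ℂ)` to the pair `N₀ ≤ G₀`. -/
def IsConjPair (G : Subgroup SL2) (N : Subgroup G) (G₀ N₀ : Subgroup SL2) : Prop :=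
  ∃ g : SL2, G.map (MulAut.conj g).toMonoidHom = G₀ ∧
    (N.map G.subtype).map (MulAut.conj g).toMonoidHom = N₀

/-- The pairs `N ⊴ G` of the McKay–Slodowy correspondence: either `N = G`, or, up to conjugation,
one of `D_n ⊲ D_{2n}` (`n ≥ 2`), `C_{2n} ⊲ D_n` (`n ≥ 2`), `C_{2n} ⊲ D_{2n}` (`n ≥ 1`),
`T ⊲ O`, `D_2 ⊲ T`. -/
def IsDistinguishedPair (G : Subgroup SL2) (N : Subgroup G) : Prop :=
  N = ⊤ ∨
  (∃ n : ℕ, 2 ≤ n ∧ IsConjPair G N (binaryDihedral (2 * n)) (binaryDihedral n)) ∨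
  (∃ n : ℕ, 2 ≤ n ∧ IsConjPair G N (binaryDihedral n) (cyclicSubgroup (2 * n))) ∨
  (∃ n : ℕ, 1 ≤ n ∧ IsConjPair G N (binaryDihedral (2 * n)) (cyclicSubgroup (2 * n))) ∨
  IsConjPair G N binaryOctahedral binaryTetrahedral ∨
  IsConjPair G N binaryTetrahedral (binaryDihedral 2)

/-! ### The modules `V` and `S^k(V)` -/

/-- The standard module `V = ℂ²`. -/
def stdRep : Representation ℂ SL2 (Fin 2 → ℂ) where
  toFun g := (g : Matrix (Fin 2) (Fin 2) ℂ).mulVecLin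
  map_one' := by
    ext
    simp
  map_mul' g h := by
    rw [Matrix.SpecialLinearGroup.coe_mul, Matrix.mulVecLin_mul]
    rfl

/-- `SL₂(ℂ)` acting on the symmetric algebra `S(V) = ℂ[X₀, X₁]`, where `X₀, X₁` is the standard
basis of `V`: so `g X_j = ∑ i, g i j X_i`. -/
def symAlg : Representation ℂ SL2 (MvPolynomial (Fin 2) ℂ) where
  toFun g := (MvPolynomial.aeval fun j : Fin 2 =>
    ∑ i : Fin 2, MvPolynomial.C (g.1 i j) * MvPolynomial.X (R := ℂ) i).toLinearMap
  map_one' := by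
    have : (MvPolynomial.aeval fun j : Fin 2 => ∑ i : Fin 2,
        MvPolynomial.C ((1 : SL2).1 i j) * MvPolynomial.X (R := ℂ) i) = AlgHom.id ℂ _ := by
      apply MvPolynomial.algHom_ext
      intro j
      fin_cases j <;> simp
    rw [this]
    rfl
  map_mul' g h := by
    have : (MvPolynomial.aeval fun j : Fin 2 => ∑ i : Fin 2,
        MvPolynomial.C ((g * h).1 i j) * MvPolynomial.X (R := ℂ) i) =
        (MvPolynomial.aeval fun j : Fin 2 => ∑ i : Fin 2,
          MvPolynomial.C (g.1 i j) * MvPolynomial.X (R := ℂ) i).comp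
        (MvPolynomial.aeval fun j : Fin 2 => ∑ i : Fin 2,
          MvPolynomial.C (h.1 i j) * MvPolynomial.X (R := ℂ) i) := by
      apply MvPolynomial.algHom_ext
      intro j
      simp [Matrix.mul_apply, Fin.sum_univ_two, MvPolynomial.algebraMap_eq]
      ring
    rw [this]
    rfl

/-- `SL₂(ℂ)` acts by degree preserving maps. -/
lemma symAlg_mem (k : ℕ) (g : SL2) :
    MvPolynomial.homogeneousSubmodule (Fin 2) ℂ k ≤
      (MvPolynomial.homogeneousSubmodule (Fin 2) ℂ k).comap (symAlg g) := by
  intro p hp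
  have h : ∀ j : Fin 2, (∑ i : Fin 2,
      MvPolynomial.C (g.1 i j) * MvPolynomial.X (R := ℂ) i).IsHomogeneous 1 := fun j =>
    MvPolynomial.IsHomogeneous.sum _ _ _ fun i _ => by
      simpa using (MvPolynomial.isHomogeneous_C (Fin 2) (g.1 i j)).mul
        (MvPolynomial.isHomogeneous_X ℂ i)
  have := MvPolynomial.IsHomogeneous.aeval
    ((MvPolynomial.mem_homogeneousSubmodule k p).1 hp) _ h
  rw [one_mul] at this
  exact this

/-- The `k`-th symmetric power `S^k(V)`: homogeneous polynomials of degree `k`. -/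
def symPow (k : ℕ) :
    Representation ℂ SL2 (MvPolynomial.homogeneousSubmodule (Fin 2) ℂ k) :=
  symAlg.subrepresentation _ (symAlg_mem k)

/-! ### Restricted and induced modules, multiplicities -/

/-- The restriction of a module of `G` to its subgroup `N`. -/
abbrev res {G : Type*} [Group G] (N : Subgroup G) {W : Type*} [AddCommGroup W] [Module ℂ W]
    (ρ : Representation ℂ G W) : Representation ℂ N W := ρ.comp N.subtype

/-- The module of `G` induced by a module of its subgroup `N`. -/
abbrev ind {G : Type*} [Group G] (N : Subgroup G) {W : Type*} [AddCommGroup W] [Module ℂ W]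
    (φ : Representation ℂ N W) : Representation ℂ G (Representation.IndV N.subtype φ) :=
  Representation.ind N.subtype φ

/-- The module `τ` is isomorphic to `⨁ i, μ i ^ m i`. -/
def DecomposesAs {H T ι : Type*} [Group H] [AddCommGroup T] [Module ℂ T]
    (τ : Representation ℂ H T) {M : ι → Type*} [∀ i, AddCommGroup (M i)] [∀ i, Module ℂ (M i)]
    (μ : ∀ i, Representation ℂ H (M i)) (m : ι → ℕ) : Prop :=
  Nonempty (τ.Equiv
    (Representation.directSum fun p : (Σ i : ι, Fin (m i)) => μ p.1))

/-- `φ` is a complete list without repetition of the irreducible modules of `H`. -/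
structure IsIrrepList {H κ : Type*} [Group H] {e : κ → ℕ}
    (φ : ∀ i, Representation ℂ H (Fin (e i) → ℂ)) : Prop where
  irreducible : ∀ i, (φ i).IsIrreducible
  inequivalent : ∀ i j, Nonempty ((φ i).Equiv (φ j)) → i = j
  complete : ∀ (n : ℕ) (π : Representation ℂ H (Fin n → ℂ)), π.IsIrreducible →
    ∃ i, Nonempty (π.Equiv (φ i))

/-- `ρ` is a list of irreducible modules of `G` whose restrictions to `N` form a complete list
without repetition of the restrictions to `N` of irreducible modules of `G`. -/
structure IsRestrictionList {G κ : Type*} [Group G] (N : Subgroup G) {d : κ → ℕ}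
    (ρ : ∀ i, Representation ℂ G (Fin (d i) → ℂ)) : Prop where
  irreducible : ∀ i, (ρ i).IsIrreducible
  inequivalent : ∀ i j, Nonempty ((res N (ρ i)).Equiv (res N (ρ j))) → i = j
  complete : ∀ (n : ℕ) (π : Representation ℂ G (Fin n → ℂ)), π.IsIrreducible →
    ∃ i, Nonempty ((res N π).Equiv (res N (ρ i)))

/-- `φ` is a list of irreducible modules of `N` whose inductions to `G` form a complete list
without repetition of the inductions to `G` of irreducible modules of `N`. -/
structure IsInductionList {G κ : Type*} [Group G] (N : Subgroup G) {d : κ → ℕ}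
    (φ : ∀ i, Representation ℂ N (Fin (d i) → ℂ)) : Prop where
  irreducible : ∀ i, (φ i).IsIrreducible
  inequivalent : ∀ i j, Nonempty ((ind N (φ i)).Equiv (ind N (φ j))) → i = j
  complete : ∀ (n : ℕ) (π : Representation ℂ N (Fin n → ℂ)), π.IsIrreducible →
    ∃ i, Nonempty ((ind N π).Equiv (ind N (φ i)))

/-- `A = 2 - Bᵀ` is the affine Cartan matrix of the realization of `N ⊴ G` by restricted modules
`ρ̌ᵢ`, where `V|_N ⊗ ρ̌ⱼ = ⨁ᵢ ρ̌ᵢ ^ B j i`; the index `o` is that of the trivial module, and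
`x k i` is the multiplicity of `ρ̌ᵢ` in `S^k(V)|_N`. -/
def IsRestrictedRealization {G : Subgroup SL2} (N : Subgroup G) {ι : Type*} [DecidableEq ι]
    (A : Matrix ι ι ℤ) (o : ι) (x : ℕ → ι → ℕ) : Prop :=
  ∃ (d : ι → ℕ) (ρ : ∀ i, Representation ℂ G (Fin (d i) → ℂ)) (B : Matrix ι ι ℕ),
    IsRestrictionList N ρ ∧
    Nonempty ((Representation.trivial ℂ N ℂ).Equiv (res N (ρ o))) ∧
    (∀ j, DecomposesAs ((res N (stdRep.comp G.subtype)).tprod (res N (ρ j)))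
      (fun i => res N (ρ i)) (B j)) ∧
    (∀ i j, A i j = (if i = j then 2 else 0) - (B j i : ℤ)) ∧
    ∀ k, DecomposesAs (res N ((symPow k).comp G.subtype)) (fun i => res N (ρ i)) (x k)

/-- `A = 2 - Dᵀ` is the affine Cartan matrix of the realization of `N ⊴ G` by induced modules
`φ̂ᵢ`, where `V ⊗ φ̂ⱼ = ⨁ᵢ φ̂ᵢ ^ D j i`; the index `o` is that of the module induced by the trivial
module, and `x k i` is the multiplicity of `φ̂ᵢ` in the module induced by `S^k(V)|_N`. -/
def IsInducedRealization {G : Subgroup SL2} (N : Subgroup G) {ι : Type*} [DecidableEq ι]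
    (A : Matrix ι ι ℤ) (o : ι) (x : ℕ → ι → ℕ) : Prop :=
  ∃ (d : ι → ℕ) (φ : ∀ i, Representation ℂ N (Fin (d i) → ℂ)) (D : Matrix ι ι ℕ),
    IsInductionList N φ ∧
    Nonempty ((ind N (Representation.trivial ℂ N ℂ)).Equiv (ind N (φ o))) ∧
    (∀ j, DecomposesAs (Representation.tprod (stdRep.comp G.subtype) (ind N (φ j)))
      (fun i => ind N (φ i)) (D j)) ∧
    (∀ i j, A i j = (if i = j then 2 else 0) - (D j i : ℤ)) ∧
    ∀ k, DecomposesAs (ind N (res N ((symPow k).comp G.subtype))) (fun i => ind N (φ i)) (x k)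

/-! ### Root lattice, reflections and Coxeter elements

The root lattice is `ι → ℤ`, the simple root `αᵢ` being `Pi.single i 1`. -/

section Coxeter

variable {ι : Type*} [Fintype ι] [DecidableEq ι]

/-- The reflection `sᵢ αⱼ = αⱼ - A i j αᵢ`. -/
def refl (A : Matrix ι ι ℤ) (i : ι) : Module.End ℤ (ι → ℤ) :=
  LinearMap.id - (LinearMap.proj i ∘ₗ A.mulVecLin).smulRight (Pi.single i (1 : ℤ))

/-- The product of the reflections `sᵢ` with `i ∈ P`, in some order. -/
def reflProd (A : Matrix ι ι ℤ) (P : Finset ι) : Module.End ℤ (ι → ℤ) :=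
  (P.toList.map (refl A)).prod

/-- The Coxeter number of the simple Lie algebra with Cartan matrix `A`: the order of a Coxeter
element, that is, of the product of all simple reflections (all orders of the factors give
conjugate elements, as the Dynkin diagram is a tree). -/
def coxeterNumber (A : Matrix ι ι ℤ) : ℕ := orderOf (reflProd A Finset.univ)

/-- The Cartan matrix left when the special vertex `o` is removed. -/
def finitePart (A : Matrix ι ι ℤ) (o : ι) : Matrix {i // i ≠ o} {i // i ≠ o} ℤ :=
  A.submatrix Subtype.val Subtype.val

/-- `P₁ ∪ P₂` is a partition of the vertices other than `o`, the simple roots of each part are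
mutually orthogonal, and those of `P₂` are orthogonal to `α_o`. -/
structure IsBipartition (A : Matrix ι ι ℤ) (o : ι) (P₁ P₂ : Finset ι) : Prop where
  disjoint : Disjoint P₁ P₂
  cover : P₁ ∪ P₂ = Finset.univ.erase o
  orthogonal₁ : ∀ i ∈ P₁, ∀ j ∈ P₁, i ≠ j → A i j = 0
  orthogonal₂ : ∀ i ∈ P₂, ∀ j ∈ P₂, i ≠ j → A i j = 0
  special : ∀ i ∈ P₂, A i o = 0 ∧ A o i = 0

/-- The alternating product `𝒞^{(k)} = 𝒞_k ⋯ 𝒞_2 𝒞_1`, where `𝒞_k` is the product of the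
reflections in `P₁` if `k` is odd and in `P₂` if `k` is even. -/
def altProd (A : Matrix ι ι ℤ) (P₁ P₂ : Finset ι) : ℕ → Module.End ℤ (ι → ℤ)
  | 0 => 1
  | k + 1 => reflProd A (if Odd (k + 1) then P₁ else P₂) * altProd A P₁ P₂ k

/-- The coefficients of `z(t)`: `z_0 = z_h = α_o`, and
`z_k = 𝒞^{(k)} α_o - 𝒞^{(k-1)} α_o` for `0 < k < h`. -/
def zVec (A : Matrix ι ι ℤ) (o : ι) (P₁ P₂ : Finset ι) (h k : ℕ) : ι → ℤ :=
  if k = 0 ∨ k = h then Pi.single o 1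
  else altProd A P₁ P₂ k (Pi.single o 1) - altProd A P₁ P₂ (k - 1) (Pi.single o 1)

/-- `ε` makes the Cartan matrix symmetric. -/
def IsSymmetrizer (A : Matrix ι ι ℤ) (ε : ι → ℚ) : Prop :=
  (∀ i, 0 < ε i) ∧ ∀ i j, ε i * A i j = ε j * A j i

/-- The invariant bilinear form on the root lattice with `(αᵢ, αⱼ) = εᵢ A i j`; so
`2 (αᵢ, αⱼ) / (αᵢ, αᵢ) = A i j`. -/
def invForm (A : Matrix ι ι ℤ) (ε : ι → ℚ) (u v : ι → ℤ) : ℚ :=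
  ∑ i, ∑ j, ε i * A i j * u i * v j

/-- The numbers `c_i`: `c_0 = 1`, `c_i = 2 (𝒞^i α_o, α_o) / (α_o, α_o)` for `0 < i < g`, where
`𝒞 = 𝒞_2 𝒞_1`, then `c_g = -1`, and `c_i = 0` for all other integers `i`. -/
def cCoeff (A : Matrix ι ι ℤ) (o : ι) (P₁ P₂ : Finset ι) (ε : ι → ℚ) (g : ℕ) (i : ℤ) : ℚ :=
  if i = 0 then 1
  else if 0 < i ∧ i < g then
    2 * invForm A ε (((reflProd A P₂ * reflProd A P₁) ^ i.toNat) (Pi.single o 1)) (Pi.single o 1) /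
      invForm A ε (Pi.single o 1) (Pi.single o 1)
  else if i = g then -1
  else 0

end Coxeter

end McKaySlodowy

end

/-!
The proof has three sources: the orbits of `N` on the projective line, the characters of `N`, and
the linear algebra of a bipartite Coxeter element.

*Degrees.* Counting the points of the projective line with non-trivial stabilizer
(`exists_orbit_data`) shows that a finite subgroup of `SL₂(ℂ)` fixes a line, and is then
commutative, or has three exceptional orbits whose orders leave four classes
(`fixed_line_or_hasClassType`). In each class the orbit data give the sum of `1 / (1 - t tr g + t²)`
over the group: the Molien series is `(1 + t^h) / ((1 - t^a) (1 - t^b))` with `a + b = h + 2` and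
`a b = 2 |N|` (`HasDegrees`, `exists_hasType`). These numbers are afterwards recognized as the `a`,
`b`, `h` of the statement.

*Characters.* Either realization provides class functions on `N`, indexed by the vertices, that are
orthogonal, are multiplied by `tr` according to the matrix `B` with `A = 2 - Bᵀ`, and have the
multiplicities `x_k` as the coefficients of the symmetric powers (`IsCharacterSystem`). For
restrictions this uses that irreducible modules of `G` with non-disjoint restrictions have
isomorphic ones, `G / N` being commutative (`nonempty_res_equiv`); for induced modules, that
distinct ones have orthogonal characters (`sum_character_ind_eq_zero`).

*The Coxeter number.* The matrix of multiplication by `2 - tr` is positive definite away from the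
special vertex, hence the finite part of `A` is a forest (`IsCharacterSystem.exists_leaf`), all
products of its simple reflections are conjugate, and the order may be computed for a bipartite one.
An eigenvector of `B` vanishing at the special vertex, with eigenvalue `ξ + ξ⁻¹`, satisfies the
equation of the function `1 / (ξ + ξ⁻¹ - tr)` on the group; the Molien series at `ξ` then gives
`ξ ^ (2 h) = 1`, and a primitive `2 h`-th root of unity occurs
(`IsCharacterSystem.pow_eq_one_of_eigenvector`, `IsCharacterSystem.exists_eigenvector`). So the
order is `h` (`IsCharacterSystem.coxeterNumber_eq`).

*The generating function.* For a bipartition, the differences of the vectors `𝒞^{(k)} α₀` satisfy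
away from the special vertex the recursion that multiplication by `V` gives for the multiplicities.
Hence their series `Z` equals `p X` for a power series `p` in one variable
(`IsCharacterSystem.mk_altDiff`), and the coordinate of `Z` at the special vertex is `1`, so that
`p` is the inverse of the Molien series (`IsCharacterSystem.altSeries_mul`). Below degree `h` this
is the polynomial `(1 - t^a) (1 - t^b)`, which gives `IsCharacterSystem.series_eq`; the coefficients
of `p` are also the differences of the `c_i`, which gives `IsCharacterSystem.sum_cCoeff`.

*Dimensions.* Below the degrees there are no invariants, so `S^k(V)` is irreducible for `2 k < a`.
Together with the number of the modules and the mass formula `∑ r² / n = |N|`, where `n` is the norm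
of the character on `N` (`IsRestrictionList.exists_norms`), this determines the largest dimension
and the sum of the dimensions (`HasType.dimensions` for `N = G`, `IsDistinguishedPair.sum_dim` for
the pairs).
-/

/-! ### Finite subgroups of `SL₂(ℂ)` acting on the projective line -/

namespace McKaySlodowy

open Matrix Polynomial
open scoped LinearAlgebra.Projectivization

/-- The trace of an element of `SL₂(ℂ)`. -/
def tr (M : SL2) : ℂ := M.1.trace

lemma tr_eq (M : SL2) : tr M = M.1 0 0 + M.1 1 1 := Matrix.trace_fin_two _

lemma det_eq (M : SL2) : M.1 0 0 * M.1 1 1 - M.1 0 1 * M.1 1 0 = 1 := by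
  rw [← Matrix.det_fin_two]; exact M.2

lemma tr_one : tr 1 = 2 := by
  rw [tr_eq]; simp; norm_num

lemma tr_inv (M : SL2) : tr M⁻¹ = tr M := by
  simp [tr_eq, Matrix.SpecialLinearGroup.coe_inv, Matrix.adjugate_fin_two]
  ring

lemma tr_mul_comm (M K : SL2) : tr (M * K) = tr (K * M) := by
  simp only [tr, Matrix.SpecialLinearGroup.coe_mul, Matrix.trace_mul_comm M.1]

lemma tr_conj (M K : SL2) : tr (K * M * K⁻¹) = tr M := by
  rw [tr_mul_comm, inv_mul_cancel_left]

lemma eigenvalue_ne_zero {M : SL2} {v : Fin 2 → ℂ} (hv : v ≠ 0) {c : ℂ} (h : M.1 *ᵥ v = c • v) :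
    c ≠ 0 := by
  rintro rfl
  apply hv
  have : (M⁻¹).1 *ᵥ (M.1 *ᵥ v) = v := by
    rw [Matrix.mulVec_mulVec, ← Matrix.SpecialLinearGroup.coe_mul]; simp
  rw [← this, h]; simp

/-- The eigenvalues of `M ∈ SL₂(ℂ)` are the roots of its characteristic polynomial. -/
lemma exists_eigenvector_iff (M : SL2) (c : ℂ) :
    (∃ v : Fin 2 → ℂ, v ≠ 0 ∧ M.1 *ᵥ v = c • v) ↔ c * c - tr M * c + 1 = 0 := by
  have h := Matrix.exists_mulVec_eq_zero_iff (M := M.1 - c • (1 : Matrix (Fin 2) (Fin 2) ℂ))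
  have h2 : (M.1 - c • (1 : Matrix (Fin 2) (Fin 2) ℂ)).det = c * c - tr M * c + 1 := by
    rw [Matrix.det_fin_two, tr_eq]
    simp
    linear_combination det_eq M
  rw [h2] at h
  rw [← h]
  simp only [Matrix.sub_mulVec, sub_eq_zero, Matrix.smul_mulVec, Matrix.one_mulVec]

lemma tr_eq_of_eigenvector {M : SL2} {v : Fin 2 → ℂ} (hv : v ≠ 0) {c : ℂ}
    (h : M.1 *ᵥ v = c • v) : tr M = c + c⁻¹ := by
  have h0 := eigenvalue_ne_zero hv h
  have := (exists_eigenvector_iff M c).1 ⟨v, hv, h⟩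
  field_simp
  linear_combination -this

/-- A non-scalar unipotent matrix has infinite order. -/
lemma eq_smul_one_of_tr_sq {M : SL2} (hM : IsOfFinOrder M) (ht : tr M ^ 2 = 4) :
    M.1 = (tr M / 2) • (1 : Matrix (Fin 2) (Fin 2) ℂ) := by
  obtain ⟨k, hk, hk1⟩ := isOfFinOrder_iff_pow_eq_one.1 hM
  -- With `c` the double eigenvalue, `M = c + D` with `D² = 0`, so that `Mᵏ = cᵏ + k cᵏ⁻¹ D`.
  set c := tr M / 2 with hc
  have hc2 : c * c = 1 := by rw [hc]; linear_combination ht / 4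
  set D : Matrix (Fin 2) (Fin 2) ℂ := M.1 - c • 1 with hD
  have hMD : M.1 = c • 1 + D := by rw [hD]; abel
  have hD2 : D * D = 0 := by
    have hd := det_eq M
    have htr := tr_eq M
    have h2c : M.1 0 0 + M.1 1 1 = 2 * c := by rw [← htr, hc]; ring
    ext i j
    fin_cases i <;> fin_cases j <;>
      simp [hD, Matrix.mul_apply, Fin.sum_univ_two]
    · linear_combination (M.1 0 0) * h2c - hd + hc2
    · linear_combination (M.1 0 1) * h2c
    · linear_combination (M.1 1 0) * h2c
    · linear_combination (M.1 1 1) * h2c - hd + hc2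
  have hpow : ∀ k : ℕ, (M.1) ^ (k + 1) = c ^ (k + 1) • 1 + ((k + 1 : ℕ) * c ^ k) • D := by
    intro k
    induction k with
    | zero => simpa using hMD
    | succ k ih =>
      rw [pow_succ, ih, hMD]
      simp only [add_mul, mul_add, Matrix.smul_mul, Matrix.mul_smul, hD2, one_mul, mul_one,
        smul_zero, add_zero, smul_smul]
      rw [add_assoc, ← add_smul]
      congr 2 <;> push_cast <;> ring
  obtain ⟨k, rfl⟩ := Nat.exists_eq_succ_of_ne_zero hk.ne'
  have h1 : (M.1) ^ (k + 1) = 1 := by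
    rw [← Matrix.SpecialLinearGroup.coe_pow, hk1]; rfl
  have hDtr : D.trace = 0 := by
    simp [hD, Matrix.trace_sub, Matrix.trace_smul]
    change tr M - _ = 0
    rw [hc]; ring
  have h3 := hpow k
  rw [h1] at h3
  -- `Mᵏ⁺¹ = 1` forces `cᵏ⁺¹ = 1` by taking traces, and then `D = 0`.
  have h4 : c ^ (k + 1) = 1 := by
    have := congrArg Matrix.trace h3
    simp [Matrix.trace_add, Matrix.trace_smul, hDtr] at this
    exact this
  have h5 : ((k + 1 : ℕ) * c ^ k : ℂ) • D = 0 := by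
    rw [h4, one_smul] at h3
    simpa using h3
  have hc0 : c ≠ 0 := by rintro h; rw [h] at hc2; simp at hc2
  have h6 : D = 0 := by
    rcases smul_eq_zero.1 h5 with h | h
    · exfalso
      have : ((k + 1 : ℕ) : ℂ) ≠ 0 := Nat.cast_ne_zero.2 (Nat.succ_ne_zero k)
      exact (mul_ne_zero this (pow_ne_zero _ hc0)) h
    · exact h
  rw [hMD, h6, add_zero]

lemma eq_one_of_tr_eq_two {M : SL2} (hM : IsOfFinOrder M) (ht : tr M = 2) : M = 1 := by
  apply Subtype.ext
  rw [eq_smul_one_of_tr_sq hM (by rw [ht]; norm_num), ht]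
  simp

lemma sq_ne_one_iff {c : ℂ} (hc : c ≠ 0) : (c + c⁻¹) ^ 2 ≠ 4 ↔ c ^ 2 ≠ 1 := by
  have : (c + c⁻¹) ^ 2 - 4 = ((c ^ 2 - 1) / c) ^ 2 := by field_simp; ring
  rw [← sub_ne_zero, this, ← sub_ne_zero (a := c ^ 2)]
  simp [hc]

lemma add_inv_eq_add_inv_iff {c d : ℂ} (hc : c ≠ 0) (hd : d ≠ 0) :
    c + c⁻¹ = d + d⁻¹ ↔ c = d ∨ c = d⁻¹ := by
  constructor
  · intro h
    have : (c - d) * (c * d - 1) = 0 := by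
      field_simp at h
      linear_combination h
    rcases mul_eq_zero.1 this with h | h
    · exact Or.inl (sub_eq_zero.1 h)
    · exact Or.inr (eq_inv_of_mul_eq_one_left (sub_eq_zero.1 h))
  · rintro (rfl | rfl)
    · rfl
    · rw [inv_inv, add_comm]

/-- If an eigenvalue of `M ∈ SL₂(ℂ)` is not `±1`, its eigenspace is a line. -/
lemma eigenspace_line {M : SL2} (ht : tr M ^ 2 ≠ 4) {v u : Fin 2 → ℂ} (hv : v ≠ 0) {c : ℂ}
    (h : M.1 *ᵥ v = c • v) (hu : M.1 *ᵥ u = c • u) : ∃ a : ℂ, u = a • v := by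
  by_contra hno
  push Not at hno
  -- Two independent eigenvectors make `M` scalar, hence `±1`.
  have hli : LinearIndependent ℂ ![v, u] := by
    rw [LinearIndependent.pair_iff' hv]
    exact fun a ha => hno a ha.symm
  have hb := basisOfLinearIndependentOfCardEqFinrank hli (by simp)
  have hall : ∀ w : Fin 2 → ℂ, M.1 *ᵥ w = c • w := by
    have hsp : Submodule.span ℂ (Set.range ![v, u]) = ⊤ :=
      hli.span_eq_top_of_card_eq_finrank (by simp)
    intro w
    have hw : w ∈ Submodule.span ℂ (Set.range ![v, u]) := by rw [hsp]; trivial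
    induction hw using Submodule.span_induction with
    | mem x hx =>
      obtain ⟨i, rfl⟩ := hx
      fin_cases i
      · exact h
      · exact hu
    | zero => simp
    | add x y _ _ hx hy => rw [Matrix.mulVec_add, hx, hy, smul_add]
    | smul a x _ hx => rw [Matrix.mulVec_smul, hx, smul_comm]
  have hM : M.1 = c • 1 := by
    apply Matrix.ext_of_mulVec_single
    intro i
    rw [hall, Matrix.smul_mulVec, Matrix.one_mulVec]
  have hd := M.2
  rw [hM] at hd
  simp at hd
  apply ht
  rw [tr_eq, hM]
  simp
  rcases hd with rfl | rfl <;> norm_num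

lemma line_smul_eq_iff (M : SL2) (p : ℙ ℂ (Fin 2 → ℂ)) :
    M • p = p ↔ ∃ c : ℂ, M.1 *ᵥ p.rep = c • p.rep := by
  have h1 : M • p = Projectivization.mk ℂ (M • p.rep)
      ((smul_ne_zero_iff_ne M).mpr p.rep_nonzero) := by
    conv_lhs => rw [← p.mk_rep]
    rw [Projectivization.smul_mk]
  rw [h1]
  conv_lhs => rhs; rw [← p.mk_rep]
  rw [Projectivization.mk_eq_mk_iff']
  constructor
  · rintro ⟨a, ha⟩
    exact ⟨a, ha.symm⟩
  · rintro ⟨a, ha⟩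
    exact ⟨a, ha.symm⟩

/-- A non-scalar element of finite order of `SL₂(ℂ)` fixes exactly two points of the projective
line. -/
lemma card_fixed_lines {M : SL2} (ht : tr M ^ 2 ≠ 4) :
    ∃ S : Finset (ℙ ℂ (Fin 2 → ℂ)), S.card = 2 ∧ ∀ p, p ∈ S ↔ M • p = p := by
  classical
  -- The two eigenvalues `c ≠ c⁻¹` have one eigenline each.
  obtain ⟨c, hc⟩ : ∃ c : ℂ, c * c - tr M * c + 1 = 0 := by
    obtain ⟨s, hs⟩ := IsAlgClosed.exists_pow_nat_eq (tr M ^ 2 - 4) (n := 2) (by norm_num)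
    exact ⟨(tr M + s) / 2, by linear_combination hs / 4⟩
  obtain ⟨v, hv, hvc⟩ := (exists_eigenvector_iff M c).2 hc
  have hc0 := eigenvalue_ne_zero hv hvc
  have htr := tr_eq_of_eigenvector hv hvc
  have hc2 : c ^ 2 ≠ 1 := (sq_ne_one_iff hc0).1 (htr ▸ ht)
  obtain ⟨w, hw, hwc⟩ := (exists_eigenvector_iff M c⁻¹).2 (by rw [htr]; field_simp; ring)
  have hcc : c ≠ c⁻¹ := by
    intro h
    apply hc2
    rw [pow_two]; nth_rewrite 2 [h]; exact mul_inv_cancel₀ hc0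
  have key : ∀ p : ℙ ℂ (Fin 2 → ℂ), M • p = p ↔
      p = Projectivization.mk ℂ v hv ∨ p = Projectivization.mk ℂ w hw := by
    intro p
    rw [line_smul_eq_iff]
    constructor
    · rintro ⟨d, hd⟩
      have hd0 := eigenvalue_ne_zero p.rep_nonzero hd
      have := tr_eq_of_eigenvector p.rep_nonzero hd
      rw [htr, eq_comm, add_inv_eq_add_inv_iff hd0 hc0] at this
      rcases this with rfl | rfl
      · left
        obtain ⟨a, ha⟩ := eigenspace_line ht hv hvc hd
        conv_lhs => rw [← p.mk_rep]
        rw [Projectivization.mk_eq_mk_iff']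
        exact ⟨a, ha.symm⟩
      · right
        obtain ⟨a, ha⟩ := eigenspace_line ht hw hwc hd
        conv_lhs => rw [← p.mk_rep]
        rw [Projectivization.mk_eq_mk_iff']
        exact ⟨a, ha.symm⟩
    · have aux : ∀ (u : Fin 2 → ℂ) (hu : u ≠ 0) (d : ℂ), M.1 *ᵥ u = d • u →
          ∃ d : ℂ, M.1 *ᵥ (Projectivization.mk ℂ u hu).rep =
            d • (Projectivization.mk ℂ u hu).rep := by
        intro u hu d hd
        obtain ⟨a, ha⟩ := Projectivization.exists_smul_eq_mk_rep ℂ u hu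
        refine ⟨d, ?_⟩
        rw [← ha, Units.smul_def, Matrix.mulVec_smul, hd, smul_comm]
      rintro (rfl | rfl)
      · exact aux v hv c hvc
      · exact aux w hw _ hwc
  refine ⟨{Projectivization.mk ℂ v hv, Projectivization.mk ℂ w hw}, ?_, fun p => by
    rw [key]; simp⟩
  rw [Finset.card_pair]
  intro h
  rw [Projectivization.mk_eq_mk_iff'] at h
  obtain ⟨a, ha⟩ := h
  have h1 : c • v = c⁻¹ • v := by
    rw [← hvc, ← ha, Matrix.mulVec_smul, hwc, smul_comm]
  rw [← sub_eq_zero, ← sub_smul, smul_eq_zero] at h1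
  exact h1.elim (fun h => hcc (sub_eq_zero.1 h)) hv

section Action

variable {H : Type*} [Group H] (f : H →* SL2)

/-- The action on the projective line of a group mapping to `SL₂(ℂ)`. -/
noncomputable abbrev lineAction : MulAction H (ℙ ℂ (Fin 2 → ℂ)) := MulAction.compHom _ f

/-- The stabilizer of a point of the projective line. -/
noncomputable def lineStab (p : ℙ ℂ (Fin 2 → ℂ)) : Subgroup H :=
  letI := lineAction f
  MulAction.stabilizer H p

lemma mem_lineStab {p : ℙ ℂ (Fin 2 → ℂ)} {g : H} : g ∈ lineStab f p ↔ f g • p = p := Iff.rfl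

variable {f}

/-- The eigenvalue on a line `p` of the elements of `SL₂(ℂ)` that fix `p`. -/
noncomputable def lineChar (p : ℙ ℂ (Fin 2 → ℂ)) (M : SL2) : ℂ :=
  open scoped Classical in
  if h : ∃ c : ℂ, M.1 *ᵥ p.rep = c • p.rep then h.choose else 1

lemma lineChar_spec {p : ℙ ℂ (Fin 2 → ℂ)} {M : SL2} (h : M • p = p) :
    M.1 *ᵥ p.rep = lineChar p M • p.rep := by
  have h' := (line_smul_eq_iff M p).1 h
  rw [lineChar, dif_pos h']
  exact h'.choose_spec

lemma lineChar_eq {p : ℙ ℂ (Fin 2 → ℂ)} {M : SL2} {c : ℂ} (h : M.1 *ᵥ p.rep = c • p.rep) :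
    lineChar p M = c := by
  have h1 := lineChar_spec ((line_smul_eq_iff M p).2 ⟨c, h⟩)
  rw [h, ← sub_eq_zero, ← sub_smul, smul_eq_zero] at h1
  exact (sub_eq_zero.1 (h1.resolve_right p.rep_nonzero)).symm

lemma lineChar_mul {p : ℙ ℂ (Fin 2 → ℂ)} {M K : SL2} (hM : M • p = p) (hK : K • p = p) :
    lineChar p (M * K) = lineChar p M * lineChar p K := by
  apply lineChar_eq
  rw [Matrix.SpecialLinearGroup.coe_mul, ← Matrix.mulVec_mulVec, lineChar_spec hK,
    Matrix.mulVec_smul, lineChar_spec hM, smul_smul, mul_comm]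

lemma lineChar_one (p : ℙ ℂ (Fin 2 → ℂ)) : lineChar p 1 = 1 := lineChar_eq (by simp)

lemma tr_eq_lineChar {p : ℙ ℂ (Fin 2 → ℂ)} {M : SL2} (h : M • p = p) :
    tr M = lineChar p M + (lineChar p M)⁻¹ :=
  tr_eq_of_eigenvector p.rep_nonzero (lineChar_spec h)

lemma lineChar_ne_zero {p : ℙ ℂ (Fin 2 → ℂ)} {M : SL2} (h : M • p = p) : lineChar p M ≠ 0 :=
  eigenvalue_ne_zero p.rep_nonzero (lineChar_spec h)

variable [Finite H] (hf : Function.Injective f)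
include hf

/-- An element of finite order with an eigenvalue `1` is trivial, so that the eigenvalue on a fixed
line determines the element. -/
lemma lineChar_injOn (p : ℙ ℂ (Fin 2 → ℂ)) :
    Set.InjOn (fun g => lineChar p (f g)) (lineStab f p : Set H) := by
  intro g hg k hk hgk
  have hgk' : g⁻¹ * k ∈ lineStab f p := mul_mem (inv_mem hg) hk
  have h1 : lineChar p (f (g⁻¹ * k)) = 1 := by
    have h2 : lineChar p (f (g * (g⁻¹ * k))) = lineChar p (f g) * lineChar p (f (g⁻¹ * k)) := by
      rw [map_mul]; exact lineChar_mul hg hgk'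
    rw [mul_inv_cancel_left] at h2
    have h3 : lineChar p (f g) ≠ 0 := lineChar_ne_zero hg
    simp only at hgk
    rw [← hgk] at h2
    exact mul_left_cancel₀ h3 (by rw [← h2, mul_one])
  have h2 : tr (f (g⁻¹ * k)) = 2 := by
    rw [tr_eq_lineChar (p := p) hgk', h1]; norm_num
  have h3 := eq_one_of_tr_eq_two (f.isOfFinOrder (isOfFinOrder_of_finite _)) h2
  rw [← map_one f] at h3
  have h4 := hf h3
  rw [inv_mul_eq_one] at h4
  exact h4

/-- The stabilizer of a point is cyclic: its eigenvalues are all the roots of unity of its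
order. -/
lemma sum_lineStab [Fintype H] {E : Type*} [AddCommMonoid E] (p : ℙ ℂ (Fin 2 → ℂ)) (F : ℂ → E)
    [DecidablePred (· ∈ lineStab f p)] :
    ∑ g with g ∈ lineStab f p, F (lineChar p (f g)) =
      ∑ ζ ∈ nthRootsFinset (Nat.card (lineStab f p)) (1 : ℂ), F ζ := by
  classical
  set S : Finset H := Finset.univ.filter (· ∈ lineStab f p) with hS
  have hcard : S.card = Nat.card (lineStab f p) := by
    rw [Nat.card_eq_fintype_card, Fintype.card_subtype]
  have hpos : 0 < Nat.card (lineStab f p) := Nat.card_pos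
  have hinj : Set.InjOn (fun g => lineChar p (f g)) (S : Set H) := by
    have := lineChar_injOn hf p
    refine this.mono ?_
    intro g hg
    simpa [hS] using hg
  -- The eigenvalues are distinct roots of unity of order dividing that of the stabilizer; by their
  -- number they are all of them.
  have himg : S.image (fun g => lineChar p (f g)) =
      nthRootsFinset (Nat.card (lineStab f p)) (1 : ℂ) := by
    apply Finset.eq_of_subset_of_card_le
    · intro ζ hζ
      obtain ⟨g, hg, rfl⟩ := Finset.mem_image.1 hζ
      rw [mem_nthRootsFinset hpos]
      have hg' : g ∈ lineStab f p := by simpa [hS] using hg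
      have hpow : ∀ k : ℕ, lineChar p (f (g ^ k)) = lineChar p (f g) ^ k := by
        intro k
        induction k with
        | zero => simp [lineChar_one]
        | succ k ih =>
          rw [pow_succ, map_mul, lineChar_mul (M := f (g ^ k)) (pow_mem hg' k) hg', ih, pow_succ]
      rw [← hpow]
      have : g ^ Nat.card (lineStab f p) = 1 := by
        have := pow_card_eq_one' (x := (⟨g, hg'⟩ : lineStab f p))
        exact congrArg Subtype.val this
      rw [this, map_one, lineChar_one]
    · rw [Finset.card_image_of_injOn hinj, hcard]
      exact (Multiset.toFinset_card_le _).trans (card_nthRoots _ _)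
  rw [← himg, Finset.sum_image hinj]

omit [Finite H] in
/-- The centralizer of a non-scalar element is the stabilizer of any of its fixed points. -/
lemma centralizer_eq_lineStab [Finite H] {p : ℙ ℂ (Fin 2 → ℂ)} {g : H} (hg : g ∈ lineStab f p)
    (ht : tr (f g) ^ 2 ≠ 4) : Subgroup.centralizer {g} = lineStab f p := by
  ext k
  rw [Subgroup.mem_centralizer_singleton_iff]
  constructor
  · intro hk
    rw [mem_lineStab, line_smul_eq_iff]
    have h1 : (f g).1 *ᵥ ((f k).1 *ᵥ p.rep) = lineChar p (f g) • ((f k).1 *ᵥ p.rep) := by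
      rw [Matrix.mulVec_mulVec, ← Matrix.SpecialLinearGroup.coe_mul, ← map_mul, ← hk, map_mul,
        Matrix.SpecialLinearGroup.coe_mul, ← Matrix.mulVec_mulVec, lineChar_spec hg,
        Matrix.mulVec_smul]
    exact eigenspace_line ht p.rep_nonzero (lineChar_spec hg) h1
  · intro hk
    apply lineChar_injOn hf p (mul_mem hk hg) (mul_mem hg hk)
    simp only [map_mul]
    rw [lineChar_mul hk hg, lineChar_mul hg hk, mul_comm]

end Action

section OrbitData

variable {H : Type*} [Group H] [Fintype H] {f : H →* SL2} (hf : Function.Injective f)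

lemma isOfFinOrder_map (f : H →* SL2) (g : H) : IsOfFinOrder (f g) :=
  f.isOfFinOrder (isOfFinOrder_of_finite g)

lemma mem_lineStab_of_tr_sq (f : H →* SL2) {g : H} (ht : tr (f g) ^ 2 = 4)
    (p : ℙ ℂ (Fin 2 → ℂ)) : g ∈ lineStab f p := by
  rw [mem_lineStab, line_smul_eq_iff]
  refine ⟨tr (f g) / 2, ?_⟩
  conv_lhs => rw [eq_smul_one_of_tr_sq (isOfFinOrder_map f g) ht]
  rw [Matrix.smul_mulVec, Matrix.one_mulVec]

lemma card_nthRootsFinset_complex {s : ℕ} (hs : 0 < s) :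
    (nthRootsFinset s (1 : ℂ)).card = s :=
  (Complex.isPrimitiveRoot_exp s hs.ne').card_nthRootsFinset

include hf

open scoped Classical in
/-- The scalars in a stabilizer are the elements with eigenvalue `±1`, and every scalar fixes every
line. -/
lemma card_lineStab_scalar (p : ℙ ℂ (Fin 2 → ℂ)) :
    ((nthRootsFinset (Nat.card (lineStab f p)) (1 : ℂ)).filter (fun ζ => ζ ^ 2 = 1)).card =
      (Finset.univ.filter fun g : H => tr (f g) ^ 2 = 4).card := by
  have h := sum_lineStab hf p (fun ζ => if ζ ^ 2 = 1 then 1 else 0)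
  rw [Finset.sum_boole, ← Finset.sum_filter, Finset.sum_const, Finset.filter_filter,
    smul_eq_mul, mul_one, Nat.cast_id] at h
  rw [← h]
  congr 1
  ext g
  simp only [Finset.mem_filter, Finset.mem_univ, true_and]
  constructor
  · rintro ⟨hg, hc⟩
    by_contra hne
    rw [tr_eq_lineChar hg] at hne
    exact (sq_ne_one_iff (lineChar_ne_zero hg)).1 hne hc
  · intro hg
    have hst := mem_lineStab_of_tr_sq f hg p
    refine ⟨hst, ?_⟩
    by_contra hne
    rw [← ne_eq, ← sq_ne_one_iff (lineChar_ne_zero hst), ← tr_eq_lineChar hst] at hne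
    exact hne hg

open scoped Classical in
/-- The class equation of a finite subgroup `H` of `SL₂(ℂ)`. The index set `Ω` is that of the orbits
of `H` on the points of the projective line fixed by some non-scalar element of `H`; a point of the
orbit `ω` has a cyclic stabilizer of order `s ω`, and there are `k ω` points. Summing a function of
the trace and of the order of the centralizer over the non-scalar elements, each of which has two
fixed points, gives a sum over the roots of unity of orders `s ω`. -/
theorem exists_orbit_data :
    ∃ (Ω : Type) (_ : Fintype Ω) (s k : Ω → ℕ),
      (∀ ω, k ω * s ω = Nat.card H) ∧
      (∀ ω, ((nthRootsFinset (s ω) (1 : ℂ)).filter (fun ζ => ζ ^ 2 = 1)).card =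
        (Finset.univ.filter fun g : H => tr (f g) ^ 2 = 4).card) ∧
      (∀ ω, ∃ ζ ∈ nthRootsFinset (s ω) (1 : ℂ), ζ ^ 2 ≠ 1) ∧
      (∀ ω, ∃ p, s ω = Nat.card (lineStab f p)) ∧
      ∀ {E : Type} [AddCommMonoid E] (Φ : ℂ → ℕ → E),
        2 • ∑ g : H with tr (f g) ^ 2 ≠ 4,
          Φ (tr (f g)) (Nat.card (Subgroup.centralizer ({g} : Set H))) =
        ∑ ω, k ω • ∑ ζ ∈ nthRootsFinset (s ω) (1 : ℂ) with ζ ^ 2 ≠ 1, Φ (ζ + ζ⁻¹) (s ω) := by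
  let := lineAction f
  have hfix : ∀ g : H, tr (f g) ^ 2 ≠ 4 →
      ∃ S : Finset (ℙ ℂ (Fin 2 → ℂ)), S.card = 2 ∧ ∀ p, p ∈ S ↔ g ∈ lineStab f p :=
    fun g hg => card_fixed_lines hg
  choose! S hS2 hS using hfix
  -- `X` is the set of the non-scalar elements, `P` that of the points fixed by some of them.
  set X : Finset H := Finset.univ.filter fun g => tr (f g) ^ 2 ≠ 4 with hX
  set P : Finset (ℙ ℂ (Fin 2 → ℂ)) := X.biUnion S with hP
  have hXmem : ∀ g, g ∈ X ↔ tr (f g) ^ 2 ≠ 4 := by simp [hX]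
  have hPmem : ∀ p, p ∈ P ↔ ∃ g : H, tr (f g) ^ 2 ≠ 4 ∧ g ∈ lineStab f p := by
    intro p
    rw [hP, Finset.mem_biUnion]
    constructor
    · rintro ⟨g, hg, hp⟩
      exact ⟨g, (hXmem g).1 hg, (hS g ((hXmem g).1 hg) p).1 hp⟩
    · rintro ⟨g, hg, hp⟩
      exact ⟨g, (hXmem g).2 hg, (hS g hg p).2 hp⟩
  let mkΩ : ℙ ℂ (Fin 2 → ℂ) → MulAction.orbitRel.Quotient H (ℙ ℂ (Fin 2 → ℂ)) :=
    fun p => Quotient.mk'' p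
  have hcardconj : ∀ (k : H) (p : ℙ ℂ (Fin 2 → ℂ)),
      Nat.card (lineStab f (k • p)) = Nat.card (lineStab f p) := by
    intro k p
    exact (Nat.card_congr (MulAction.stabilizerEquivStabilizer (g := k) (a := p) rfl).toEquiv).symm
  have hmk : ∀ p q, mkΩ p = mkΩ q ↔ ∃ k : H, k • q = p := by
    intro p q
    change Quotient.mk'' p = Quotient.mk'' q ↔ _
    rw [Quotient.eq'']
    exact Iff.rfl
  have hrep : ∀ p, ∃ k : H, k • p = (mkΩ p).out := by
    intro p
    rw [← hmk]
    exact Quotient.out_eq' _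
  have hPsmul : ∀ (k : H) (p), p ∈ P → k • p ∈ P := by
    intro k p hp
    obtain ⟨g, hg, hgp⟩ := (hPmem p).1 hp
    refine (hPmem _).2 ⟨k * g * k⁻¹, ?_, ?_⟩
    · rw [map_mul, map_mul, map_inv, tr_conj]; exact hg
    · change (k * g * k⁻¹) • k • p = k • p
      have : g • p = p := hgp
      rw [smul_smul, inv_mul_cancel_right, mul_smul, this]
  refine ⟨{ω // ω ∈ P.image mkΩ}, inferInstance, fun ω => Nat.card (lineStab f ω.1.out),
    fun ω => (P.filter fun p => mkΩ p = ω.1).card, ?_, ?_, ?_,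
    fun ω => ⟨_, rfl⟩, ?_⟩
  · rintro ⟨ω, hω⟩
    obtain ⟨p, hp, rfl⟩ := Finset.mem_image.1 hω
    obtain ⟨k, hk⟩ := hrep p
    have h1 : ((P.filter fun q => mkΩ q = mkΩ p : Finset _) : Set (ℙ ℂ (Fin 2 → ℂ))) =
        MulAction.orbit H p := by
      ext q
      simp only [Finset.coe_filter, Set.mem_ofPred_eq, MulAction.mem_orbit_iff]
      constructor
      · rintro ⟨-, h⟩
        exact (hmk _ _).1 h
      · rintro ⟨k, rfl⟩
        exact ⟨hPsmul k p hp, (hmk _ _).2 ⟨k, rfl⟩⟩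
    have h2 : (P.filter fun q => mkΩ q = mkΩ p).card = Nat.card (MulAction.orbit H p) := by
      rw [← h1]; simp
    dsimp only
    rw [h2, ← hk, hcardconj]
    have := Nat.card_congr (MulAction.orbitProdStabilizerEquivGroup H p)
    rw [Nat.card_prod] at this
    exact this
  · intro ω
    exact card_lineStab_scalar hf _
  · rintro ⟨ω, hω⟩
    obtain ⟨p, hp, rfl⟩ := Finset.mem_image.1 hω
    obtain ⟨k, hk⟩ := hrep p
    obtain ⟨g, hg, hgp⟩ := (hPmem _).1 (hPsmul k p hp)
    rw [hk] at hgp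
    have hpow : ∃ ζ ∈ nthRootsFinset (Nat.card (lineStab f (mkΩ p).out)) (1 : ℂ),
        ζ = lineChar (mkΩ p).out (f g) := by
      by_contra hno
      push Not at hno
      have h := sum_lineStab hf (mkΩ p).out
        (fun ζ => if ζ = lineChar (mkΩ p).out (f g) then 1 else 0)
      rw [Finset.sum_eq_zero (s := nthRootsFinset _ _) (fun ζ hζ => if_neg (hno ζ hζ)),
        Finset.sum_eq_zero_iff] at h
      have := h g (by simpa using hgp)
      simp at this
    obtain ⟨ζ, hζ, rfl⟩ := hpow
    refine ⟨_, hζ, ?_⟩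
    rw [← sq_ne_one_iff (lineChar_ne_zero hgp), ← tr_eq_lineChar hgp]
    exact hg
  · intro E _ Φ
    set F : H → E := fun g =>
      Φ (tr (f g)) (Nat.card (Subgroup.centralizer ({g} : Set H))) with hF
    -- Double counting of the pairs of an element of `X` and one of its two fixed points.
    have hdouble : 2 • ∑ g ∈ X, F g = ∑ p ∈ P, ∑ g ∈ X with g ∈ lineStab f p, F g := by
      have : ∀ g ∈ X, 2 • F g = ∑ p ∈ P, if g ∈ lineStab f p then F g else 0 := by
        intro g hg
        have hg' := (hXmem g).1 hg
        rw [← Finset.sum_filter, Finset.sum_const]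
        congr 1
        refine (hS2 g hg').symm.trans (congrArg Finset.card ?_)
        ext p
        rw [hS g hg', Finset.mem_filter, hPmem]
        exact ⟨fun h => ⟨⟨g, hg', h⟩, h⟩, fun h => h.2⟩
      rw [← Finset.sum_nsmul, Finset.sum_congr rfl this, Finset.sum_comm]
      refine Finset.sum_congr rfl fun p _ => ?_
      rw [← Finset.sum_filter]
    -- The stabilizer of a point is parametrized by its eigenvalues there.
    have hparam : ∀ p, ∑ g ∈ X with g ∈ lineStab f p, F g =
        ∑ ζ ∈ nthRootsFinset (Nat.card (lineStab f p)) (1 : ℂ) with ζ ^ 2 ≠ 1,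
          Φ (ζ + ζ⁻¹) (Nat.card (lineStab f p)) := by
      intro p
      rw [Finset.sum_filter (p := fun ζ : ℂ => ζ ^ 2 ≠ 1), ← sum_lineStab hf p, hX,
        Finset.filter_filter, ← Finset.sum_filter, Finset.filter_filter]
      have hiff : ∀ g, (tr (f g) ^ 2 ≠ 4 ∧ g ∈ lineStab f p) ↔
          (g ∈ lineStab f p ∧ lineChar p (f g) ^ 2 ≠ 1) := by
        intro g
        rw [and_comm]
        refine and_congr_right fun hg => ?_
        rw [tr_eq_lineChar hg, sq_ne_one_iff (lineChar_ne_zero hg)]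
      simp only [hiff]
      refine Finset.sum_congr rfl fun g hg => ?_
      simp only [Finset.mem_filter, Finset.mem_univ, true_and] at hg
      simp only [hF]
      rw [centralizer_eq_lineStab hf hg.1 ((hiff g).2 hg).1, tr_eq_lineChar hg.1]
    -- Points of the same orbit have stabilizers of the same order.
    rw [hdouble, ← Finset.sum_fiberwise_of_maps_to (g := mkΩ) (t := P.image mkΩ)
      (fun p hp => Finset.mem_image_of_mem _ hp), ← Finset.sum_coe_sort]
    refine Finset.sum_congr rfl fun ω _ => ?_
    rw [← Finset.sum_const]
    refine Finset.sum_congr rfl fun p hp => ?_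
    obtain ⟨k, hk⟩ := hrep p
    rw [(Finset.mem_filter.1 hp).2] at hk
    dsimp only
    rw [hparam p, ← hk, hcardconj]

end OrbitData

/-- The solutions of the class equation with three orbits: half the order `n` of the group and
half the orders `m₁ ≤ m₂ ≤ m₃` of the stabilizers. -/
def IsPolyhedral (n m₁ m₂ m₃ : ℕ) : Prop :=
  (m₁ = 2 ∧ m₂ = 2 ∧ 2 ≤ m₃ ∧ n = 2 * m₃) ∨ (m₁ = 2 ∧ m₂ = 3 ∧ m₃ = 3 ∧ n = 12) ∨
    (m₁ = 2 ∧ m₂ = 3 ∧ m₃ = 4 ∧ n = 24) ∨ (m₁ = 2 ∧ m₂ = 3 ∧ m₃ = 5 ∧ n = 60)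

/-- The classification of the solutions of `∑ 1 / mᵢ = 1 + 2 / n`, where `n / mᵢ = kᵢ` is an
integer. -/
lemma isPolyhedral_of_classEquation {n m₁ m₂ m₃ k₁ k₂ k₃ : ℕ} (h₁ : k₁ * m₁ = n)
    (h₂ : k₂ * m₂ = n) (h₃ : k₃ * m₃ = n) (hm₁ : 2 ≤ m₁) (hm₁₂ : m₁ ≤ m₂) (hm₂₃ : m₂ ≤ m₃)
    (hn : 0 < n) (hk : n + 2 = k₁ + k₂ + k₃) : IsPolyhedral n m₁ m₂ m₃ := by
  have hk₁ : 0 < k₁ := Nat.pos_of_ne_zero (by rintro rfl; omega)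
  have hk₂ : 0 < k₂ := Nat.pos_of_ne_zero (by rintro rfl; omega)
  have hk₃ : 0 < k₃ := Nat.pos_of_ne_zero (by rintro rfl; omega)
  have h21 : k₂ ≤ k₁ := by
    by_contra hlt; push Not at hlt
    have : k₁ * m₁ < k₂ * m₂ := Nat.mul_lt_mul_of_lt_of_le hlt hm₁₂ (by omega)
    omega
  have h32 : k₃ ≤ k₂ := by
    by_contra hlt; push Not at hlt
    have : k₂ * m₂ < k₃ * m₃ := Nat.mul_lt_mul_of_lt_of_le hlt hm₂₃ (by omega)
    omega
  have e₁ : m₁ = 2 := by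
    by_contra hne
    have : k₁ * 3 ≤ k₁ * m₁ := Nat.mul_le_mul_left _ (by omega)
    omega
  subst e₁
  rcases Nat.lt_or_ge m₂ 3 with hlt | hge
  · have e₂ : m₂ = 2 := by omega
    subst e₂
    have e₃ : k₃ = 2 := by omega
    subst e₃
    exact Or.inl ⟨rfl, rfl, by omega, by omega⟩
  · have e₂ : m₂ = 3 := by
      by_contra hne
      have : k₂ * 4 ≤ k₂ * m₂ := Nat.mul_le_mul_left _ (by omega)
      omega
    subst e₂
    have h6 : k₃ * m₃ < 6 * k₃ := by omega
    have : m₃ < 6 := by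
      by_contra hge
      have : k₃ * 6 ≤ k₃ * m₃ := Nat.mul_le_mul_left _ (by omega)
      omega
    right
    interval_cases m₃
    · exact Or.inl ⟨rfl, rfl, rfl, by omega⟩
    · exact Or.inr (Or.inl ⟨rfl, rfl, rfl, by omega⟩)
    · exact Or.inr (Or.inr ⟨rfl, rfl, rfl, by omega⟩)

section Classification

variable {H : Type*} [Group H] [Fintype H] {f : H →* SL2} (hf : Function.Injective f)

open scoped Classical in
/-- The group `H ⊆ SL₂(ℂ)` of order `2 n` contains `-1` and has three orbits of special points on
the projective line, with stabilizers of orders `2 m₁`, `2 m₂`, `2 m₃`. -/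
structure HasClassType (f : H →* SL2) (n m₁ m₂ m₃ : ℕ) : Prop where
  poly : IsPolyhedral n m₁ m₂ m₃
  card : Nat.card H = 2 * n
  scalar : (Finset.univ.filter fun g : H => tr (f g) ^ 2 = 4).card = 2
  sum : ∃ k₁ k₂ k₃ : ℕ, k₁ * m₁ = n ∧ k₂ * m₂ = n ∧ k₃ * m₃ = n ∧
    ∀ {E : Type} [AddCommMonoid E] (Φ : ℂ → ℕ → E),
      2 • ∑ g : H with tr (f g) ^ 2 ≠ 4,
        Φ (tr (f g)) (Nat.card (Subgroup.centralizer ({g} : Set H))) =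
      k₁ • ∑ ζ ∈ nthRootsFinset (2 * m₁) (1 : ℂ) with ζ ^ 2 ≠ 1, Φ (ζ + ζ⁻¹) (2 * m₁) +
      k₂ • ∑ ζ ∈ nthRootsFinset (2 * m₂) (1 : ℂ) with ζ ^ 2 ≠ 1, Φ (ζ + ζ⁻¹) (2 * m₂) +
      k₃ • ∑ ζ ∈ nthRootsFinset (2 * m₃) (1 : ℂ) with ζ ^ 2 ≠ 1, Φ (ζ + ζ⁻¹) (2 * m₃)

include hf

open scoped Classical in
/-- The scalar matrices of determinant one are `1` and `-1`. -/
lemma card_scalar_le : (Finset.univ.filter fun g : H => tr (f g) ^ 2 = 4).card ≤ 2 := by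
  have : (Finset.univ.filter fun g : H => tr (f g) ^ 2 = 4).card ≤ ({2, -2} : Finset ℂ).card := by
    apply Finset.card_le_card_of_injOn (fun g => tr (f g))
    · intro g hg
      simp only [Finset.coe_filter, Finset.mem_univ, true_and, Set.mem_ofPred_eq] at hg
      have : (tr (f g) - 2) * (tr (f g) + 2) = 0 := by linear_combination hg
      rcases mul_eq_zero.1 this with h | h
      · simp [sub_eq_zero.1 h]
      · simp [eq_neg_of_add_eq_zero_left h]
    · intro g hg k hk hgk
      simp only [Finset.coe_filter, Finset.mem_univ, true_and, Set.mem_ofPred_eq] at hg hk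
      apply hf
      apply Subtype.ext
      rw [eq_smul_one_of_tr_sq (isOfFinOrder_map f g) hg,
        eq_smul_one_of_tr_sq (isOfFinOrder_map f k) hk]
      simp only at hgk
      rw [hgk]
  exact this.trans Finset.card_le_two

open scoped Classical in
/-- A finite subgroup of `SL₂(ℂ)` fixes a point of the projective line, or is of one of the
polyhedral types. -/
theorem fixed_line_or_hasClassType :
    (∃ p, lineStab f p = ⊤) ∨ ∃ n m₁ m₂ m₃, HasClassType f n m₁ m₂ m₃ := by
  obtain ⟨Ω, _, s, k, hks, hz, hns, hp, hsum⟩ := exists_orbit_data hf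
  set z := (Finset.univ.filter fun g : H => tr (f g) ^ 2 = 4).card with hzdef
  have hz2 : z ≤ 2 := card_scalar_le hf
  have hz1 : 1 ≤ z := by
    apply Finset.card_pos.2 ⟨1, _⟩
    simp [tr_one]; norm_num
  have hHpos : 0 < Nat.card H := Nat.card_pos
  have hspos : ∀ ω, 0 < s ω := fun ω => Nat.pos_of_ne_zero fun h => by
    have := hks ω; rw [h] at this; omega
  have hkpos : ∀ ω, 0 < k ω := fun ω => Nat.pos_of_ne_zero fun h => by
    have := hks ω; rw [h] at this; omega
  -- the number of non-scalar elements of a stabilizer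
  have hcnt : ∀ ω, ((nthRootsFinset (s ω) (1 : ℂ)).filter (fun ζ => ζ ^ 2 ≠ 1)).card + z = s ω := by
    intro ω
    have := Finset.card_filter_add_card_filter_not (s := nthRootsFinset (s ω) (1 : ℂ))
      (fun ζ => ζ ^ 2 = 1)
    rw [hz ω, card_nthRootsFinset_complex (hspos ω)] at this
    simp only [ne_eq]
    omega
  have hlt : ∀ ω, z < s ω := by
    intro ω
    obtain ⟨ζ, hζ, hζ2⟩ := hns ω
    have : 0 < ((nthRootsFinset (s ω) (1 : ℂ)).filter (fun ζ => ζ ^ 2 ≠ 1)).card :=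
      Finset.card_pos.2 ⟨ζ, Finset.mem_filter.2 ⟨hζ, hζ2⟩⟩
    have := hcnt ω
    omega
  -- `z = 2` if `-1` is an eigenvalue, and `z = 1` otherwise
  have hpar : ∀ ω, (z = 2 ∧ Even (s ω)) ∨ (z = 1 ∧ ¬ Even (s ω)) := by
    intro ω
    by_cases he : Even (s ω)
    · left
      refine ⟨le_antisymm hz2 ?_, he⟩
      rw [← hz ω]
      refine (Finset.card_pair (show (1 : ℂ) ≠ -1 by norm_num)).symm.le.trans ?_
      apply Finset.card_le_card
      intro ζ hζ
      simp only [Finset.mem_insert, Finset.mem_singleton] at hζ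
      rw [Finset.mem_filter, mem_nthRootsFinset (hspos ω)]
      rcases hζ with rfl | rfl
      · simp
      · simp [he.neg_one_pow]
    · right
      refine ⟨le_antisymm ?_ hz1, he⟩
      rw [← hz ω]
      refine le_trans ?_ (Finset.card_singleton (1 : ℂ)).le
      apply Finset.card_le_card
      intro ζ hζ
      rw [Finset.mem_filter, mem_nthRootsFinset (hspos ω)] at hζ
      obtain ⟨j, hj⟩ := Nat.not_even_iff_odd.1 he
      have := hζ.1
      rw [hj, pow_succ, pow_mul, hζ.2, one_pow, one_mul] at this
      simpa using this
  have hzs : ∀ ω, z ∣ s ω := by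
    intro ω
    rcases hpar ω with ⟨h, he⟩ | ⟨h, -⟩
    · rw [h]; exact he.two_dvd
    · rw [h]; exact one_dvd _
  choose m hm using hzs
  have hm2 : ∀ ω, 2 ≤ m ω := by
    intro ω
    have h1 := hlt ω
    rw [hm ω] at h1
    by_contra hcon
    have : z * m ω ≤ z * 1 := Nat.mul_le_mul_left _ (by omega)
    omega
  -- the class equation
  have hcls := hsum (fun _ _ => (1 : ℕ))
  simp only [Finset.sum_const, smul_eq_mul, mul_one] at hcls
  have hcompl := Finset.card_filter_add_card_filter_not (s := (Finset.univ : Finset H))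
      (fun g => tr (f g) ^ 2 = 4)
  rw [← hzdef, Finset.card_univ, ← Nat.card_eq_fintype_card] at hcompl
  have hzn : z ∣ Nat.card H ∨ IsEmpty Ω := by
    rcases isEmpty_or_nonempty Ω with h | ⟨⟨ω⟩⟩
    · exact Or.inr h
    · left; rw [← hks ω, hm ω]; exact Dvd.intro_left (k ω * m ω) (by ring)
  rcases hzn with ⟨n, hn⟩ | hempty
  · have hkm : ∀ ω, k ω * m ω = n := by
      intro ω
      apply Nat.eq_of_mul_eq_mul_left hz1
      rw [← hn, ← hks ω, hm ω]; ring
    have hkn : ∀ ω, 2 * k ω ≤ n := by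
      intro ω
      rw [← hkm ω, mul_comm]
      exact Nat.mul_le_mul_left _ (hm2 ω)
    have hcls2 : 2 * (n - 1) = ∑ ω, (n - k ω) := by
      apply Nat.eq_of_mul_eq_mul_left hz1
      rw [Finset.mul_sum]
      have h1 : ∀ ω, z * (n - k ω) =
          k ω * ((nthRootsFinset (s ω) (1 : ℂ)).filter (fun ζ => ζ ^ 2 ≠ 1)).card := by
        intro ω
        have h2 : ((nthRootsFinset (s ω) (1 : ℂ)).filter (fun ζ => ζ ^ 2 ≠ 1)).card =
          z * (m ω - 1) := by
          have := hcnt ω; rw [hm ω] at this ⊢; rw [Nat.mul_sub]; omega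
        rw [h2, ← hkm ω, Nat.mul_sub, Nat.mul_sub, Nat.mul_sub]
        ring_nf
      rw [Finset.sum_congr rfl fun ω _ => h1 ω, ← hcls, mul_left_comm]
      congr 1
      rw [Nat.mul_sub, ← hn, mul_one]
      simp only [ne_eq]
      omega
    have hn0 : 0 < n := Nat.pos_of_ne_zero (by rintro rfl; omega)
    -- A special orbit of one point is a fixed point.
    have hfix1 : ∀ ω, k ω = 1 → ∃ p, lineStab f p = ⊤ := by
      intro ω hω
      obtain ⟨p, hp⟩ := hp ω
      refine ⟨p, ?_⟩
      apply Subgroup.eq_top_of_card_eq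
      rw [← hp, ← hks ω, hω, one_mul]
    -- Each orbit contributes at least `n / 2` to the sum `2 (n - 1)`, so there are at most three.
    have hcardle : Fintype.card Ω ≤ 3 := by
      by_contra hcon
      have h1 : ∑ ω : Ω, n ≤ ∑ ω : Ω, 2 * (n - k ω) :=
        Finset.sum_le_sum fun ω _ => by have := hkn ω; omega
      rw [← Finset.mul_sum, ← hcls2, Finset.sum_const, Finset.card_univ, smul_eq_mul] at h1
      have h2 : 4 * n ≤ Fintype.card Ω * n := Nat.mul_le_mul_right _ (by omega)
      omega
    rcases Nat.lt_or_ge (Fintype.card Ω) 3 with hlt3 | hge3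
    · left
      rcases Nat.lt_or_ge (Fintype.card Ω) 2 with hlt2 | hge2
      · have hsub : Fintype.card Ω = 0 ∨ Fintype.card Ω = 1 := by omega
        rcases hsub with h0 | h1
        · -- Without special orbits every element is scalar, and any point is fixed.
          have : IsEmpty Ω := Fintype.card_eq_zero_iff.1 h0
          have hn1 : n = 1 := by
            rw [Finset.univ_eq_empty, Finset.sum_empty] at hcls2
            omega
          let p : ℙ ℂ (Fin 2 → ℂ) := Projectivization.mk ℂ (fun _ => 1) (by
            intro h; simpa using congrFun h 0)
          refine ⟨p, ?_⟩
          rw [eq_top_iff]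
          intro g _
          apply mem_lineStab_of_tr_sq
          by_contra hg
          have : 0 < (Finset.univ.filter fun g : H => ¬ tr (f g) ^ 2 = 4).card :=
            Finset.card_pos.2 ⟨g, by simpa using hg⟩
          rw [hn1] at hn
          omega
        · -- A single orbit contributes less than `n`, which is at most `2 (n - 1)`.
          obtain ⟨ω, hω⟩ := Fintype.card_eq_one_iff.1 h1
          have : (Finset.univ : Finset Ω) = {ω} := by
            ext x; simp [hω x]
          rw [this, Finset.sum_singleton] at hcls2
          have h3 := hkpos ω
          have := hkn ω
          omega
      · have h2 : (Finset.univ : Finset Ω).card = 2 := by rw [Finset.card_univ]; omega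
        -- For two orbits the class equation is `k x + k y = 2`, so that both are fixed points.
        obtain ⟨x, y, hxy, huniv⟩ := Finset.card_eq_two.1 h2
        rw [huniv, Finset.sum_pair hxy] at hcls2
        have h3 := hkpos x
        have h4 := hkpos y
        have := hkn x
        have := hkn y
        exact hfix1 x (by omega)
    · right
      have h3 : (Finset.univ : Finset Ω).card = 3 := by rw [Finset.card_univ]; omega
      obtain ⟨x, y, w, hxy, hxw, hyw, huniv⟩ := Finset.card_eq_three.1 h3
      have hsum3 : ∀ {E : Type} [AddCommMonoid E] (F : Ω → E), ∑ ω, F ω = F x + F y + F w := by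
        intro E _ F
        rw [huniv, Finset.sum_insert (by simp [hxy, hxw]), Finset.sum_pair hyw, add_assoc]
      rw [hsum3] at hcls2
      have key : n + 2 = k x + k y + k w := by
        have := hkn x
        have := hkn y
        have := hkn w
        omega
      -- three special points in any order give a class type once the stabilizers are sorted
      have hsorted : ∀ a b c : Ω, m a ≤ m b → m b ≤ m c → n + 2 = k a + k b + k c →
          (∀ {E : Type} [AddCommMonoid E] (F : Ω → E), ∑ ω, F ω = F a + F b + F c) →
          ∃ n m₁ m₂ m₃, HasClassType f n m₁ m₂ m₃ := by
        intro a b c hab hbc hk hF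
        have hpoly := isPolyhedral_of_classEquation (hkm a) (hkm b) (hkm c) (hm2 a) hab hbc hn0 hk
        have hma : m a = 2 := by rcases hpoly with h | h | h | h <;> exact h.1
        have hz' : z = 2 := by
          rcases hpar a with ⟨h, -⟩ | ⟨h, hodd⟩
          · exact h
          · exfalso; apply hodd; rw [hm a, hma]; exact even_two.mul_left _
        refine ⟨n, m a, m b, m c, hpoly, by rw [hn, hz'], hz', k a, k b, k c, hkm a, hkm b, hkm c,
          ?_⟩
        intro E _ Φ
        rw [hsum Φ, hF]
        simp only [hm, hz']
      rcases le_total (m x) (m y) with h1 | h1 <;> rcases le_total (m y) (m w) with h2 | h2 <;>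
        rcases le_total (m x) (m w) with h3 | h3
      · exact hsorted x y w h1 h2 key hsum3
      · exact hsorted x y w h1 h2 key hsum3
      · exact hsorted x w y h3 h2 (by omega) fun F => by rw [hsum3]; abel
      · exact hsorted w x y h3 h1 (by omega) fun F => by rw [hsum3]; abel
      · exact hsorted y x w h1 h3 (by omega) fun F => by rw [hsum3]; abel
      · exact hsorted y w x h2 h3 (by omega) fun F => by rw [hsum3]; abel
      · exact hsorted w y x h2 h1 (by omega) fun F => by rw [hsum3]; abel
      · exact hsorted w y x h2 h1 (by omega) fun F => by rw [hsum3]; abel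
  · left
    let p : ℙ ℂ (Fin 2 → ℂ) := Projectivization.mk ℂ (fun _ => 1) (by
      intro h; simpa using congrFun h 0)
    refine ⟨p, ?_⟩
    rw [eq_top_iff]
    intro g _
    apply mem_lineStab_of_tr_sq
    by_contra hg
    have : 0 < (Finset.univ.filter fun g : H => ¬ tr (f g) ^ 2 = 4).card :=
      Finset.card_pos.2 ⟨g, by simpa using hg⟩
    rw [Finset.univ_eq_empty (α := Ω), Finset.sum_empty] at hcls
    simp only [ne_eq] at hcls
    omega

end Classification

end McKaySlodowy

namespace McKaySlodowy

open Polynomial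

/-! ### The degrees `a`, `b`, `h` and the Molien series -/

/-- The power series `1 / (1 - x t + t²)`, the generating function of the characters of the
symmetric powers at an element of trace `x`. -/
noncomputable def molien (x : ℂ) : PowerSeries ℂ :=
  (1 - PowerSeries.C x * PowerSeries.X + PowerSeries.X ^ 2)⁻¹

lemma molien_mul (x : ℂ) :
    molien x * (1 - PowerSeries.C x * PowerSeries.X + PowerSeries.X ^ 2) = 1 := by
  apply PowerSeries.inv_mul_cancel
  simp

lemma sum_nthRootsFinset_pow {M j : ℕ} (hM : 0 < M) (hj : ¬ M ∣ j) :
    ∑ ζ ∈ nthRootsFinset M (1 : ℂ), ζ ^ j = 0 := by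
  have hη := Complex.isPrimitiveRoot_exp M hM.ne'
  set η := Complex.exp (2 * Real.pi * Complex.I / M)
  have hη0 : η ≠ 0 := hη.ne_zero hM.ne'
  -- The sum is invariant under multiplication of its terms by `ηʲ ≠ 1`.
  have h1 : ∑ ζ ∈ nthRootsFinset M (1 : ℂ), (η * ζ) ^ j =
      ∑ ζ ∈ nthRootsFinset M (1 : ℂ), ζ ^ j := by
    refine Finset.sum_nbij' (fun ζ => η * ζ) (fun ζ => η⁻¹ * ζ) ?_ ?_ ?_ ?_ ?_
    · intro ζ hζ
      rw [mem_nthRootsFinset hM] at hζ ⊢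
      rw [mul_pow, hζ, hη.pow_eq_one, one_mul]
    · intro ζ hζ
      rw [mem_nthRootsFinset hM] at hζ ⊢
      rw [mul_pow, hζ, inv_pow, hη.pow_eq_one, inv_one, one_mul]
    · intro ζ _; simp [hη0]
    · intro ζ _; simp [hη0]
    · intro ζ _; rfl
  simp only [mul_pow, ← Finset.mul_sum] at h1
  have h2 : (η ^ j - 1) * ∑ ζ ∈ nthRootsFinset M (1 : ℂ), ζ ^ j = 0 := by
    rw [sub_mul, h1, one_mul, sub_self]
  refine (mul_eq_zero.1 h2).resolve_left ?_
  rw [sub_eq_zero, hη.pow_eq_one_iff_dvd]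
  exact hj

lemma ne_zero_of_mem_roots {M : ℕ} (hM : 0 < M) {ζ : ℂ} (hζ : ζ ∈ nthRootsFinset M (1 : ℂ)) :
    ζ ≠ 0 := by
  rw [mem_nthRootsFinset hM] at hζ
  rintro rfl
  rw [zero_pow hM.ne'] at hζ
  exact zero_ne_one hζ

/-- The Molien series of a cyclic group, up to the factor `M⁻¹`. -/
noncomputable def cyclicMolien (M : ℕ) : PowerSeries ℂ :=
  ∑ ζ ∈ nthRootsFinset M (1 : ℂ), molien (ζ + ζ⁻¹)

/-- Closed form of the Molien series of a cyclic group, from the partial fraction decomposition of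
its terms and orthogonality of the powers of the roots of unity. -/
lemma cyclicMolien_mul {M : ℕ} (hM : 0 < M) :
    (1 - PowerSeries.X ^ 2) * (1 - PowerSeries.X ^ M) * cyclicMolien M =
      PowerSeries.C (M : ℂ) * (1 + PowerSeries.X ^ M) := by
  set u : ℂ → PowerSeries ℂ := fun ζ => (1 - PowerSeries.C ζ * PowerSeries.X)⁻¹ with hu
  have hu1 : ∀ ζ, u ζ * (1 - PowerSeries.C ζ * PowerSeries.X) = 1 := fun ζ =>
    PowerSeries.inv_mul_cancel _ (by simp)
  -- Partial fractions: `(1 - t²) / ((1 - ζ t)(1 - ζ⁻¹ t)) = 1 / (1 - ζ t) + 1 / (1 - ζ⁻¹ t) - 1`.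
  have key : ∀ ζ : ℂ, ζ ≠ 0 → (1 - PowerSeries.X ^ 2) * molien (ζ + ζ⁻¹) = u ζ + u ζ⁻¹ - 1 := by
    intro ζ hζ
    have h1 := hu1 ζ
    have h2 := hu1 ζ⁻¹
    have h3 := molien_mul (ζ + ζ⁻¹)
    have hC : (PowerSeries.C ζ : PowerSeries ℂ) * PowerSeries.C ζ⁻¹ = 1 := by
      rw [← map_mul, mul_inv_cancel₀ hζ, map_one]
    rw [map_add] at h3
    set c := (PowerSeries.C ζ : PowerSeries ℂ)
    set d := (PowerSeries.C ζ⁻¹ : PowerSeries ℂ)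
    set w := molien (ζ + ζ⁻¹)
    set x := (PowerSeries.X : PowerSeries ℂ)
    have hw : w = u ζ * u ζ⁻¹ := by
      have h4 : w * ((1 - c * x) * (1 - d * x)) = 1 := by
        linear_combination h3 + w * x ^ 2 * hC
      calc w = w * ((u ζ * (1 - c * x)) * (u ζ⁻¹ * (1 - d * x))) := by rw [h1, h2]; ring
        _ = (w * ((1 - c * x) * (1 - d * x))) * (u ζ * u ζ⁻¹) := by ring
        _ = _ := by rw [h4, one_mul]
    rw [hw]
    linear_combination (u ζ * u ζ⁻¹ * x ^ 2) * hC + (u ζ⁻¹ - u ζ⁻¹ * (1 - d * x)) * h1 +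
      (u ζ - 1) * h2
  -- Only the constant terms of the geometric sums survive the summation over `ζ`.
  have hsum : (1 - PowerSeries.X ^ M) * ∑ ζ ∈ nthRootsFinset M (1 : ℂ), u ζ =
      PowerSeries.C (M : ℂ) := by
    have h1 : ∀ ζ ∈ nthRootsFinset M (1 : ℂ), (1 - PowerSeries.X ^ M) * u ζ =
        ∑ j ∈ Finset.range M, PowerSeries.C (ζ ^ j) * PowerSeries.X ^ j := by
      intro ζ hζ
      rw [mem_nthRootsFinset hM] at hζ
      have h2 := mul_neg_geom_sum (PowerSeries.C ζ * PowerSeries.X) M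
      rw [mul_pow, ← map_pow, hζ, map_one, one_mul] at h2
      rw [← h2, mul_comm, ← mul_assoc, hu1, one_mul]
      refine Finset.sum_congr rfl fun j _ => ?_
      rw [mul_pow, map_pow]
    rw [Finset.mul_sum, Finset.sum_congr rfl h1, Finset.sum_comm]
    simp only [← Finset.sum_mul, ← map_sum]
    rw [Finset.sum_eq_single 0]
    · simp [card_nthRootsFinset_complex hM]
    · intro j hj hj0
      rw [sum_nthRootsFinset_pow hM, map_zero, zero_mul]
      intro hdvd
      exact absurd (Nat.le_of_dvd (Nat.pos_of_ne_zero hj0) hdvd)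
        (not_le.2 (Finset.mem_range.1 hj))
    · intro h
      exact absurd (Finset.mem_range.2 hM) h
  have hinv : ∑ ζ ∈ nthRootsFinset M (1 : ℂ), u ζ⁻¹ = ∑ ζ ∈ nthRootsFinset M (1 : ℂ), u ζ := by
    refine Finset.sum_nbij' (fun ζ => ζ⁻¹) (fun ζ => ζ⁻¹) ?_ ?_ ?_ ?_ ?_
    · intro ζ hζ
      rw [mem_nthRootsFinset hM] at hζ ⊢
      rw [inv_pow, hζ, inv_one]
    · intro ζ hζ
      rw [mem_nthRootsFinset hM] at hζ ⊢
      rw [inv_pow, hζ, inv_one]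
    · simp
    · simp
    · simp
  rw [mul_comm (1 - PowerSeries.X ^ 2), mul_assoc, cyclicMolien, Finset.mul_sum,
    Finset.sum_congr rfl fun ζ hζ => key ζ (ne_zero_of_mem_roots hM hζ), Finset.sum_sub_distrib,
    Finset.sum_add_distrib, hinv, mul_sub, mul_add, hsum, Finset.sum_const,
    card_nthRootsFinset_complex hM, nsmul_eq_mul, mul_one]
  rw [map_natCast]
  ring

/-- The quotient of `(1 - t^a)(1 - t^b)` by `(1 - ζ t)(1 - ζ⁻¹ t)`. -/
lemma exists_quotient {a b : ℕ} {ζ : ℂ} (hζ : ζ ≠ 0)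
    (h : (ζ ^ 2 ≠ 1 ∧ (ζ ^ a = 1 ∨ ζ ^ b = 1)) ∨ (ζ ^ 2 = 1 ∧ ζ ^ a = 1 ∧ ζ ^ b = 1)) :
    ∃ q : ℂ[X], q * (1 - C (ζ + ζ⁻¹) * X + X ^ 2) = (1 - X ^ a) * (1 - X ^ b) := by
  have hfac : (1 - C (ζ + ζ⁻¹) * X + X ^ 2 : ℂ[X]) = (1 - C ζ * X) * (1 - C ζ⁻¹ * X) := by
    have : (C ζ : ℂ[X]) * C ζ⁻¹ = 1 := by rw [← C_mul, mul_inv_cancel₀ hζ, C_1]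
    rw [C_add]
    linear_combination -X ^ 2 * this
  have hdvd : ∀ (c : ℂ) (k : ℕ), c ^ k = 1 → (1 - C c * X : ℂ[X]) ∣ 1 - X ^ k := by
    intro c k hc
    have := sub_dvd_pow_sub_pow (1 : ℂ[X]) (C c * X) k
    rwa [one_pow, mul_pow, ← C_pow, hc, C_1, one_mul] at this
  rw [hfac]
  suffices hs : (1 - C ζ * X) * (1 - C ζ⁻¹ * X) ∣ ((1 - X ^ a) * (1 - X ^ b) : ℂ[X]) by
    obtain ⟨q, hq⟩ := hs
    exact ⟨q, by rw [hq, mul_comm]⟩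
  -- If `ζ² ≠ 1` the two linear factors are coprime and divide the same `1 - t^a` or `1 - t^b`; if
  -- `ζ² = 1` they coincide, and each of `1 - t^a`, `1 - t^b` takes one.
  rcases h with ⟨h2, h⟩ | ⟨h2, ha, hb⟩
  · have hcop : IsCoprime (1 - C ζ * X : ℂ[X]) (1 - C ζ⁻¹ * X) := by
      have hne : ζ ^ 2 - 1 ≠ 0 := sub_ne_zero.2 h2
      refine ⟨C (-1 / (ζ ^ 2 - 1)), C (ζ ^ 2 / (ζ ^ 2 - 1)), ?_⟩
      have e1 : (C (-1 / (ζ ^ 2 - 1)) : ℂ[X]) + C (ζ ^ 2 / (ζ ^ 2 - 1)) = 1 := by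
        rw [← C_add, ← C_1]; congr 1; field_simp; ring
      have e2 : (C (-1 / (ζ ^ 2 - 1)) : ℂ[X]) * C ζ + C (ζ ^ 2 / (ζ ^ 2 - 1)) * C ζ⁻¹ = 0 := by
        rw [← C_mul, ← C_mul, ← C_add, ← C_0]; congr 1; field_simp; ring
      linear_combination e1 - X * e2
    rcases h with h | h
    · exact (hcop.mul_dvd (hdvd _ _ h) (hdvd _ _ (by rw [inv_pow, h, inv_one]))).mul_right _
    · exact (hcop.mul_dvd (hdvd _ _ h) (hdvd _ _ (by rw [inv_pow, h, inv_one]))).mul_left _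
  · exact mul_dvd_mul (hdvd _ _ ha) (hdvd _ _ (by rw [inv_pow, hb, inv_one]))

section Degrees

/-- The numbers `a`, `b` and `h` attached to a finite group `H ⊆ SL₂(ℂ)`: the Molien series of the
invariants is `(1 + t^h) / ((1 - t^a)(1 - t^b))`, each summand of the Molien series has poles
cancelled by `(1 - t^a)(1 - t^b)`, and eigenvalues shared by non-conjugate elements are
`2h`-th roots of unity. -/
structure HasDegrees {H : Type*} [Group H] [Fintype H] (f : H →* SL2) (a b h : ℕ) : Prop where
  a_pos : 0 < a
  b_pos : 0 < b
  h_pos : 0 < h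
  even_a : Even a
  add : a + b = h + 2
  mul : a * b = 2 * Nat.card H
  quot : ∃ q : H → ℂ[X],
    (∀ g, q g * (1 - C (tr (f g)) * X + X ^ 2) = (1 - X ^ a) * (1 - X ^ b)) ∧
    ∑ g, q g = C (Nat.card H : ℂ) * (1 + X ^ h)
  shared : ∀ g k : H, tr (f g) = tr (f k) → ¬ IsConj g k → ∀ ξ : ℂ, ξ ≠ 0 →
    ξ + ξ⁻¹ = tr (f g) → ξ ^ (2 * h) = 1 ∧ ξ ^ 2 ≠ 1

variable {H : Type*} [Group H] [Fintype H] {f : H →* SL2}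

open scoped Classical in
/-- The centralizers of the members of a conjugacy class have orders adding up to the order of the
group. -/
lemma sum_card_centralizer_conj (g : H) :
    ∑ x : H with IsConj g x, Nat.card (Subgroup.centralizer ({x} : Set H)) = Nat.card H := by
  have h1 : ∀ x : H, Nat.card (Subgroup.centralizer ({x} : Set H)) =
      Nat.card (MulAction.stabilizer (ConjAct H) x) :=
    Subgroup.nat_card_centralizer_nat_card_stabilizer
  have h2 : ∀ x : H, IsConj g x → Nat.card (Subgroup.centralizer ({x} : Set H)) =
      Nat.card (MulAction.stabilizer (ConjAct H) g) := by
    intro x hx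
    rw [h1]
    obtain ⟨c, hc⟩ := (ConjAct.mem_orbit_conjAct (g := x) (h := g)).2 hx.symm
    rw [← show c • g = x from hc]
    exact (Nat.card_congr
      (MulAction.stabilizerEquivStabilizer (g := c) (a := g) rfl).toEquiv).symm
  rw [Finset.sum_congr rfl fun x hx => h2 x (Finset.mem_filter.1 hx).2, Finset.sum_const,
    smul_eq_mul]
  have h3 := Nat.card_congr (MulAction.orbitProdStabilizerEquivGroup (ConjAct H) g)
  rw [Nat.card_prod] at h3
  rw [show Nat.card H = Nat.card (ConjAct H) from rfl, ← h3]
  congr 1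
  rw [← Fintype.card_subtype, ← Nat.card_eq_fintype_card]
  apply Nat.card_congr
  refine Equiv.subtypeEquivRight fun x => ?_
  rw [ConjAct.mem_orbit_conjAct]
  exact isConj_comm

/-- A polynomial quotient by `1 - x t + t²` is the product with its inverse power series. -/
lemma coe_quot {a b : ℕ} {x : ℂ} {q : ℂ[X]}
    (hq : q * (1 - C x * X + X ^ 2) = (1 - X ^ a) * (1 - X ^ b)) :
    (q : PowerSeries ℂ) =
      (1 - PowerSeries.X ^ a) * (1 - PowerSeries.X ^ b) * molien x := by
  have h := congrArg (fun p : ℂ[X] => (p : PowerSeries ℂ)) hq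
  simp only [coe_mul, coe_add, coe_sub, coe_one, coe_pow, coe_X, coe_C] at h
  rw [← h]
  linear_combination (-(q : PowerSeries ℂ)) * molien_mul x

/-- The polynomial form of a closed expression for the Molien series. -/
lemma sum_quot_eq {a b h : ℕ} {q : H → ℂ[X]}
    (hq : ∀ g, q g * (1 - C (tr (f g)) * X + X ^ 2) = (1 - X ^ a) * (1 - X ^ b))
    (hM : (1 - PowerSeries.X ^ a) * (1 - PowerSeries.X ^ b) * ∑ g, molien (tr (f g)) =
      PowerSeries.C (Nat.card H : ℂ) * (1 + PowerSeries.X ^ h)) :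
    ∑ g, q g = C (Nat.card H : ℂ) * (1 + X ^ h) := by
  apply Polynomial.coe_injective ℂ
  simp only [coe_mul, coe_add, coe_one, coe_pow, coe_X, coe_C]
  rw [← hM, Finset.mul_sum]
  have := map_sum (Polynomial.coeToPowerSeries.ringHom (R := ℂ)) q Finset.univ
  simp only [Polynomial.coeToPowerSeries.ringHom_apply] at this
  rw [this]
  exact Finset.sum_congr rfl fun g _ => coe_quot (hq g)

variable (hf : Function.Injective f)
include hf

/-- A group that fixes a point of the projective line is cyclic, parametrized by its eigenvalue
there; its degrees are `2`, `|H|` and `|H|`. -/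
theorem hasDegrees_of_fixed_line {p : Projectivization ℂ (Fin 2 → ℂ)} (hp : lineStab f p = ⊤) :
    HasDegrees f 2 (Nat.card H) (Nat.card H) := by
  classical
  have hmem : ∀ g, g ∈ lineStab f p := fun g => hp ▸ Subgroup.mem_top g
  have hpos : 0 < Nat.card H := Nat.card_pos
  have hsum : ∀ {E : Type} [AddCommMonoid E] (F : ℂ → E),
      ∑ g, F (lineChar p (f g)) = ∑ ζ ∈ nthRootsFinset (Nat.card H) (1 : ℂ), F ζ := by
    intro E _ F
    have := sum_lineStab hf p F
    rw [hp, Subgroup.card_top] at this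
    simpa using this
  have hroot : ∀ g, lineChar p (f g) ^ Nat.card H = 1 := by
    intro g
    by_contra hne
    have := hsum (fun ζ => if ζ = lineChar p (f g) then 1 else 0)
    rw [Finset.sum_eq_zero (s := nthRootsFinset _ _), Finset.sum_eq_zero_iff] at this
    · simpa using this g (Finset.mem_univ _)
    · intro ζ hζ
      rw [mem_nthRootsFinset hpos] at hζ
      rw [if_neg]
      rintro rfl
      exact hne hζ
  refine ⟨two_pos, hpos, hpos, even_two, by ring, rfl, ?_, ?_⟩
  · have hex : ∀ g, ∃ q : ℂ[X], q * (1 - C (tr (f g)) * X + X ^ 2) =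
        (1 - X ^ 2) * (1 - X ^ Nat.card H) := by
      intro g
      rw [tr_eq_lineChar (hmem g)]
      apply exists_quotient (lineChar_ne_zero (hmem g))
      by_cases h2 : lineChar p (f g) ^ 2 = 1
      · exact Or.inr ⟨h2, h2, hroot g⟩
      · exact Or.inl ⟨h2, Or.inr (hroot g)⟩
    choose q hq using hex
    refine ⟨q, hq, sum_quot_eq hq ?_⟩
    rw [Finset.sum_congr rfl fun g _ => by rw [tr_eq_lineChar (hmem g)],
      hsum (fun ζ => molien (ζ + ζ⁻¹)), ← cyclicMolien, cyclicMolien_mul hpos]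
  · intro g k hgk hconj ξ hξ hξg
    have hg0 := lineChar_ne_zero (hmem g)
    have hξ2 : lineChar p (f g) = ξ ∨ lineChar p (f g) = ξ⁻¹ := by
      rw [← add_inv_eq_add_inv_iff hg0 hξ, hξg, tr_eq_lineChar (hmem g)]
    have hξM : ξ ^ Nat.card H = 1 := by
      have := hroot g
      rcases hξ2 with h | h
      · rwa [h] at this
      · rwa [h, inv_pow, inv_eq_one] at this
    refine ⟨by rw [mul_comm, pow_mul, hξM, one_pow], fun h2 => hconj ?_⟩
    -- If `ξ² = 1` then `g` and `k` are scalar with the same trace, hence equal.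
    have hgs : tr (f g) ^ 2 = 4 := by
      by_contra hne
      rw [← hξg] at hne
      exact (sq_ne_one_iff hξ).1 hne h2
    have : f g = f k := by
      apply Subtype.ext
      rw [eq_smul_one_of_tr_sq (isOfFinOrder_map f g) hgs,
        eq_smul_one_of_tr_sq (isOfFinOrder_map f k) (hgk ▸ hgs), hgk]
    rw [hf this]

end Degrees

section Polyhedral

variable {H : Type*} [Group H] [Fintype H] {f : H →* SL2} (hf : Function.Injective f)

/-- The degrees `a`, `b`, `h` of the polyhedral types. -/
def IsPolyhedralDegrees (n m₁ m₂ m₃ a b h : ℕ) : Prop :=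
  (m₁ = 2 ∧ m₂ = 2 ∧ 2 ≤ m₃ ∧ n = 2 * m₃ ∧ a = 4 ∧ b = 2 * m₃ ∧ h = 2 * m₃ + 2) ∨
  (m₁ = 2 ∧ m₂ = 3 ∧ m₃ = 3 ∧ n = 12 ∧ a = 6 ∧ b = 8 ∧ h = 12) ∨
  (m₁ = 2 ∧ m₂ = 3 ∧ m₃ = 4 ∧ n = 24 ∧ a = 8 ∧ b = 12 ∧ h = 18) ∨
  (m₁ = 2 ∧ m₂ = 3 ∧ m₃ = 5 ∧ n = 60 ∧ a = 12 ∧ b = 20 ∧ h = 30)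

lemma IsPolyhedral.exists_degrees {n m₁ m₂ m₃ : ℕ} (h : IsPolyhedral n m₁ m₂ m₃) :
    ∃ a b h, IsPolyhedralDegrees n m₁ m₂ m₃ a b h := by
  rcases h with ⟨h1, h2, h3, h4⟩ | ⟨h1, h2, h3, h4⟩ | ⟨h1, h2, h3, h4⟩ | ⟨h1, h2, h3, h4⟩
  · exact ⟨_, _, _, Or.inl ⟨h1, h2, h3, h4, rfl, rfl, rfl⟩⟩
  · exact ⟨_, _, _, Or.inr (Or.inl ⟨h1, h2, h3, h4, rfl, rfl, rfl⟩)⟩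
  · exact ⟨_, _, _, Or.inr (Or.inr (Or.inl ⟨h1, h2, h3, h4, rfl, rfl, rfl⟩))⟩
  · exact ⟨_, _, _, Or.inr (Or.inr (Or.inr ⟨h1, h2, h3, h4, rfl, rfl, rfl⟩))⟩

/-- The Molien series of a polyhedral type is the combination of the cyclic ones prescribed by the
class equation. -/
lemma sum_orbits_cyclicMolien {n m₁ m₂ m₃ a b h k₁ k₂ k₃ : ℕ}
    (hd : IsPolyhedralDegrees n m₁ m₂ m₃ a b h)
    (h₁ : k₁ * m₁ = n) (h₂ : k₂ * m₂ = n) (h₃ : k₃ * m₃ = n) :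
    (1 - PowerSeries.X ^ a) * (1 - PowerSeries.X ^ b) *
      ((k₁ : PowerSeries ℂ) * cyclicMolien (2 * m₁) + (k₂ : PowerSeries ℂ) * cyclicMolien (2 * m₂) +
        (k₃ : PowerSeries ℂ) * cyclicMolien (2 * m₃) - (n : PowerSeries ℂ) * cyclicMolien 2) =
      (4 * n : PowerSeries ℂ) * (1 + PowerSeries.X ^ h) := by
  -- In each case the closed forms of the cyclic Molien series are brought to the common denominator
  -- `(1 - t^a)(1 - t^b)`.
  have hA := cyclicMolien_mul (M := 2) (by norm_num)
  have hW : ∀ m : ℕ, 0 < m → _ := fun m hm => cyclicMolien_mul (M := 2 * m) (by omega)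
  simp only [map_natCast] at hA hW
  simp only [Nat.cast_mul, Nat.cast_ofNat] at hA hW
  rcases hd with ⟨rfl, rfl, hm, rfl, rfl, rfl, rfl⟩ | ⟨rfl, rfl, rfl, rfl, rfl, rfl, rfl⟩ |
    ⟨rfl, rfl, rfl, rfl, rfl, rfl, rfl⟩ | ⟨rfl, rfl, rfl, rfl, rfl, rfl, rfl⟩
  · obtain rfl : k₁ = m₃ := by omega
    obtain rfl : k₂ = k₁ := by omega
    obtain rfl : k₃ = 2 := Nat.eq_of_mul_eq_mul_right (by omega) h₃
    have h4 := hW 2 (by norm_num)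
    have h5 := hW k₂ (by omega)
    have hne : (1 - PowerSeries.X ^ 2 : PowerSeries ℂ) ≠ 0 := by
      intro h0
      have := congrArg PowerSeries.constantCoeff h0
      simp at this
    apply mul_left_cancel₀ hne
    rw [pow_succ _ (2 * k₂ + 1), pow_succ _ (2 * k₂)]
    push_cast
    generalize (PowerSeries.X ^ (2 * k₂) : PowerSeries ℂ) = Q at *
    generalize cyclicMolien 2 = A at *
    generalize cyclicMolien (2 * 2) = B at *
    generalize cyclicMolien (2 * k₂) = D at *
    set y := (PowerSeries.X : PowerSeries ℂ)
    linear_combination (-2 * k₂ * (1 + y ^ 2) * (1 - Q)) * hA + (2 * k₂ * (1 - Q)) * h4 +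
      (2 * (1 - y ^ 4)) * h5
  · obtain rfl : k₁ = 6 := by omega
    obtain rfl : k₂ = 4 := by omega
    obtain rfl : k₃ = 4 := by omega
    have h4 := hW 2 (by norm_num)
    have h6 := hW 3 (by norm_num)
    push_cast at h4 h6 ⊢
    generalize cyclicMolien 2 = A at *
    generalize cyclicMolien (2 * 2) = B at *
    generalize cyclicMolien (2 * 3) = D at *
    set y := (PowerSeries.X : PowerSeries ℂ)
    linear_combination (-12 * (1 + y ^ 2 + y ^ 4) * (1 + y ^ 2 + y ^ 4 + y ^ 6)) * hA +
      (6 * (1 + y ^ 2 + y ^ 4) * (1 + y ^ 4)) * h4 + (8 * (1 + y ^ 2 + y ^ 4 + y ^ 6)) * h6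
  · obtain rfl : k₁ = 12 := by omega
    obtain rfl : k₂ = 8 := by omega
    obtain rfl : k₃ = 6 := by omega
    have h4 := hW 2 (by norm_num)
    have h6 := hW 3 (by norm_num)
    have h8 := hW 4 (by norm_num)
    push_cast at h4 h6 h8 ⊢
    generalize cyclicMolien 2 = A at *
    generalize cyclicMolien (2 * 2) = B at *
    generalize cyclicMolien (2 * 3) = D at *
    generalize cyclicMolien (2 * 4) = E at *
    set y := (PowerSeries.X : PowerSeries ℂ)
    linear_combination (-24 * (1 + y ^ 2 + y ^ 4 + y ^ 6) *
        (1 + y ^ 2 + y ^ 4 + y ^ 6 + y ^ 8 + y ^ 10)) * hA +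
      (12 * (1 + y ^ 4) * (1 + y ^ 2 + y ^ 4 + y ^ 6 + y ^ 8 + y ^ 10)) * h4 +
      (8 * (1 + y ^ 2 + y ^ 4 + y ^ 6) * (1 + y ^ 6)) * h6 +
      (6 * (1 + y ^ 2 + y ^ 4 + y ^ 6 + y ^ 8 + y ^ 10)) * h8
  · obtain rfl : k₁ = 30 := by omega
    obtain rfl : k₂ = 20 := by omega
    obtain rfl : k₃ = 12 := by omega
    have h4 := hW 2 (by norm_num)
    have h6 := hW 3 (by norm_num)
    have h10 := hW 5 (by norm_num)
    push_cast at h4 h6 h10 ⊢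
    generalize cyclicMolien 2 = A at *
    generalize cyclicMolien (2 * 2) = B at *
    generalize cyclicMolien (2 * 3) = D at *
    generalize cyclicMolien (2 * 5) = E at *
    set y := (PowerSeries.X : PowerSeries ℂ)
    linear_combination (-60 * (1 + y ^ 2 + y ^ 4 + y ^ 6 + y ^ 8 + y ^ 10) *
        (1 + y ^ 2 + y ^ 4 + y ^ 6 + y ^ 8 + y ^ 10 + y ^ 12 + y ^ 14 + y ^ 16 + y ^ 18)) * hA +
      (30 * (1 + y ^ 4 + y ^ 8) *
        (1 + y ^ 2 + y ^ 4 + y ^ 6 + y ^ 8 + y ^ 10 + y ^ 12 + y ^ 14 + y ^ 16 + y ^ 18)) * h4 +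
      (20 * (1 + y ^ 6) *
        (1 + y ^ 2 + y ^ 4 + y ^ 6 + y ^ 8 + y ^ 10 + y ^ 12 + y ^ 14 + y ^ 16 + y ^ 18)) * h6 +
      (12 * (1 + y ^ 2 + y ^ 4 + y ^ 6 + y ^ 8 + y ^ 10) * (1 + y ^ 10)) * h10

lemma sum_roots_sq_eq_one {E : Type*} [AddCommMonoid E] {m : ℕ} (hm : 0 < m) (Φ : ℂ → E) :
    ∑ ζ ∈ nthRootsFinset (2 * m) (1 : ℂ) with ζ ^ 2 = 1, Φ (ζ + ζ⁻¹) =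
      Φ 2 + Φ (-2) := by
  classical
  have : (nthRootsFinset (2 * m) (1 : ℂ)).filter (fun ζ => ζ ^ 2 = 1) = {1, -1} := by
    ext ζ
    rw [Finset.mem_filter, mem_nthRootsFinset (by omega), Finset.mem_insert, Finset.mem_singleton,
      ← sq_eq_one_iff]
    constructor
    · exact fun h => h.2
    · intro h
      exact ⟨by rw [pow_mul, h, one_pow], h⟩
  rw [this, Finset.sum_pair (by norm_num)]
  norm_num

namespace HasClassType

variable {n m₁ m₂ m₃ : ℕ} (hT : HasClassType f n m₁ m₂ m₃)
include hT

lemma n_pos : 0 < n := by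
  rcases hT.poly with h | h | h | h <;> omega

include hf in
open scoped Classical in
/-- The scalar part of the class equation: the elements `1` and `-1`, both central. -/
lemma sum_scalar {E : Type*} [AddCommMonoid E] (Φ : ℂ → ℕ → E) :
    ∑ g : H with tr (f g) ^ 2 = 4,
      Φ (tr (f g)) (Nat.card (Subgroup.centralizer ({g} : Set H))) =
      Φ 2 (2 * n) + Φ (-2) (2 * n) := by
  set Z := (Finset.univ.filter fun g : H => tr (f g) ^ 2 = 4) with hZ
  have hcen : ∀ g ∈ Z, Nat.card (Subgroup.centralizer ({g} : Set H)) = 2 * n := by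
    intro g hg
    have hg' : tr (f g) ^ 2 = 4 := by simpa [hZ] using hg
    have hsc := eq_smul_one_of_tr_sq (isOfFinOrder_map f g) hg'
    have : Subgroup.centralizer ({g} : Set H) = ⊤ := by
      rw [eq_top_iff]
      intro k _
      rw [Subgroup.mem_centralizer_singleton_iff]
      apply hf
      apply Subtype.ext
      simp only [map_mul, Matrix.SpecialLinearGroup.coe_mul]
      rw [hsc]
      simp
    rw [this, Subgroup.card_top, hT.card]
  rw [Finset.sum_congr rfl fun g hg => by rw [hcen g hg]]
  have hinj : Set.InjOn (fun g => tr (f g)) (Z : Set H) := by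
    intro g hg k hk hgk
    have hg' : tr (f g) ^ 2 = 4 := by simpa [hZ] using hg
    have hk' : tr (f k) ^ 2 = 4 := by simpa [hZ] using hk
    apply hf
    apply Subtype.ext
    rw [eq_smul_one_of_tr_sq (isOfFinOrder_map f g) hg',
      eq_smul_one_of_tr_sq (isOfFinOrder_map f k) hk']
    simp only at hgk
    rw [hgk]
  have himg : Z.image (fun g => tr (f g)) = {2, -2} := by
    apply Finset.eq_of_subset_of_card_le
    · intro x hx
      obtain ⟨g, hg, rfl⟩ := Finset.mem_image.1 hx
      have hg' : tr (f g) ^ 2 = 4 := by simpa [hZ] using hg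
      have : (tr (f g) - 2) * (tr (f g) + 2) = 0 := by linear_combination hg'
      rcases mul_eq_zero.1 this with h | h
      · simp [sub_eq_zero.1 h]
      · simp [eq_neg_of_add_eq_zero_left h]
    · rw [Finset.card_image_of_injOn hinj, hT.scalar]
      exact Finset.card_le_two
  rw [← Finset.sum_pair (f := fun x => Φ x (2 * n)) (show (2 : ℂ) ≠ -2 by norm_num), ← himg,
    Finset.sum_image hinj]

end HasClassType

end Polyhedral

section Polyhedral

variable {H : Type*} [Group H] [Fintype H] {f : H →* SL2}

lemma card_roots_sq_ne_one {m : ℕ} (hm : 0 < m) :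
    ((nthRootsFinset (2 * m) (1 : ℂ)).filter (fun ζ => ζ ^ 2 ≠ 1)).card = 2 * m - 2 := by
  classical
  have h := Finset.card_filter_add_card_filter_not (s := nthRootsFinset (2 * m) (1 : ℂ))
    (fun ζ => ζ ^ 2 = 1)
  rw [card_nthRootsFinset_complex (by omega)] at h
  have h2 := sum_roots_sq_eq_one hm (fun _ => (1 : ℕ))
  rw [Finset.sum_const, smul_eq_mul, mul_one] at h2
  simp only [ne_eq]
  omega

namespace HasClassType

variable {n m₁ m₂ m₃ : ℕ} (hT : HasClassType f n m₁ m₂ m₃) (hf : Function.Injective f)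
include hT

lemma two_le : 2 ≤ m₁ ∧ 2 ≤ m₂ ∧ 2 ≤ m₃ := by
  rcases hT.poly with h | h | h | h <;> omega

open scoped Classical in
/-- Every non-scalar element has a centralizer of order `2 mᵢ` for some `i`, and its eigenvalues are
roots of unity of that order. -/
lemma exists_root {g : H} (hg : tr (f g) ^ 2 ≠ 4) :
    ∃ m, (m = m₁ ∨ m = m₂ ∨ m = m₃) ∧
      Nat.card (Subgroup.centralizer ({g} : Set H)) = 2 * m ∧
      ∃ ζ : ℂ, ζ ^ (2 * m) = 1 ∧ ζ ^ 2 ≠ 1 ∧ tr (f g) = ζ + ζ⁻¹ := by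
  obtain ⟨k₁, k₂, k₃, h₁, h₂, h₃, hsum⟩ := hT.sum
  have h2 := hT.two_le
  -- The class equation for the indicator function of the trace and centralizer order of `g`.
  have h := hsum (fun x c => if x = tr (f g) ∧
    c = Nat.card (Subgroup.centralizer ({g} : Set H)) then 1 else 0)
  by_contra hno
  have hz : ∀ m, (m = m₁ ∨ m = m₂ ∨ m = m₃) →
      ∑ ζ ∈ nthRootsFinset (2 * m) (1 : ℂ) with ζ ^ 2 ≠ 1, (if ζ + ζ⁻¹ = tr (f g) ∧
        2 * m = Nat.card (Subgroup.centralizer ({g} : Set H)) then 1 else 0) = 0 := by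
    intro m hm
    refine Finset.sum_eq_zero fun ζ hζ => if_neg ?_
    rintro ⟨hζ1, hc⟩
    rw [Finset.mem_filter, mem_nthRootsFinset (by omega)] at hζ
    exact hno ⟨m, hm, hc.symm, ζ, hζ.1, hζ.2, hζ1.symm⟩
  rw [hz m₁ (by simp), hz m₂ (by simp), hz m₃ (by simp)] at h
  have hpos := Finset.single_le_sum (f := fun y : H => if tr (f y) = tr (f g) ∧
    Nat.card (Subgroup.centralizer ({y} : Set H)) =
      Nat.card (Subgroup.centralizer ({g} : Set H)) then 1 else 0)
    (s := Finset.univ.filter fun y : H => tr (f y) ^ 2 ≠ 4) (fun _ _ => Nat.zero_le _)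
    (Finset.mem_filter.2 ⟨Finset.mem_univ g, hg⟩)
  rw [if_pos ⟨rfl, rfl⟩] at hpos
  simp only [smul_eq_mul, mul_zero, add_zero] at h
  omega

include hf in
open scoped Classical in
/-- The number of conjugacy classes is `2 + ∑ (mᵢ - 1)`. -/
lemma sum_card_centralizer :
    ∑ g : H, Nat.card (Subgroup.centralizer ({g} : Set H)) =
      Nat.card H * (m₁ + m₂ + m₃ - 1) := by
  have h2 := hT.two_le
  have hs := hT.sum_scalar hf (fun _ c => c)
  obtain ⟨k₁, k₂, k₃, h₁, h₂, h₃, hsum⟩ := hT.sum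
  -- The class equation weighted by the orders of the centralizers counts the conjugacy classes.
  have h := hsum (fun _ c => c)
  simp only [Finset.sum_const, smul_eq_mul] at h
  rw [card_roots_sq_ne_one (by omega), card_roots_sq_ne_one (by omega),
    card_roots_sq_ne_one (by omega)] at h
  rw [← Finset.sum_filter_add_sum_filter_not Finset.univ (fun g : H => tr (f g) ^ 2 = 4), hs,
    hT.card]
  have e : ∀ k m : ℕ, 2 ≤ m → k * m = n → k * ((2 * m - 2) * (2 * m)) = 4 * (n * (m - 1)) := by
    intro k m hm hk
    obtain ⟨j, rfl⟩ : ∃ j, m = j + 1 := ⟨m - 1, by omega⟩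
    rw [← hk, show 2 * (j + 1) - 2 = 2 * j by omega, Nat.add_sub_cancel]
    ring
  rw [e _ _ h2.1 h₁, e _ _ h2.2.1 h₂, e _ _ h2.2.2 h₃] at h
  have : 2 * n * (m₁ + m₂ + m₃ - 1) =
      2 * (n * (m₁ - 1) + n * (m₂ - 1) + n * (m₃ - 1)) + (2 * n + 2 * n) := by
    obtain ⟨i, rfl⟩ : ∃ j, m₁ = j + 1 := ⟨m₁ - 1, by omega⟩
    obtain ⟨j, rfl⟩ : ∃ j, m₂ = j + 1 := ⟨m₂ - 1, by omega⟩
    obtain ⟨l, rfl⟩ : ∃ j, m₃ = j + 1 := ⟨m₃ - 1, by omega⟩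
    rw [show i + 1 + (j + 1) + (l + 1) - 1 = i + j + l + 2 by omega, Nat.add_sub_cancel,
      Nat.add_sub_cancel, Nat.add_sub_cancel]
    ring
  rw [this]
  simp only [ne_eq] at h
  omega

include hf in
open scoped Classical in
/-- The Molien series of the polyhedral types, by the class equation for `Φ = molien`. -/
lemma sum_molien {a b h : ℕ} (hd : IsPolyhedralDegrees n m₁ m₂ m₃ a b h) :
    (1 - PowerSeries.X ^ a) * (1 - PowerSeries.X ^ b) * ∑ g, molien (tr (f g)) =
      PowerSeries.C (Nat.card H : ℂ) * (1 + PowerSeries.X ^ h) := by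
  have h2 := hT.two_le
  have hs := hT.sum_scalar hf (fun x _ => molien x)
  obtain ⟨k₁, k₂, k₃, h₁, h₂, h₃, hsum⟩ := hT.sum
  -- A sum over the roots of unity `≠ ±1` is a cyclic Molien series less its two scalar terms.
  have hW : ∀ m, 2 ≤ m → ∑ ζ ∈ nthRootsFinset (2 * m) (1 : ℂ) with ζ ^ 2 ≠ 1,
      molien (ζ + ζ⁻¹) = cyclicMolien (2 * m) - (molien 2 + molien (-2)) := by
    intro m hm
    rw [cyclicMolien, ← Finset.sum_filter_add_sum_filter_not (nthRootsFinset (2 * m) (1 : ℂ))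
      (fun ζ : ℂ => ζ ^ 2 = 1) (fun ζ => molien (ζ + ζ⁻¹)),
      sum_roots_sq_eq_one (by omega) molien]
    simp
  have hW2 : cyclicMolien 2 = molien 2 + molien (-2) := by
    have h3 := sum_roots_sq_eq_one (m := 1) one_pos molien
    rw [mul_one] at h3
    rw [cyclicMolien, ← h3, Finset.sum_filter_of_ne]
    intro ζ hζ _
    rwa [mem_nthRootsFinset (by norm_num)] at hζ
  have h := hsum (fun x _ => molien x)
  rw [hW _ h2.1, hW _ h2.2.1, hW _ h2.2.2, ← hW2] at h
  have hmain := sum_orbits_cyclicMolien hd h₁ h₂ h₃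
  rw [← Finset.sum_filter_add_sum_filter_not Finset.univ (fun g : H => tr (f g) ^ 2 = 4), hs,
    ← hW2, hT.card]
  have hkn : k₁ + k₂ + k₃ = n + 2 := by
    rcases hT.poly with ⟨rfl, rfl, h5, h6⟩ | ⟨rfl, rfl, rfl, rfl⟩ | ⟨rfl, rfl, rfl, rfl⟩ |
      ⟨rfl, rfl, rfl, rfl⟩
    · have : k₃ = 2 := Nat.eq_of_mul_eq_mul_right (by omega) (h₃.trans h6)
      omega
    · omega
    · omega
    · omega
  have hkn' : (k₁ : PowerSeries ℂ) + k₂ + k₃ = n + 2 := by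
    have := congrArg (Nat.cast : ℕ → PowerSeries ℂ) hkn
    push_cast at this
    exact this
  have h2ne : (2 : PowerSeries ℂ) ≠ 0 := by
    intro h0
    have := congrArg PowerSeries.constantCoeff h0
    rw [map_ofNat, map_zero] at this
    exact two_ne_zero this
  apply mul_left_cancel₀ h2ne
  rw [map_natCast]
  simp only [nsmul_eq_mul, Nat.cast_ofNat] at h
  push_cast
  linear_combination (1 - PowerSeries.X ^ a) * (1 - PowerSeries.X ^ b) * h + hmain -
    (1 - PowerSeries.X ^ a) * (1 - PowerSeries.X ^ b) * cyclicMolien 2 * hkn'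

include hf in
open scoped Classical in
/-- Two conjugacy classes of the same trace belong to different orbits of special points. -/
lemma pow_eq_one_of_shared {g k : H} (hgk : tr (f g) = tr (f k)) (hconj : ¬ IsConj g k) {ξ : ℂ}
    (hξ : ξ ≠ 0) (hξg : ξ + ξ⁻¹ = tr (f g)) :
    ξ ^ 2 ≠ 1 ∧ (ξ ^ (2 * m₁) = 1 ∨ ξ ^ (2 * m₂) = 1) := by
  have hns : tr (f g) ^ 2 ≠ 4 := by
    intro hgs
    apply hconj
    have : f g = f k := by
      apply Subtype.ext
      rw [eq_smul_one_of_tr_sq (isOfFinOrder_map f g) hgs,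
        eq_smul_one_of_tr_sq (isOfFinOrder_map f k) (hgk ▸ hgs), hgk]
    rw [hf this]
  refine ⟨(sq_ne_one_iff hξ).1 (hξg ▸ hns), ?_⟩
  -- Otherwise the elements of this trace come from the third orbit alone, where the eigenvalues `ξ`
  -- and `ξ⁻¹` have total weight at most `4 n`, while two conjugacy classes have total weight `2
  -- |H|`, twice as much as the class equation then allows.
  by_contra hcon
  push Not at hcon
  have h2 := hT.two_le
  obtain ⟨k₁, k₂, k₃, h₁, h₂, h₃, hsum⟩ := hT.sum
  have h := hsum (fun x c => if x = tr (f g) then c else 0)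
  have hle : ∀ m, 2 ≤ m → ∑ ζ ∈ nthRootsFinset (2 * m) (1 : ℂ) with ζ ^ 2 ≠ 1,
      (if ζ + ζ⁻¹ = tr (f g) then 2 * m else 0) ≤ 4 * m := by
    intro m hm
    rw [← Finset.sum_filter, Finset.sum_const, smul_eq_mul]
    have : (((nthRootsFinset (2 * m) (1 : ℂ)).filter (fun ζ => ζ ^ 2 ≠ 1)).filter
        (fun ζ => ζ + ζ⁻¹ = tr (f g))).card ≤ ({ξ, ξ⁻¹} : Finset ℂ).card := by
      apply Finset.card_le_card
      intro ζ hζ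
      simp only [Finset.mem_filter] at hζ
      have hζ0 := ne_zero_of_mem_roots (by omega) hζ.1.1
      have := hζ.2
      rw [← hξg, add_inv_eq_add_inv_iff hζ0 hξ] at this
      simpa using this
    have := Nat.mul_le_mul_right (2 * m) (this.trans Finset.card_le_two)
    omega
  have hzero : ∀ m, 2 ≤ m → ξ ^ (2 * m) ≠ 1 →
      ∑ ζ ∈ nthRootsFinset (2 * m) (1 : ℂ) with ζ ^ 2 ≠ 1,
      (if ζ + ζ⁻¹ = tr (f g) then 2 * m else 0) = 0 := by
    intro m hm hne
    refine Finset.sum_eq_zero fun ζ hζ => if_neg fun hζ1 => hne ?_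
    rw [Finset.mem_filter] at hζ
    have hζ0 := ne_zero_of_mem_roots (by omega) hζ.1
    have hζ2 := hζ.1
    rw [mem_nthRootsFinset (by omega)] at hζ2
    rw [← hξg, add_inv_eq_add_inv_iff hζ0 hξ] at hζ1
    rcases hζ1 with rfl | rfl
    · exact hζ2
    · rwa [inv_pow, inv_eq_one] at hζ2
  rw [hzero _ h2.1 hcon.1, hzero _ h2.2.1 hcon.2] at h
  have h3 := Nat.mul_le_mul_left k₃ (hle _ h2.2.2)
  rw [show k₃ * (4 * m₃) = 4 * (k₃ * m₃) by ring, h₃] at h3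
  have hlow : Nat.card H + Nat.card H ≤ ∑ x : H with tr (f x) ^ 2 ≠ 4,
      (if tr (f x) = tr (f g) then Nat.card (Subgroup.centralizer ({x} : Set H)) else 0) := by
    rw [← Finset.sum_filter, Finset.filter_filter]
    have hdisj : Disjoint (Finset.univ.filter fun x => IsConj g x)
        (Finset.univ.filter fun x => IsConj k x) := by
      rw [Finset.disjoint_filter]
      exact fun x _ h1 h2 => hconj (h1.trans h2.symm)
    have htrc : ∀ u x : H, IsConj u x → tr (f x) = tr (f u) := by
      intro u x hux
      obtain ⟨c, rfl⟩ := isConj_iff.1 hux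
      rw [map_mul, map_mul, map_inv, tr_conj]
    have e := congrArg₂ (· + ·) (sum_card_centralizer_conj g) (sum_card_centralizer_conj k)
    rw [← Finset.sum_union hdisj] at e
    refine e.symm.le.trans (Finset.sum_le_sum_of_subset ?_)
    intro x hx
    simp only [Finset.mem_union, Finset.mem_filter, Finset.mem_univ, true_and] at hx ⊢
    rcases hx with hx | hx
    · have := htrc _ _ hx
      exact ⟨by rw [this]; exact hns, this⟩
    · have := htrc _ _ hx
      exact ⟨by rw [this, ← hgk]; exact hns, by rw [this, hgk]⟩
  have hn := hT.n_pos
  rw [hT.card] at hlow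
  simp only [smul_eq_mul, mul_zero, zero_add] at h h3
  omega

include hf in
/-- The polyhedral types have the degrees listed in `IsPolyhedralDegrees`: all `2 mᵢ` divide `a` or
`b`, and `2 m₁`, `2 m₂` divide `2 h`. -/
theorem hasDegrees {a b h : ℕ} (hd : IsPolyhedralDegrees n m₁ m₂ m₃ a b h) :
    HasDegrees f a b h := by
  classical
  have h2 := hT.two_le
  have hcard := hT.card
  have hbas : 0 < a ∧ 0 < b ∧ 0 < h ∧ Even a ∧ Even b ∧ a + b = h + 2 ∧ a * b = 4 * n ∧
      (2 * m₁ ∣ a ∨ 2 * m₁ ∣ b) ∧ (2 * m₂ ∣ a ∨ 2 * m₂ ∣ b) ∧ (2 * m₃ ∣ a ∨ 2 * m₃ ∣ b) ∧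
      2 * m₁ ∣ 2 * h ∧ 2 * m₂ ∣ 2 * h := by
    rcases hd with ⟨rfl, rfl, hm, rfl, rfl, rfl, rfl⟩ | ⟨rfl, rfl, rfl, rfl, rfl, rfl, rfl⟩ |
      ⟨rfl, rfl, rfl, rfl, rfl, rfl, rfl⟩ | ⟨rfl, rfl, rfl, rfl, rfl, rfl, rfl⟩
    · refine ⟨by omega, by omega, by omega, ⟨2, rfl⟩, ⟨m₃, by ring⟩, by omega, by ring,
        Or.inl (by norm_num), Or.inl (by norm_num), Or.inr dvd_rfl, ⟨m₃ + 1, by ring⟩,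
        ⟨m₃ + 1, by ring⟩⟩
    all_goals decide
  obtain ⟨ha, hb, hh, hea, heb, hadd, hmul, hd1, hd2, hd3, he1, he2⟩ := hbas
  refine ⟨ha, hb, hh, hea, hadd, by rw [hmul, hcard]; ring, ?_, ?_⟩
  · have hex : ∀ g, ∃ q : ℂ[X], q * (1 - C (tr (f g)) * X + X ^ 2) =
        (1 - X ^ a) * (1 - X ^ b) := by
      intro g
      by_cases hg : tr (f g) ^ 2 = 4
      · have hx : (tr (f g) / 2) ^ 2 = 1 := by linear_combination hg / 4
        have hx0 : tr (f g) / 2 ≠ 0 := by rintro h0; rw [h0] at hx; simp at hx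
        have hxi : tr (f g) = tr (f g) / 2 + (tr (f g) / 2)⁻¹ := by
          rw [show (tr (f g) / 2)⁻¹ = tr (f g) / 2 by
            rw [inv_eq_iff_eq_inv]; exact eq_inv_of_mul_eq_one_left (by rw [← pow_two, hx])]
          ring
        rw [hxi]
        apply exists_quotient hx0
        right
        obtain ⟨i, hi⟩ := hea
        obtain ⟨j, hj⟩ := heb
        exact ⟨hx, by rw [hi, ← two_mul, pow_mul, hx, one_pow],
          by rw [hj, ← two_mul, pow_mul, hx, one_pow]⟩
      · obtain ⟨m, hm, -, ζ, hζ, hζ2, hζt⟩ := hT.exists_root hg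
        rw [hζt]
        have hζ0 : ζ ≠ 0 := by
          rintro rfl
          rw [zero_pow (by rcases hm with rfl | rfl | rfl <;> omega)] at hζ
          exact zero_ne_one hζ
        apply exists_quotient hζ0
        left
        refine ⟨hζ2, ?_⟩
        have : 2 * m ∣ a ∨ 2 * m ∣ b := by
          rcases hm with rfl | rfl | rfl <;> assumption
        rcases this with ⟨c, hc⟩ | ⟨c, hc⟩
        · left; rw [hc, pow_mul, hζ, one_pow]
        · right; rw [hc, pow_mul, hζ, one_pow]
    choose q hq using hex
    exact ⟨q, hq, sum_quot_eq hq (hT.sum_molien hf hd)⟩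
  · intro g k hgk hconj ξ hξ hξg
    obtain ⟨hξ2, hor⟩ := hT.pow_eq_one_of_shared hf hgk hconj hξ hξg
    refine ⟨?_, hξ2⟩
    obtain ⟨c, hc⟩ := he1
    obtain ⟨d, hd'⟩ := he2
    rcases hor with h1 | h1
    · rw [hc, pow_mul, h1, one_pow]
    · rw [hd', pow_mul, h1, one_pow]

end HasClassType

end Polyhedral

end McKaySlodowy

namespace McKaySlodowy

open Representation Module

/-! ### Representations of finite groups -/

section Representations

variable {H W U : Type*} [Group H] [AddCommGroup W] [Module ℂ W] [AddCommGroup U] [Module ℂ U]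

lemma isIrreducible_iff (ρ : Representation ℂ H W) :
    ρ.IsIrreducible ↔ Nontrivial W ∧
      ∀ p : Submodule ℂ W, (∀ g, p ≤ p.comap (ρ g)) → p = ⊥ ∨ p = ⊤ := by
  constructor
  · intro h
    constructor
    · by_contra hn
      rw [not_nontrivial_iff_subsingleton] at hn
      obtain ⟨a, b, hab⟩ := h.exists_pair_ne
      exact hab (Subrepresentation.toSubmodule_injective (Subsingleton.elim _ _))
    · intro p hp
      rcases h.eq_bot_or_eq_top ⟨p, fun g v hv => hp g hv⟩ with h1 | h1
      · left
        exact congrArg Subrepresentation.toSubmodule h1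
      · right
        exact congrArg Subrepresentation.toSubmodule h1
  · rintro ⟨hW, hp⟩
    refine @IsSimpleOrder.mk _ _ _ ⟨⊥, ⊤, fun h => ?_⟩ fun q => ?_
    · exact bot_ne_top (α := Submodule ℂ W) (congrArg Subrepresentation.toSubmodule h)
    · rcases hp q.toSubmodule (fun g v hv => q.apply_mem_toSubmodule g hv) with h1 | h1
      · left
        exact Subrepresentation.toSubmodule_injective h1
      · right
        exact Subrepresentation.toSubmodule_injective h1

lemma isIrreducible_of_surjective {K : Type*} [Group K] {ρ : Representation ℂ H W}
    (hρ : ρ.IsIrreducible) (c : K →* H) (hc : Function.Surjective c) :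
    IsIrreducible (ρ.comp c : Representation ℂ K W) := by
  rw [isIrreducible_iff] at hρ ⊢
  refine ⟨hρ.1, fun p hp => hρ.2 p fun g => ?_⟩
  obtain ⟨k, rfl⟩ := hc g
  exact hp k

lemma isIrreducible_of_equiv {ρ : Representation ℂ H W} {σ : Representation ℂ H U}
    (hρ : ρ.IsIrreducible) (e : ρ.Equiv σ) : σ.IsIrreducible := by
  rw [isIrreducible_iff] at hρ ⊢
  obtain ⟨h1, h2⟩ := hρ
  refine ⟨e.toLinearEquiv.symm.toEquiv.nontrivial, fun p hp => ?_⟩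
  have hmem : ∀ u, e.symm u ∈ p.comap e.toIntertwiningMap.toLinearMap ↔ u ∈ p := fun u => by
    rw [Submodule.mem_comap]
    exact iff_of_eq (congrArg (· ∈ p) (e.apply_symm_apply u))
  rcases h2 (p.comap e.toIntertwiningMap.toLinearMap) (fun g w hw => by
    rw [Submodule.mem_comap] at hw ⊢
    have := hp g hw
    rw [Submodule.mem_comap] at this ⊢
    convert this using 1
    exact IntertwiningMap.isIntertwining _ _ e.toIntertwiningMap g w) with h | h
  · left
    rw [eq_bot_iff]
    intro u hu
    rw [← hmem, h, Submodule.mem_bot] at hu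
    rw [Submodule.mem_bot, ← e.apply_symm_apply u, hu]
    exact map_zero e.toIntertwiningMap.toLinearMap
  · right
    rw [eq_top_iff]
    intro u _
    rw [← hmem, h]
    trivial

lemma exists_minimal_invariant [FiniteDimensional ℂ W] (ρ : Representation ℂ H W)
    {p : Submodule ℂ W} (hp : ∀ g, p ≤ p.comap (ρ g)) (h0 : p ≠ ⊥) :
    ∃ q ≤ p, (∀ g, q ≤ q.comap (ρ g)) ∧ q ≠ ⊥ ∧
      ∀ q' ≤ q, (∀ g, q' ≤ q'.comap (ρ g)) → q' = ⊥ ∨ q' = q := by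
  obtain ⟨q, hq, hmin⟩ := exists_minimal_of_wellFoundedLT
    (fun q : Submodule ℂ W => q ≤ p ∧ (∀ g, q ≤ q.comap (ρ g)) ∧ q ≠ ⊥) ⟨p, le_rfl, hp, h0⟩
  refine ⟨q, hq.1, hq.2.1, hq.2.2, fun q' hq' hinv => ?_⟩
  by_cases h : q' = ⊥
  · exact Or.inl h
  · exact Or.inr (le_antisymm hq' (hmin ⟨hq'.trans hq.1, hinv, h⟩ hq'))

open scoped ComplexOrder in
/-- The matrices of `ρ` are unitary for a Hermitian form obtained by averaging. -/
theorem char_inv_eq_star [Finite H] [FiniteDimensional ℂ W] (ρ : Representation ℂ H W) (g : H) :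
    ρ.character g⁻¹ = star (ρ.character g) := by
  classical
  have := Fintype.ofFinite H
  let b := finBasis ℂ W
  let M : H → Matrix _ _ ℂ := fun g => LinearMap.toMatrix b b (ρ g)
  have hM1 : M 1 = 1 := by simp [M]
  have hMm : ∀ g h, M (g * h) = M g * M h := fun g h => by
    simp only [M, map_mul, LinearMap.toMatrix_mul]
  have htr : ∀ g, ρ.character g = (M g).trace := fun g =>
    LinearMap.trace_eq_matrix_trace ℂ b (ρ g)
  let P := ∑ g, (M g).conjTranspose * M g
  have hP : P.PosDef := by
    have h1 : P = (M 1).conjTranspose * M 1 + ∑ g ∈ Finset.univ.erase 1,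
        (M g).conjTranspose * M g :=
      (Finset.add_sum_erase _ _ (Finset.mem_univ 1)).symm
    rw [h1, hM1, Matrix.conjTranspose_one, one_mul]
    exact Matrix.PosDef.one.add_posSemidef
      (Matrix.posSemidef_sum _ fun g _ => Matrix.posSemidef_conjTranspose_mul_self _)
  have hu : IsUnit P.det := hP.det_pos.ne'.isUnit
  have hinv : (M g).conjTranspose * P * M g = P := by
    simp only [P, Finset.mul_sum, Finset.sum_mul]
    refine Fintype.sum_equiv (Equiv.mulRight g) _ _ fun x => ?_
    simp only [Equiv.coe_mulRight, hMm, Matrix.conjTranspose_mul, mul_assoc]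
  have h2 : P * M g⁻¹ = (M g).conjTranspose * P := by
    conv_lhs => rw [← hinv, mul_assoc, ← hMm, mul_inv_cancel, hM1, mul_one]
  have h3 : M g⁻¹ = P⁻¹ * ((M g).conjTranspose * P) := by
    rw [← h2, Matrix.nonsing_inv_mul_cancel_left _ _ hu]
  rw [htr, htr, h3, Matrix.trace_mul_comm, Matrix.mul_nonsing_inv_cancel_right _ _ hu,
    Matrix.trace_conjTranspose]

/-- Modules whose characters are not orthogonal are joined by a nonzero homomorphism. -/
lemma exists_intertwining_of_sum_ne_zero [Fintype H] [FiniteDimensional ℂ W]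
    [FiniteDimensional ℂ U] (ρ : Representation ℂ H W) (σ : Representation ℂ H U)
    (h : ∑ g, σ.character g * ρ.character g⁻¹ ≠ 0) : ∃ T : IntertwiningMap ρ σ, T ≠ 0 := by
  have : Invertible (Nat.card H : ℂ) :=
    invertibleOfNonzero (Nat.cast_ne_zero.2 Nat.card_pos.ne')
  have h1 := card_inv_mul_sum_char_mul_char_eq_finrank ρ σ
  by_contra! hT
  have : Subsingleton (IntertwiningMap ρ σ) := ⟨fun a b => by rw [hT a, hT b]⟩
  rw [finrank_zero_of_subsingleton, Nat.cast_zero, mul_eq_zero] at h1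
  rcases h1 with h1 | h1
  · exact inv_ne_zero (Nat.cast_ne_zero.2 Nat.card_pos.ne') h1
  · exact h h1

lemma bijective_of_irreducible {ρ : Representation ℂ H W} {σ : Representation ℂ H U}
    (hρ : ρ.IsIrreducible) (hσ : σ.IsIrreducible) (T : IntertwiningMap ρ σ) (hT : T ≠ 0) :
    Function.Bijective T :=
  (IsIrreducible.bijective_or_eq_zero T).resolve_right hT

/-- If `G/N` is abelian, irreducible modules of `G` whose restrictions to `N` have a common
constituent have isomorphic restrictions: `G/N` acts on `Hom_N(W, U)`, and a common eigenvector of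
this action is an isomorphism. -/
theorem nonempty_res_equiv {G : Type*} [Group G] (N : Subgroup G) [N.Normal]
    (hab : ∀ x y : G, x⁻¹ * y⁻¹ * x * y ∈ N) [FiniteDimensional ℂ W] [FiniteDimensional ℂ U]
    {ρ : Representation ℂ G W} {σ : Representation ℂ G U} (hρ : ρ.IsIrreducible)
    (hσ : σ.IsIrreducible) (T : IntertwiningMap (res N ρ) (res N σ)) (hT : T ≠ 0) :
    Nonempty ((res N ρ).Equiv (res N σ)) := by
  -- `G` acts by `L` on `Hom(W, U)`, and `p = Hom_N(W, U)` is an invariant subspace.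
  let L := linHom ρ σ
  have hL : ∀ g S, L g S = σ g ∘ₗ S ∘ₗ ρ g⁻¹ := fun g S => rfl
  let p : Submodule ℂ (W →ₗ[ℂ] U) := invariants (L.comp N.subtype)
  have hpm : ∀ S, S ∈ p ↔ ∀ n ∈ N, L n S = S := by
    intro S
    simp only [p, mem_invariants]
    exact ⟨fun h n hn => h ⟨n, hn⟩, fun h n => h n n.2⟩
  have hLm : ∀ g k S, L (g * k) S = L g (L k S) := fun g k S => by rw [map_mul]; rfl
  have hpinv : ∀ g, p ≤ p.comap (L g) := by
    intro g S hS
    rw [Submodule.mem_comap, hpm]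
    intro n hn
    rw [← hLm, show n * g = g * (g⁻¹ * n * g) by group, hLm]
    congr 1
    refine (hpm S).1 hS _ ?_
    have := ‹N.Normal›.conj_mem n hn g⁻¹
    simpa using this
  have hp0 : p ≠ ⊥ := by
    intro h
    apply hT
    have : T.toLinearMap ∈ p := by
      rw [hpm]
      intro n hn
      rw [hL]
      ext w
      have := IntertwiningMap.isIntertwining _ _ T ⟨n, hn⟩ (ρ n⁻¹ w)
      simp only [MonoidHom.coe_comp, Function.comp_apply, Subgroup.coe_subtype] at this
      simp only [LinearMap.comp_apply, IntertwiningMap.toLinearMap_apply]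
      rw [← this, ← Module.End.mul_apply, ← map_mul, mul_inv_cancel, map_one, Module.End.one_apply]
    rw [h, Submodule.mem_bot] at this
    exact IntertwiningMap.ext this
  -- On `p` the operators `L g` commute, so that on a minimal invariant subspace `q` each is a
  -- scalar.
  obtain ⟨q, hqp, hq, hq0, hmin⟩ := exists_minimal_invariant L hpinv hp0
  have hc : ∀ g, ∃ c : ℂ, ∀ S ∈ q, L g S = c • S := by
    intro g
    have : Nontrivial q := Submodule.nontrivial_iff_ne_bot.2 hq0
    obtain ⟨c, hc⟩ := Module.End.exists_eigenvalue ((L g).restrict (hq g))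
    obtain ⟨v, hv⟩ := hc.exists_hasEigenvector
    refine ⟨c, ?_⟩
    have hv1 : L g v.1 = c • v.1 := congrArg Subtype.val hv.apply_eq_smul
    have h1 := hmin (q ⊓ LinearMap.ker (L g - c • LinearMap.id)) inf_le_left (by
      intro k S hS
      rw [Submodule.mem_comap, Submodule.mem_inf]
      refine ⟨hq k hS.1, ?_⟩
      have h2 : S ∈ LinearMap.ker (L g - c • LinearMap.id) := hS.2
      change L k S ∈ LinearMap.ker (L g - c • LinearMap.id)
      rw [LinearMap.mem_ker, LinearMap.sub_apply, sub_eq_zero, LinearMap.smul_apply,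
        LinearMap.id_apply] at h2 ⊢
      rw [← map_smul, ← h2, ← hLm, ← hLm,
        show g * k = k * g * (g⁻¹ * k⁻¹ * g * k) by group, hLm (k * g)]
      congr 1
      exact (hpm S).1 (hqp hS.1) _ (hab g k))
    rcases h1 with h1 | h1
    · exfalso
      have : v.1 ∈ q ⊓ LinearMap.ker (L g - c • LinearMap.id) := by
        refine ⟨v.2, ?_⟩
        change v.1 ∈ LinearMap.ker (L g - c • LinearMap.id)
        rw [LinearMap.mem_ker, LinearMap.sub_apply, hv1]
        simp
      rw [h1, Submodule.mem_bot] at this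
      exact hv.2 (Subtype.ext this)
    · intro S hS
      rw [← h1] at hS
      have h2 : S ∈ LinearMap.ker (L g - c • LinearMap.id) := hS.2
      rwa [LinearMap.mem_ker, LinearMap.sub_apply, sub_eq_zero] at h2
  obtain ⟨S, hSq, hS0⟩ := Submodule.exists_mem_ne_zero_of_ne_bot hq0
  -- A nonzero element `S` of `q` intertwines the actions of `G` up to scalars; its kernel and range
  -- are therefore invariant.
  have hkey : ∀ g, ∃ c : ℂ, c ≠ 0 ∧ ∀ w, σ g (S w) = c • S (ρ g w) := by
    intro g
    obtain ⟨c, hc⟩ := hc g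
    have h1 := hc S hSq
    have h2 : ∀ w, σ g (S w) = c • S (ρ g w) := by
      intro w
      have := LinearMap.congr_fun h1 (ρ g w)
      rw [hL] at this
      simpa using this
    refine ⟨c, ?_, h2⟩
    rintro rfl
    apply hS0
    ext w
    have h3 := h2 w
    rw [zero_smul] at h3
    have : σ g⁻¹ (σ g (S w)) = 0 := by rw [h3, map_zero]
    simpa using this
  rw [isIrreducible_iff] at hρ hσ
  have hbij : Function.Bijective S := by
    constructor
    · rw [← LinearMap.ker_eq_bot]
      refine (hρ.2 (LinearMap.ker S) fun g w hw => ?_).resolve_right fun h =>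
        hS0 (LinearMap.ker_eq_top.1 h)
      obtain ⟨c, hc0, hc⟩ := hkey g
      rw [Submodule.mem_comap, LinearMap.mem_ker]
      rw [LinearMap.mem_ker] at hw
      have := hc w
      rw [hw, map_zero] at this
      exact (smul_eq_zero.1 this.symm).resolve_left hc0
    · rw [← LinearMap.range_eq_top]
      refine (hσ.2 (LinearMap.range S) fun g u hu => ?_).resolve_left fun h =>
        hS0 (LinearMap.range_eq_bot.1 h)
      obtain ⟨w, rfl⟩ := hu
      obtain ⟨c, hc0, hc⟩ := hkey g
      rw [Submodule.mem_comap, hc]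
      exact Submodule.smul_mem _ _ ⟨_, rfl⟩
  refine ⟨Representation.Equiv.mk (LinearEquiv.ofBijective S hbij) fun n => ?_⟩
  ext w
  have h1 := (hpm S).1 (hqp hSq) n n.2
  have := LinearMap.congr_fun h1 (ρ n w)
  rw [hL] at this
  simpa using this.symm

/-- A class function orthogonal to every irreducible character vanishes: the operator it defines
is zero on every irreducible module, hence on the regular one. -/
theorem eq_zero_of_orthogonal [Fintype H] {F : H → ℂ} (hF : ∀ g k, F (k * g * k⁻¹) = F g)
    (horth : ∀ (n : ℕ) (π : Representation ℂ H (Fin n → ℂ)), π.IsIrreducible →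
      ∑ g, F g * π.character g = 0) : F = 0 := by
  classical
  -- The operator `∑ F g • ρ g` commutes with `ρ`, hence is a scalar if `ρ` is irreducible; its
  -- trace vanishes by assumption.
  have hcomm : ∀ {X : Type _} [AddCommGroup X] [Module ℂ X] (ρ : Representation ℂ H X) (k : H),
      (∑ g, F g • ρ g) ∘ₗ ρ k = ρ k ∘ₗ ∑ g, F g • ρ g := by
    intro X _ _ ρ k
    refine LinearMap.ext fun x => ?_
    simp only [LinearMap.comp_apply, LinearMap.sum_apply, LinearMap.smul_apply, map_sum, map_smul]
    refine (Fintype.sum_equiv (MulAut.conj k).toEquiv _ _ fun g => ?_).symm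
    have : F (k * g * k⁻¹) = F g := hF g k
    simp only [MulEquiv.toEquiv_eq_coe, EquivLike.coe_coe, MulAut.conj_apply, this]
    rw [← Module.End.mul_apply, ← Module.End.mul_apply, ← map_mul, ← map_mul, inv_mul_cancel_right]
  have hirr : ∀ {X : Type _} [AddCommGroup X] [Module ℂ X] [FiniteDimensional ℂ X]
      (ρ : Representation ℂ H X), ρ.IsIrreducible → ∑ g, F g • ρ g = 0 := by
    intro X _ _ _ ρ hρ
    let e : X ≃ₗ[ℂ] (Fin (finrank ℂ X) → ℂ) := (finBasis ℂ X).equivFun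
    let π : Representation ℂ H (Fin (finrank ℂ X) → ℂ) :=
      { toFun := fun g => e.conj (ρ g)
        map_one' := by rw [map_one]; exact e.conj_id
        map_mul' := fun g k => by rw [map_mul]; exact e.conj_comp _ _ }
    let E : ρ.Equiv π := Representation.Equiv.mk e fun g => by
      ext x
      simp [π, LinearEquiv.conj_apply]
    have hsum := horth _ π (isIrreducible_of_equiv hρ E)
    rw [← char_iso E] at hsum
    obtain ⟨c, hc⟩ := (IsIrreducible.algebraMap_intertwiningMap_bijective_of_isAlgClosed
      (ρ := ρ)).2 ⟨∑ g, F g • ρ g, fun k => hcomm ρ k⟩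
    have hc' : c • (LinearMap.id : X →ₗ[ℂ] X) = ∑ g, F g • ρ g :=
      congrArg IntertwiningMap.toLinearMap hc
    have htr := congrArg (LinearMap.trace ℂ X) hc'
    rw [map_sum] at htr
    simp only [map_smul, LinearMap.trace_id, smul_eq_mul] at htr
    rw [show ∑ g, F g * LinearMap.trace ℂ X (ρ g) = 0 from hsum, mul_eq_zero] at htr
    rcases htr with h | h
    · rw [← hc', h, zero_smul]
    · have : Nontrivial X := ((isIrreducible_iff ρ).1 hρ).1
      exact absurd h (Nat.cast_ne_zero.2 (finrank_pos (R := ℂ) (M := X)).ne')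
  -- An irreducible submodule of a complement of the kernel of `T` in the regular module would lie
  -- in this kernel.
  let R := leftRegular ℂ H
  let T := ∑ g, F g • R g
  have : FiniteDimensional ℂ (MonoidAlgebra ℂ H) :=
    Module.Finite.equiv (MonoidAlgebra.coeffLinearEquiv ℂ).symm
  have hT : T = 0 := by
    let K : Subrepresentation R := ⟨LinearMap.ker T, fun k v hv => by
      rw [LinearMap.mem_ker] at hv ⊢
      have := LinearMap.congr_fun (hcomm R k) v
      rw [LinearMap.comp_apply, LinearMap.comp_apply] at this
      rw [this, hv, map_zero]⟩
    have : NeZero (Nat.card H : ℂ) := ⟨Nat.cast_ne_zero.2 Nat.card_pos.ne'⟩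
    have : IsSemisimpleRepresentation R :=
      (isSemisimpleRepresentation_iff_isSemisimpleModule_asModule R).2 inferInstance
    obtain ⟨Q, hQ⟩ := exists_isCompl K
    by_contra hT0
    have hQ0 : Q.toSubmodule ≠ ⊥ := by
      intro h
      have : Q = ⊥ := Subrepresentation.toSubmodule_injective h
      rw [this] at hQ
      have : K = ⊤ := by simpa using hQ.sup_eq_top
      exact hT0 (LinearMap.ker_eq_top.1 (congrArg Subrepresentation.toSubmodule this))
    obtain ⟨q, hqQ, hq, hq0, hmin⟩ := exists_minimal_invariant R
      (fun g v hv => Q.apply_mem_toSubmodule g hv) hQ0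
    have hsub : IsIrreducible (R.subrepresentation q hq) := by
      rw [isIrreducible_iff]
      refine ⟨Submodule.nontrivial_iff_ne_bot.2 hq0, fun p hp => ?_⟩
      rcases hmin (p.map q.subtype) (Submodule.map_subtype_le _ _) (by
        rintro g _ ⟨v, hv, rfl⟩
        exact ⟨_, hp g hv, rfl⟩) with h | h
      · left
        rw [eq_bot_iff]
        intro v hv
        have h' : (v : MonoidAlgebra ℂ H) ∈ p.map q.subtype := ⟨v, hv, rfl⟩
        rw [h, Submodule.mem_bot] at h'
        exact Subtype.ext h'
      · right
        rw [eq_top_iff]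
        rintro v -
        have : (v : MonoidAlgebra ℂ H) ∈ p.map q.subtype := by
          rw [h]
          exact v.2
        obtain ⟨w, hw, hwv⟩ := this
        rwa [← Subtype.ext hwv]
    have hz := hirr _ hsub
    have hqK : q ≤ K.toSubmodule := by
      intro v hv
      have := congrArg Subtype.val (LinearMap.congr_fun hz ⟨v, hv⟩)
      simp only [LinearMap.sum_apply, LinearMap.smul_apply, AddSubmonoidClass.coe_finsetSum,
        Submodule.coe_smul] at this
      change T v = 0
      simp only [T, LinearMap.sum_apply, LinearMap.smul_apply]
      exact this
    apply hq0
    rw [eq_bot_iff]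
    have hd : K.toSubmodule ⊓ Q.toSubmodule = ⊥ := by
      have := congrArg Subrepresentation.toSubmodule hQ.inf_eq_bot
      exact this
    rw [← hd]
    exact le_inf hqK hqQ
  -- `F g` is a coefficient of `T 1`.
  funext g
  have h1 := congrArg (fun x : MonoidAlgebra ℂ H => x.coeff g)
    (LinearMap.congr_fun hT (MonoidAlgebra.single 1 1))
  simp only [T, R, LinearMap.sum_apply, LinearMap.smul_apply, ofMulAction_single, smul_eq_mul,
    mul_one, LinearMap.zero_apply] at h1
  simpa [Finsupp.single_apply] using h1

lemma DecomposesAs.character_eq {ι : Type*} [Fintype ι] {M : ι → Type*}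
    [∀ i, AddCommGroup (M i)] [∀ i, Module ℂ (M i)] [∀ i, FiniteDimensional ℂ (M i)]
    {τ : Representation ℂ H W} {μ : ∀ i, Representation ℂ H (M i)} {m : ι → ℕ}
    (h : DecomposesAs τ μ m) (g : H) :
    τ.character g = ∑ i, (m i : ℂ) * (μ i).character g := by
  classical
  obtain ⟨e⟩ := h
  rw [char_iso e]
  -- The character of a direct sum is the sum of the characters.
  have key : ∀ (J : Type _) [Fintype J] (Q : J → Type _) [∀ j, AddCommGroup (Q j)]
      [∀ j, Module ℂ (Q j)] [∀ j, FiniteDimensional ℂ (Q j)]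
      (ν : ∀ j, Representation ℂ H (Q j)),
      (Representation.directSum ν).character g = ∑ j, (ν j).character g := by
    intro J _ Q _ _ _ ν
    have : DecidableEq J := Classical.decEq J
    have : FiniteDimensional ℂ (DirectSum J Q) :=
      Module.Finite.equiv (DirectSum.linearEquivFunOnFintype ℂ J Q).symm
    have hid : (Representation.directSum ν) g = ∑ j, (Representation.directSum ν) g ∘ₗ
        (DirectSum.lof ℂ J Q j ∘ₗ DirectSum.component ℂ J Q j) := by
      refine LinearMap.ext fun x => ?_
      rw [LinearMap.sum_apply]
      simp only [LinearMap.comp_apply]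
      rw [← map_sum]
      congr 1
      exact (DFinsupp.ext fun j => by
        rw [DFinsupp.finsetSum_apply]
        simp [DirectSum.lof_eq_of, DirectSum.of_apply, DirectSum.component]
        rfl)
    rw [Representation.character, hid, map_sum]
    refine Finset.sum_congr rfl fun j _ => ?_
    rw [← LinearMap.comp_assoc, LinearMap.trace_comp_comm', Representation.character]
    congr 1
    ext w
    simp [DirectSum.component.lof_self]
  rw [key]
  rw [Fintype.sum_sigma]
  refine Finset.sum_congr rfl fun i _ => ?_
  exact (Finset.sum_const ((μ i).character g)).trans
    (by rw [Finset.card_univ, Fintype.card_fin, nsmul_eq_mul])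

end Representations

/-! ### Modules induced from a normal subgroup -/

section Induction

open scoped TensorProduct

lemma finiteDimensional_monoidAlgebra (G : Type*) [Finite G] :
    FiniteDimensional ℂ (MonoidAlgebra ℂ G) :=
  Module.Finite.equiv (MonoidAlgebra.coeffLinearEquiv ℂ).symm

/-- The trace of an operator induced on coinvariants is an average: the averaging operator
identifies the coinvariants with a direct summand. -/
lemma trace_coinvariants_map {H X : Type*} [Group H] [Fintype H] [AddCommGroup X] [Module ℂ X]
    [FiniteDimensional ℂ X] (τ : Representation ℂ H X) (T : IntertwiningMap τ τ) :
    LinearMap.trace ℂ _ (Coinvariants.map τ τ T) =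
      (Nat.card H : ℂ)⁻¹ * ∑ n, LinearMap.trace ℂ X (T.toLinearMap ∘ₗ τ n) := by
  have : FiniteDimensional ℂ (Coinvariants τ) :=
    Module.Finite.of_surjective _ (Coinvariants.mk_surjective τ)
  have hc : (Nat.card H : ℂ) ≠ 0 := Nat.cast_ne_zero.2 Nat.card_pos.ne'
  -- The averaging operator `e` factors through the coinvariants, as a section `s` of the
  -- projection.
  let e : X →ₗ[ℂ] X := (Nat.card H : ℂ)⁻¹ • ∑ n, τ n
  have he : ∀ k, e ∘ₗ τ k = e := by
    intro k
    refine LinearMap.ext fun x => ?_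
    simp only [e, LinearMap.comp_apply, LinearMap.smul_apply, LinearMap.sum_apply]
    congr 1
    refine Fintype.sum_equiv (Equiv.mulRight k) _ _ fun n => ?_
    rw [Equiv.coe_mulRight, map_mul, Module.End.mul_apply]
  let s : Coinvariants τ →ₗ[ℂ] X := Coinvariants.lift τ e he
  have hs : s ∘ₗ Coinvariants.mk τ = e := Coinvariants.lift_comp_mk _ _ _
  have hms : Coinvariants.mk τ ∘ₗ s = LinearMap.id := by
    apply Coinvariants.hom_ext
    rw [LinearMap.comp_assoc, hs]
    refine LinearMap.ext fun x => ?_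
    simp only [e, LinearMap.comp_apply, LinearMap.smul_apply, LinearMap.sum_apply, map_smul,
      map_sum, Coinvariants.mk_self_apply, LinearMap.id_apply]
    rw [Finset.sum_const, Finset.card_univ, ← Nat.card_eq_fintype_card, ← Nat.cast_smul_eq_nsmul ℂ,
      smul_smul, inv_mul_cancel₀ hc, one_smul]
  have h1 : Coinvariants.map τ τ T = Coinvariants.mk τ ∘ₗ (T.toLinearMap ∘ₗ s) := by
    apply Coinvariants.hom_ext
    rw [Coinvariants.map_comp_mk, LinearMap.comp_assoc, LinearMap.comp_assoc, hs]
    refine LinearMap.ext fun x => ?_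
    simp only [e, LinearMap.comp_apply, LinearMap.smul_apply, LinearMap.sum_apply, map_smul,
      map_sum]
    have : ∀ n, Coinvariants.mk τ (T.toLinearMap (τ n x)) = Coinvariants.mk τ (T x) := by
      intro n
      rw [IntertwiningMap.toLinearMap_apply, IntertwiningMap.isIntertwining,
        Coinvariants.mk_self_apply]
    simp only [this]
    rw [Finset.sum_const, Finset.card_univ, ← Nat.card_eq_fintype_card, ← Nat.cast_smul_eq_nsmul ℂ,
      smul_smul, inv_mul_cancel₀ hc, one_smul]
    rfl
  have h2 : T.toLinearMap ∘ₗ e =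
      (Nat.card H : ℂ)⁻¹ • ∑ n, T.toLinearMap ∘ₗ τ n := by
    refine LinearMap.ext fun x => ?_
    simp [e]
  rw [h1, LinearMap.trace_comp_comm', LinearMap.comp_assoc, hs, h2, map_smul, map_sum, smul_eq_mul]

open scoped Classical in
lemma trace_monoidAlgebra {G : Type*} [Fintype G] (T : MonoidAlgebra ℂ G →ₗ[ℂ] MonoidAlgebra ℂ G)
    (f : G → G) (hT : ∀ x, T (MonoidAlgebra.single x 1) = MonoidAlgebra.single (f x) 1) :
    LinearMap.trace ℂ _ T = ∑ x, if f x = x then 1 else 0 := by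
  let b : Basis G ℂ (MonoidAlgebra ℂ G) := Basis.ofRepr (MonoidAlgebra.coeffLinearEquiv ℂ)
  have hb : ∀ x, b x = MonoidAlgebra.single x 1 := fun x => rfl
  rw [LinearMap.trace_eq_matrix_trace ℂ b, Matrix.trace]
  refine Finset.sum_congr rfl fun x _ => ?_
  rw [Matrix.diag_apply, LinearMap.toMatrix_apply, hb, hT, ← hb, b.repr_self,
    Finsupp.single_apply]

variable {G : Type*} [Group G] (N : Subgroup G) {W U : Type*} [AddCommGroup W] [Module ℂ W]
  [FiniteDimensional ℂ W] [AddCommGroup U] [Module ℂ U] [FiniteDimensional ℂ U]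

instance finiteDimensional_indV [Finite G] (φ : Representation ℂ N W) :
    FiniteDimensional ℂ (IndV N.subtype φ) :=
  have := finiteDimensional_monoidAlgebra G
  Module.Finite.of_surjective _ (Coinvariants.mk_surjective _)

variable [N.Normal]

/-- The character of an induced module, for a normal subgroup. -/
theorem character_ind [Fintype G] [Fintype N] (φ : Representation ℂ N W) (g : N) :
    (ind N φ).character g =
      (Nat.card N : ℂ)⁻¹ * ∑ x : G, φ.character (MulAut.conjNormal x g) := by
  classical
  have := finiteDimensional_monoidAlgebra G
  rw [Representation.character, Representation.ind_apply, trace_coinvariants_map]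
  congr 1
  -- The trace of `g` on `ℂ[G] ⊗ W` twisted by `n`: the permutation `y ↦ n y g⁻¹` fixes `y` if and
  -- only if `n = y g y⁻¹`.
  have h1 : ∀ n : N, LinearMap.trace ℂ _ ((MonoidAlgebra.mapDomainLinearMap ℂ ℂ
      fun x : G => x * (g : G)⁻¹).rTensor W ∘ₗ
      (Representation.tprod ((leftRegular ℂ G).comp N.subtype) φ) n) =
      ∑ x : G, if n = MulAut.conjNormal x g then φ.character n else 0 := by
    intro n
    have h2 : (MonoidAlgebra.mapDomainLinearMap ℂ ℂ fun x : G => x * (g : G)⁻¹).rTensor W ∘ₗ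
      (Representation.tprod ((leftRegular ℂ G).comp N.subtype) φ) n =
      TensorProduct.map ((MonoidAlgebra.mapDomainLinearMap ℂ ℂ fun x : G => x * (g : G)⁻¹) ∘ₗ
        leftRegular ℂ G n) (φ n) := by
      ext
      simp
    rw [h2, LinearMap.trace_tensorProduct', trace_monoidAlgebra _ (fun x => n * x * (g : G)⁻¹)
      (fun x => by simp), Finset.sum_mul]
    refine Finset.sum_congr rfl fun x _ => ?_
    have : (n : G) * x * (g : G)⁻¹ = x ↔ n = MulAut.conjNormal x g := by
      rw [Subtype.ext_iff, MulAut.conjNormal_apply, mul_inv_eq_iff_eq_mul, eq_mul_inv_iff_mul_eq]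
    simp only [this, ite_mul, one_mul, zero_mul]
    rfl
  refine (Finset.sum_congr rfl fun n _ => h1 n).trans ?_
  rw [Finset.sum_comm]
  simp

omit [FiniteDimensional ℂ W] [FiniteDimensional ℂ U] in
/-- Conjugate modules of a normal subgroup induce isomorphic modules. -/
theorem nonempty_ind_equiv {φ : Representation ℂ N W} {π : Representation ℂ N U} (z : G)
    (T : W ≃ₗ[ℂ] U) (hT : ∀ (n : N) (w : W), T (φ (MulAut.conjNormal z n) w) = π n (T w)) :
    Nonempty ((ind N φ).Equiv (ind N π)) := by
  have hT' : ∀ (n : N) (w : W), T (φ n w) = π (MulAut.conjNormal z⁻¹ n) (T w) := by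
    intro n w
    rw [← hT, ← MulAut.mul_apply, ← map_mul, mul_inv_cancel, map_one, MulAut.one_apply]
  have hT2 : ∀ (n : N) (u : U), T.symm (π n u) = φ (MulAut.conjNormal z n) (T.symm u) := by
    intro n u
    rw [LinearEquiv.symm_apply_eq, hT, LinearEquiv.apply_symm_apply]
  -- The mutually inverse maps `h ⊗ w ↦ z⁻¹ h ⊗ T w` and `h ⊗ u ↦ z h ⊗ T⁻¹ u`.
  let F : IndV N.subtype φ →ₗ[ℂ] IndV N.subtype π := Coinvariants.lift _
    (Coinvariants.mk _ ∘ₗ TensorProduct.map (leftRegular ℂ G z⁻¹) T.toLinearMap) fun n => by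
      refine TensorProduct.ext <| MonoidAlgebra.lhom_ext' fun h => LinearMap.ext_ring <|
        LinearMap.ext fun w => ?_
      have := Coinvariants.mk_self_apply
        (Representation.tprod ((leftRegular ℂ G).comp N.subtype) π) (MulAut.conjNormal z⁻¹ n)
        (MonoidAlgebra.single (z⁻¹ * h) 1 ⊗ₜ T w)
      simpa [hT', mul_assoc] using this
  let F' : IndV N.subtype π →ₗ[ℂ] IndV N.subtype φ := Coinvariants.lift _
    (Coinvariants.mk _ ∘ₗ TensorProduct.map (leftRegular ℂ G z) T.symm.toLinearMap) fun n => by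
      refine TensorProduct.ext <| MonoidAlgebra.lhom_ext' fun h => LinearMap.ext_ring <|
        LinearMap.ext fun w => ?_
      have := Coinvariants.mk_self_apply
        (Representation.tprod ((leftRegular ℂ G).comp N.subtype) φ) (MulAut.conjNormal z n)
        (MonoidAlgebra.single (z * h) 1 ⊗ₜ T.symm w)
      simpa [hT2, mul_assoc] using this
  have h1 : ∀ h w, F (IndV.mk N.subtype φ h w) = IndV.mk N.subtype π (z⁻¹ * h) (T w) := by
    intro h w
    simp [F, IndV.mk]
  have h2 : ∀ h u, F' (IndV.mk N.subtype π h u) = IndV.mk N.subtype φ (z * h) (T.symm u) := by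
    intro h w
    simp [F', IndV.mk]
  refine ⟨Representation.Equiv.mk (LinearEquiv.ofLinearMap F F' ?_ ?_) fun g => ?_⟩
  · refine IndV.hom_ext _ _ fun h => LinearMap.ext fun w => ?_
    change F (F' (IndV.mk _ _ h w)) = IndV.mk _ _ h w
    rw [h2, h1, inv_mul_cancel_left, LinearEquiv.apply_symm_apply]
  · refine IndV.hom_ext _ _ fun h => LinearMap.ext fun w => ?_
    change F' (F (IndV.mk _ _ h w)) = IndV.mk _ _ h w
    rw [h1, h2, mul_inv_cancel_left, LinearEquiv.symm_apply_apply]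
  · refine IndV.hom_ext _ _ fun h => LinearMap.ext fun w => ?_
    change F (Representation.ind N.subtype φ g (IndV.mk _ _ h w)) =
      Representation.ind N.subtype π g (F (IndV.mk _ _ h w))
    rw [ind_mk, h1, h1, ind_mk, mul_assoc]

/-- Irreducible modules of a normal subgroup that induce non-isomorphic modules have induced
characters orthogonal on the subgroup. -/
theorem sum_character_ind_eq_zero [Fintype G] [Fintype N] {φ : Representation ℂ N W}
    {π : Representation ℂ N U} (hφ : φ.IsIrreducible) (hπ : π.IsIrreducible)
    (hne : ¬ Nonempty ((ind N φ).Equiv (ind N π))) :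
    ∑ n : N, (ind N φ).character n * (ind N π).character ((n : G)⁻¹) = 0 := by
  -- If some `G`-conjugates of the two modules were not orthogonal, they would be isomorphic, and
  -- the induced modules as well.
  have key : ∀ x y : G, ∑ n : N, φ.character (MulAut.conjNormal x n) *
      π.character (MulAut.conjNormal y n⁻¹) = 0 := by
    intro x y
    by_contra h
    apply hne
    let c : N →* N := (MulAut.conjNormal (x * y⁻¹) : MulAut N).toMonoidHom
    have hc : ∀ n, c n = MulAut.conjNormal (x * y⁻¹) n := fun n => rfl
    have h1 : ∑ n : N, Representation.character (φ.comp c : Representation ℂ N W) n *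
        π.character n⁻¹ ≠ 0 := by
      convert h using 1
      refine Fintype.sum_equiv (MulAut.conjNormal y : MulAut N).symm.toEquiv _ _ fun n => ?_
      have e1 : (MulAut.conjNormal y : MulAut N) ((MulAut.conjNormal y : MulAut N).symm n) = n :=
        MulEquiv.apply_symm_apply _ _
      have e2 : c n = MulAut.conjNormal x ((MulAut.conjNormal y : MulAut N).symm n) := by
        rw [hc, map_mul, MulAut.mul_apply, map_inv]
        rfl
      change φ.character (c n) * _ = φ.character (MulAut.conjNormal x
        ((MulAut.conjNormal y : MulAut N).symm n)) * π.character (MulAut.conjNormal y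
        ((MulAut.conjNormal y : MulAut N).symm n)⁻¹)
      rw [map_inv, e1, e2]
    have h2 : ∑ n : N, π.character n *
        Representation.character (φ.comp c : Representation ℂ N W) n⁻¹ ≠ 0 := by
      convert h1 using 1
      refine Fintype.sum_equiv (Equiv.inv N) _ _ fun n => ?_
      simp [mul_comm]
    obtain ⟨T, hT⟩ := exists_intertwining_of_sum_ne_zero _ _ h2
    have hb := bijective_of_irreducible
      (isIrreducible_of_surjective hφ c (MulEquiv.surjective _)) hπ T hT
    refine nonempty_ind_equiv N (x * y⁻¹) (LinearEquiv.ofBijective T.toLinearMap hb) fun n w => ?_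
    exact IntertwiningMap.isIntertwining _ _ T n w
  have hinv : ∀ n : N, (ind N π).character ((n : G)⁻¹) = (ind N π).character ((n⁻¹ : N) : G) :=
    fun n => rfl
  simp only [hinv, character_ind]
  have : ∀ n : N, (Nat.card N : ℂ)⁻¹ * (∑ x : G, φ.character (MulAut.conjNormal x n)) *
      ((Nat.card N : ℂ)⁻¹ * ∑ y : G, π.character (MulAut.conjNormal y n⁻¹)) =
      (Nat.card N : ℂ)⁻¹ * (Nat.card N : ℂ)⁻¹ * ∑ x : G, ∑ y : G,
        φ.character (MulAut.conjNormal x n) * π.character (MulAut.conjNormal y n⁻¹) := by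
    intro n
    rw [← Finset.sum_mul_sum]
    ring
  simp only [this]
  rw [← Finset.mul_sum, Finset.sum_comm]
  rw [Finset.sum_eq_zero, mul_zero]
  intro x _
  rw [Finset.sum_comm]
  exact Finset.sum_eq_zero fun y _ => key x y

end Induction

end McKaySlodowy

namespace McKaySlodowy

open Representation Module Matrix

/-! ### Characters of the symmetric powers -/

section SymmetricPowers

lemma molien_add_inv {ζ : ℂ} (hζ : ζ ≠ 0) :
    molien (ζ + ζ⁻¹) = PowerSeries.mk (fun i => ζ ^ i) * PowerSeries.mk (fun i => ζ⁻¹ ^ i) := by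
  -- The geometric series are the inverses of the factors of `1 - (ζ + ζ⁻¹) t + t²`.
  have key : ∀ c : ℂ, PowerSeries.mk (fun i => c ^ i) *
      (1 - PowerSeries.C c * PowerSeries.X) = 1 := by
    intro c
    ext n
    rcases n with _ | n
    · simp
    · rw [mul_sub, mul_one, ← mul_assoc, map_sub, PowerSeries.coeff_succ_mul_X,
        PowerSeries.coeff_mul_C, PowerSeries.coeff_mk, PowerSeries.coeff_mk, pow_succ, sub_self,
        PowerSeries.coeff_one, if_neg (Nat.succ_ne_zero n)]
  have hC : PowerSeries.C ζ * PowerSeries.C ζ⁻¹ = 1 := by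
    rw [← map_mul, mul_inv_cancel₀ hζ, map_one]
  have h := molien_mul (ζ + ζ⁻¹)
  have h1 := key ζ
  have h2 := key ζ⁻¹
  set A := PowerSeries.mk (fun i => ζ ^ i)
  set B := PowerSeries.mk (fun i => ζ⁻¹ ^ i)
  set c := PowerSeries.C ζ
  set d := PowerSeries.C ζ⁻¹
  rw [map_add] at h
  have e : molien (ζ + ζ⁻¹) = molien (ζ + ζ⁻¹) *
      ((A * (1 - c * PowerSeries.X)) * (B * (1 - d * PowerSeries.X))) := by
    rw [h1, h2, mul_one, mul_one]
  rw [e]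
  linear_combination A * B * h + molien (ζ + ζ⁻¹) * A * B * PowerSeries.X ^ 2 * hC

/-- The monomial basis of the homogeneous polynomials of degree `k`. -/
lemma exists_basis_homogeneous (k : ℕ) :
    ∃ b : Basis (Finset.HasAntidiagonal.antidiagonal k) ℂ
      (MvPolynomial.homogeneousSubmodule (Fin 2) ℂ k),
      ∀ p, (b p : MvPolynomial (Fin 2) ℂ) =
        MvPolynomial.X 0 ^ p.1.1 * MvPolynomial.X 1 ^ p.1.2 := by
  have hmon : ∀ i j : ℕ, (MvPolynomial.X 0 ^ i * MvPolynomial.X 1 ^ j : MvPolynomial (Fin 2) ℂ) =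
      MvPolynomial.monomial (Finsupp.single 0 i + Finsupp.single 1 j) 1 := by
    intro i j
    rw [MvPolynomial.X_pow_eq_monomial, MvPolynomial.X_pow_eq_monomial, MvPolynomial.monomial_mul,
      one_mul]
  let v : Finset.HasAntidiagonal.antidiagonal k →
      MvPolynomial.homogeneousSubmodule (Fin 2) ℂ k := fun p =>
    ⟨MvPolynomial.X 0 ^ p.1.1 * MvPolynomial.X 1 ^ p.1.2, by
      have h := (MvPolynomial.isHomogeneous_X_pow (R := ℂ) (0 : Fin 2) p.1.1).mul
        (MvPolynomial.isHomogeneous_X_pow (1 : Fin 2) p.1.2)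
      rw [Finset.HasAntidiagonal.mem_antidiagonal.1 p.2] at h
      exact h⟩
  have hli : LinearIndependent ℂ v := by
    apply LinearIndependent.of_comp (Submodule.subtype _)
    have : (Submodule.subtype _ ∘ v) = (MvPolynomial.basisMonomials (Fin 2) ℂ) ∘
        (fun p : Finset.HasAntidiagonal.antidiagonal k =>
          (Finsupp.single 0 p.1.1 + Finsupp.single 1 p.1.2 : Fin 2 →₀ ℕ)) := by
      funext p
      rw [Function.comp_apply, Function.comp_apply, MvPolynomial.coe_basisMonomials]
      exact hmon _ _
    rw [this]
    refine (MvPolynomial.basisMonomials (Fin 2) ℂ).linearIndependent.comp _ fun p q hpq => ?_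
    have h0 := DFunLike.congr_fun hpq 0
    have h1 := DFunLike.congr_fun hpq 1
    simp at h0 h1
    exact Subtype.ext (Prod.ext h0 h1)
  have hspan : ⊤ ≤ Submodule.span ℂ (Set.range v) := by
    rintro ⟨p, hp⟩ -
    have hd : ∀ d ∈ p.support, d 0 + d 1 = k := by
      intro d hd
      by_contra hne
      have h1 := MvPolynomial.IsHomogeneous.coeff_eq_zero hp (d := d) (by
        rw [Finsupp.degree_eq_sum, Fin.sum_univ_two]
        exact hne)
      exact MvPolynomial.mem_support_iff.1 hd h1
    have hsum : (⟨p, hp⟩ : MvPolynomial.homogeneousSubmodule (Fin 2) ℂ k) =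
        ∑ d ∈ p.support.attach, MvPolynomial.coeff d.1 p •
          v ⟨(d.1 0, d.1 1), Finset.HasAntidiagonal.mem_antidiagonal.2 (hd d.1 d.2)⟩ := by
      apply Subtype.ext
      rw [AddSubmonoidClass.coe_finsetSum]
      have h := Finset.sum_attach p.support (fun d => MvPolynomial.coeff d p •
        (MvPolynomial.X 0 ^ d 0 * MvPolynomial.X 1 ^ d 1 : MvPolynomial (Fin 2) ℂ))
      refine Eq.trans ?_ h.symm
      change p = _
      conv_lhs => rw [MvPolynomial.as_sum p]
      refine Finset.sum_congr rfl fun d _ => ?_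
      rw [hmon, MvPolynomial.smul_monomial, smul_eq_mul, mul_one]
      congr 2
      refine Finsupp.ext fun i => ?_
      fin_cases i <;> simp
    rw [hsum]
    exact Submodule.sum_mem _ fun d _ => Submodule.smul_mem _ _ (Submodule.subset_span ⟨_, rfl⟩)
  exact ⟨Basis.mk hli hspan, fun p => by rw [Basis.mk_apply]⟩

/-- An element of finite order of `SL₂(ℂ)` is diagonalizable. -/
lemma exists_conj_diagonal {M : SL2} (hM : IsOfFinOrder M) :
    ∃ (K D : SL2) (ζ : ℂ), ζ ≠ 0 ∧ M = K * D * K⁻¹ ∧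
      D.1 = !![ζ, 0; 0, ζ⁻¹] := by
  -- A scalar matrix is diagonal; otherwise there are eigenvectors `v`, `w` for distinct eigenvalues
  -- `c`, `c⁻¹`.
  by_cases ht : tr M ^ 2 = 4
  · have h := eq_smul_one_of_tr_sq hM ht
    have hc2 : (tr M / 2) ^ 2 = 1 := by linear_combination ht / 4
    have hc0 : tr M / 2 ≠ 0 := by rintro h0; rw [h0] at hc2; simp at hc2
    refine ⟨1, M, tr M / 2, hc0, by simp, ?_⟩
    have : (tr M / 2)⁻¹ = tr M / 2 := by
      rw [inv_eq_iff_eq_inv]; exact eq_inv_of_mul_eq_one_left (by rw [← pow_two, hc2])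
    rw [this]
    conv_lhs => rw [h]
    ext i j
    fin_cases i <;> fin_cases j <;> simp
  · obtain ⟨c, hc⟩ : ∃ c : ℂ, c * c - tr M * c + 1 = 0 := by
      obtain ⟨s, hs⟩ := IsAlgClosed.exists_pow_nat_eq (tr M ^ 2 - 4) (n := 2) (by norm_num)
      exact ⟨(tr M + s) / 2, by linear_combination hs / 4⟩
    obtain ⟨v, hv, hvc⟩ := (exists_eigenvector_iff M c).2 hc
    have hc0 := eigenvalue_ne_zero hv hvc
    have htr := tr_eq_of_eigenvector hv hvc
    have hc2 : c ^ 2 ≠ 1 := (sq_ne_one_iff hc0).1 (htr ▸ ht)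
    obtain ⟨w, hw, hwc⟩ := (exists_eigenvector_iff M c⁻¹).2 (by rw [htr]; field_simp; ring)
    have hcc : c⁻¹ - c ≠ 0 := by
      intro h
      apply hc2
      rw [pow_two]
      nth_rewrite 2 [← sub_eq_zero.1 h]
      exact mul_inv_cancel₀ hc0
    have hδ : v 0 * w 1 - v 1 * w 0 ≠ 0 := by
      intro hδ
      apply hv
      have key : ∀ i, v i • w = w i • v := by
        intro i
        ext j
        fin_cases i <;> fin_cases j <;> simp
        · exact mul_comm _ _
        · linear_combination hδ
        · linear_combination -hδ
        · exact mul_comm _ _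
      ext i
      have h1 := congrArg (fun u => M.1 *ᵥ u) (key i)
      simp only [Matrix.mulVec_smul, hvc, hwc] at h1
      rw [smul_comm (w i) c, ← key i, smul_comm, ← sub_eq_zero, ← sub_smul, smul_smul,
        smul_eq_zero] at h1
      have h2 := h1.resolve_right hw
      exact (mul_eq_zero.1 h2).resolve_left hcc
    -- The columns of `K` are `v` and `δ⁻¹ w`, so that its determinant is one.
    set δ := v 0 * w 1 - v 1 * w 0 with hδd
    let K : SL2 := ⟨!![v 0, δ⁻¹ * w 0; v 1, δ⁻¹ * w 1], by
      rw [Matrix.det_fin_two_of]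
      have : δ⁻¹ * δ = 1 := inv_mul_cancel₀ hδ
      rw [hδd] at this ⊢
      linear_combination this⟩
    let D : SL2 := ⟨!![c, 0; 0, c⁻¹], by
      rw [Matrix.det_fin_two_of, mul_inv_cancel₀ hc0, mul_zero, sub_zero]⟩
    refine ⟨K, D, c, hc0, ?_, rfl⟩
    rw [eq_mul_inv_iff_mul_eq]
    have hv0 := congrFun hvc 0
    have hv1 := congrFun hvc 1
    have hw0 := congrFun hwc 0
    have hw1 := congrFun hwc 1
    simp only [Matrix.mulVec, dotProduct, Fin.sum_univ_two, Pi.smul_apply, smul_eq_mul]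
      at hv0 hv1 hw0 hw1
    apply Subtype.ext
    rw [Matrix.SpecialLinearGroup.coe_mul, Matrix.SpecialLinearGroup.coe_mul]
    ext i j
    fin_cases i <;> fin_cases j <;> simp [K, D, Matrix.mul_apply, Fin.sum_univ_two]
    · linear_combination hv0
    · linear_combination δ⁻¹ * hw0
    · linear_combination hv1
    · linear_combination δ⁻¹ * hw1

/-- The generating function of the characters of the symmetric powers: a diagonal matrix acts on the
monomial `X₀ⁱ X₁ʲ` by `ζⁱ ζ⁻ʲ`. -/
theorem character_symPow {M : SL2} (hM : IsOfFinOrder M) (k : ℕ) :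
    (symPow k).character M = PowerSeries.coeff k (molien (tr M)) := by
  obtain ⟨K, D, ζ, hζ, rfl, hD⟩ := exists_conj_diagonal hM
  rw [char_conj, tr_conj]
  have htr : tr D = ζ + ζ⁻¹ := by rw [tr_eq, hD]; simp
  obtain ⟨b, hb⟩ := exists_basis_homogeneous k
  have hDb : ∀ p, symPow k D (b p) = (ζ ^ p.1.1 * ζ⁻¹ ^ p.1.2) • b p := by
    intro p
    apply Subtype.ext
    change symAlg D (b p) = _
    rw [Submodule.coe_smul, hb]
    change MvPolynomial.aeval _ (MvPolynomial.X 0 ^ p.1.1 * MvPolynomial.X 1 ^ p.1.2) = _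
    rw [map_mul, map_pow, map_pow, MvPolynomial.aeval_X, MvPolynomial.aeval_X, hD]
    simp only [Fin.sum_univ_two, Matrix.of_apply, Matrix.cons_val', Matrix.cons_val_zero,
      Matrix.cons_val_one, Matrix.cons_val_fin_one, map_zero, zero_mul, add_zero, zero_add, mul_pow,
      MvPolynomial.smul_eq_C_mul, map_mul, map_pow]
    ring
  rw [htr, molien_add_inv hζ, PowerSeries.coeff_mul, Representation.character,
    LinearMap.trace_eq_matrix_trace ℂ b, Matrix.trace]
  rw [← Finset.sum_coe_sort (Finset.HasAntidiagonal.antidiagonal k)]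
  refine Finset.sum_congr rfl fun p _ => ?_
  rw [Matrix.diag_apply, LinearMap.toMatrix_apply, hDb, map_smul, b.repr_self]
  simp

lemma character_stdRep (M : SL2) : stdRep.character M = tr M :=
  Matrix.trace_toLin'_eq _

end SymmetricPowers

end McKaySlodowy

namespace McKaySlodowy

open Representation Module

/-! ### Character systems of the two realizations -/

section InducedCharacters

variable {G : Type*} [Group G] [Fintype G] (N : Subgroup G) [N.Normal] [Fintype N] {W : Type*}
  [AddCommGroup W] [Module ℂ W] [FiniteDimensional ℂ W]

omit [N.Normal] [Fintype N] in
lemma inv_card_mul_card : (Nat.card N : ℂ)⁻¹ * Nat.card G = N.index := by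
  have hcN : (Nat.card N : ℂ) ≠ 0 := Nat.cast_ne_zero.2 Nat.card_pos.ne'
  rw [inv_mul_eq_iff_eq_mul₀ hcN, ← Nat.cast_mul, Subgroup.card_mul_index]

/-- The value of an induced character at an element on whose conjugates the original character is
constant. -/
lemma character_ind_of_forall_conj {φ : Representation ℂ N W} {g : N} {v : ℂ}
    (h : ∀ y : G, φ.character (MulAut.conjNormal y g) = v) :
    (ind N φ).character g = N.index * v := by
  rw [character_ind]
  simp only [h]
  rw [Finset.sum_const, Finset.card_univ, ← Nat.card_eq_fintype_card, nsmul_eq_mul, ← mul_assoc,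
    inv_card_mul_card]

lemma character_ind_res (σ : Representation ℂ G W) (g : N) :
    (ind N (res N σ)).character g = N.index * σ.character g := by
  refine character_ind_of_forall_conj N fun y => ?_
  rw [← char_conj σ g y, ← MulAut.conjNormal_apply]
  rfl

/-- Induction preserves the scalar by which a central element acts. -/
lemma character_ind_mul {φ : Representation ℂ N W} {z : N} (hz : ∀ g : G, g * z = z * g) {s : ℂ}
    (hs : ∀ g, φ.character (z * g) = s * φ.character g) (g : N) :
    (ind N φ).character (z * g : N) = s * (ind N φ).character g := by
  have hy : ∀ y : G, φ.character (MulAut.conjNormal y (z * g)) =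
      s * φ.character (MulAut.conjNormal y g) := by
    intro y
    rw [← hs, map_mul]
    congr 2
    apply Subtype.ext
    rw [MulAut.conjNormal_apply, hz, mul_inv_cancel_right]
  rw [character_ind, character_ind]
  simp only [hy]
  rw [← Finset.mul_sum, mul_left_comm]

end InducedCharacters

section CharacterSystems

/-- The character theoretic content of a realization of a finite group `f : H → SL₂(ℂ)`: pairwise
orthogonal class functions `ψ i` of norm `n i`, one of them the constant `c`, closed under
multiplication by the trace, and the expansions of the characters of the symmetric powers. -/
structure IsCharacterSystem {H : Type*} [Group H] [Fintype H] (f : H →* SL2) {ι : Type*}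
    [Fintype ι] (B : Matrix ι ι ℕ) (o : ι) (x : ℕ → ι → ℕ) (ψ : ι → H → ℂ) (n : ι → ℕ)
    (c : ℕ) : Prop where
  conj : ∀ i g k, ψ i (k * g * k⁻¹) = ψ i g
  inv : ∀ i g, ψ i g⁻¹ = star (ψ i g)
  one_ne_zero : ∀ i, ψ i 1 ≠ 0
  n_pos : ∀ i, 0 < n i
  norm : ∀ i, ∑ g, ψ i g * ψ i g⁻¹ = Nat.card H * n i
  orth : ∀ i j, i ≠ j → ∑ g, ψ i g * ψ j g⁻¹ = 0
  c_pos : 0 < c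
  const : ∀ g, ψ o g = c
  mul_tr : ∀ j g, tr (f g) * ψ j g = ∑ i, (B j i : ℂ) * ψ i g
  sym : ∀ k g, c * PowerSeries.coeff k (molien (tr (f g))) = ∑ i, (x k i : ℂ) * ψ i g
  parity : ∀ z, (f z).1 = -1 → ∀ i, ∃ s : ℤ, (s = 1 ∨ s = -1) ∧ ∀ g, ψ i (z * g) = s * ψ i g

variable {H W : Type*} [Group H] [AddCommGroup W] [Module ℂ W]

/-- The norm of a character is the dimension of the endomorphism algebra of the module. -/
lemma exists_finrank_norm [Fintype H] [FiniteDimensional ℂ W] [Nontrivial W]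
    (ρ : Representation ℂ H W) :
    ∃ n : ℕ, 0 < n ∧ ∑ g, ρ.character g * ρ.character g⁻¹ = Nat.card H * n ∧
      n ≤ finrank ℂ W ^ 2 ∧ (ρ.IsIrreducible → n = 1) := by
  have hc : (Nat.card H : ℂ) ≠ 0 := Nat.cast_ne_zero.2 Nat.card_pos.ne'
  have : Invertible (Nat.card H : ℂ) := invertibleOfNonzero hc
  have h1 := card_inv_mul_sum_char_mul_char_eq_finrank ρ ρ
  rw [inv_mul_eq_iff_eq_mul₀ hc] at h1
  have hinj : Function.Injective (IntertwiningMap.toLinearMapl (ρ := ρ) (σ := ρ)) :=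
    IntertwiningMap.toLinearMap_injective _ _
  have hfin : FiniteDimensional ℂ (IntertwiningMap ρ ρ) := FiniteDimensional.of_injective _ hinj
  have hnt : Nontrivial (IntertwiningMap ρ ρ) := by
    refine ⟨⟨IntertwiningMap.id ρ, 0, fun h => ?_⟩⟩
    obtain ⟨w, hw⟩ := exists_ne (0 : W)
    exact hw (LinearMap.congr_fun (congrArg IntertwiningMap.toLinearMap h) w)
  refine ⟨_, finrank_pos, h1, ?_, fun h => IsIrreducible.finrank_intertwiningMap_self ρ⟩
  have := LinearMap.finrank_le_finrank_of_injective hinj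
  rwa [finrank_linearMap, ← pow_two] at this

/-- A central involution acts on an irreducible module by a sign. -/
lemma exists_sign_of_central [FiniteDimensional ℂ W] {ρ : Representation ℂ H W}
    (hρ : ρ.IsIrreducible) {z : H} (hz : ∀ g, g * z = z * g) (hz2 : z * z = 1) :
    ∃ s : ℤ, (s = 1 ∨ s = -1) ∧ ∀ g, ρ.character (z * g) = s * ρ.character g := by
  obtain ⟨c, hc⟩ := (IsIrreducible.algebraMap_intertwiningMap_bijective_of_isAlgClosed
    (ρ := ρ)).2 ⟨ρ z, fun k => by
      rw [← Module.End.mul_eq_comp, ← Module.End.mul_eq_comp, ← map_mul, ← map_mul, hz]⟩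
  have hc' : c • (LinearMap.id : W →ₗ[ℂ] W) = ρ z := congrArg IntertwiningMap.toLinearMap hc
  have hcc : c * c = 1 := by
    obtain ⟨w, hw⟩ := @exists_ne W ((isIrreducible_iff ρ).1 hρ).1 0
    have h1 : ρ (z * z) w = (c * c) • w := by
      rw [map_mul, ← hc', Module.End.mul_apply]
      simp [smul_smul]
    rw [hz2, map_one, Module.End.one_apply] at h1
    have h2 : (1 - c * c) • w = 0 := by rw [sub_smul, one_smul, ← h1, sub_self]
    exact (sub_eq_zero.1 ((smul_eq_zero.1 h2).resolve_right hw)).symm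
  have hch : ∀ g, ρ.character (z * g) = c * ρ.character g := by
    intro g
    rw [Representation.character, map_mul, ← hc', Module.End.mul_eq_comp, LinearMap.smul_comp,
      LinearMap.id_comp, map_smul]
    rfl
  rcases mul_self_eq_one_iff.1 hcc with rfl | rfl
  · exact ⟨1, Or.inl rfl, by simpa using hch⟩
  · exact ⟨-1, Or.inr rfl, by simpa using hch⟩

variable {G : Subgroup SL2} (N : Subgroup G)

/-- The inclusion of `N` into `SL₂(ℂ)`. -/
def incl : N →* SL2 := G.subtype.comp N.subtype

lemma incl_injective : Function.Injective (incl N) :=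
  G.subtype_injective.comp N.subtype_injective

lemma finrank_pos_of_irreducible {d : ℕ} {ρ : Representation ℂ H (Fin d → ℂ)}
    (hρ : ρ.IsIrreducible) : 0 < d := by
  have := ((isIrreducible_iff ρ).1 hρ).1
  have h := finrank_pos (R := ℂ) (M := Fin d → ℂ)
  rwa [finrank_fin_fun] at h

/-- The element `-1` of `N` is a central involution of `G`. -/
lemma central_of_coe_eq_neg_one {z : N} (hz : (incl N z).1 = -1) :
    (∀ g : G, g * z = z * g) ∧ (∀ g : N, g * z = z * g) ∧ z * z = 1 := by
  have h1 : ∀ g : G, g * z = z * g := by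
    intro g
    apply Subtype.ext
    apply Subtype.ext
    change g.1.1 * (incl N z).1 = (incl N z).1 * g.1.1
    rw [hz, mul_neg_one, neg_one_mul]
  refine ⟨h1, fun g => Subtype.ext (h1 g), ?_⟩
  apply incl_injective N
  rw [map_mul, map_one]
  apply Subtype.ext
  rw [Matrix.SpecialLinearGroup.coe_mul, hz]
  simp

lemma isOfFinOrder_incl [Finite N] (g : N) : IsOfFinOrder (incl N g) :=
  have := Fintype.ofFinite N
  isOfFinOrder_map (incl N) g

instance finiteDimensional_homogeneous (k : ℕ) :
    FiniteDimensional ℂ (MvPolynomial.homogeneousSubmodule (Fin 2) ℂ k) :=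
  Module.Finite.iff_fg.2 (MvPolynomial.homogeneousSubmodule_fg (Fin 2) ℂ k)

variable [Fintype G] [Fintype N] {ι : Type*} [Fintype ι] [DecidableEq ι] {A : Matrix ι ι ℤ} {o : ι}
  {x : ℕ → ι → ℕ}

omit [Fintype N] [Fintype G] in
/-- Irreducible characters of commutative groups have absolute value one. -/
lemma character_mul_inv_of_comm [Finite N] {m : ℕ} {π : Representation ℂ N (Fin m → ℂ)}
    (hπ : π.IsIrreducible) (hc : ∀ x y : N, x * y = y * x) (g : N) :
    π.character g * π.character g⁻¹ = 1 := by
  have hcomm : IsMulCommutative N := ⟨⟨hc⟩⟩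
  have hfin := IsIrreducible.finrank_eq_one_of_isMulCommutative π
  obtain ⟨u, hu, -⟩ := LinearMap.existsUnique_eq_smul_id_of_finrank_eq_one hfin (π g)
  have h1 : u • π g⁻¹ = 1 := by
    rw [← map_one π, ← mul_inv_cancel g, map_mul, hu, smul_mul_assoc]
    rfl
  have h2 := congrArg (LinearMap.trace ℂ (Fin m → ℂ)) h1
  rw [map_smul, LinearMap.trace_one, hfin, Nat.cast_one, smul_eq_mul] at h2
  rw [character, hu, map_smul, LinearMap.trace_id, hfin, Nat.cast_one, smul_eq_mul, mul_one]
  exact h2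

/-- The restricted characters form a character system if `G/N` is abelian: inequivalent ones have no
common constituent. -/
theorem IsRestrictedRealization.exists_system [N.Normal]
    (hab : ∀ x y : G, x⁻¹ * y⁻¹ * x * y ∈ N) (hA : IsRestrictedRealization N A o x) :
    ∃ (B : Matrix ι ι ℕ) (ψ : ι → N → ℂ) (n : ι → ℕ) (c : ℕ),
      (∀ i j, A i j = (if i = j then 2 else 0) - (B j i : ℤ)) ∧
      IsCharacterSystem (incl N) B o x ψ n c ∧
      (N = ⊤ → (∀ x y : N, x * y = y * x) → ∀ i, ∃ s, ∀ g, ψ i g * ψ i g⁻¹ = s) := by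
  obtain ⟨d, ρ, B, hρ, ⟨e₀⟩, hB, hAB, hx⟩ := hA
  have hnt : ∀ i, Nontrivial (Fin (d i) → ℂ) := fun i =>
    ((isIrreducible_iff _).1 (hρ.irreducible i)).1
  choose n hn0 hn1 hn2 hn3 using fun i => exists_finrank_norm (res N (ρ i))
  refine ⟨B, fun i => (res N (ρ i)).character, n, 1, hAB, ?_, fun hN hc i =>
    ⟨1, character_mul_inv_of_comm N (isIrreducible_of_surjective (hρ.irreducible i) _ ?_) hc⟩⟩
  swap
  · exact fun g => ⟨⟨g, hN ▸ Subgroup.mem_top g⟩, rfl⟩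
  -- The fields of `IsCharacterSystem`, in order.
  constructor
  · exact fun i g k => char_conj _ _ _
  · exact fun i g => char_inv_eq_star _ _
  · intro i
    rw [char_one, finrank_fin_fun]
    exact Nat.cast_ne_zero.2 (finrank_pos_of_irreducible (hρ.irreducible i)).ne'
  · exact hn0
  · exact hn1
  · intro i j hij
    by_contra h
    obtain ⟨T, hT⟩ := exists_intertwining_of_sum_ne_zero _ _ h
    exact hij (hρ.inequivalent j i (nonempty_res_equiv N hab (hρ.irreducible j)
      (hρ.irreducible i) T hT)).symm
  · exact one_pos
  · intro g
    rw [← char_iso e₀]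
    simp [Representation.character]
  · intro j g
    rw [← (hB j).character_eq, char_tensor]
    exact congrArg (· * _) (character_stdRep _).symm
  · intro k g
    rw [← (hx k).character_eq, Nat.cast_one, one_mul]
    exact (character_symPow (isOfFinOrder_incl N g) k).symm
  · intro z hz i
    obtain ⟨h1, h2, h3⟩ := central_of_coe_eq_neg_one N hz
    obtain ⟨s, hs, hs'⟩ := exists_sign_of_central (hρ.irreducible i) (z := (z : G)) h1
      (congrArg Subtype.val h3)
    exact ⟨s, hs, fun g => hs' g⟩

/-- The induced characters form a character system on `N`: inequivalent ones vanish on a common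
constituent, being sums over `G`-orbits of irreducible characters. -/
theorem IsInducedRealization.exists_system [N.Normal] (hA : IsInducedRealization N A o x) :
    ∃ (B : Matrix ι ι ℕ) (ψ : ι → N → ℂ) (n : ι → ℕ) (c : ℕ),
      (∀ i j, A i j = (if i = j then 2 else 0) - (B j i : ℤ)) ∧
      IsCharacterSystem (incl N) B o x ψ n c ∧
      (N = ⊤ → (∀ x y : N, x * y = y * x) → ∀ i, ∃ s, ∀ g, ψ i g * ψ i g⁻¹ = s) := by
  obtain ⟨d, φ, B, hφ, ⟨e₀⟩, hB, hAB, hx⟩ := hA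
  have hone : ∀ i, (ind N (φ i)).character 1 = N.index * d i := fun i =>
    character_ind_of_forall_conj N (g := 1) fun y => by
      rw [map_one, char_one, finrank_fin_fun]
  have hone' : ∀ i, (ind N (φ i)).character 1 ≠ 0 := by
    intro i
    rw [hone]
    exact mul_ne_zero (Nat.cast_ne_zero.2 N.index_ne_zero_of_finite)
      (Nat.cast_ne_zero.2 (finrank_pos_of_irreducible (hφ.irreducible i)).ne')
  have hnt : ∀ i, Nontrivial (IndV N.subtype (φ i)) := by
    intro i
    by_contra h
    rw [not_nontrivial_iff_subsingleton] at h
    apply hone' i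
    rw [char_one, finrank_zero_of_subsingleton, Nat.cast_zero]
  choose n hn0 hn1 hn2 hn3 using fun i => exists_finrank_norm (res N (ind N (φ i)))
  refine ⟨B, fun i => (res N (ind N (φ i))).character, n, N.index, hAB, ?_, fun hN hc i =>
    ⟨N.index * N.index, fun g => ?_⟩⟩
  swap
  · have hch : ∀ g : N, (ind N (φ i)).character g = N.index * (φ i).character g := by
      refine fun g => character_ind_of_forall_conj N fun y => ?_
      rw [← char_conj (φ i) g ⟨y, hN ▸ Subgroup.mem_top y⟩]
      rfl
    change (ind N (φ i)).character g * (ind N (φ i)).character (g⁻¹ : N) = _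
    rw [hch, hch, mul_mul_mul_comm, character_mul_inv_of_comm N (hφ.irreducible i) hc, mul_one]
  -- The fields of `IsCharacterSystem`, in order.
  constructor
  · exact fun i g k => char_conj _ _ _
  · exact fun i g => char_inv_eq_star _ _
  · exact hone'
  · exact hn0
  · exact hn1
  · intro i j hij
    exact sum_character_ind_eq_zero N (hφ.irreducible i) (hφ.irreducible j)
      fun h => hij (hφ.inequivalent i j h)
  · exact Nat.pos_of_ne_zero N.index_ne_zero_of_finite
  · intro g
    change (ind N (φ o)).character g = _
    rw [← char_iso e₀, character_ind_of_forall_conj N (v := 1), mul_one]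
    intro y
    simp [Representation.character]
  · intro j g
    change _ = ∑ i, (B j i : ℂ) * (ind N (φ i)).character g
    rw [← (hB j).character_eq, char_tensor]
    exact congrArg (· * _) (character_stdRep _).symm
  · intro k g
    change _ = ∑ i, (x k i : ℂ) * (ind N (φ i)).character g
    rw [← (hx k).character_eq, character_ind_res]
    exact congrArg (_ * ·) (character_symPow (isOfFinOrder_incl N g) k).symm
  · intro z hz i
    obtain ⟨h1, h2, h3⟩ := central_of_coe_eq_neg_one N hz
    obtain ⟨s, hs, hs'⟩ := exists_sign_of_central (hφ.irreducible i) h2 h3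
    exact ⟨s, hs, character_ind_mul N h1 hs'⟩

end CharacterSystems

/-! ### The second orthogonality relation for restrictions -/

section SecondOrthogonality

variable {G : Type*} [Group G] [Fintype G] (N : Subgroup G) [N.Normal] [Fintype N] {τ : Type*}
  [Fintype τ] {r : τ → ℕ} {ρ : ∀ i, Representation ℂ G (Fin (r i) → ℂ)}

open scoped Classical in
/-- The orbit-stabilizer theorem for conjugation. -/
lemma card_conj_mul_card_centralizer (g : G) :
    (Finset.univ.filter fun x : G => IsConj g x).card *
      Nat.card (Subgroup.centralizer ({g} : Set G)) = Nat.card G := by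
  rw [Subgroup.nat_card_centralizer_nat_card_stabilizer]
  have h3 := Nat.card_congr (MulAction.orbitProdStabilizerEquivGroup (ConjAct G) g)
  rw [Nat.card_prod] at h3
  rw [show Nat.card G = Nat.card (ConjAct G) from rfl, ← h3]
  congr 1
  rw [← Fintype.card_subtype, ← Nat.card_eq_fintype_card]
  apply Nat.card_congr
  refine Equiv.subtypeEquivRight fun x => ?_
  rw [ConjAct.mem_orbit_conjAct]
  exact isConj_comm

variable {N}

omit [Fintype τ] in
/-- A `G`-invariant function on `N` orthogonal to the restricted characters vanishes. -/
lemma IsRestrictionList.eq_zero_of_orthogonal (hρ : IsRestrictionList N ρ) {F : N → ℂ}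
    (hF : ∀ (x : G) (n : N), F (MulAut.conjNormal x n) = F n)
    (h : ∀ i, ∑ n : N, F n * (ρ i).character n = 0) : F = 0 := by
  classical
  -- The extension of `F` by zero is a class function on `G` orthogonal to the irreducible
  -- characters.
  let F' : G → ℂ := fun g => if hg : g ∈ N then F ⟨g, hg⟩ else 0
  have hF' : F' = 0 := by
    apply McKaySlodowy.eq_zero_of_orthogonal
    · intro g k
      by_cases hg : g ∈ N
      · have hk : k * g * k⁻¹ ∈ N := ‹N.Normal›.conj_mem g hg k
        simp only [F', dif_pos hg, dif_pos hk]
        rw [← hF k ⟨g, hg⟩]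
        rfl
      · have hk : k * g * k⁻¹ ∉ N := fun hk => hg (by
          have := ‹N.Normal›.conj_mem _ hk k⁻¹
          simpa [mul_assoc] using this)
        simp only [F', dif_neg hg, dif_neg hk]
    · intro m π hπ
      obtain ⟨i, ⟨e⟩⟩ := hρ.complete m π hπ
      rw [← h i, ← Finset.sum_filter_add_sum_filter_not Finset.univ (fun g : G => g ∈ N)]
      rw [Finset.sum_eq_zero (s := Finset.univ.filter fun g : G => ¬ g ∈ N) (fun g hg => by
        rw [Finset.mem_filter] at hg
        simp only [F', dif_neg hg.2, zero_mul]), add_zero]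
      rw [Finset.sum_subtype (F := ‹Fintype N›) (p := fun g => g ∈ N)
        (Finset.univ.filter fun g : G => g ∈ N) (fun g => by simp) (fun g => F' g * π.character g)]
      refine Finset.sum_congr (Finset.ext fun _ => by simp) fun n _ => ?_
      have : π.character n = (ρ i).character n := congrFun (char_iso e) n
      rw [this]
      simp [F']
  funext n
  have := congrFun hF' n
  simpa [F'] using this

/-- Second orthogonality relation for the restricted characters. -/
theorem IsRestrictionList.sum_character_mul (hρ : IsRestrictionList N ρ) {n : τ → ℕ}
    (hn : ∀ i, 0 < n i)
    (hnorm : ∀ i, ∑ g : N, (ρ i).character g * (ρ i).character ((g : G)⁻¹) = Nat.card N * n i)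
    (horth : ∀ i j, i ≠ j → ∑ g : N, (ρ i).character g * (ρ j).character ((g : G)⁻¹) = 0)
    (g : N) :
    (Nat.card G : ℂ) * ∑ i, (ρ i).character g * (ρ i).character ((g : G)⁻¹) / n i =
      Nat.card N * Nat.card (Subgroup.centralizer ({(g : G)} : Set G)) := by
  classical
  have hcN : (Nat.card N : ℂ) ≠ 0 := Nat.cast_ne_zero.2 Nat.card_pos.ne'
  -- Let `S` be the conjugacy class of `g` in `G`, a subset of `N`. Its indicator function equals
  -- its Fourier expansion in the restricted characters, the difference `F` being orthogonal to all
  -- of them.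
  let S := Finset.univ.filter fun x : N => IsConj (g : G) x
  have hS : S.card = (Finset.univ.filter fun x : G => IsConj (g : G) x).card := by
    refine Finset.card_nbij (fun x => (x : G)) (fun x hx => by simp [S] at hx; simp [hx])
      (fun x _ y _ hxy => Subtype.ext hxy) fun x hx => ?_
    have hx' : IsConj (g : G) x := by simpa using hx
    obtain ⟨c, rfl⟩ := isConj_iff.1 hx'
    exact ⟨⟨_, ‹N.Normal›.conj_mem g g.2 c⟩, by simp [S], rfl⟩
  have hSchar : ∀ i, ∀ x ∈ S, (ρ i).character ((x : G)⁻¹) = (ρ i).character ((g : G)⁻¹) := by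
    intro i x hx
    have hx' : IsConj (g : G) x := by simpa [S] using hx
    obtain ⟨c, hc⟩ := isConj_iff.1 hx'
    rw [← hc, conj_inv, char_conj]
  let F : N → ℂ := fun x => (if x ∈ S then 1 else 0) -
    ∑ i, (S.card : ℂ) * (ρ i).character ((g : G)⁻¹) / (Nat.card N * n i) * (ρ i).character x
  have hFz : (fun x : N => F x⁻¹) = 0 := by
    apply hρ.eq_zero_of_orthogonal
    · intro y x
      have e1 : (((MulAut.conjNormal y x)⁻¹ : N) : G) = y * (x⁻¹ : N) * y⁻¹ := by
        rw [← map_inv, MulAut.conjNormal_apply]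
      simp only [F]
      congr 1
      · congr 1
        simp only [S, Finset.mem_filter, Finset.mem_univ, true_and, e1, eq_iff_iff]
        have : IsConj ((x⁻¹ : N) : G) (y * (x⁻¹ : N) * y⁻¹) := isConj_iff.2 ⟨y, rfl⟩
        exact ⟨fun h => h.trans this.symm, fun h => h.trans this⟩
      · refine Finset.sum_congr rfl fun i _ => ?_
        rw [e1, char_conj]
    · intro j
      have e2 : ∑ x : N, F x⁻¹ * (ρ j).character x = ∑ x : N, F x * (ρ j).character ((x : G)⁻¹) :=
        Fintype.sum_equiv (Equiv.inv N) _ _ fun x => by simp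
      rw [e2]
      simp only [F, sub_mul, Finset.sum_sub_distrib, ite_mul, one_mul, zero_mul, Finset.sum_mul]
      rw [Finset.sum_comm, Finset.sum_eq_single j]
      · simp only [mul_assoc]
        rw [← Finset.mul_sum, hnorm, ← Finset.sum_filter, Finset.sum_congr (Finset.ext fun x => by
          simp) (hSchar j), Finset.sum_const, nsmul_eq_mul]
        have : (n j : ℂ) ≠ 0 := Nat.cast_ne_zero.2 (hn j).ne'
        field_simp
        ring
      · intro i _ hij
        simp only [mul_assoc]
        rw [← Finset.mul_sum, horth i j hij, mul_zero]
      · simp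
  have hgS : g ∈ S := Finset.mem_filter.2 ⟨Finset.mem_univ _, IsConj.refl _⟩
  have h1 := congrFun hFz g⁻¹
  simp only [inv_inv, F, Pi.zero_apply] at h1
  rw [if_pos hgS, sub_eq_zero] at h1
  have h2 := card_conj_mul_card_centralizer (g : G)
  rw [← hS] at h2
  have h3 : (Nat.card G : ℂ) = S.card * Nat.card (Subgroup.centralizer ({(g : G)} : Set G)) := by
    rw [← h2, Nat.cast_mul]
  have h4 : (Nat.card N : ℂ) = S.card *
      ∑ i, (ρ i).character g * (ρ i).character ((g : G)⁻¹) / n i := by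
    rw [← mul_one (Nat.card N : ℂ), h1, Finset.mul_sum, Finset.mul_sum]
    refine Finset.sum_congr rfl fun i _ => ?_
    have : (n i : ℂ) ≠ 0 := Nat.cast_ne_zero.2 (hn i).ne'
    field_simp
  rw [h3, h4]
  ring

end SecondOrthogonality

end McKaySlodowy

namespace McKaySlodowy

/-! ### The affine form and the multiplicities -/

section Traces

/-- The eigenvalues of an element of finite order are conjugate roots of unity. -/
lemma exists_real_tr {M : SL2} (hM : IsOfFinOrder M) : ∃ t : ℝ, tr M = t ∧ |t| ≤ 2 := by
  obtain ⟨K, D, ζ, hζ, hKD, hD⟩ := exists_conj_diagonal hM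
  obtain ⟨k, hk, hk1⟩ := isOfFinOrder_iff_pow_eq_one.1 hM
  have hDk : D ^ k = 1 := by
    rw [hKD, conj_pow, conj_eq_one_iff] at hk1
    exact hk1
  have hdiag : D.1 = Matrix.diagonal ![ζ, ζ⁻¹] := by
    rw [hD]
    ext i j
    fin_cases i <;> fin_cases j <;> simp
  have hζk : ζ ^ k = 1 := by
    have h1 := congrArg (fun M : SL2 => M.1 0 0) hDk
    simpa [Matrix.SpecialLinearGroup.coe_pow, hdiag, Matrix.diagonal_pow] using h1
  have hnorm := Complex.norm_eq_one_of_pow_eq_one hζk hk.ne'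
  have hinv : ζ⁻¹ = star ζ := by
    rw [Complex.star_def, Complex.inv_def, Complex.normSq_eq_norm_sq, hnorm]
    simp
  refine ⟨2 * ζ.re, ?_, ?_⟩
  · rw [hKD, tr_conj, tr_eq, hD]
    simp only [Matrix.of_apply, Matrix.cons_val', Matrix.cons_val_zero, Matrix.cons_val_one,
      Matrix.cons_val_fin_one]
    rw [hinv, Complex.star_def, Complex.add_conj]
  · rw [abs_mul, abs_two]
    have := Complex.abs_re_le_norm ζ
    rw [hnorm] at this
    linarith

lemma coeff_zero_molien (y : ℂ) : PowerSeries.coeff 0 (molien y) = 1 := by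
  have := congrArg (PowerSeries.coeff 0) (molien_mul y)
  simpa using this

lemma molien_eq (y : ℂ) : molien y =
    1 + PowerSeries.C y * (molien y * PowerSeries.X) - molien y * PowerSeries.X ^ 2 := by
  linear_combination molien_mul y

lemma coeff_one_molien (y : ℂ) : PowerSeries.coeff 1 (molien y) = y := by
  have h := congrArg (PowerSeries.coeff 1) (molien_eq y)
  rw [map_sub, map_add, PowerSeries.coeff_C_mul, PowerSeries.coeff_succ_mul_X,
    coeff_zero_molien, PowerSeries.coeff_mul_X_pow'] at h
  simpa [PowerSeries.coeff_one] using h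

lemma coeff_molien_add_two (y : ℂ) (k : ℕ) : PowerSeries.coeff (k + 2) (molien y) =
    y * PowerSeries.coeff (k + 1) (molien y) - PowerSeries.coeff k (molien y) := by
  have h := congrArg (PowerSeries.coeff (k + 2)) (molien_eq y)
  rw [map_sub, map_add, PowerSeries.coeff_C_mul, PowerSeries.coeff_succ_mul_X,
    PowerSeries.coeff_mul_X_pow', if_pos (by omega), Nat.add_sub_cancel, PowerSeries.coeff_one,
    if_neg (by omega), zero_add] at h
  exact h

end Traces

namespace IsCharacterSystem

variable {H : Type*} [Group H] [Fintype H] {f : H →* SL2} {ι : Type*} [Fintype ι]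
  {B : Matrix ι ι ℕ} {o : ι} {x : ℕ → ι → ℕ} {ψ : ι → H → ℂ} {n : ι → ℕ} {c : ℕ}
  (S : IsCharacterSystem f B o x ψ n c)
include S

/-- The coefficients of a combination of the `ψ i` are its inner products with them. -/
lemma sum_mul_inv (u : ι → ℂ) (j : ι) :
    ∑ g, (∑ i, u i * ψ i g) * ψ j g⁻¹ = Nat.card H * n j * u j := by
  classical
  simp only [Finset.sum_mul]
  rw [Finset.sum_comm, Finset.sum_eq_single j]
  · simp only [mul_assoc]
    rw [← Finset.mul_sum, S.norm]
    ring
  · intro i _ hij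
    simp only [mul_assoc]
    rw [← Finset.mul_sum, S.orth i j hij, mul_zero]
  · simp

lemma card_mul_ne_zero (j : ι) : (Nat.card H * n j : ℂ) ≠ 0 :=
  mul_ne_zero (Nat.cast_ne_zero.2 Nat.card_pos.ne') (Nat.cast_ne_zero.2 (S.n_pos j).ne')

/-- The functions `ψ i` are linearly independent. -/
lemma coeff_eq_zero {u : ι → ℂ} (h : ∀ g, ∑ i, u i * ψ i g = 0) : u = 0 := by
  funext j
  have h1 := S.sum_mul_inv u j
  simp only [h, zero_mul, Finset.sum_const_zero] at h1
  exact (mul_eq_zero.1 h1.symm).resolve_left (S.card_mul_ne_zero j)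

lemma coeff_ext {u w : ι → ℂ} (h : ∀ g, ∑ i, u i * ψ i g = ∑ i, w i * ψ i g) : u = w := by
  rw [← sub_eq_zero]
  apply S.coeff_eq_zero
  intro g
  simp only [Pi.sub_apply, sub_mul, Finset.sum_sub_distrib, h, sub_self]

/-- The mean value of a combination of the `ψ i` is its coefficient at `o`. -/
lemma sum_eq (u : ι → ℂ) : ∑ g, ∑ i, u i * ψ i g = Nat.card H * c * u o := by
  have h1 := S.sum_mul_inv u o
  simp only [S.const] at h1
  rw [← Finset.sum_mul] at h1
  have h2 := S.norm o
  simp only [S.const, Finset.sum_const, Finset.card_univ, ← Nat.card_eq_fintype_card,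
    nsmul_eq_mul] at h2
  have hc : (c : ℂ) ≠ 0 := Nat.cast_ne_zero.2 S.c_pos.ne'
  apply mul_right_cancel₀ hc
  rw [h1]
  linear_combination -u o * h2

/-- Multiplication by the trace acts on coefficients as the matrix `B`. -/
lemma tr_mul_sum (u : ι → ℂ) (g : H) :
    tr (f g) * ∑ i, u i * ψ i g = ∑ i, (∑ j, (B j i : ℂ) * u j) * ψ i g := by
  simp only [Finset.mul_sum, Finset.sum_mul]
  rw [Finset.sum_comm]
  refine Finset.sum_congr rfl fun j _ => ?_
  rw [mul_left_comm, S.mul_tr, Finset.mul_sum]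
  exact Finset.sum_congr rfl fun i _ => by ring

/-- The numbers `n i` symmetrize `B`. -/
lemma symm (i j : ι) : n i * B j i = n j * B i j := by
  classical
  have key : ∀ i j, ∑ g, tr (f g) * ψ j g * ψ i g⁻¹ = Nat.card H * n i * B j i := by
    intro i j
    rw [← S.sum_mul_inv (fun i => (B j i : ℂ)) i]
    exact Finset.sum_congr rfl fun g _ => by rw [S.mul_tr]
  have h : ∑ g, tr (f g) * ψ j g * ψ i g⁻¹ = ∑ g, tr (f g) * ψ i g * ψ j g⁻¹ := by
    refine Fintype.sum_equiv (Equiv.inv H) _ _ fun g => ?_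
    simp only [Equiv.inv_apply, map_inv, tr_inv, inv_inv]
    ring
  rw [key, key, mul_assoc, mul_assoc] at h
  have h2 := mul_left_cancel₀ (Nat.cast_ne_zero.2 Nat.card_pos.ne') h
  exact_mod_cast h2

/-- The affine form is positive definite on the finite part. -/
lemma pos (hf : Function.Injective f) {u : ι → ℝ} (hu : u ≠ 0) (huo : u o = 0) :
    0 < 2 * ∑ i, n i * u i ^ 2 - ∑ i, ∑ j, n i * B j i * u i * u j := by
  -- Up to the factor `|H|` the form is the sum of `(2 - tr g) |F g|²`, where `F` has coefficients
  -- `u`.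
  let F : H → ℂ := fun g => ∑ i, (u i : ℂ) * ψ i g
  have hFs : ∀ g, F g⁻¹ = star (F g) := by
    intro g
    simp only [F, star_sum, star_mul', S.inv]
    refine Finset.sum_congr rfl fun i _ => ?_
    rw [Complex.star_def, Complex.conj_ofReal]
  have h1 : ∑ g, F g * F g⁻¹ = (Nat.card H * ∑ i, n i * u i ^ 2 : ℝ) := by
    have : ∀ g, F g * F g⁻¹ = ∑ j, (u j : ℂ) * (F g * ψ j g⁻¹) := by
      intro g
      conv_lhs => rw [show F g⁻¹ = ∑ j, (u j : ℂ) * ψ j g⁻¹ from rfl, Finset.mul_sum]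
      exact Finset.sum_congr rfl fun j _ => by ring
    simp only [this]
    rw [Finset.sum_comm]
    simp only [← Finset.mul_sum]
    have e : ∀ j, ∑ g, F g * ψ j g⁻¹ = Nat.card H * n j * u j := S.sum_mul_inv _
    simp only [e]
    push_cast
    rw [Finset.mul_sum]
    exact Finset.sum_congr rfl fun j _ => by ring
  have h2 : ∑ g, tr (f g) * F g * F g⁻¹ =
      (Nat.card H * ∑ i, ∑ j, n i * B j i * u i * u j : ℝ) := by
    have : ∀ g, tr (f g) * F g * F g⁻¹ =
        ∑ i, (u i : ℂ) * ((∑ k, (∑ j, (B j k : ℂ) * u j) * ψ k g) * ψ i g⁻¹) := by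
      intro g
      rw [← S.tr_mul_sum (fun i => (u i : ℂ)) g, show F g⁻¹ = ∑ j, (u j : ℂ) * ψ j g⁻¹ from rfl,
        Finset.mul_sum]
      exact Finset.sum_congr rfl fun j _ => by ring
    simp only [this]
    rw [Finset.sum_comm]
    simp only [← Finset.mul_sum]
    simp only [S.sum_mul_inv]
    push_cast
    rw [Finset.mul_sum]
    refine Finset.sum_congr rfl fun i _ => ?_
    rw [Finset.mul_sum, Finset.mul_sum, Finset.mul_sum]
    exact Finset.sum_congr rfl fun j _ => by ring
  choose t ht1 ht2 using fun g => exists_real_tr (isOfFinOrder_map f g)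
  have h3 : Nat.card H * (2 * ∑ i, n i * u i ^ 2 - ∑ i, ∑ j, n i * B j i * u i * u j) =
      ∑ g, (2 - t g) * Complex.normSq (F g) := by
    have : ((Nat.card H * (2 * ∑ i, n i * u i ^ 2 - ∑ i, ∑ j, n i * B j i * u i * u j) : ℝ) : ℂ) =
        ((∑ g, (2 - t g) * Complex.normSq (F g) : ℝ) : ℂ) := by
      have e : ((∑ g, (2 - t g) * Complex.normSq (F g) : ℝ) : ℂ) =
          2 * ∑ g, F g * F g⁻¹ - ∑ g, tr (f g) * F g * F g⁻¹ := by
        rw [Finset.mul_sum, ← Finset.sum_sub_distrib, Complex.ofReal_sum]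
        refine Finset.sum_congr rfl fun g _ => ?_
        rw [hFs, ht1, Complex.ofReal_mul, ← Complex.mul_conj, Complex.star_def]
        push_cast
        ring
      rw [e, h1, h2]
      push_cast
      ring
    exact_mod_cast this
  have hnn : ∀ g, 0 ≤ (2 - t g) * Complex.normSq (F g) := fun g =>
    mul_nonneg (by have := (abs_le.1 (ht2 g)).2; linarith) (Complex.normSq_nonneg _)
  have hcard : (0 : ℝ) < Nat.card H := Nat.cast_pos.2 Nat.card_pos
  have hpos : 0 < ∑ g, (2 - t g) * Complex.normSq (F g) := by
    refine lt_of_le_of_ne (Finset.sum_nonneg fun g _ => hnn g) fun h => hu ?_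
    have hz := (Finset.sum_eq_zero_iff_of_nonneg fun g _ => hnn g).1 h.symm
    -- If the form vanishes, `F` vanishes outside `1`; since its mean `u o` is zero, it vanishes
    -- there too.
    have hF1 : ∀ g, g ≠ 1 → F g = 0 := by
      intro g hg
      rcases mul_eq_zero.1 (hz g (Finset.mem_univ _)) with h2 | h2
      · exfalso
        apply hg
        apply hf
        rw [map_one]
        apply eq_one_of_tr_eq_two (isOfFinOrder_map f g)
        rw [ht1, show t g = 2 by linarith]
        norm_num
      · exact Complex.normSq_eq_zero.1 h2
    have hsum : ∑ g, F g = 0 := by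
      have := S.sum_eq (fun i => (u i : ℂ))
      rw [huo, Complex.ofReal_zero, mul_zero] at this
      exact this
    rw [Finset.sum_eq_single 1 (fun g _ hg => hF1 g hg) (by simp)] at hsum
    have hF : ∀ g, F g = 0 := fun g => by
      by_cases hg : g = 1
      · rw [hg, hsum]
      · exact hF1 g hg
    have := S.coeff_eq_zero hF
    funext i
    exact Complex.ofReal_eq_zero.1 (congrFun this i)
  rw [← h3] at hpos
  exact (pos_iff_pos_of_mul_pos hpos).1 hcard

lemma x_zero [DecidableEq ι] (i : ι) : (x 0 i : ℂ) = if i = o then 1 else 0 := by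
  have : (fun i => (x 0 i : ℂ)) = fun i => if i = o then 1 else 0 := by
    apply S.coeff_ext
    intro g
    rw [← S.sym]
    have h := coeff_zero_molien (tr (f g))
    simp [h, S.const]
  exact congrFun this i

lemma x_one (i : ι) : x 1 i = B o i := by
  classical
  have : (fun i => (x 1 i : ℂ)) = fun i => (B o i : ℂ) := by
    apply S.coeff_ext
    intro g
    rw [← S.sym, coeff_one_molien, ← S.mul_tr, S.const, mul_comm]
  exact_mod_cast congrFun this i

/-- Clebsch-Gordan recursion for the multiplicities. -/
lemma x_add_two (k : ℕ) (i : ι) : x (k + 2) i + x k i = ∑ j, B j i * x (k + 1) j := by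
  have : (fun i => (x (k + 2) i + x k i : ℂ)) = fun i => ∑ j, (B j i : ℂ) * x (k + 1) j := by
    apply S.coeff_ext
    intro g
    rw [← S.tr_mul_sum, ← S.sym]
    simp only [add_mul, Finset.sum_add_distrib, ← S.sym]
    rw [coeff_molien_add_two]
    ring
  exact_mod_cast congrFun this i

/-- The multiplicities of the special index are given by the Molien series. -/
lemma sum_molien_eq (k : ℕ) :
    ∑ g, PowerSeries.coeff k (molien (tr (f g))) = Nat.card H * x k o := by
  have h := S.sum_eq (fun i => (x k i : ℂ))
  simp only [← S.sym] at h
  rw [← Finset.mul_sum] at h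
  have hc : (c : ℂ) ≠ 0 := Nat.cast_ne_zero.2 S.c_pos.ne'
  apply mul_left_cancel₀ hc
  rw [h]
  ring

end IsCharacterSystem

/-! ### Words and Coxeter elements -/

section Coxeter

/-- Elementary moves on words: exchange of two adjacent letters related by `r`, and rotation. -/
inductive WordStep {α : Type*} (r : α → α → Prop) : List α → List α → Prop
  | swap (p q : List α) {x y : α} (h : r x y) : WordStep r (p ++ x :: y :: q) (p ++ y :: x :: q)
  | rotate (x : α) (p : List α) : WordStep r (x :: p) (p ++ [x])

variable {α : Type*} {r : α → α → Prop}

open Relation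

lemma WordStep.perm {a b : List α} (h : WordStep r a b) : a.Perm b := by
  cases h with
  | swap p q h => exact List.Perm.append_left p (List.Perm.swap _ _ q)
  | rotate x p => exact (List.perm_append_singleton x p).symm

lemma wordEquiv_perm {a b : List α} (h : EqvGen (WordStep r) a b) : a.Perm b := by
  induction h with
  | rel _ _ h => exact h.perm
  | refl => exact List.Perm.refl _
  | symm _ _ _ ih => exact ih.symm
  | trans _ _ _ _ _ ih₁ ih₂ => exact ih₁.trans ih₂

lemma wordEquiv_rotate (p w : List α) : EqvGen (WordStep r) (p ++ w) (w ++ p) := by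
  induction p generalizing w with
  | nil => simpa using EqvGen.refl w
  | cons x p ih =>
    refine (EqvGen.rel _ _ (WordStep.rotate x (p ++ w))).trans _ _ _ ?_
    have := ih (w ++ [x])
    simpa using this

lemma wordEquiv_move (p l q : List α) {i : α} (h : ∀ k ∈ l, r i k) :
    EqvGen (WordStep r) (p ++ i :: (l ++ q)) (p ++ (l ++ i :: q)) := by
  induction l generalizing p with
  | nil => exact EqvGen.refl _
  | cons x l ih =>
    refine (EqvGen.rel _ _ (WordStep.swap p (l ++ q) (h x List.mem_cons_self))).trans _ _ _ ?_
    have := ih (p ++ [x]) fun k hk => h k (List.mem_cons_of_mem _ hk)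
    simpa using this

/-- A letter related to all other letters but at most one may be put in front of equivalent
words. -/
lemma wordEquiv_cons {i j : α} {a b : List α} (hab : EqvGen (WordStep r) a b) (ha : a.Nodup)
    (h : ∀ k ∈ a, k = j ∨ (r i k ∧ r k i)) : EqvGen (WordStep r) (i :: a) (i :: b) := by
  induction hab with
  | refl => exact EqvGen.refl _
  | symm x y hxy ih =>
    have hp := wordEquiv_perm hxy
    exact (ih (hp.nodup_iff.2 ha) fun k hk => h k (hp.mem_iff.1 hk)).symm
  | trans x y z hxy _ ih₁ ih₂ =>
    have hp := wordEquiv_perm hxy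
    exact (ih₁ ha h).trans _ _ _ (ih₂ (hp.nodup_iff.1 ha) fun k hk => h k (hp.mem_iff.2 hk))
  | rel x y hxy =>
    cases hxy with
    | swap p q hr => exact EqvGen.rel _ _ (WordStep.swap (i :: p) q hr)
    | rotate x p =>
      rcases h x List.mem_cons_self with rfl | hx
      · -- `i x p ~ x p i ~ x i p ~ i p x`, as `i` is related to every letter of `p`
        have hp : ∀ k ∈ p, r i k := fun k hk =>
          ((h k (List.mem_cons_of_mem _ hk)).resolve_left (by
            rintro rfl
            exact (List.nodup_cons.1 ha).1 hk)).1
        refine (EqvGen.rel _ _ (WordStep.rotate i (x :: p))).trans _ _ _ ?_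
        have h1 := wordEquiv_move [x] p [] hp
        simp only [List.append_nil, List.cons_append, List.nil_append] at h1
        refine (h1.symm _ _).trans _ _ _ ?_
        exact EqvGen.rel _ _ (WordStep.rotate x (i :: p))
      · refine (EqvGen.rel _ _ (WordStep.swap [] p hx.1)).trans _ _ _ ?_
        exact EqvGen.rel _ _ (WordStep.rotate x (i :: p))

/-- If every set of letters has a member related to all others but at most one, all words
without repetition in the same letters are equivalent. -/
theorem wordEquiv_of_perm (hleaf : ∀ l : List α, l ≠ [] →
      ∃ i ∈ l, ∃ j, ∀ k ∈ l, k ≠ i → k = j ∨ (r i k ∧ r k i))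
    (l m : List α) (hl : l.Nodup) (hlm : l.Perm m) : EqvGen (WordStep r) l m := by
  induction hN : l.length generalizing l m with
  | zero =>
    rw [List.length_eq_zero_iff] at hN
    subst hN
    rw [List.nil_perm.1 hlm]
    exact EqvGen.refl _
  | succ N ih =>
    obtain ⟨i, hi, j, hj⟩ := hleaf l (by rintro rfl; simp at hN)
    -- Rotation brings the letter `i` to the front.
    have key : ∀ l : List α, i ∈ l → ∃ l', EqvGen (WordStep r) l (i :: l') := by
      intro l hi
      obtain ⟨p, q, rfl⟩ := List.append_of_mem hi
      exact ⟨q ++ p, wordEquiv_rotate p (i :: q)⟩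
    obtain ⟨l', hl'⟩ := key l hi
    obtain ⟨m', hm'⟩ := key m (hlm.mem_iff.1 hi)
    have hpl := wordEquiv_perm hl'
    have hpm := wordEquiv_perm hm'
    have hnd := hpl.nodup_iff.1 hl
    have hp' : l'.Perm m' := (hpl.symm.trans (hlm.trans hpm)).cons_inv
    have hlen : l'.length = N := by
      have := hpl.length_eq
      rw [hN, List.length_cons] at this
      omega
    have h1 := ih l' m' (List.nodup_cons.1 hnd).2 hp' hlen
    refine hl'.trans _ _ _ (EqvGen.trans _ _ _ (wordEquiv_cons h1 (List.nodup_cons.1 hnd).2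
      (j := j) fun k hk => hj k (hpl.mem_iff.2 (List.mem_cons_of_mem _ hk)) ?_) (hm'.symm _ _))
    rintro rfl
    exact (List.nodup_cons.1 hnd).1 hk

/-- Exchanging commuting factors does not change a product, and rotation conjugates it by its first
factor. -/
lemma isConj_prod_of_wordEquiv {M : Type*} [Monoid M] {s : α → M} (hs : ∀ x, s x * s x = 1)
    (hr : ∀ x y, r x y → s x * s y = s y * s x) {a b : List α} (h : EqvGen (WordStep r) a b) :
    IsConj (a.map s).prod (b.map s).prod := by
  induction h with
  | refl => exact IsConj.refl _
  | symm _ _ _ ih => exact ih.symm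
  | trans _ _ _ _ _ ih₁ ih₂ => exact ih₁.trans ih₂
  | rel _ _ h =>
    cases h with
    | swap p q h =>
      simp only [List.map_append, List.map_cons, List.prod_append, List.prod_cons]
      rw [← mul_assoc (s _) (s _), hr _ _ h, mul_assoc]
    | rotate x p =>
      refine ⟨⟨s x, s x, hs x, hs x⟩, ?_⟩
      simp only [List.map_append, List.map_cons, List.prod_append, List.prod_cons, List.map_nil,
        List.prod_nil, mul_one]
      rw [SemiconjBy]
      simp only [mul_assoc, hs, mul_one]
      rw [← mul_assoc, hs, one_mul]

lemma orderOf_eq_of_isConj {M : Type*} [Monoid M] {a b : M} (h : IsConj a b) :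
    orderOf a = orderOf b := by
  obtain ⟨u, hu⟩ := h
  refine orderOf_eq_orderOf_iff.2 fun k => ?_
  have h1 : SemiconjBy (u : M) (a ^ k) (b ^ k) := hu.pow_right k
  constructor
  · intro ha
    rw [ha] at h1
    have h2 : (u : M) * 1 = b ^ k * u := h1
    rw [mul_one] at h2
    exact u.isUnit.mul_right_cancel (h2.symm.trans (one_mul _).symm)
  · intro hb
    rw [hb] at h1
    have h2 : (u : M) * a ^ k = 1 * u := h1
    rw [one_mul] at h2
    exact u.isUnit.mul_left_cancel (h2.trans (mul_one _).symm)

variable {κ : Type*} [Fintype κ] [DecidableEq κ] {A : Matrix κ κ ℤ}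

lemma refl_apply (A : Matrix κ κ ℤ) (i : κ) (v : κ → ℤ) :
    refl A i v = v - (A.mulVec v i) • Pi.single i 1 := rfl

lemma refl_mul_self (h2 : ∀ i, A i i = 2) (i : κ) : refl A i * refl A i = 1 := by
  refine LinearMap.ext fun v => ?_
  rw [Module.End.mul_apply, refl_apply, refl_apply, Matrix.mulVec_sub, Matrix.mulVec_smul]
  have : A.mulVec (Pi.single i 1) i = 2 := by rw [Matrix.mulVec_single_one]; exact h2 i
  rw [Pi.sub_apply, Pi.smul_apply, this, Module.End.one_apply]
  ext j
  simp
  ring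

lemma refl_mul_comm {i j : κ} (hij : A i j = 0) (hji : A j i = 0) :
    refl A i * refl A j = refl A j * refl A i := by
  refine LinearMap.ext fun v => ?_
  simp only [Module.End.mul_apply, refl_apply, Matrix.mulVec_sub, Matrix.mulVec_smul,
    Pi.sub_apply, Pi.smul_apply]
  have h1 : A.mulVec (Pi.single i 1) j = 0 := by rw [Matrix.mulVec_single_one]; exact hji
  have h2 : A.mulVec (Pi.single j 1) i = 0 := by rw [Matrix.mulVec_single_one]; exact hij
  rw [h1, h2]
  ext k
  simp
  ring

/-- The product of reflections in mutually orthogonal roots. -/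
lemma reflProd_apply {P : Finset κ} (hP : ∀ i ∈ P, ∀ j ∈ P, i ≠ j → A i j = 0) (v : κ → ℤ)
    (k : κ) : reflProd A P v k = if k ∈ P then v k - A.mulVec v k else v k := by
  have key : ∀ l : List κ, l.Nodup → (∀ i ∈ l, ∀ j ∈ l, i ≠ j → A i j = 0) →
      ∀ k, (l.map (refl A)).prod v k = if k ∈ l then v k - A.mulVec v k else v k := by
    intro l
    induction l with
    | nil => intro _ _ k; simp
    | cons i l ih =>
      intro hnd horth k
      rw [List.nodup_cons] at hnd
      have ih' := ih hnd.2 fun a ha b hb => horth a (List.mem_cons_of_mem _ ha) b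
        (List.mem_cons_of_mem _ hb)
      set w := (l.map (refl A)).prod v with hw
      -- The previous reflections do not change the `i`-th coordinate of `A v`.
      have hAw : A.mulVec w i = A.mulVec v i := by
        simp only [Matrix.mulVec, dotProduct]
        refine Finset.sum_congr rfl fun j _ => ?_
        rw [ih']
        by_cases hj : j ∈ l
        · rw [horth i List.mem_cons_self j (List.mem_cons_of_mem _ hj)
            (by rintro rfl; exact hnd.1 hj), zero_mul, zero_mul]
        · rw [if_neg hj]
      rw [List.map_cons, List.prod_cons, Module.End.mul_apply, ← hw, refl_apply, hAw, Pi.sub_apply,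
        ih', Pi.smul_apply, smul_eq_mul]
      by_cases hk : k = i
      · subst hk
        rw [if_neg hnd.1, if_pos List.mem_cons_self, Pi.single_eq_same, mul_one]
      · rw [Pi.single_eq_of_ne hk, mul_zero, sub_zero]
        simp [hk]
  have := key P.toList P.nodup_toList (by simpa using hP) k
  rw [reflProd, this]
  simp

/-- All orderings of the product of the simple reflections of a forest have the same order. -/
theorem coxeterNumber_eq (h2 : ∀ i, A i i = 2)
    (hleaf : ∀ S : Finset κ, S.Nonempty →
      ∃ i ∈ S, ∃ j, ∀ k ∈ S, k ≠ i → k = j ∨ (A i k = 0 ∧ A k i = 0))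
    {P₁ P₂ : Finset κ} (hd : Disjoint P₁ P₂) (hc : P₁ ∪ P₂ = Finset.univ) :
    coxeterNumber A = orderOf (reflProd A P₂ * reflProd A P₁) := by
  rw [coxeterNumber, reflProd, reflProd, reflProd, ← List.prod_append, ← List.map_append]
  apply orderOf_eq_of_isConj
  apply isConj_prod_of_wordEquiv (r := fun i j => A i j = 0 ∧ A j i = 0) (refl_mul_self h2)
    (fun i j h => refl_mul_comm h.1 h.2)
  apply wordEquiv_of_perm _ _ _ (Finset.nodup_toList _)
  · rw [List.perm_iff_count]
    intro k
    have hnd : (P₂.toList ++ P₁.toList).Nodup := by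
      rw [List.nodup_append]
      refine ⟨P₂.nodup_toList, P₁.nodup_toList, ?_⟩
      intro a ha b hb hab
      subst hab
      rw [Finset.mem_toList] at ha hb
      exact Finset.disjoint_left.1 hd hb ha
    rw [List.count_eq_one_of_mem (Finset.nodup_toList _) (by simp),
      List.count_eq_one_of_mem hnd ?_]
    have : k ∈ P₁ ∪ P₂ := by rw [hc]; exact Finset.mem_univ k
    rw [Finset.mem_union] at this
    simpa [or_comm] using this
  · -- In a forest every set of vertices has one with at most one neighbour in the set.
    intro l hl
    obtain ⟨i, hi, j, hj⟩ := hleaf l.toFinset (by simpa [List.toFinset_nonempty_iff] using hl)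
    refine ⟨i, by simpa using hi, j, fun k hk hki => ?_⟩
    rcases hj k (by simpa using hk) hki with h | h
    · exact Or.inl h
    · exact Or.inr ⟨h, h.symm⟩

/-- A forest is bipartite: a leaf is coloured unlike its neighbour. -/
lemma exists_coloring (hleaf : ∀ S : Finset κ, S.Nonempty →
      ∃ i ∈ S, ∃ j, ∀ k ∈ S, k ≠ i → k = j ∨ (A i k = 0 ∧ A k i = 0)) :
    ∃ P₁ P₂ : Finset κ, Disjoint P₁ P₂ ∧ P₁ ∪ P₂ = Finset.univ ∧
      (∀ i ∈ P₁, ∀ j ∈ P₁, i ≠ j → A i j = 0) ∧ (∀ i ∈ P₂, ∀ j ∈ P₂, i ≠ j → A i j = 0) := by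
  have key : ∀ N, ∀ S : Finset κ, S.card = N → ∃ col : κ → Bool, ∀ i ∈ S, ∀ j ∈ S, i ≠ j →
      col i = col j → A i j = 0 := by
    intro N
    induction N with
    | zero =>
      intro S hS
      rw [Finset.card_eq_zero] at hS
      subst hS
      exact ⟨fun _ => true, by simp⟩
    | succ N ih =>
      intro S hS
      obtain ⟨i, hi, j, hj⟩ := hleaf S (Finset.card_pos.1 (by omega))
      obtain ⟨col, hcol⟩ := ih (S.erase i) (by rw [Finset.card_erase_of_mem hi]; omega)
      refine ⟨Function.update col i (!col j), fun k hk l hl hkl h => ?_⟩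
      by_cases hki : k = i
      · subst hki
        rw [Function.update_self, Function.update_of_ne (Ne.symm hkl)] at h
        rcases hj l hl (Ne.symm hkl) with rfl | h1
        · simp at h
        · exact h1.1
      · by_cases hli : l = i
        · subst hli
          rw [Function.update_self, Function.update_of_ne hkl] at h
          rcases hj k hk hkl with rfl | h1
          · simp at h
          · exact h1.2
        · rw [Function.update_of_ne hki, Function.update_of_ne hli] at h
          exact hcol k (Finset.mem_erase.2 ⟨hki, hk⟩) l (Finset.mem_erase.2 ⟨hli, hl⟩) hkl h
  obtain ⟨col, hcol⟩ := key _ Finset.univ rfl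
  refine ⟨Finset.univ.filter fun i => col i = true, Finset.univ.filter fun i => ¬ col i = true,
    Finset.disjoint_filter_filter_not _ _ _, Finset.filter_union_filter_not_eq _ _, ?_, ?_⟩
  · intro i hi j hj hij
    simp only [Finset.mem_filter] at hi hj
    exact hcol i (Finset.mem_univ _) j (Finset.mem_univ _) hij (hi.2.trans hj.2.symm)
  · intro i hi j hj hij
    simp only [Finset.mem_filter, Bool.not_eq_true] at hi hj
    exact hcol i (Finset.mem_univ _) j (Finset.mem_univ _) hij (hi.2.trans hj.2.symm)

end Coxeter

end McKaySlodowy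

namespace McKaySlodowy

open Polynomial

/-! ### Eigenvalues of the finite part -/

/-- The polynomials `q g` of `HasDegrees` evaluated at `ξ`. -/
lemma HasDegrees.exists_eval {H : Type*} [Group H] [Fintype H] {f : H →* SL2} {a b h : ℕ}
    (hd : HasDegrees f a b h) (ξ : ℂ) (hξ : ξ ≠ 0) : ∃ e : H → ℂ,
    (∀ g, e g * (ξ * (ξ + ξ⁻¹ - tr (f g))) = (1 - ξ ^ a) * (1 - ξ ^ b)) ∧
    ∑ g, e g = Nat.card H * (1 + ξ ^ h) := by
  obtain ⟨q, hq1, hq2⟩ := hd.quot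
  refine ⟨fun g => (q g).eval ξ, fun g => ?_, ?_⟩
  · have := congrArg (Polynomial.eval ξ) (hq1 g)
    simp only [eval_mul, eval_add, eval_sub, eval_one, eval_C, eval_X, eval_pow] at this
    rw [← this]
    field_simp
    ring
  · have := congrArg (Polynomial.eval ξ) hq2
    rw [eval_finsetSum] at this
    simpa using this

namespace IsCharacterSystem

variable {H : Type*} [Group H] [Fintype H] {f : H →* SL2} {ι : Type*} [Fintype ι]
  {B : Matrix ι ι ℕ} {o : ι} {x : ℕ → ι → ℕ} {ψ : ι → H → ℂ} {n : ι → ℕ} {c : ℕ}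
  (S : IsCharacterSystem f B o x ψ n c)
include S

/-- Adjacency is a symmetric relation. -/
lemma B_eq_zero_iff (i j : ι) : B i j = 0 ↔ B j i = 0 := by
  have h := S.symm i j
  have hi := S.n_pos i
  have hj := S.n_pos j
  constructor <;> intro h0
  · rw [h0, mul_zero] at h
    exact (Nat.mul_eq_zero.1 h).resolve_left hi.ne'
  · rw [h0, mul_zero] at h
    exact (Nat.mul_eq_zero.1 h.symm).resolve_left hj.ne'

/-- The finite part is a forest: the form is not positive on `∑ αᵢ / √nᵢ`, summed over a set in
which every vertex has two neighbours. -/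
lemma exists_leaf (hf : Function.Injective f) (T : Finset ι) (hT : T.Nonempty) (ho : o ∉ T) :
    ∃ i ∈ T, ∃ j, ∀ k ∈ T, k ≠ i → k = j ∨ (B i k = 0 ∧ B k i = 0) := by
  classical
  by_contra! hno
  let u : ι → ℝ := fun i => if i ∈ T then (√(n i : ℝ))⁻¹ else 0
  have hs : ∀ i, 0 < √(n i : ℝ) := fun i => Real.sqrt_pos.2 (Nat.cast_pos.2 (S.n_pos i))
  have hss : ∀ i, √(n i : ℝ) * √(n i : ℝ) = n i := fun i =>
    Real.mul_self_sqrt (Nat.cast_nonneg _)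
  have hu : ∀ i ∈ T, u i = (√(n i : ℝ))⁻¹ := fun i hi => if_pos hi
  have hu0 : ∀ i, 0 ≤ u i := by
    intro i
    by_cases hi : i ∈ T
    · rw [hu i hi]
      exact (inv_pos.2 (hs i)).le
    · exact (if_neg hi).symm.le
  have hune : u ≠ 0 := by
    obtain ⟨i, hi⟩ := hT
    intro h
    have := congrFun h i
    rw [hu i hi] at this
    exact (inv_pos.2 (hs i)).ne' this
  have hpos := S.pos hf hune (if_neg ho)
  have h1 : ∑ i, n i * u i ^ 2 = T.card := by
    rw [← Finset.sum_subset (Finset.subset_univ T) (fun i _ hi => by simp [u, hi])]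
    rw [Finset.card_eq_sum_ones, Nat.cast_sum]
    refine Finset.sum_congr rfl fun i hi => ?_
    rw [hu i hi, ← hss i]
    have := (hs i).ne'
    field_simp
    simp
  have hterm0 : ∀ i j, 0 ≤ n i * B j i * u i * u j := fun i j =>
    mul_nonneg (mul_nonneg (by positivity) (hu0 i)) (hu0 j)
  -- Each edge contributes at least one, since `n i * B j i / √(n i * n j)` is the square root of
  -- the integer `B j i * B i j`.
  have hterm1 : ∀ i ∈ T, ∀ j ∈ T, B j i ≠ 0 → 1 ≤ n i * B j i * u i * u j := by
    intro i hi j hj hB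
    have hBr : (1 : ℝ) ≤ B j i := by exact_mod_cast Nat.one_le_iff_ne_zero.2 hB
    have hBr' : (1 : ℝ) ≤ B i j := by
      exact_mod_cast Nat.one_le_iff_ne_zero.2 fun h => hB ((S.B_eq_zero_iff i j).1 h)
    have hsym : (n i * B j i : ℝ) = n j * B i j := by exact_mod_cast S.symm i j
    have hsq : (n i * B j i * u i * u j) ^ 2 = B j i * B i j := by
      rw [hu i hi, hu j hj]
      have e1 := (hs i).ne'
      have e2 := (hs j).ne'
      have e : (n i * B j i * (√(n i : ℝ))⁻¹ * (√(n j : ℝ))⁻¹) ^ 2 =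
          (n i * B j i) * (n i * B j i) / ((√(n i : ℝ) * √(n i : ℝ)) *
            (√(n j : ℝ) * √(n j : ℝ))) := by
        field_simp
      rw [e, hss, hss]
      nth_rewrite 2 [hsym]
      have e3 : (n i : ℝ) ≠ 0 := Nat.cast_ne_zero.2 (S.n_pos i).ne'
      have e4 : (n j : ℝ) ≠ 0 := Nat.cast_ne_zero.2 (S.n_pos j).ne'
      field_simp
    have : (1 : ℝ) ≤ (n i * B j i * u i * u j) ^ 2 := by
      rw [hsq]
      nlinarith
    exact (one_le_sq_iff₀ (hterm0 i j)).1 this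
  -- By assumption every vertex of `T` has two neighbours in `T`.
  have h2 : ∑ i ∈ T, (2 : ℝ) ≤ ∑ i, ∑ j, n i * B j i * u i * u j := by
    refine le_trans (Finset.sum_le_sum fun i hi => ?_) (Finset.sum_le_sum_of_subset_of_nonneg
      (Finset.subset_univ T) fun i _ _ => Finset.sum_nonneg fun j _ => hterm0 i j)
    obtain ⟨k₁, hk₁, hk₁i, -, hB₁⟩ := hno i hi i
    obtain ⟨k₂, hk₂, hk₂i, hk₂₁, hB₂⟩ := hno i hi k₁
    have hB : ∀ k, (B i k = 0 → B k i ≠ 0) → B k i ≠ 0 := fun k h hk =>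
      h ((S.B_eq_zero_iff k i).1 hk) hk
    have e1 := hterm1 i hi k₁ hk₁ (hB k₁ hB₁)
    have e2 := hterm1 i hi k₂ hk₂ (hB k₂ hB₂)
    have e3 := Finset.sum_le_sum_of_subset_of_nonneg (Finset.subset_univ ({k₂, k₁} : Finset ι))
      (f := fun j => (n i * B j i * u i * u j : ℝ)) fun j _ _ => hterm0 i j
    rw [Finset.sum_pair hk₂₁] at e3
    linarith
  rw [Finset.sum_const, nsmul_eq_mul] at h2
  rw [h1] at hpos
  linarith

variable {a b h : ℕ} (hd : HasDegrees f a b h)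
include hd

/-- The eigenvalues of the finite part are of the form `2 cos (π k / h)`. -/
lemma pow_eq_one_of_eigenvector {u : ι → ℂ} (hu : u ≠ 0) (huo : u o = 0) {ξ : ℂ} (hξ : ξ ≠ 0)
    (hev : ∀ i, i ≠ o → ∑ j, (B j i : ℂ) * u j = (ξ + ξ⁻¹) * u i) :
    ξ ^ (2 * h) = 1 ∧ ξ ^ 2 ≠ 1 := by
  classical
  -- `F` has mean zero, and `(tr g - (ξ + ξ⁻¹)) F g` is a constant `K`.
  let F : H → ℂ := fun g => ∑ i, u i * ψ i g
  let K : ℂ := c * ∑ j, (B j o : ℂ) * u j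
  have hFK : ∀ g, (tr (f g) - (ξ + ξ⁻¹)) * F g = K := by
    intro g
    rw [sub_mul, S.tr_mul_sum u g, Finset.mul_sum, ← Finset.sum_sub_distrib,
      Finset.sum_eq_single o]
    · rw [S.const, huo, zero_mul, mul_zero, sub_zero, mul_comm]
    · intro i _ hi
      rw [hev i hi]
      ring
    · simp
  have hFsum : ∑ g, F g = 0 := by
    rw [S.sum_eq, huo, mul_zero]
  have hFconj : ∀ g k, IsConj g k → F k = F g := by
    intro g k hgk
    obtain ⟨y, rfl⟩ := isConj_iff.1 hgk
    simp only [F, S.conj]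
  have hF0 : ∃ g, F g ≠ 0 := by
    by_contra! hF
    exact hu (S.coeff_eq_zero hF)
  by_cases hK : K = 0
  · -- `F` is supported on elements of trace `ξ + ξ⁻¹`. As it has mean zero, these are not all
    -- conjugate.
    obtain ⟨g, hg⟩ := hF0
    have htr : ∀ k, F k ≠ 0 → tr (f k) = ξ + ξ⁻¹ := fun k hk =>
      sub_eq_zero.1 ((mul_eq_zero.1 ((hFK k).trans hK)).resolve_right hk)
    by_cases hall : ∀ k, tr (f g) = tr (f k) → IsConj g k
    · exfalso
      have h1 : ∑ k, F k = ∑ k with IsConj g k, F g := by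
        rw [Finset.sum_filter]
        refine Finset.sum_congr rfl fun k _ => ?_
        by_cases hk : IsConj g k
        · rw [if_pos hk, hFconj g k hk]
        · rw [if_neg hk]
          by_contra h0
          exact hk (hall k ((htr g hg).trans (htr k h0).symm))
      rw [hFsum, Finset.sum_const, nsmul_eq_mul, eq_comm, mul_eq_zero] at h1
      rcases h1 with h1 | h1
      · have : g ∈ Finset.univ.filter fun k => IsConj g k :=
          Finset.mem_filter.2 ⟨Finset.mem_univ _, IsConj.refl g⟩
        rw [Nat.cast_eq_zero, Finset.card_eq_zero] at h1
        rw [h1] at this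
        exact Finset.notMem_empty _ this
      · exact hg h1
    · push Not at hall
      obtain ⟨k, hk1, hk2⟩ := hall
      exact hd.shared g k hk1 hk2 ξ hξ (htr g hg).symm
  · constructor
    · -- `F` is proportional to `1 / (tr g - (ξ + ξ⁻¹))`, whose mean is a multiple of `1 + ξ^h` by
      -- the formula for the Molien series.
      obtain ⟨e, he1, he2⟩ := hd.exists_eval ξ hξ
      have h1 : ∀ g, e g * (ξ * K) = -((1 - ξ ^ a) * (1 - ξ ^ b)) * F g := by
        intro g
        rw [← he1 g, ← hFK g]
        ring
      have h2 : (∑ g, e g) * (ξ * K) = 0 := by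
        rw [Finset.sum_mul, Finset.sum_congr rfl fun g _ => h1 g, ← Finset.mul_sum, hFsum,
          mul_zero]
      rw [he2, mul_eq_zero, mul_eq_zero] at h2
      have h3 : 1 + ξ ^ h = 0 :=
        (h2.resolve_right (mul_ne_zero hξ hK)).resolve_left
          (Nat.cast_ne_zero.2 Nat.card_pos.ne')
      rw [mul_comm, pow_mul, eq_neg_of_add_eq_zero_right h3]
      norm_num
    · -- for `ξ = ±1` all values of `F` are multiples of `K` of the same sign
      intro hξ2
      obtain ⟨s, hs, hsξ⟩ : ∃ s : ℝ, s * s = 1 ∧ ξ = s := by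
        rcases mul_self_eq_one_iff.1 ((pow_two ξ).symm.trans hξ2) with rfl | rfl
        · exact ⟨1, by norm_num, by norm_num⟩
        · exact ⟨-1, by norm_num, by norm_num⟩
      choose t ht1 ht2 using fun g => exists_real_tr (isOfFinOrder_map f g)
      have hξi : ξ⁻¹ = ξ := by
        rw [inv_eq_iff_eq_inv]
        exact eq_inv_of_mul_eq_one_left (by rw [← pow_two, hξ2])
      have hs1 : |s| = 1 := by
        have : |s| * |s| = 1 := by rw [← abs_mul, hs, abs_one]
        nlinarith [abs_nonneg s]
      have hpos : ∀ g, 0 < 2 - s * t g := by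
        intro g
        have h1 : |s * t g| ≤ 2 := by rw [abs_mul, hs1, one_mul]; exact ht2 g
        refine lt_of_le_of_ne (by have := (abs_le.1 h1).2; linarith) fun h0 => hK ?_
        rw [← hFK g, hξi, ht1, hsξ]
        have : (t g : ℂ) - (s + s) = 0 := by
          have : t g - (s + s) = 0 := by linear_combination (-t g) * hs + s * h0
          exact_mod_cast this
        rw [this, zero_mul]
      have h1 : ∀ g, F g = -(s * K) * ((2 - s * t g)⁻¹ : ℝ) := by
        intro g
        have hne : ((2 - s * t g : ℝ) : ℂ) ≠ 0 := Complex.ofReal_ne_zero.2 (hpos g).ne'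
        rw [Complex.ofReal_inv, eq_mul_inv_iff_mul_eq₀ hne, ← hFK g, hξi, ht1, hsξ]
        have hsc : (s : ℂ) * s = 1 := by exact_mod_cast hs
        push_cast
        linear_combination (-2 * F g) * hsc
      have h2 : -(s * K) * ((∑ g, (2 - s * t g)⁻¹ : ℝ) : ℂ) = 0 := by
        rw [Complex.ofReal_sum, Finset.mul_sum, ← hFsum]
        exact Finset.sum_congr rfl fun g _ => (h1 g).symm
      rw [mul_eq_zero, neg_eq_zero, mul_eq_zero] at h2
      have h3 : (∑ g, (2 - s * t g)⁻¹ : ℝ) > 0 :=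
        Finset.sum_pos (fun g _ => inv_pos.2 (hpos g)) ⟨1, Finset.mem_univ _⟩
      rcases h2 with (h2 | h2) | h2
      · rw [← hsξ] at h2
        exact hξ h2
      · exact hK h2
      · exact h3.ne' (Complex.ofReal_eq_zero.1 h2)

/-- The eigenvalue `2 cos (π / h)` of the finite part occurs: `1 / (2 cos (π / h) - tr g)` is
orthogonal to the constants. -/
lemma exists_eigenvector (hh : 2 ≤ h) {ξ : ℂ} (hξ : IsPrimitiveRoot ξ (2 * h)) :
    ∃ u : ι → ℂ, u ≠ 0 ∧ u o = 0 ∧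
      ∀ i, i ≠ o → ∑ j, (B j i : ℂ) * u j = (ξ + ξ⁻¹) * u i := by
  classical
  have hξ0 : ξ ≠ 0 := hξ.ne_zero (by omega)
  have hadd := hd.add
  have ha := hd.a_pos
  have hb := hd.b_pos
  have hE : (1 - ξ ^ a) * (1 - ξ ^ b) ≠ 0 := by
    refine mul_ne_zero ?_ ?_
    · exact sub_ne_zero.2 (hξ.pow_ne_one_of_pos_of_lt ha.ne' (by omega)).symm
    · exact sub_ne_zero.2 (hξ.pow_ne_one_of_pos_of_lt hb.ne' (by omega)).symm
  have hξh : 1 + ξ ^ h = 0 := by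
    have h1 : (1 + ξ ^ h) * (1 - ξ ^ h) = 0 := by
      have := hξ.pow_eq_one
      rw [mul_comm, pow_mul] at this
      linear_combination -this
    exact (mul_eq_zero.1 h1).resolve_right
      (sub_ne_zero.2 (hξ.pow_ne_one_of_pos_of_lt (by omega) (by omega)).symm)
  obtain ⟨e, he1, he2⟩ := hd.exists_eval ξ hξ0
  rw [hξh, mul_zero] at he2
  have htr : ∀ g, ξ + ξ⁻¹ - tr (f g) ≠ 0 := by
    intro g h0
    have := he1 g
    rw [h0, mul_zero, mul_zero] at this
    exact hE this.symm
  -- `L` represents multiplication by `ξ + ξ⁻¹ - tr g`, which has no zeros; the vector sought is the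
  -- preimage of the constants.
  let L : Matrix ι ι ℂ := (ξ + ξ⁻¹) • 1 - Matrix.of fun i j => (B j i : ℂ)
  have hL : ∀ u i, L.mulVec u i = (ξ + ξ⁻¹) * u i - ∑ j, (B j i : ℂ) * u j := by
    intro u i
    rw [Matrix.sub_mulVec, Pi.sub_apply, Matrix.smul_mulVec, Matrix.one_mulVec]
    rfl
  have hLF : ∀ u g, ∑ i, L.mulVec u i * ψ i g = (ξ + ξ⁻¹ - tr (f g)) * ∑ i, u i * ψ i g := by
    intro u g
    rw [sub_mul, S.tr_mul_sum u g, Finset.mul_sum, ← Finset.sum_sub_distrib]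
    exact Finset.sum_congr rfl fun i _ => by rw [hL]; ring
  have hinj : Function.Injective L.mulVecLin := by
    rw [← LinearMap.ker_eq_bot, LinearMap.ker_eq_bot']
    intro u hu
    apply S.coeff_eq_zero
    intro g
    have h1 := hLF u g
    rw [show L.mulVec u = 0 from hu] at h1
    simp only [Pi.zero_apply, zero_mul, Finset.sum_const_zero] at h1
    exact (mul_eq_zero.1 h1.symm).resolve_left (htr g)
  obtain ⟨u, hu⟩ := LinearMap.injective_iff_surjective.1 hinj (Pi.single o 1)
  have hu' : L.mulVec u = Pi.single o 1 := hu
  refine ⟨u, ?_, ?_, ?_⟩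
  · rintro rfl
    rw [Matrix.mulVec_zero] at hu'
    have := congrFun hu' o
    rw [Pi.single_eq_same] at this
    exact zero_ne_one this
  · -- The mean of `1 / (ξ + ξ⁻¹ - tr g)` is a multiple of `1 + ξ^h = 0`.
    have h1 : ∀ g, (1 - ξ ^ a) * (1 - ξ ^ b) * ∑ i, u i * ψ i g = e g * (ξ * c) := by
      intro g
      have h2 := hLF u g
      rw [hu', Finset.sum_eq_single o (fun i _ hi => by rw [Pi.single_eq_of_ne hi, zero_mul])
        (by simp), Pi.single_eq_same, one_mul, S.const] at h2
      rw [← he1 g, h2]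
      ring
    have h2 : (1 - ξ ^ a) * (1 - ξ ^ b) * (Nat.card H * c * u o) = 0 := by
      rw [← S.sum_eq, Finset.mul_sum, Finset.sum_congr rfl fun g _ => h1 g, ← Finset.sum_mul, he2,
        zero_mul]
    have h3 : (Nat.card H * c : ℂ) ≠ 0 := mul_ne_zero (Nat.cast_ne_zero.2 Nat.card_pos.ne')
      (Nat.cast_ne_zero.2 S.c_pos.ne')
    exact (mul_eq_zero.1 ((mul_eq_zero.1 h2).resolve_left hE)).resolve_left h3
  · intro i hi
    have := congrFun hu' i
    rw [hL, Pi.single_eq_of_ne hi, sub_eq_zero] at this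
    exact this.symm

end IsCharacterSystem

end McKaySlodowy

namespace McKaySlodowy

/-! ### The order of the Coxeter element -/

section Eigenvectors

variable {κ : Type*} [Fintype κ] [DecidableEq κ]

/-- A symmetrizable matrix is diagonalizable. -/
lemma span_eigenvectors_eq_top {M : Matrix κ κ ℂ} {B : Matrix κ κ ℕ} {n : κ → ℕ}
    (hM : ∀ i j, M i j = B j i) (hn : ∀ i, 0 < n i) (hsym : ∀ i j, n i * B j i = n j * B i j) :
    Submodule.span ℂ {u : κ → ℂ | ∃ l : ℂ, M.mulVec u = l • u} = ⊤ := by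
  have hs : ∀ i, √(n i : ℝ) ≠ 0 := fun i => (Real.sqrt_pos.2 (Nat.cast_pos.2 (hn i))).ne'
  have hss : ∀ i, √(n i : ℝ) * √(n i : ℝ) = n i := fun i =>
    Real.mul_self_sqrt (Nat.cast_nonneg _)
  -- Conjugation by the diagonal matrix of the `√(n i)` makes the matrix symmetric.
  let R : Matrix κ κ ℂ := Matrix.of fun i j => ((√(n i : ℝ) * B j i / √(n j : ℝ) : ℝ) : ℂ)
  have hRa : ∀ i j, R i j = ((√(n i : ℝ) * B j i / √(n j : ℝ) : ℝ) : ℂ) := fun _ _ => rfl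
  have hR : R.IsHermitian := by
    ext i j
    rw [Matrix.conjTranspose_apply, hRa, hRa, Complex.star_def,
      Complex.conj_ofReal]
    congr 1
    rw [div_eq_div_iff (hs i) (hs j), mul_right_comm, hss, mul_right_comm, hss]
    exact_mod_cast hsym j i
  rw [eq_top_iff]
  rintro v -
  let D : (κ → ℂ) →ₗ[ℂ] (κ → ℂ) :=
    { toFun := fun w i => ((√(n i : ℝ))⁻¹ : ℝ) * w i
      map_add' := fun u w => by ext i; simp [mul_add]
      map_smul' := fun l w => by ext i; simp; ring }
  let w : EuclideanSpace ℂ κ := WithLp.toLp 2 fun i => (√(n i : ℝ) : ℂ) * v i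
  have hw : D w.ofLp = v := by
    ext i
    have : (√(n i : ℝ) : ℂ) ≠ 0 := Complex.ofReal_ne_zero.2 (hs i)
    simp only [D, w, LinearMap.coe_mk, AddHom.coe_mk]
    push_cast
    field_simp
  have hsum := hR.eigenvectorBasis.sum_repr w
  have hv : v = ∑ j, (hR.eigenvectorBasis.repr w j) • D (hR.eigenvectorBasis j).ofLp := by
    rw [← hw]
    conv_lhs => rw [← hsum]
    rw [WithLp.ofLp_sum, map_sum]
    simp only [WithLp.ofLp_smul, map_smul]
  rw [hv]
  refine Submodule.sum_mem _ fun j _ => Submodule.smul_mem _ _ (Submodule.subset_span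
    ⟨hR.eigenvalues j, ?_⟩)
  have he := hR.mulVec_eigenvectorBasis j
  ext i
  have hei := congrFun he i
  simp only [Matrix.mulVec, dotProduct, Pi.smul_apply, hRa] at hei
  simp only [Matrix.mulVec, dotProduct, Pi.smul_apply, D, LinearMap.coe_mk, AddHom.coe_mk, hM,
    smul_eq_mul]
  rw [mul_left_comm]
  have hc : ((hR.eigenvalues j : ℂ)) * (hR.eigenvectorBasis j).ofLp i =
      hR.eigenvalues j • (hR.eigenvectorBasis j).ofLp i := by
    rw [Complex.real_smul]
  rw [hc, ← hei, Finset.mul_sum]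
  refine Finset.sum_congr rfl fun k _ => ?_
  have e1 : (√(n i : ℝ) : ℂ) ≠ 0 := Complex.ofReal_ne_zero.2 (hs i)
  have e2 : (√(n k : ℝ) : ℂ) ≠ 0 := Complex.ofReal_ne_zero.2 (hs k)
  push_cast
  field_simp

/-- The operator `v ↦ v - Π (2 - M) v`, where `Π` is the projection to the coordinates in `P`; for
mutually orthogonal roots it is the product of the reflections. -/
noncomputable def partReflection (M : Matrix κ κ ℂ) (P : Finset κ) : Module.End ℂ (κ → ℂ) where
  toFun v k := if k ∈ P then M.mulVec v k - v k else v k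
  map_add' u v := by
    ext k
    by_cases hk : k ∈ P
    · simp only [hk, if_true, Matrix.mulVec_add, Pi.add_apply]
      ring
    · simp [hk]
  map_smul' l v := by
    ext k
    by_cases hk : k ∈ P
    · simp only [hk, if_true, Matrix.mulVec_smul, Pi.smul_apply, smul_eq_mul, RingHom.id_apply]
      ring
    · simp [hk]

lemma partReflection_apply (M : Matrix κ κ ℂ) (P : Finset κ) (v : κ → ℂ) (k : κ) :
    partReflection M P v k = if k ∈ P then M.mulVec v k - v k else v k := rfl

variable {M : Matrix κ κ ℂ} {P₁ P₂ : Finset κ} (hd : Disjoint P₁ P₂)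
  (hc : P₁ ∪ P₂ = Finset.univ) (h₁ : ∀ i ∈ P₁, ∀ j ∈ P₁, M i j = 0)
  (h₂ : ∀ i ∈ P₂, ∀ j ∈ P₂, M i j = 0)
include hd hc h₁ h₂

/-- For an eigenvector `u = u₁ + u₂` of eigenvalue `s + s⁻¹` of a bipartite matrix, `s⁻¹ u₁ + u₂`
is an eigenvector of eigenvalue `s²` of the Coxeter element. -/
lemma coxeter_eigenvector {u : κ → ℂ} {s : ℂ} (hs : s ≠ 0)
    (hu : M.mulVec u = (s + s⁻¹) • u) :
    (partReflection M P₂ * partReflection M P₁) (fun k => if k ∈ P₁ then s⁻¹ * u k else u k) =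
      s ^ 2 • fun k => if k ∈ P₁ then s⁻¹ * u k else u k := by
  have hmem : ∀ k, k ∉ P₁ → k ∈ P₂ := fun k hk => by
    have : k ∈ P₁ ∪ P₂ := by rw [hc]; exact Finset.mem_univ k
    exact (Finset.mem_union.1 this).resolve_left hk
  have hnot : ∀ k ∈ P₁, k ∉ P₂ := fun k hk => Finset.disjoint_left.1 hd hk
  have hu' : ∀ k, ∑ j, M k j * u j = (s + s⁻¹) * u k := fun k => congrFun hu k
  -- The first reflection product maps `(s⁻¹ u₁, u₂)` to `(s u₁, u₂)`, the second one maps this to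
  -- `(s u₁, s² u₂)`.
  have e1 : partReflection M P₁ (fun k => if k ∈ P₁ then s⁻¹ * u k else u k) =
      fun k => if k ∈ P₁ then s * u k else u k := by
    ext k
    rw [partReflection_apply]
    by_cases hk : k ∈ P₁
    · simp only [hk, if_true]
      have : M.mulVec (fun k => if k ∈ P₁ then s⁻¹ * u k else u k) k = (s + s⁻¹) * u k := by
        rw [← hu' k]
        refine Finset.sum_congr rfl fun j _ => ?_
        change M k j * (if j ∈ P₁ then s⁻¹ * u j else u j) = M k j * u j
        by_cases hj : j ∈ P₁
        · rw [h₁ k hk j hj, zero_mul, zero_mul]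
        · rw [if_neg hj]
      rw [this]
      ring
    · simp [hk]
  rw [Module.End.mul_apply, e1]
  ext k
  rw [partReflection_apply, Pi.smul_apply, smul_eq_mul]
  by_cases hk : k ∈ P₁
  · rw [if_neg (hnot k hk)]
    simp only [hk, if_true]
    field_simp
  · rw [if_pos (hmem k hk)]
    simp only [hk, if_false]
    have : M.mulVec (fun k => if k ∈ P₁ then s * u k else u k) k = s * ((s + s⁻¹) * u k) := by
      rw [← hu' k, Finset.mul_sum]
      refine Finset.sum_congr rfl fun j _ => ?_
      change M k j * (if j ∈ P₁ then s * u j else u j) = s * (M k j * u j)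
      by_cases hj : j ∈ P₁
      · rw [if_pos hj]
        ring
      · rw [h₂ k (hmem k hk) j (hmem j hj), zero_mul, zero_mul, mul_zero]
    rw [this]
    field_simp
    ring

/-- If all eigenvalues of a diagonalizable bipartite matrix are of the form `ξ + ξ⁻¹` with `ξ^(2h) =
1` and `ξ ≠ ±1`, the Coxeter element has order dividing `h`. -/
lemma coxeter_pow_eq_one {h : ℕ}
    (hspan : Submodule.span ℂ {u : κ → ℂ | ∃ l : ℂ, M.mulVec u = l • u} = ⊤)
    (hev : ∀ (u : κ → ℂ) (ξ : ℂ), u ≠ 0 → ξ ≠ 0 → M.mulVec u = (ξ + ξ⁻¹) • u →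
      ξ ^ (2 * h) = 1 ∧ ξ ^ 2 ≠ 1) :
    (partReflection M P₂ * partReflection M P₁) ^ h = 1 := by
  set C := partReflection M P₂ * partReflection M P₁ with hC
  have hpow : ∀ (e : κ → ℂ) (l : ℂ), C e = l • e → (C ^ h) e = l ^ h • e := by
    intro e l he
    induction h with
    | zero => simp
    | succ m _ =>
      have : ∀ m : ℕ, (C ^ m) e = l ^ m • e := by
        intro m
        induction m with
        | zero => simp
        | succ m ih => rw [pow_succ, Module.End.mul_apply, he, map_smul, ih, smul_smul, pow_succ,
            mul_comm]
      exact this _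
  have key : ∀ u ∈ {u : κ → ℂ | ∃ l : ℂ, M.mulVec u = l • u}, (C ^ h) u = u := by
    rintro u ⟨l, hl⟩
    by_cases hu0 : u = 0
    · rw [hu0, map_zero]
    obtain ⟨ξ, hξ0, rfl⟩ : ∃ ξ : ℂ, ξ ≠ 0 ∧ l = ξ + ξ⁻¹ := by
      obtain ⟨s, hs⟩ := IsAlgClosed.exists_pow_nat_eq (l ^ 2 - 4) (n := 2) (by norm_num)
      have h1 : ((l + s) / 2) * ((l - s) / 2) = 1 := by linear_combination -hs / 4
      refine ⟨(l + s) / 2, left_ne_zero_of_mul_eq_one h1, ?_⟩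
      rw [inv_eq_of_mul_eq_one_right h1]
      ring
    obtain ⟨hp, hne⟩ := hev u ξ hu0 hξ0 hl
    have hne' : ξ⁻¹ - ξ ≠ 0 := by
      intro h0
      apply hne
      rw [pow_two]
      nth_rewrite 2 [← sub_eq_zero.1 h0]
      exact mul_inv_cancel₀ hξ0
    have e1 := hpow _ _ (coxeter_eigenvector hd hc h₁ h₂ hξ0 hl)
    have e2 := hpow _ _ (coxeter_eigenvector hd hc h₁ h₂ (inv_ne_zero hξ0)
      (by rw [inv_inv, add_comm]; exact hl))
    rw [← pow_mul, hp, one_smul] at e1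
    rw [← pow_mul, inv_pow, hp, inv_one, one_smul, inv_inv] at e2
    -- `u` is a combination of the two eigenvectors of the Coxeter element
    have hcomb : (ξ⁻¹ - ξ) • u = (1 - ξ) • (fun k => if k ∈ P₁ then ξ⁻¹ * u k else u k) +
        (ξ⁻¹ - 1) • (fun k => if k ∈ P₁ then ξ * u k else u k) := by
      ext k
      by_cases hk : k ∈ P₁
      · simp only [Pi.smul_apply, Pi.add_apply, hk, if_true, smul_eq_mul]
        field_simp
        ring
      · simp only [Pi.smul_apply, Pi.add_apply, hk, if_false, smul_eq_mul]
        ring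
    have h3 : (C ^ h) ((ξ⁻¹ - ξ) • u) = (ξ⁻¹ - ξ) • u := by
      rw [hcomb, map_add, map_smul, map_smul, e1, e2]
    rw [map_smul] at h3
    exact smul_right_injective _ hne' h3
  refine LinearMap.ext fun v => ?_
  have hv : v ∈ Submodule.span ℂ {u : κ → ℂ | ∃ l : ℂ, M.mulVec u = l • u} := by
    rw [hspan]; trivial
  rw [Module.End.one_apply]
  induction hv using Submodule.span_induction with
  | mem u hu => exact key u hu
  | zero => exact map_zero _
  | add u w _ _ hu hw => rw [map_add, hu, hw]
  | smul l u _ hu => rw [map_smul, hu]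

end Eigenvectors

section Order

variable {H : Type*} [Group H] [Fintype H] {f : H →* SL2} {ι : Type*} [Fintype ι] [DecidableEq ι]
  {B : Matrix ι ι ℕ} {o : ι} {x : ℕ → ι → ℕ} {ψ : ι → H → ℂ} {n : ι → ℕ} {c : ℕ}

/-- The Coxeter number is `h`: the eigenvalues of the Coxeter element are the squares of `2h`-th
roots of unity, and a primitive `h`-th root of unity occurs. -/
theorem IsCharacterSystem.coxeterNumber_eq (S : IsCharacterSystem f B o x ψ n c)
    (hf : Function.Injective f) {a b h : ℕ} (hd : HasDegrees f a b h) {A : Matrix ι ι ℤ}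
    (hA : ∀ i j, A i j = (if i = j then 2 else 0) - (B j i : ℤ))
    (hloop : ∀ i, i ≠ o → B i i = 0) :
    coxeterNumber (finitePart A o) = h := by
  have hAd : ∀ i : {i // i ≠ o}, finitePart A o i i = 2 := fun i => by
    rw [finitePart, Matrix.submatrix_apply, hA, if_pos rfl, hloop i i.2]
    simp
  have hAo : ∀ i j : {i // i ≠ o}, i ≠ j → finitePart A o i j = -(B j i : ℤ) := fun i j hij => by
    rw [finitePart, Matrix.submatrix_apply, hA, if_neg fun h => hij (Subtype.ext h), zero_sub]
  have hleaf : ∀ T : Finset {i // i ≠ o}, T.Nonempty → ∃ i ∈ T, ∃ j, ∀ k ∈ T, k ≠ i →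
      k = j ∨ (finitePart A o i k = 0 ∧ finitePart A o k i = 0) := by
    intro T hT
    obtain ⟨i, hi, j, hj⟩ := S.exists_leaf hf (T.map (Function.Embedding.subtype _))
      (hT.map) (by simp)
    obtain ⟨i', hi', rfl⟩ := Finset.mem_map.1 hi
    have hj' : ∀ k ∈ T, k ≠ i' → (k : ι) = j ∨
        (finitePart A o i' k = 0 ∧ finitePart A o k i' = 0) := by
      intro k hk hki
      rcases hj k (Finset.mem_map_of_mem _ hk) (fun h => hki (Subtype.ext h)) with h | ⟨h1, h2⟩
      · exact Or.inl h
      · right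
        rw [hAo _ _ hki, hAo _ _ hki.symm]
        exact ⟨by simpa using h2, by simpa using h1⟩
    by_cases hjo : j = o
    · exact ⟨i', hi', i', fun k hk hki => Or.inr ((hj' k hk hki).resolve_left
        fun h => k.2 (h.trans hjo))⟩
    · exact ⟨i', hi', ⟨j, hjo⟩, fun k hk hki => (hj' k hk hki).imp_left fun h => Subtype.ext h⟩
  obtain ⟨P₁, P₂, hdis, hcov, ho₁, ho₂⟩ := exists_coloring hleaf
  rw [McKaySlodowy.coxeterNumber_eq hAd hleaf hdis hcov]
  -- The complexification of the Coxeter element `C` is the operator `D` given by `M = 2 - A`.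
  let M : Matrix {i // i ≠ o} {i // i ≠ o} ℂ := Matrix.of fun i j => (B j i : ℂ)
  have hMa : ∀ i j, M i j = (B j i : ℂ) := fun _ _ => rfl
  have hMA : ∀ i j, ((finitePart A o i j : ℤ) : ℂ) = (if i = j then 2 else 0) - M i j := by
    intro i j
    by_cases hij : i = j
    · subst hij
      rw [hAd, if_pos rfl, hMa, hloop i i.2]
      simp
    · rw [hAo i j hij, if_neg hij, hMa]
      simp
  have hM : ∀ P : Finset {i // i ≠ o}, (∀ i ∈ P, ∀ j ∈ P, i ≠ j → finitePart A o i j = 0) →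
      ∀ i ∈ P, ∀ j ∈ P, M i j = 0 := by
    intro P hP i hi j hj
    by_cases hij : i = j
    · subst hij
      rw [hMa, hloop i i.2, Nat.cast_zero]
    · have := hMA i j
      rw [hP i hi j hj hij, if_neg hij] at this
      simpa using this
  have hcast : ∀ P : Finset {i // i ≠ o}, (∀ i ∈ P, ∀ j ∈ P, i ≠ j → finitePart A o i j = 0) →
      ∀ v : {i // i ≠ o} → ℤ, (fun k => ((reflProd (finitePart A o) P v k : ℤ) : ℂ)) =
        partReflection M P fun k => (v k : ℂ) := by
    intro P hP v
    ext k
    rw [reflProd_apply hP, partReflection_apply]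
    by_cases hk : k ∈ P
    · rw [if_pos hk, if_pos hk]
      simp only [Matrix.mulVec, dotProduct]
      push_cast
      simp only [hMA, sub_mul, Finset.sum_sub_distrib, ite_mul, zero_mul]
      rw [Finset.sum_ite_eq]
      simp
      ring
    · rw [if_neg hk, if_neg hk]
  set C := reflProd (finitePart A o) P₂ * reflProd (finitePart A o) P₁ with hC
  set D := partReflection M P₂ * partReflection M P₁ with hD
  have hone : ∀ v : {i // i ≠ o} → ℤ, (fun j => ((C v j : ℤ) : ℂ)) = D fun j => (v j : ℂ) := by
    intro v
    rw [hC, hD, Module.End.mul_apply, Module.End.mul_apply, hcast P₂ ho₂, hcast P₁ ho₁]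
  have hCD : ∀ (k : ℕ) (v : {i // i ≠ o} → ℤ), (fun j => (((C ^ k) v j : ℤ) : ℂ)) =
      (D ^ k) fun j => (v j : ℂ) := by
    intro k
    induction k with
    | zero => intro v; rfl
    | succ k ih =>
      intro v
      rw [pow_succ C, pow_succ D, Module.End.mul_apply (C ^ k), Module.End.mul_apply (D ^ k), ih,
        hone]
  -- Vectors on the finite part are identified with vectors vanishing at `o`.
  have hext : ∀ (u : {i // i ≠ o} → ℂ) (g : ι → ℂ),
      ∑ j, g j * (if hj : j ≠ o then u ⟨j, hj⟩ else 0) = ∑ j : {i // i ≠ o}, g j * u j := by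
    intro u g
    rw [← Finset.sum_erase (s := Finset.univ) (a := o) (h := by simp),
      Finset.sum_subtype (p := fun i => i ≠ o) _ (by simp)]
    exact Finset.sum_congr rfl fun j _ => by rw [dif_pos j.2]
  have hev : ∀ (u : {i // i ≠ o} → ℂ) (ξ : ℂ), u ≠ 0 → ξ ≠ 0 → M.mulVec u = (ξ + ξ⁻¹) • u →
      ξ ^ (2 * h) = 1 ∧ ξ ^ 2 ≠ 1 := by
    intro u ξ hu hξ hMu
    refine S.pow_eq_one_of_eigenvector hd (u := fun j => if hj : j ≠ o then u ⟨j, hj⟩ else 0)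
      ?_ (by simp) hξ ?_
    · intro h0
      apply hu
      ext j
      have := congrFun h0 j
      simpa [j.2] using this
    · intro i hi
      rw [hext u fun j => (B j i : ℂ), dif_pos hi]
      exact congrFun hMu ⟨i, hi⟩
  have hCh : C ^ h = 1 := by
    have h1 := coxeter_pow_eq_one hdis hcov (hM P₁ ho₁) (hM P₂ ho₂)
      (span_eigenvectors_eq_top (M := M) (B := B.submatrix Subtype.val Subtype.val)
        (n := fun i => n i) (fun i j => rfl) (fun i => S.n_pos i) fun i j => S.symm i j) hev
    refine LinearMap.ext fun v => ?_
    ext j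
    have h2 := congrFun (hCD h v) j
    rw [h1] at h2
    exact Int.cast_injective (α := ℂ) h2
  apply Nat.dvd_antisymm (orderOf_dvd_of_pow_eq_one hCh)
  -- Conversely, the eigenvalue `ξ + ξ⁻¹` with `ξ` a primitive `2h`-th root of unity makes `ξ²` an
  -- eigenvalue of `D`. If `h = 1` there is nothing to prove.
  have hh := hd.h_pos
  by_cases hh1 : h = 1
  · rw [hh1]
    exact one_dvd _
  have hξ := Complex.isPrimitiveRoot_exp (2 * h) (by omega)
  set ξ := Complex.exp (2 * Real.pi * Complex.I / (2 * h : ℕ))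
  obtain ⟨u, hu0, huo, hu⟩ := S.exists_eigenvector hd (by omega) hξ
  have hξ0 : ξ ≠ 0 := hξ.ne_zero (by omega)
  let w : {i // i ≠ o} → ℂ := fun i => u i
  have hwu : ∀ j, u j = if hj : j ≠ o then w ⟨j, hj⟩ else 0 := by
    intro j
    by_cases hj : j = o
    · rw [dif_neg (not_not.2 hj), hj, huo]
    · rw [dif_pos hj]
  have hMw : M.mulVec w = (ξ + ξ⁻¹) • w := by
    ext i
    have h1 := hu i i.2
    rw [Finset.sum_congr rfl fun j _ => by rw [hwu j], hext w fun j => (B j i : ℂ)] at h1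
    exact h1
  have heig := coxeter_eigenvector hdis hcov (hM P₁ ho₁) (hM P₂ ho₂) hξ0 hMw
  set e : {i // i ≠ o} → ℂ := fun k => if k ∈ P₁ then ξ⁻¹ * w k else w k with he
  have hpow : ∀ k, (D ^ k) e = (ξ ^ 2) ^ k • e := by
    intro k
    induction k with
    | zero => simp
    | succ k ih => rw [pow_succ, Module.End.mul_apply, heig, map_smul, ih, smul_smul,
        pow_succ (ξ ^ 2), mul_comm]
  have hDk : D ^ orderOf C = 1 := by
    refine LinearMap.pi_ext' fun i => LinearMap.ext_ring ?_
    have h1 := hCD (orderOf C) (Pi.single i 1)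
    rw [pow_orderOf_eq_one] at h1
    have h2 : (fun j => (((Pi.single i 1 : {i // i ≠ o} → ℤ) j : ℤ) : ℂ)) = Pi.single i 1 := by
      ext j
      by_cases hj : j = i
      · subst hj; simp
      · simp [Pi.single_eq_of_ne hj]
    have h3 : (fun j => (((1 : Module.End ℤ ({i // i ≠ o} → ℤ)) (Pi.single i 1) j : ℤ) : ℂ)) =
        Pi.single i 1 := h2
    rw [h3, h2] at h1
    exact h1.symm
  have h4 := hpow (orderOf C)
  rw [hDk, Module.End.one_apply] at h4
  obtain ⟨i, hi⟩ : ∃ i, e i ≠ 0 := by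
    by_contra! h0
    apply hu0
    ext j
    rw [hwu j]
    by_cases hj : j = o
    · rw [dif_neg (not_not.2 hj)]; rfl
    · rw [dif_pos hj]
      have := h0 ⟨j, hj⟩
      rw [he] at this
      by_cases hP : (⟨j, hj⟩ : {i // i ≠ o}) ∈ P₁
      · simp only [hP, if_true] at this
        exact (mul_eq_zero.1 this).resolve_left (inv_ne_zero hξ0)
      · simp only [hP, if_false] at this
        exact this
  have h5 := congrFun h4 i
  rw [Pi.smul_apply, smul_eq_mul] at h5
  have h6 : (ξ ^ 2) ^ orderOf C = 1 := mul_right_cancel₀ hi (h5.symm.trans (one_mul _).symm)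
  rw [← pow_mul] at h6
  exact Nat.dvd_of_mul_dvd_mul_left two_pos (hξ.dvd_of_pow_eq_one _ h6)

end Order

/-! ### The vectors `z_k` -/

section Lattice

variable {ι : Type*} [Fintype ι] [DecidableEq ι]

/-- The differences `𝒞^{(k)} α_o - 𝒞^{(k-1)} α_o`, starting from `α_o`. -/
noncomputable def altDiff (A : Matrix ι ι ℤ) (o : ι) (P₁ P₂ : Finset ι) : ℕ → ι → ℤ
  | 0 => Pi.single o 1
  | k + 1 => altProd A P₁ P₂ (k + 1) (Pi.single o 1) - altProd A P₁ P₂ k (Pi.single o 1)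

/-- An alternating product of even length is a power of the Coxeter element. -/
lemma altProd_even (A : Matrix ι ι ℤ) (P₁ P₂ : Finset ι) (k : ℕ) :
    altProd A P₁ P₂ (2 * k) = (reflProd A P₂ * reflProd A P₁) ^ k := by
  induction k with
  | zero => rfl
  | succ k ih =>
    rw [pow_succ', ← ih, mul_assoc]
    change reflProd A (if Odd (2 * k + 2) then P₁ else P₂) *
      (reflProd A (if Odd (2 * k + 1) then P₁ else P₂) * altProd A P₁ P₂ (2 * k)) = _
    rw [if_neg (by rw [Nat.not_odd_iff_even]; exact ⟨k + 1, by ring⟩), if_pos ⟨k, rfl⟩]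

/-- Pairing with a simple root is a scaled coordinate of `A u`. -/
lemma invForm_single (A : Matrix ι ι ℤ) {ε : ι → ℚ} (hε : IsSymmetrizer A ε) (u : ι → ℤ)
    (o : ι) : invForm A ε u (Pi.single o 1) = ε o * (A.mulVec u o : ℤ) := by
  rw [invForm, Matrix.mulVec, dotProduct, Int.cast_sum, Finset.mul_sum]
  refine Finset.sum_congr rfl fun i _ => ?_
  rw [Finset.sum_eq_single o (fun j _ hj => by simp [hj]) (by simp), Pi.single_eq_same,
    Int.cast_one, mul_one, hε.2 i o, Int.cast_mul, mul_assoc]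

variable {A : Matrix ι ι ℤ} {B : Matrix ι ι ℕ} {o : ι} {P₁ P₂ : Finset ι}
  (hA : ∀ i j, A i j = (if i = j then 2 else 0) - (B j i : ℤ)) (hB : ∀ i, B i i = 0)
  (hP : IsBipartition A o P₁ P₂)

include hA in
lemma mulVec_eq (v : ι → ℤ) (k : ι) : A.mulVec v k = 2 * v k - ∑ j, (B j k : ℤ) * v j := by
  simp only [Matrix.mulVec, dotProduct, hA, sub_mul, ite_mul, zero_mul, Finset.sum_sub_distrib,
    Finset.sum_ite_eq, Finset.mem_univ, if_true]

include hA hP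

lemma IsBipartition.altProd_succ_apply (k : ℕ) (i : ι) :
    altProd A P₁ P₂ (k + 1) (Pi.single o 1) i =
      if i ∈ (if Odd (k + 1) then P₁ else P₂) then
        ∑ j, (B j i : ℤ) * altProd A P₁ P₂ k (Pi.single o 1) j -
          altProd A P₁ P₂ k (Pi.single o 1) i
      else altProd A P₁ P₂ k (Pi.single o 1) i := by
  rw [altProd, Module.End.mul_apply, reflProd_apply, mulVec_eq hA]
  · split_ifs <;> ring
  · split_ifs
    exacts [hP.orthogonal₁, hP.orthogonal₂]

/-- The reflections in the roots other than `α_o` fix the coefficient of `α_o`. -/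
lemma IsBipartition.altProd_apply_special (k : ℕ) :
    altProd A P₁ P₂ k (Pi.single o 1) o = 1 := by
  have hs : o ∉ P₁ ∪ P₂ := by rw [hP.cover]; simp
  rw [Finset.mem_union, not_or] at hs
  induction k with
  | zero => simp [altProd]
  | succ k ih =>
    rw [hP.altProd_succ_apply hA, ih, if_neg]
    split_ifs
    exacts [hs.1, hs.2]

lemma IsBipartition.altDiff_special (k : ℕ) :
    altDiff A o P₁ P₂ k o = if k = 0 then 1 else 0 := by
  cases k with
  | zero => simp [altDiff]
  | succ k => simp [altDiff, hP.altProd_apply_special hA]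

/-- Each step changes only the coordinates in the set it reflects. -/
lemma IsBipartition.altDiff_eq_zero {k : ℕ} {i : ι}
    (hi : i ∉ (if Odd (k + 1) then P₁ else P₂)) : altDiff A o P₁ P₂ (k + 1) i = 0 := by
  rw [altDiff, Pi.sub_apply, hP.altProd_succ_apply hA, if_neg hi, sub_self]

omit hP [Fintype ι] in
lemma B_eq_zero {P : Finset ι} (hB : ∀ i, B i i = 0)
    (h : ∀ i ∈ P, ∀ j ∈ P, i ≠ j → A i j = 0) {i j : ι} (hi : i ∈ P) (hj : j ∈ P) :
    B j i = 0 := by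
  by_cases hij : i = j
  · rw [hij, hB]
  · have h1 := h i hi j hj hij
    rw [hA, if_neg hij] at h1
    simpa using h1

omit hA in
lemma IsBipartition.ne_special {i : ι} (hi : i ∈ P₂) : i ≠ o := by
  have : i ∈ Finset.univ.erase o := by rw [← hP.cover]; exact Finset.mem_union_right _ hi
  exact Finset.ne_of_mem_erase this

lemma IsBipartition.B_special {i : ι} (hi : i ∈ P₂) : B o i = 0 ∧ B i o = 0 := by
  have ho := hP.ne_special hi
  obtain ⟨h1, h2⟩ := hP.special i hi
  rw [hA, if_neg ho] at h1
  rw [hA, if_neg ho.symm] at h2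
  exact ⟨by simpa using h1, by simpa using h2⟩

include hB

/-- The vectors `z_k` satisfy the same recursion as the multiplicities, away from `o`. -/
lemma IsBipartition.altDiff_add_two (k : ℕ) {i : ι} (hi : i ≠ o) :
    altDiff A o P₁ P₂ (k + 2) i + altDiff A o P₁ P₂ k i =
      ∑ j, (B j i : ℤ) * altDiff A o P₁ P₂ (k + 1) j := by
  have hmem : i ∈ P₁ ∪ P₂ := by rw [hP.cover]; exact Finset.mem_erase.2 ⟨hi, Finset.mem_univ i⟩
  set v := fun k => altProd A P₁ P₂ k (Pi.single o 1) with hv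
  have hsum : ∑ j, (B j i : ℤ) * altDiff A o P₁ P₂ (k + 1) j =
      ∑ j, (B j i : ℤ) * v (k + 1) j - ∑ j, (B j i : ℤ) * v k j := by
    simp only [altDiff, Pi.sub_apply, mul_sub, Finset.sum_sub_distrib, hv]
  have hadj : ∀ k, i ∈ (if Odd (k + 1) then P₁ else P₂) → ∀ j,
      (B j i : ℤ) * altDiff A o P₁ P₂ (k + 1) j = 0 := by
    intro k hk j
    by_cases hj : j ∈ (if Odd (k + 1) then P₁ else P₂)
    · have : B j i = 0 := by
        split_ifs at hk hj
        exacts [B_eq_zero hA hB hP.orthogonal₁ hk hj, B_eq_zero hA hB hP.orthogonal₂ hk hj]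
      rw [this, Nat.cast_zero, zero_mul]
    · rw [hP.altDiff_eq_zero hA hj, mul_zero]
  -- For `i` in the set of the step `k + 1` both sides vanish: this step changes no neighbour of
  -- `i`, and the steps `k` and `k + 2` do not change `i`.
  by_cases hk : i ∈ (if Odd (k + 1) then P₁ else P₂)
  · have hz : ∑ j, (B j i : ℤ) * altDiff A o P₁ P₂ (k + 1) j = 0 :=
      Finset.sum_eq_zero fun j _ => hadj k hk j
    have hnot : ∀ m : ℕ, (Odd m ↔ ¬ Odd (k + 1)) → i ∉ (if Odd m then P₁ else P₂) := by
      intro m hm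
      by_cases h1 : Odd (k + 1)
      · rw [if_pos h1] at hk
        rw [if_neg (by tauto)]
        exact Finset.disjoint_left.1 hP.disjoint hk
      · rw [if_neg h1] at hk
        rw [if_pos (by tauto)]
        exact Finset.disjoint_right.1 hP.disjoint hk
    rw [hz, hP.altDiff_eq_zero hA (hnot (k + 1 + 1) Nat.odd_add_one), zero_add]
    cases k with
    | zero => simp [altDiff, hi]
    | succ k =>
      exact hP.altDiff_eq_zero hA (hnot _ (by rw [Nat.odd_add_one (n := k + 1), not_not]))
  · -- Otherwise `i` is reflected at the steps `k` and `k + 2`; subtract the two formulas.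
    have hk2 : i ∈ (if Odd (k + 1 + 1) then P₁ else P₂) := by
      by_cases h1 : Odd (k + 1)
      · rw [if_pos h1] at hk
        rw [if_neg (by rwa [Nat.odd_add_one, not_not])]
        exact (Finset.mem_union.1 hmem).resolve_left hk
      · rw [if_neg h1] at hk
        rw [if_pos (by rwa [Nat.odd_add_one])]
        exact (Finset.mem_union.1 hmem).resolve_right hk
    have e2 : v (k + 2) i = ∑ j, (B j i : ℤ) * v (k + 1) j - v (k + 1) i := by
      simp only [hv]
      rw [hP.altProd_succ_apply hA (k + 1), if_pos hk2]
    have e1 : v (k + 1) i = v k i := by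
      simp only [hv]
      rw [hP.altProd_succ_apply hA k, if_neg hk]
    rw [hsum]
    change v (k + 2) i - v (k + 1) i + _ = _
    cases k with
    | zero =>
      have h0 : i ∈ P₂ := by simpa [show ¬ Odd 2 by decide] using hk2
      have ev : v 0 i = 0 := by simp [hv, altProd, hi]
      have es : ∑ j, (B j i : ℤ) * v 0 j = 0 := by
        refine Finset.sum_eq_zero fun j _ => ?_
        by_cases hj : j = o
        · rw [hj, (hP.B_special hA h0).1, Nat.cast_zero, zero_mul]
        · simp [hv, altProd, hj]
      have : altDiff A o P₁ P₂ 0 i = v 0 i := rfl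
      rw [this, es, e2, e1, ev]
      ring
    | succ k =>
      have hk0 : i ∈ (if Odd (k + 1) then P₁ else P₂) := by
        rwa [show (if Odd (k + 1) then P₁ else P₂) = if Odd (k + 1 + 1 + 1) then P₁ else P₂ from
          if_congr ⟨fun ⟨m, hm⟩ => ⟨m + 1, by omega⟩, fun ⟨m, hm⟩ => ⟨m - 1, by omega⟩⟩ rfl rfl]
      have e0 : v (k + 1) i = ∑ j, (B j i : ℤ) * v k j - v k i := by
        simp only [hv]
        rw [hP.altProd_succ_apply hA k, if_pos hk0]
      -- the step from `v k` to `v (k + 1)` changes only coordinates not adjacent to `i`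
      have es : ∑ j, (B j i : ℤ) * v (k + 1) j = ∑ j, (B j i : ℤ) * v k j := by
        rw [← sub_eq_zero, ← Finset.sum_sub_distrib]
        refine Finset.sum_eq_zero fun j _ => ?_
        rw [← mul_sub]
        exact hadj k hk0 j
      change v (k + 3) i - v (k + 2) i + (v (k + 1) i - v k i) = _
      linarith

omit hB in
/-- The initial case of the recursion. -/
lemma IsBipartition.altDiff_one {i : ι} (hi : i ≠ o) :
    altDiff A o P₁ P₂ 1 i = ∑ j, (B j i : ℤ) * altDiff A o P₁ P₂ 0 j := by
  have hmem : i ∈ P₁ ∪ P₂ := by rw [hP.cover]; exact Finset.mem_erase.2 ⟨hi, Finset.mem_univ i⟩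
  have h0 : altProd A P₁ P₂ 0 (Pi.single o 1) i = 0 := by simp [altProd, hi]
  change altProd A P₁ P₂ (0 + 1) (Pi.single o 1) i - altProd A P₁ P₂ 0 (Pi.single o 1) i = _
  rw [h0, sub_zero, hP.altProd_succ_apply hA, h0, sub_zero]
  by_cases h : i ∈ P₁
  · rw [if_pos (by simpa using h)]
    rfl
  · rw [if_neg (by simpa using h)]
    symm
    refine Finset.sum_eq_zero fun j _ => ?_
    by_cases hj : j = o
    · rw [hj, (hP.B_special hA ((Finset.mem_union.1 hmem).resolve_left h)).1, Nat.cast_zero,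
        zero_mul]
    · simp [altDiff, hj]

omit hB in
/-- The coordinate of `2 (𝒞^i α_o, α_o) / (α_o, α_o)` in terms of the `z_k`. -/
lemma IsBipartition.mulVec_altProd (k : ℕ) :
    A.mulVec (altProd A P₁ P₂ (2 * (k + 1)) (Pi.single o 1)) o =
      A.mulVec (altProd A P₁ P₂ (2 * k) (Pi.single o 1)) o -
        ∑ j, (B j o : ℤ) * altDiff A o P₁ P₂ (2 * k + 1) j := by
  have h2 : ∑ j, (B j o : ℤ) * altDiff A o P₁ P₂ (2 * k + 2) j = 0 := by
    refine Finset.sum_eq_zero fun j _ => ?_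
    by_cases hj : j ∈ P₂
    · rw [(hP.B_special hA hj).2, Nat.cast_zero, zero_mul]
    · rw [hP.altDiff_eq_zero hA, mul_zero]
      rwa [if_neg]
      rw [Nat.not_odd_iff_even]
      exact ⟨k + 1, by ring⟩
  rw [mulVec_eq hA, mulVec_eq hA, hP.altProd_apply_special hA, hP.altProd_apply_special hA]
  have h3 : ∑ j, (B j o : ℤ) * altProd A P₁ P₂ (2 * (k + 1)) (Pi.single o 1) j =
      ∑ j, (B j o : ℤ) * altDiff A o P₁ P₂ (2 * k + 2) j +
      ∑ j, (B j o : ℤ) * altDiff A o P₁ P₂ (2 * k + 1) j +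
      ∑ j, (B j o : ℤ) * altProd A P₁ P₂ (2 * k) (Pi.single o 1) j := by
    rw [← Finset.sum_add_distrib, ← Finset.sum_add_distrib]
    refine Finset.sum_congr rfl fun j _ => ?_
    simp only [altDiff, Pi.sub_apply]
    rw [show 2 * (k + 1) = 2 * k + 1 + 1 by ring]
    ring
  rw [h3, h2]
  ring

lemma IsBipartition.mulVec_altProd_zero :
    A.mulVec (altProd A P₁ P₂ (2 * 0) (Pi.single o 1)) o = 2 := by
  rw [mulVec_eq hA, hP.altProd_apply_special hA, Finset.sum_eq_zero]
  · norm_num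
  intro j _
  by_cases hj : j = o
  · rw [hj, hB, Nat.cast_zero, zero_mul]
  · simp [altProd, hj]

end Lattice

/-! ### The generating function of the multiplicities -/

section Series

variable {ι : Type*} [Fintype ι] [DecidableEq ι]

omit [DecidableEq ι] in
/-- The homogeneous recursion determines the series from their (zero) initial terms. -/
lemma eq_zero_of_recursion {B : Matrix ι ι ℕ} {W : ι → PowerSeries ℤ}
    (hW : ∀ i, (1 + PowerSeries.X ^ 2) * W i =
      PowerSeries.X * ∑ j, PowerSeries.C (B j i : ℤ) * W j) (i : ι) : W i = 0 := by
  have key : ∀ k i, PowerSeries.coeff k (W i) = 0 := by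
    intro k
    induction k using Nat.strong_induction_on with
    | _ k ih =>
      intro i
      have h1 : W i = PowerSeries.X * ((∑ j, PowerSeries.C (B j i : ℤ) * W j) -
          PowerSeries.X * W i) := by linear_combination hW i
      rw [h1]
      cases k with
      | zero => exact PowerSeries.coeff_zero_X_mul _
      | succ k =>
        rw [PowerSeries.coeff_succ_X_mul, map_sub, map_sum, Finset.sum_eq_zero, zero_sub,
          neg_eq_zero]
        · cases k with
          | zero => exact PowerSeries.coeff_zero_X_mul _
          | succ k => rw [PowerSeries.coeff_succ_X_mul, ih k (by omega)]
        · intro j _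
          rw [PowerSeries.coeff_C_mul, ih k (by omega), mul_zero]
  ext k
  rw [key, map_zero]

omit [DecidableEq ι] in
/-- The recursion of the multiplicities in terms of generating functions. -/
lemma mk_recursion {B : Matrix ι ι ℕ} {u : ℕ → ι → ℤ} {i : ι}
    (h1 : u 1 i = ∑ j, (B j i : ℤ) * u 0 j)
    (h2 : ∀ k, u (k + 2) i + u k i = ∑ j, (B j i : ℤ) * u (k + 1) j) :
    (1 + PowerSeries.X ^ 2) * PowerSeries.mk (fun k => u k i) = PowerSeries.C (u 0 i) +
      PowerSeries.X * ∑ j, PowerSeries.C (B j i : ℤ) * PowerSeries.mk fun k => u k j := by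
  have e : (1 + PowerSeries.X ^ 2) * PowerSeries.mk (fun k => u k i) =
      PowerSeries.mk (fun k => u k i) + PowerSeries.mk (fun k => u k i) * PowerSeries.X ^ 2 := by
    ring
  rw [e]
  ext k
  rw [map_add, map_add, PowerSeries.coeff_mul_X_pow', PowerSeries.coeff_mk, PowerSeries.coeff_C]
  match k with
  | 0 => simp
  | 1 =>
    rw [PowerSeries.coeff_succ_X_mul, map_sum]
    simp [h1]
  | k + 2 =>
    rw [PowerSeries.coeff_succ_X_mul, map_sum]
    simp only [PowerSeries.coeff_C_mul, PowerSeries.coeff_mk]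
    simp [h2 k]

variable {H : Type*} [Group H] [Fintype H] {f : H →* SL2}
  {B : Matrix ι ι ℕ} {o : ι} {x : ℕ → ι → ℕ} {ψ : ι → H → ℂ} {n : ι → ℕ} {c : ℕ}
  (S : IsCharacterSystem f B o x ψ n c) {a b h : ℕ} (hd : HasDegrees f a b h)

include S

lemma IsCharacterSystem.mk_x (i : ι) :
    (1 + PowerSeries.X ^ 2) * PowerSeries.mk (fun k => (x k i : ℤ)) =
      PowerSeries.C (if i = o then 1 else 0 : ℤ) + PowerSeries.X *
        ∑ j, PowerSeries.C (B j i : ℤ) * PowerSeries.mk fun k => (x k j : ℤ) := by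
  have h0 : ∀ i, (x 0 i : ℤ) = if i = o then 1 else 0 := fun i => by
    have := S.x_zero i
    exact_mod_cast this
  rw [← h0]
  refine mk_recursion (u := fun k i => (x k i : ℤ)) ?_ fun k => ?_
  · simp only [h0, S.x_one]
    simp
  · exact_mod_cast S.x_add_two k i

include hd

omit [DecidableEq ι] in
/-- The multiplicities of the special index have the Molien series of the invariants as generating
function. -/
lemma IsCharacterSystem.special_series :
    PowerSeries.mk (fun k => (x k o : ℤ)) * ((1 - PowerSeries.X ^ a) * (1 - PowerSeries.X ^ b)) =
      1 + PowerSeries.X ^ h := by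
  obtain ⟨q, hq, hs⟩ := hd.quot
  apply PowerSeries.map_injective (Int.castRingHom ℂ) Int.cast_injective
  have hcard : PowerSeries.C (Nat.card H : ℂ) ≠ 0 := by
    rw [Ne, map_eq_zero_iff _ PowerSeries.C_injective]
    exact Nat.cast_ne_zero.2 Nat.card_pos.ne'
  apply mul_left_cancel₀ hcard
  have h1 : PowerSeries.C (Nat.card H : ℂ) *
      PowerSeries.map (Int.castRingHom ℂ) (PowerSeries.mk (fun k => (x k o : ℤ))) =
      ∑ g, molien (tr (f g)) := by
    ext k
    rw [PowerSeries.coeff_C_mul, PowerSeries.coeff_map, PowerSeries.coeff_mk, map_sum,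
      S.sum_molien_eq]
    simp
  have h2 := congrArg (Polynomial.coeToPowerSeries.ringHom (R := ℂ)) hs
  rw [map_sum] at h2
  simp only [Polynomial.coeToPowerSeries.ringHom_apply, Polynomial.coe_mul, Polynomial.coe_add,
    Polynomial.coe_one, Polynomial.coe_pow, Polynomial.coe_X, Polynomial.coe_C] at h2
  rw [map_mul, ← mul_assoc, h1, Finset.sum_mul]
  simp only [map_add, map_mul, map_sub, map_one, map_pow, PowerSeries.map_X]
  rw [← h2]
  exact Finset.sum_congr rfl fun g _ => by rw [coe_quot (hq g), mul_comm]

/-- The series `X (1 - t^a) (1 - t^b)` is a polynomial of degree `h` with leading coefficient `α_o`: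
its value on the group consists of the monic polynomials `q g` of degree `h`. -/
lemma IsCharacterSystem.coeff_series (k : ℕ) (hk : h ≤ k) (i : ι) :
    PowerSeries.coeff k (PowerSeries.mk (fun k => (x k i : ℤ)) *
      ((1 - PowerSeries.X ^ a) * (1 - PowerSeries.X ^ b))) = if k = h ∧ i = o then 1 else 0 := by
  obtain ⟨q, hq, -⟩ := hd.quot
  have hqm : ∀ g, (q g).Monic ∧ (q g).natDegree = h := by
    intro g
    have hDm : (1 - Polynomial.C (tr (f g)) * Polynomial.X + Polynomial.X ^ 2 :
        Polynomial ℂ).Monic ∧ (1 - Polynomial.C (tr (f g)) * Polynomial.X + Polynomial.X ^ 2 :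
        Polynomial ℂ).natDegree = 2 := by
      constructor
      · monicity!
      · compute_degree!
    have hR : ((1 - Polynomial.X ^ a) * (1 - Polynomial.X ^ b) : Polynomial ℂ).Monic ∧
        ((1 - Polynomial.X ^ a) * (1 - Polynomial.X ^ b) : Polynomial ℂ).natDegree = a + b := by
      have e : ((1 - Polynomial.X ^ a) * (1 - Polynomial.X ^ b) : Polynomial ℂ) =
          (Polynomial.X ^ a - Polynomial.C 1) * (Polynomial.X ^ b - Polynomial.C 1) := by
        rw [Polynomial.C_1]
        ring
      have ma := Polynomial.monic_X_pow_sub_C (1 : ℂ) hd.a_pos.ne'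
      have mb := Polynomial.monic_X_pow_sub_C (1 : ℂ) hd.b_pos.ne'
      rw [e]
      exact ⟨ma.mul mb, by rw [ma.natDegree_mul mb, Polynomial.natDegree_X_pow_sub_C,
        Polynomial.natDegree_X_pow_sub_C]⟩
    rw [← hq g] at hR
    have hm := Polynomial.Monic.of_mul_monic_right hDm.1 hR.1
    refine ⟨hm, ?_⟩
    have h1 := hR.2
    rw [hm.natDegree_mul hDm.1, hDm.2, hd.add] at h1
    omega
  -- The `k`-th coefficient of `c * q g`, expanded in the `ψ i`.
  have hsum : ∀ g, (c : ℂ) * (q g).coeff k = ∑ i, ((PowerSeries.coeff k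
      (PowerSeries.mk (fun k => (x k i : ℤ)) *
      ((1 - PowerSeries.X ^ a) * (1 - PowerSeries.X ^ b))) : ℤ) : ℂ) * ψ i g := by
    intro g
    have h1 : PowerSeries.C (c : ℂ) * molien (tr (f g)) = ∑ i, PowerSeries.C (ψ i g) *
        PowerSeries.map (Int.castRingHom ℂ) (PowerSeries.mk (fun k => (x k i : ℤ))) := by
      ext k
      rw [PowerSeries.coeff_C_mul, S.sym, map_sum]
      refine Finset.sum_congr rfl fun i _ => ?_
      rw [PowerSeries.coeff_C_mul, PowerSeries.coeff_map, PowerSeries.coeff_mk, mul_comm]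
      simp
    have h2 : PowerSeries.C (c : ℂ) * (q g : PowerSeries ℂ) = ∑ i, PowerSeries.C (ψ i g) *
        PowerSeries.map (Int.castRingHom ℂ) (PowerSeries.mk (fun k => (x k i : ℤ)) *
          ((1 - PowerSeries.X ^ a) * (1 - PowerSeries.X ^ b))) := by
      rw [coe_quot (hq g), mul_left_comm, h1, Finset.mul_sum]
      refine Finset.sum_congr rfl fun i _ => ?_
      simp only [map_mul, map_sub, map_one, map_pow, PowerSeries.map_X]
      ring
    have h3 := congrArg (PowerSeries.coeff k) h2
    rw [PowerSeries.coeff_C_mul, Polynomial.coeff_coe, map_sum] at h3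
    rw [h3]
    refine Finset.sum_congr rfl fun i _ => ?_
    rw [PowerSeries.coeff_C_mul, PowerSeries.coeff_map, mul_comm]
    rfl
  rcases hk.eq_or_lt with rfl | hlt
  · have := S.coeff_ext (u := fun i => ((PowerSeries.coeff h
      (PowerSeries.mk (fun k => (x k i : ℤ)) *
      ((1 - PowerSeries.X ^ a) * (1 - PowerSeries.X ^ b))) : ℤ) : ℂ))
      (w := fun i => if i = o then 1 else 0) fun g => by
        rw [← hsum, ← (hqm g).2, (hqm g).1.coeff_natDegree]
        simp [S.const]
    have := congrFun this i
    simp only [true_and]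
    exact_mod_cast this
  · have := S.coeff_eq_zero (u := fun i => ((PowerSeries.coeff k
      (PowerSeries.mk (fun k => (x k i : ℤ)) *
      ((1 - PowerSeries.X ^ a) * (1 - PowerSeries.X ^ b))) : ℤ) : ℂ)) fun g => by
        rw [← hsum, Polynomial.coeff_eq_zero_of_natDegree_lt (by rw [(hqm g).2]; exact hlt),
          mul_zero]
    have := congrFun this i
    rw [if_neg (by omega)]
    exact Int.cast_injective (α := ℂ) (this.trans Int.cast_zero.symm)

omit S hd

/-- The series `p` with `Z = p X`, where `Z` has the coefficients `altDiff`. -/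
noncomputable def altSeries (A : Matrix ι ι ℤ) (B : Matrix ι ι ℕ) (o : ι) (P₁ P₂ : Finset ι) :
    PowerSeries ℤ :=
  1 + PowerSeries.X ^ 2 - PowerSeries.X *
    ∑ j, PowerSeries.C (B j o : ℤ) * PowerSeries.mk fun k => altDiff A o P₁ P₂ k j

variable {A : Matrix ι ι ℤ} {P₁ P₂ : Finset ι}
  (hA : ∀ i j, A i j = (if i = j then 2 else 0) - (B j i : ℤ)) (hB : ∀ i, B i i = 0)
  (hP : IsBipartition A o P₁ P₂)
include hA hP

lemma IsBipartition.mk_altDiff_special :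
    PowerSeries.mk (fun k => altDiff A o P₁ P₂ k o) = 1 := by
  ext k
  rw [PowerSeries.coeff_mk, PowerSeries.coeff_one, hP.altDiff_special hA]

include S hB

/-- Both sides satisfy the recursion off `o`, and the definition of `altSeries` is the recursion at
`o`. -/
lemma IsCharacterSystem.mk_altDiff (i : ι) :
    PowerSeries.mk (fun k => altDiff A o P₁ P₂ k i) =
      altSeries A B o P₁ P₂ * PowerSeries.mk fun k => (x k i : ℤ) := by
  rw [← sub_eq_zero]
  refine eq_zero_of_recursion (B := B)
    (W := fun i => PowerSeries.mk (fun k => altDiff A o P₁ P₂ k i)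
    - altSeries A B o P₁ P₂ * PowerSeries.mk fun k => (x k i : ℤ)) (fun i => ?_) i
  have hx := S.mk_x i
  have hz : (1 + PowerSeries.X ^ 2) * PowerSeries.mk (fun k => altDiff A o P₁ P₂ k i) =
      PowerSeries.C (if i = o then 1 else 0 : ℤ) * altSeries A B o P₁ P₂ + PowerSeries.X *
        ∑ j, PowerSeries.C (B j i : ℤ) * PowerSeries.mk fun k => altDiff A o P₁ P₂ k j := by
    by_cases hi : i = o
    · subst hi
      rw [hP.mk_altDiff_special hA, if_pos rfl, map_one, altSeries]
      ring
    · rw [mk_recursion (hP.altDiff_one hA hi) fun k => hP.altDiff_add_two hA hB k hi, if_neg hi,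
        map_zero, zero_mul]
      simp [altDiff, hi]
  have hs : ∑ j, PowerSeries.C (B j i : ℤ) * (PowerSeries.mk (fun k => altDiff A o P₁ P₂ k j) -
      altSeries A B o P₁ P₂ * PowerSeries.mk fun k => (x k j : ℤ)) =
      ∑ j, PowerSeries.C (B j i : ℤ) * PowerSeries.mk (fun k => altDiff A o P₁ P₂ k j) -
      altSeries A B o P₁ P₂ *
        ∑ j, PowerSeries.C (B j i : ℤ) * PowerSeries.mk fun k => (x k j : ℤ) := by
    rw [Finset.mul_sum, ← Finset.sum_sub_distrib]
    exact Finset.sum_congr rfl fun j _ => by ring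
  rw [hs]
  linear_combination hz - altSeries A B o P₁ P₂ * hx

lemma IsCharacterSystem.altSeries_mul :
    altSeries A B o P₁ P₂ * PowerSeries.mk (fun k => (x k o : ℤ)) = 1 := by
  rw [← S.mk_altDiff hA hB hP, hP.mk_altDiff_special hA]

include hd

/-- The generating function of the multiplicities is `z(t) / ((1 - t ^ a) (1 - t ^ b))`. -/
theorem IsCharacterSystem.series_eq (j : ι) :
    PowerSeries.mk (fun k => (x k j : ℤ)) * ((1 - PowerSeries.X ^ a) * (1 - PowerSeries.X ^ b)) =
      ∑ i ∈ Finset.range (h + 1),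
        PowerSeries.C (zVec A o P₁ P₂ h i j) * PowerSeries.X ^ i := by
  ext k
  have hR : PowerSeries.coeff k (∑ i ∈ Finset.range (h + 1),
      PowerSeries.C (zVec A o P₁ P₂ h i j) * PowerSeries.X ^ i) =
      if k < h + 1 then zVec A o P₁ P₂ h k j else 0 := by
    rw [map_sum]
    simp only [PowerSeries.coeff_C_mul, PowerSeries.coeff_X_pow, mul_ite, mul_one, mul_zero,
      Finset.sum_ite_eq, Finset.mem_range]
  rw [hR]
  -- In degrees `≥ h` the left side is known; in lower degrees `X (1 - t^a) (1 - t^b) = Z (1 +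
  -- t^h)`, where `Z` has the coefficients `altDiff`.
  rcases le_or_gt h k with hk | hk
  · rw [S.coeff_series hd k hk j]
    by_cases hkh : k = h
    · subst hkh
      rw [if_pos (Nat.lt_succ_self _), zVec, if_pos (Or.inr rfl), Pi.single_apply]
      simp
    · rw [if_neg (fun h => hkh h.1), if_neg (by omega)]
  · have h1 : PowerSeries.mk (fun k => (x k j : ℤ)) *
        ((1 - PowerSeries.X ^ a) * (1 - PowerSeries.X ^ b)) =
        PowerSeries.mk (fun k => altDiff A o P₁ P₂ k j) * (1 + PowerSeries.X ^ h) := by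
      rw [← S.special_series hd, S.mk_altDiff hA hB hP]
      linear_combination (-PowerSeries.mk (fun k => (x k j : ℤ)) *
        ((1 - PowerSeries.X ^ a) * (1 - PowerSeries.X ^ b))) * S.altSeries_mul hA hB hP
    rw [h1, mul_add, mul_one, map_add, PowerSeries.coeff_mul_X_pow', if_neg (by omega), add_zero,
      PowerSeries.coeff_mk, if_pos (by omega), zVec]
    cases k with
    | zero => simp [altDiff]
    | succ k => rw [if_neg (by omega)]; rfl

/-- Below degree `h`, the series `altSeries` agrees with `(1 - t ^ a) (1 - t ^ b)`. -/
lemma IsCharacterSystem.coeff_altSeries {k : ℕ} (hk : k < h) :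
    PowerSeries.coeff k (altSeries A B o P₁ P₂) =
      PowerSeries.coeff k ((1 - PowerSeries.X ^ a) * (1 - PowerSeries.X ^ b) : PowerSeries ℤ) := by
  have h1 : altSeries A B o P₁ P₂ * (1 + PowerSeries.X ^ h) =
      (1 - PowerSeries.X ^ a) * (1 - PowerSeries.X ^ b) := by
    rw [← S.special_series hd, ← mul_assoc, S.altSeries_mul hA hB hP, one_mul]
  rw [← h1, mul_add, mul_one, map_add, PowerSeries.coeff_mul_X_pow', if_neg (by omega), add_zero]

omit S hd in
/-- The differences of the numbers `c_i` are coefficients of `altSeries`. -/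
lemma IsBipartition.mulVec_altProd_sub {k : ℕ} (hk : 0 < k) :
    A.mulVec (altProd A P₁ P₂ (2 * k) (Pi.single o 1)) o -
      (if k = 1 then 1 else A.mulVec (altProd A P₁ P₂ (2 * (k - 1)) (Pi.single o 1)) o) =
      PowerSeries.coeff (2 * k) (altSeries A B o P₁ P₂) := by
  obtain ⟨k, rfl⟩ := Nat.exists_eq_add_of_lt hk
  rw [zero_add, hP.mulVec_altProd hA, altSeries, map_sub, map_add,
    show 2 * (k + 1) = 2 * k + 1 + 1 by ring, PowerSeries.coeff_succ_X_mul, map_sum,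
    PowerSeries.coeff_one, PowerSeries.coeff_X_pow]
  simp only [PowerSeries.coeff_C_mul, PowerSeries.coeff_mk, Nat.add_sub_cancel]
  by_cases hk0 : k = 0
  · subst hk0
    rw [hP.mulVec_altProd_zero hA hB]
    norm_num
    ring
  · rw [if_neg (show ¬ k + 1 = 1 by omega), if_neg (show ¬ 2 * k + 1 + 1 = 0 by omega),
      if_neg (show ¬ 2 * k + 1 + 1 = 2 by omega)]
    ring

end Series

/-! ### The numbers `c_i` -/

section CoxeterCoefficients

variable {ι : Type*} [Fintype ι] [DecidableEq ι] {H : Type*} [Group H] [Fintype H] {f : H →* SL2}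
  {B : Matrix ι ι ℕ} {o : ι} {x : ℕ → ι → ℕ} {ψ : ι → H → ℂ} {n : ι → ℕ} {c : ℕ}
  {A : Matrix ι ι ℤ} {P₁ P₂ : Finset ι}

/-- The numbers `c_i` in the range where they are defined by the form do not depend on the
symmetrizer. -/
lemma cCoeff_eq (hoo : A o o = 2) {ε : ι → ℚ} (hε : IsSymmetrizer A ε) {g i : ℕ} (hi : 0 < i)
    (hig : i < g) : cCoeff A o P₁ P₂ ε g i =
      (A.mulVec (altProd A P₁ P₂ (2 * i) (Pi.single o 1)) o : ℤ) := by
  have h1 : A.mulVec (Pi.single o 1) o = 2 := by rw [Matrix.mulVec_single_one]; exact hoo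
  have h2 := (hε.1 o).ne'
  rw [cCoeff, if_neg (by omega), if_pos (by omega), Int.toNat_natCast, ← altProd_even,
    invForm_single A hε, invForm_single A hε, h1]
  push_cast
  field_simp

/-- The alternating sum of the numbers `c_i` is the numerator `(1 - t ^ a) (1 - t ^ b)`: below the
middle this is the comparison of series, above it both sides are explicit, and the middle
coefficient is fixed by the value at `t = 1`. -/
theorem IsCharacterSystem.sum_cCoeff (S : IsCharacterSystem f B o x ψ n c) {a b h : ℕ}
    (hd : HasDegrees f a b h) (hA : ∀ i j, A i j = (if i = j then 2 else 0) - (B j i : ℤ))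
    (hB : ∀ i, B i i = 0) (hP : IsBipartition A o P₁ P₂) {g : ℕ} (hg : h = 2 * g) {ε : ι → ℚ}
    (hε : IsSymmetrizer A ε) :
    ∑ i ∈ Finset.range (g + 2), Polynomial.C (cCoeff A o P₁ P₂ ε g (i : ℤ) -
        cCoeff A o P₁ P₂ ε g ((i : ℤ) - 1)) * Polynomial.X ^ (2 * i) =
      (1 - Polynomial.X ^ a) * (1 - Polynomial.X ^ b) := by
  have hoo : A o o = 2 := by rw [hA, hB]; simp
  obtain ⟨a', ha⟩ := hd.even_a
  have hadd := hd.add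
  have hapos := hd.a_pos
  have hbpos := hd.b_pos
  have hhpos := hd.h_pos
  obtain ⟨b', hb⟩ : ∃ b', b = b' + b' := ⟨g + 1 - a', by omega⟩
  -- Both sides are even; `d i` and the coefficients of `Q` are those of `t ^ (2 i)`.
  set d : ℕ → ℚ := fun i => cCoeff A o P₁ P₂ ε g (i : ℤ) - cCoeff A o P₁ P₂ ε g ((i : ℤ) - 1)
    with hdd
  set Q : Polynomial ℤ := (1 - Polynomial.X ^ a') * (1 - Polynomial.X ^ b') with hQ
  have hQ2 : Polynomial.expand ℤ 2 Q = (1 - Polynomial.X ^ a) * (1 - Polynomial.X ^ b) := by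
    rw [hQ, ha, hb]
    simp only [map_mul, map_sub, map_one, map_pow, Polynomial.expand_X]
    ring
  have hd0 : d 0 = 1 := by
    simp only [hdd, cCoeff]
    rw [if_pos (by simp), if_neg (by norm_num), if_neg (by norm_num), if_neg (by omega), sub_zero]
  have hQc : ∀ k, 2 * k < h → (Q.coeff k : ℤ) =
      PowerSeries.coeff (2 * k) (altSeries A B o P₁ P₂) := by
    intro k hk
    rw [S.coeff_altSeries hd hA hB hP hk]
    have e : ((1 - PowerSeries.X ^ a) * (1 - PowerSeries.X ^ b) : PowerSeries ℤ) =
        (Polynomial.expand ℤ 2 Q : Polynomial ℤ) := by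
      rw [hQ2]
      simp
    rw [e, Polynomial.coeff_coe, mul_comm 2 k, Polynomial.coeff_expand_mul two_pos]
  -- Degrees below the middle.
  have hdk : ∀ k, 0 < k → k < g → d k = (Q.coeff k : ℤ) := by
    intro k hk hkg
    rw [hQc k (by omega), ← hP.mulVec_altProd_sub hA hB hk]
    simp only [hdd]
    rw [cCoeff_eq hoo hε hk hkg]
    by_cases hk1 : k = 1
    · subst hk1
      rw [if_pos rfl, cCoeff, if_pos (by simp)]
      push_cast
      ring
    · have : (k : ℤ) - 1 = ((k - 1 : ℕ) : ℤ) := by omega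
      rw [this, cCoeff_eq hoo hε (by omega) (by omega), if_neg hk1]
      push_cast
      ring
  have hdg : d (g + 1) = 1 := by
    simp only [hdd, cCoeff]
    rw [if_neg (by omega), if_neg (by omega), if_neg (by omega), if_neg (by omega),
      if_neg (by omega), if_pos (by push_cast; ring)]
    norm_num
  have hQx : Q = 1 - Polynomial.X ^ a' - Polynomial.X ^ b' + Polynomial.X ^ (g + 1) := by
    rw [hQ, show g + 1 = a' + b' by omega]
    ring
  set L : Polynomial ℚ := ∑ i ∈ Finset.range (g + 2), Polynomial.C (d i) * Polynomial.X ^ i with hL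
  have hLc : ∀ k, L.coeff k = if k < g + 2 then d k else 0 := by
    intro k
    rw [hL, Polynomial.finsetSum_coeff]
    simp only [Polynomial.coeff_C_mul, Polynomial.coeff_X_pow, mul_ite, mul_one, mul_zero,
      Finset.sum_ite_eq, Finset.mem_range]
  -- All coefficients but the middle one agree.
  have hoff : ∀ k, k ≠ g → (L - Q.map (Int.castRingHom ℚ)).coeff k = 0 := by
    intro k hk
    rw [Polynomial.coeff_sub, hLc, Polynomial.coeff_map, eq_intCast, sub_eq_zero]
    rcases Nat.eq_zero_or_pos k with rfl | hk0
    · rw [if_pos (by omega), hd0, hQx]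
      simp [Polynomial.coeff_X_pow, Polynomial.coeff_one, show 0 ≠ a' by omega,
        show 0 ≠ b' by omega]
    rcases lt_trichotomy k (g + 1) with h1 | h1 | h1
    · rw [if_pos (by omega), hdk k hk0 (by omega)]
    · subst h1
      rw [if_pos (by omega), hdg, hQx]
      simp [Polynomial.coeff_X_pow, Polynomial.coeff_one, show g + 1 ≠ a' by omega,
        show g + 1 ≠ b' by omega]
    · rw [if_neg (by omega), hQx]
      simp [Polynomial.coeff_X_pow, Polynomial.coeff_one, show k ≠ a' by omega,
        show k ≠ b' by omega, show k ≠ g + 1 by omega, show k ≠ 0 by omega]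
  have hLQ : L = Q.map (Int.castRingHom ℚ) := by
    have hm : L - Q.map (Int.castRingHom ℚ) =
        Polynomial.monomial g ((L - Q.map (Int.castRingHom ℚ)).coeff g) := by
      ext k
      rw [Polynomial.coeff_monomial]
      split_ifs with hk
      · rw [hk]
      · exact hoff k fun h => hk h.symm
    have he := congrArg (Polynomial.eval 1) hm
    -- The left side telescopes at `t = 1`, and the right side vanishes there.
    have htel : ∑ i ∈ Finset.range (g + 2), d i = 0 := by
      have := Finset.sum_range_sub (fun i : ℕ => cCoeff A o P₁ P₂ ε g ((i : ℤ) - 1)) (g + 2)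
      simp only [Nat.cast_add, Nat.cast_one, add_sub_cancel_right] at this
      simp only [hdd]
      rw [this]
      simp only [cCoeff]
      rw [if_neg (by push_cast; omega), if_neg (by push_cast; omega),
        if_neg (by push_cast; omega), if_neg (by simp), if_neg (by simp), if_neg (by simp)]
      norm_num
    rw [Polynomial.eval_sub, hL, Polynomial.eval_finsetSum, Polynomial.eval_monomial] at he
    simp only [Polynomial.eval_mul, Polynomial.eval_C, Polynomial.eval_pow, Polynomial.eval_X,
      one_pow, mul_one, htel] at he
    have hQ1 : (Q.map (Int.castRingHom ℚ)).eval 1 = 0 := by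
      have ha' : a' ≠ 0 := by omega
      rw [hQ]
      simp
    rw [hQ1, sub_zero] at he
    rw [← sub_eq_zero, hm, ← he, Polynomial.monomial_zero_right]
  have hfin := congrArg (Polynomial.expand ℚ 2) hLQ
  rw [← Polynomial.map_expand, hQ2, hL, map_sum] at hfin
  simp only [map_mul, map_pow, Polynomial.expand_C, Polynomial.expand_X, ← pow_mul] at hfin
  rw [hfin]
  simp

end CoxeterCoefficients

/-! ### Bipartitions and loops -/

section Loops

/-- The matrix `-1` is the only involution in `SL₂(ℂ)`. -/
lemma neg_one_of_sq {M : SL2} (h2 : M ^ 2 = 1) (h1 : M ≠ 1) : M.1 = -1 := by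
  have hdet := det_eq M
  have hsq : M.1 * M.1 = 1 := by
    rw [← Matrix.SpecialLinearGroup.coe_mul, ← pow_two, h2]
    rfl
  have e := fun i j => congrFun (congrFun hsq i) j
  have e00 := e 0 0
  have e01 := e 0 1
  have e10 := e 1 0
  simp only [Matrix.mul_apply, Fin.sum_univ_two, Matrix.one_apply] at e00 e01 e10
  norm_num at e00 e01 e10
  have hs : M.1 0 0 + M.1 1 1 ≠ 0 := by
    intro h0
    have : (2 : ℂ) = 0 := by linear_combination M.1 0 0 * h0 - e00 - hdet
    norm_num at this
  have hb : M.1 0 1 = 0 :=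
    (mul_eq_zero.1 (show (M.1 0 0 + M.1 1 1) * M.1 0 1 = 0 by linear_combination e01)).resolve_left
      hs
  have hc : M.1 1 0 = 0 :=
    (mul_eq_zero.1 (show (M.1 0 0 + M.1 1 1) * M.1 1 0 = 0 by linear_combination e10)).resolve_left
      hs
  rw [hb, zero_mul, add_zero] at e00
  rw [hb, zero_mul, sub_zero] at hdet
  rcases mul_self_eq_one_iff.1 e00 with h | h
  · exfalso
    rw [h, one_mul] at hdet
    apply h1
    ext i j
    fin_cases i <;> fin_cases j <;> simp [h, hb, hc, hdet]
  · have hd : M.1 1 1 = -1 := by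
      rw [h] at hdet
      linear_combination -hdet
    ext i j
    fin_cases i <;> fin_cases j <;> simp [h, hb, hc, hd]

lemma exists_neg_one {H : Type*} [Group H] [Fintype H] {f : H →* SL2}
    (hf : Function.Injective f) (he : Even (Nat.card H)) : ∃ z, (f z).1 = -1 := by
  have : Fact (Nat.Prime 2) := ⟨Nat.prime_two⟩
  obtain ⟨z, hz⟩ := exists_prime_orderOf_dvd_card' (G := H) 2 he.two_dvd
  refine ⟨z, neg_one_of_sq ?_ fun h => ?_⟩
  · rw [← map_pow, orderOf_dvd_iff_pow_eq_one.1 hz.dvd, map_one]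
  · rw [hf (h.trans (map_one f).symm), orderOf_one] at hz
    omega

variable {ι : Type*} [Fintype ι] {H : Type*} [Group H] [Fintype H] {f : H →* SL2}
  {B : Matrix ι ι ℕ} {o : ι} {x : ℕ → ι → ℕ} {ψ : ι → H → ℂ} {n : ι → ℕ} {c : ℕ}

/-- If `-1` lies in the group, its sign on the `ψ i` is a proper 2-coloring of the graph. -/
lemma IsCharacterSystem.exists_sign (S : IsCharacterSystem f B o x ψ n c) {z : H}
    (hz : (f z).1 = -1) : ∃ s : ι → ℤ, (∀ i, s i = 1 ∨ s i = -1) ∧ s o = 1 ∧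
      ∀ i j, s i = s j → B j i = 0 := by
  choose s hs1 hs2 using S.parity z hz
  refine ⟨s, hs1, ?_, fun i j hij => ?_⟩
  · have h1 := hs2 o 1
    rw [S.const, S.const] at h1
    have hc : (c : ℂ) ≠ 0 := Nat.cast_ne_zero.2 S.c_pos.ne'
    have : ((1 : ℤ) : ℂ) = s o := mul_right_cancel₀ hc (by rw [Int.cast_one, one_mul]; exact h1)
    exact (Int.cast_injective this).symm
  · have hneg : ∀ g, tr (f (z * g)) = -tr (f g) := by
      intro g
      rw [map_mul, tr, Matrix.SpecialLinearGroup.coe_mul, hz, neg_one_mul, Matrix.trace_neg]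
      rfl
    have key : (fun i => (B j i : ℂ) * s i) = fun i => -(s j : ℂ) * B j i := by
      apply S.coeff_ext
      intro g
      have h1 := S.mul_tr j (z * g)
      rw [hneg, hs2] at h1
      simp only [hs2] at h1
      have h2 := S.mul_tr j g
      calc ∑ i, (B j i : ℂ) * s i * ψ i g = -tr (f g) * (s j * ψ j g) := by
            rw [h1]; exact Finset.sum_congr rfl fun i _ => by ring
        _ = -(s j : ℂ) * ∑ i, (B j i : ℂ) * ψ i g := by rw [← h2]; ring
        _ = _ := by rw [Finset.mul_sum]; exact Finset.sum_congr rfl fun i _ => by ring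
    have h3 := congrFun key i
    change (B j i : ℂ) * s i = -(s j : ℂ) * B j i at h3
    rw [hij] at h3
    have h4 : (s j : ℂ) ≠ 0 := by
      rcases hs1 j with h | h <;> rw [h] <;> norm_num
    have h5 : (s j : ℂ) * (2 * B j i) = 0 := by linear_combination h3
    have h6 := (mul_eq_zero.1 h5).resolve_left h4
    exact_mod_cast (mul_eq_zero.1 h6).resolve_left two_ne_zero

lemma IsCharacterSystem.loop_eq_zero (S : IsCharacterSystem f B o x ψ n c) {z : H}
    (hz : (f z).1 = -1) (i : ι) : B i i = 0 := by
  obtain ⟨s, -, -, hs⟩ := S.exists_sign hz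
  exact hs i i rfl

lemma IsCharacterSystem.exists_isBipartition [DecidableEq ι]
    (S : IsCharacterSystem f B o x ψ n c) {z : H}
    (hz : (f z).1 = -1) {A : Matrix ι ι ℤ}
    (hA : ∀ i j, A i j = (if i = j then 2 else 0) - (B j i : ℤ)) :
    ∃ P₁ P₂, IsBipartition A o P₁ P₂ := by
  obtain ⟨s, hs1, hso, hs⟩ := S.exists_sign hz
  have hA0 : ∀ i j, i ≠ j → s i = s j → A i j = 0 := by
    intro i j hij h
    rw [hA, if_neg hij, hs i j h]
    simp
  -- The indices on which `-1` acts with sign `-1` or `1`; the trivial index has sign `1`.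
  refine ⟨Finset.univ.filter fun i => s i = -1, Finset.univ.filter fun i => i ≠ o ∧ s i = 1,
    ?_, ?_, ?_, ?_, ?_⟩
  · rw [Finset.disjoint_filter]
    intro i _ h1 h2
    rw [h1] at h2
    exact absurd h2.2 (by norm_num)
  · ext i
    simp only [Finset.mem_union, Finset.mem_filter, Finset.mem_univ, true_and, Finset.mem_erase,
      and_true]
    constructor
    · rintro (h | h)
      · rintro rfl
        rw [hso] at h
        exact absurd h (by norm_num)
      · exact h.1
    · intro h
      rcases hs1 i with h1 | h1
      · exact Or.inr ⟨h, h1⟩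
      · exact Or.inl h1
  · intro i hi j hj hij
    rw [Finset.mem_filter] at hi hj
    exact hA0 i j hij (hi.2.trans hj.2.symm)
  · intro i hi j hj hij
    rw [Finset.mem_filter] at hi hj
    exact hA0 i j hij (hi.2.2.trans hj.2.2.symm)
  · intro i hi
    rw [Finset.mem_filter] at hi
    exact ⟨hA0 i o hi.2.1 (hi.2.2.trans hso.symm), hA0 o i hi.2.1.symm (hso.trans hi.2.2.symm)⟩

/-- The norms `n i` symmetrize the Cartan matrix. -/
lemma IsCharacterSystem.isSymmetrizer [DecidableEq ι]
    (S : IsCharacterSystem f B o x ψ n c) {A : Matrix ι ι ℤ}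
    (hA : ∀ i j, A i j = (if i = j then 2 else 0) - (B j i : ℤ)) :
    IsSymmetrizer A fun i => (n i : ℚ) := by
  refine ⟨fun i => Nat.cast_pos.2 (S.n_pos i), fun i j => ?_⟩
  have h := S.symm i j
  have h' : (n i : ℚ) * B j i = n j * B i j := by exact_mod_cast h
  rw [hA, hA]
  by_cases hij : i = j
  · rw [hij]
  · rw [if_neg hij, if_neg (Ne.symm hij)]
    push_cast
    linear_combination -h'

/-- If all the `ψ i` have constant absolute value, there are no loops: the trace of the
corresponding matrix has mean zero. -/
lemma IsCharacterSystem.loop_eq_zero_of_norm (S : IsCharacterSystem f B o x ψ n c)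
    {i : ι} {r : ℂ} (hr : ∀ g, ψ i g * ψ i g⁻¹ = r) (hx : B o o = 0) : B i i = 0 := by
  have h1 := S.sum_mul_inv (fun k => (B i k : ℂ)) i
  simp only [← S.mul_tr] at h1
  have h2 : ∀ g, tr (f g) * ψ i g * ψ i g⁻¹ = r * PowerSeries.coeff 1 (molien (tr (f g))) := by
    intro g
    rw [mul_assoc, hr, coeff_one_molien, mul_comm]
  simp only [h2] at h1
  rw [← Finset.mul_sum, S.sum_molien_eq, S.x_one, hx, Nat.cast_zero, mul_zero, mul_zero] at h1
  exact_mod_cast (mul_eq_zero.1 h1.symm).resolve_left (S.card_mul_ne_zero i)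

end Loops

end McKaySlodowy

namespace McKaySlodowy

open Polynomial

/-! ### The five classes of finite subgroups -/

section Classification

variable {H : Type*} [Group H] [Fintype H] {f : H →* SL2} (hf : Function.Injective f)

include hf in
lemma mul_comm_of_mem_lineStab {p : Projectivization ℂ (Fin 2 → ℂ)} {g k : H}
    (hg : g ∈ lineStab f p) (hk : k ∈ lineStab f p) : g * k = k * g := by
  apply lineChar_injOn hf p (mul_mem hg hk) (mul_mem hk hg)
  simp only [map_mul]
  rw [lineChar_mul hk hg, lineChar_mul hg hk, mul_comm]

include hf in
/-- The centralizer of a non-scalar element is commutative. -/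
lemma mul_comm_of_mem_centralizer {g x y : H} (hg : tr (f g) ^ 2 ≠ 4) (hx : g * x = x * g)
    (hy : g * y = y * g) : x * y = y * x := by
  obtain ⟨S, hS, hmem⟩ := card_fixed_lines hg
  obtain ⟨p, hp⟩ := Finset.card_pos.1 (show 0 < S.card by omega)
  have hp' : g ∈ lineStab f p := (hmem p).1 hp
  have hC := centralizer_eq_lineStab hf hp' hg
  refine mul_comm_of_mem_lineStab hf (p := p) ?_ ?_
  · rw [← hC, Subgroup.mem_centralizer_singleton_iff]; exact hx.symm
  · rw [← hC, Subgroup.mem_centralizer_singleton_iff]; exact hy.symm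

/-- `H` is a finite subgroup of `SL₂(ℂ)` with degrees `a`, `b`, `h`, in one of the five classes:
commutative, binary dihedral, tetrahedral, octahedral, icosahedral. -/
def HasType (f : H →* SL2) (a b h : ℕ) : Prop :=
  HasDegrees f a b h ∧
  ((a = 2 ∧ ∀ x y : H, x * y = y * x) ∨
  (∃ m, 2 ≤ m ∧ Nat.card H = 4 * m ∧ a = 4 ∧ b = 2 * m ∧ h = 2 * m + 2 ∧
    (∃ K : Subgroup H, K.index = 2 ∧ ∀ x ∈ K, ∀ y ∈ K, x * y = y * x) ∧
    ∑ g : H, Nat.card (Subgroup.centralizer ({g} : Set H)) = Nat.card H * (m + 3)) ∨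
  (Nat.card H = 24 ∧ a = 6 ∧ b = 8 ∧ h = 12 ∧
    ∑ g : H, Nat.card (Subgroup.centralizer ({g} : Set H)) = Nat.card H * 7) ∨
  (Nat.card H = 48 ∧ a = 8 ∧ b = 12 ∧ h = 18 ∧
    ∑ g : H, Nat.card (Subgroup.centralizer ({g} : Set H)) = Nat.card H * 8) ∨
  (Nat.card H = 120 ∧ a = 12 ∧ b = 20 ∧ h = 30 ∧
    ∑ g : H, Nat.card (Subgroup.centralizer ({g} : Set H)) = Nat.card H * 9))

open scoped Classical in
/-- A non-scalar element with centralizer of order `2 m₃`: one that fixes a point of the third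
orbit. -/
lemma HasClassType.exists_card_centralizer {n m₁ m₂ m₃ : ℕ} (hT : HasClassType f n m₁ m₂ m₃) :
    ∃ g : H, tr (f g) ^ 2 ≠ 4 ∧ Nat.card (Subgroup.centralizer ({g} : Set H)) = 2 * m₃ := by
  obtain ⟨k₁, k₂, k₃, h₁, h₂, h₃, hsum⟩ := hT.sum
  have h2 := hT.two_le
  -- Count the non-scalar elements with centralizer of order `2 m₃`: the third orbit contributes `k₃
  -- (2 m₃ - 2) > 0` of them.
  have h := hsum (fun _ c => if c = 2 * m₃ then 1 else 0)
  by_contra! hne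
  rw [Finset.sum_eq_zero (fun g hg => if_neg (hne g (Finset.mem_filter.1 hg).2))] at h
  simp only [if_true, Finset.sum_const, smul_eq_mul, mul_one] at h
  rw [card_roots_sq_ne_one (show 0 < m₃ by omega)] at h
  have hn : 0 < n := hT.n_pos
  have hk : 0 < k₃ := Nat.pos_of_ne_zero fun h0 => by rw [h0, zero_mul] at h₃; omega
  have : 0 < k₃ * (2 * m₃ - 2) := Nat.mul_pos hk (by omega)
  omega

include hf in
/-- A finite subgroup of `SL₂(ℂ)` either fixes a line, and is then commutative, or has the orbit
data of one of the four non-commutative classes. In the dihedral class the commutative subgroup of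
index two is the centralizer of an element of order larger than two fixing a point of the third
orbit. -/
theorem exists_hasType : ∃ a b h, HasType f a b h := by
  rcases fixed_line_or_hasClassType hf with ⟨p, hp⟩ | ⟨n, m₁, m₂, m₃, hT⟩
  · refine ⟨_, _, _, hasDegrees_of_fixed_line hf hp, Or.inl ⟨rfl, fun x y => ?_⟩⟩
    apply mul_comm_of_mem_lineStab hf (p := p) <;> rw [hp] <;> trivial
  · obtain ⟨a, b, h, hd⟩ := hT.poly.exists_degrees
    refine ⟨a, b, h, hT.hasDegrees hf hd, Or.inr ?_⟩
    have hs := hT.sum_card_centralizer hf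
    have hc := hT.card
    rcases hd with ⟨rfl, rfl, hm, rfl, rfl, rfl, rfl⟩ | ⟨rfl, rfl, rfl, rfl, rfl, rfl, rfl⟩ |
      ⟨rfl, rfl, rfl, rfl, rfl, rfl, rfl⟩ | ⟨rfl, rfl, rfl, rfl, rfl, rfl, rfl⟩
    · refine Or.inl ⟨m₃, hm, by omega, rfl, rfl, rfl, ?_, by rw [hs]; congr 1; omega⟩
      obtain ⟨g, hg, hgc⟩ := hT.exists_card_centralizer
      refine ⟨Subgroup.centralizer {g}, ?_, fun x hx y hy => ?_⟩
      · have := (Subgroup.centralizer ({g} : Set H)).card_mul_index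
        rw [hgc, hc] at this
        exact Nat.eq_of_mul_eq_mul_left (show 0 < 2 * m₃ by omega) (by rw [this]; ring)
      · rw [Subgroup.mem_centralizer_singleton_iff] at hx hy
        exact mul_comm_of_mem_centralizer hf hg hx.symm hy.symm
    · exact Or.inr (Or.inl ⟨by omega, rfl, rfl, rfl, hs⟩)
    · exact Or.inr (Or.inr (Or.inl ⟨by omega, rfl, rfl, rfl, hs⟩))
    · exact Or.inr (Or.inr (Or.inr ⟨by omega, rfl, rfl, rfl, hs⟩))

end Classification

/-! ### Centralizers in a group with a commutative subgroup of index two -/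

section DihedralCentralizers

variable {G : Type*} [Group G] [Fintype G] {f : G →* SL2} (hf : Function.Injective f)
  {K : Subgroup G} (hK : K.index = 2) (hKc : ∀ x ∈ K, ∀ y ∈ K, x * y = y * x)
  (hG : ∃ x y : G, x * y ≠ y * x) {z : G} (hz : (f z).1 = -1)
include hf

include hz in
/-- An element of finite order with trace `±2` is `1` or `-1`. -/
lemma eq_one_or_eq_of_tr_sq {g : G} (hg : tr (f g) ^ 2 = 4) : g = 1 ∨ g = z := by
  have h := eq_smul_one_of_tr_sq (isOfFinOrder_map f g) hg
  have h2 : (tr (f g) - 2) * (tr (f g) + 2) = 0 := by linear_combination hg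
  rcases mul_eq_zero.1 h2 with h3 | h3
  · left
    apply hf
    rw [map_one]
    exact eq_one_of_tr_eq_two (isOfFinOrder_map f g) (sub_eq_zero.1 h3)
  · right
    apply hf
    apply Subtype.ext
    rw [h, hz, eq_neg_of_add_eq_zero_left h3]
    norm_num

omit [Fintype G] in
include hz in
/-- The element `-1` is a central involution. -/
lemma ne_one_of_eq_neg_one : z ≠ 1 ∧ z * z = 1 ∧ ∀ g, g * z = z * g := by
  refine ⟨?_, ?_, fun g => ?_⟩
  · rintro rfl
    rw [map_one] at hz
    have := congrFun (congrFun hz 0) 0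
    simp at this
    norm_num at this
  · apply hf
    apply Subtype.ext
    rw [map_mul, Matrix.SpecialLinearGroup.coe_mul, hz, map_one]
    simp
  · apply hf
    apply Subtype.ext
    rw [map_mul, map_mul, Matrix.SpecialLinearGroup.coe_mul, Matrix.SpecialLinearGroup.coe_mul, hz,
      mul_neg_one, neg_one_mul]

include hK hKc hG in
/-- In a non-commutative group with a commutative subgroup `K` of index two, the centralizer of a
non-scalar element of `K` is `K`. -/
lemma centralizer_eq_of_mem {g : G} (hgK : g ∈ K) (hg : tr (f g) ^ 2 ≠ 4) :
    Subgroup.centralizer {g} = K := by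
  apply le_antisymm
  · intro x hx
    rw [Subgroup.mem_centralizer_singleton_iff] at hx
    by_contra hxK
    obtain ⟨u, v, huv⟩ := hG
    -- An element of the centralizer outside `K` would, together with `K`, make `g` central; but the
    -- centralizer of a non-scalar element is commutative.
    have hall : ∀ y, g * y = y * g := by
      intro y
      by_cases hy : y ∈ K
      · exact hKc g hgK y hy
      · have hxy : x⁻¹ * y ∈ K :=
          (Subgroup.mul_mem_iff_of_index_two hK).2 (iff_of_false (by rwa [inv_mem_iff]) hy)
        have h1 := hKc g hgK _ hxy
        have h2 : y = x * (x⁻¹ * y) := by group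
        rw [h2, ← mul_assoc, ← hx, mul_assoc, h1, mul_assoc x]
    exact huv (mul_comm_of_mem_centralizer hf hg (hall u) (hall v))
  · intro x hx
    rw [Subgroup.mem_centralizer_singleton_iff]
    exact hKc x hx g hgK

include hK hKc hG hz in
/-- In the same situation the elements outside `K` have centralizers of order four. -/
lemma card_centralizer_of_notMem (hzK : z ∈ K) {g : G} (hgK : g ∉ K) :
    Nat.card (Subgroup.centralizer ({g} : Set G)) = 4 := by
  classical
  obtain ⟨hz1, hzz, hzc⟩ := ne_one_of_eq_neg_one hf hz
  -- A non-scalar element of `K` that commutes with `g` would put `g` into its centralizer, which is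
  -- `K`.
  have hin : ∀ x, x ∈ K → x * g = g * x → x = 1 ∨ x = z := by
    intro x hx hxg
    apply eq_one_or_eq_of_tr_sq hf hz
    by_contra ht
    apply hgK
    rw [← centralizer_eq_of_mem hf hK hKc hG hx ht, Subgroup.mem_centralizer_singleton_iff]
    exact hxg.symm
  -- Two elements outside `K` that commute differ by an element of `K` that commutes with both.
  have hset : (Subgroup.centralizer ({g} : Set G) : Set G) =
      (({1, z, g, g * z} : Finset G) : Set G) := by
    ext x
    rw [SetLike.mem_coe, Subgroup.mem_centralizer_singleton_iff]
    simp only [Finset.coe_insert, Finset.coe_singleton, Set.mem_insert_iff,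
      Set.mem_singleton_iff]
    constructor
    · intro hx
      by_cases hxK : x ∈ K
      · rcases hin x hxK hx with h | h
        · exact Or.inl h
        · exact Or.inr (Or.inl h)
      · have hxy : g⁻¹ * x ∈ K :=
          (Subgroup.mul_mem_iff_of_index_two hK).2 (iff_of_false (by rwa [inv_mem_iff]) hxK)
        rcases hin _ hxy (by rw [mul_assoc, hx]; group) with h | h
        · right; right; left
          exact (inv_mul_eq_one.1 h).symm
        · right; right; right
          rw [← h]; group
    · rintro (rfl | rfl | rfl | rfl)
      · simp
      · exact (hzc g).symm
      · rfl
      · rw [mul_assoc, ← hzc]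
  have hcard : ({1, z, g, g * z} : Finset G).card = 4 := by
    have h1g : (1 : G) ≠ g := fun h => hgK (h ▸ one_mem K)
    have hzg : z ≠ g := fun h => hgK (h ▸ hzK)
    have h1gz : (1 : G) ≠ g * z := fun h => by
      have := eq_inv_of_mul_eq_one_left h.symm
      exact hgK (this ▸ inv_mem hzK)
    have hzgz : z ≠ g * z := fun h =>
      h1g (mul_right_cancel (b := z) (by rw [one_mul]; exact h))
    have hggz : g ≠ g * z := fun h => hz1 (by simpa using h)
    rw [Finset.card_insert_of_notMem (by simp [hz1.symm, h1g, h1gz]),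
      Finset.card_insert_of_notMem (by simp [hzg, hzgz]),
      Finset.card_insert_of_notMem (by simpa using hggz), Finset.card_singleton]
  rw [← hcard, ← Set.ncard_coe_finset, ← hset]
  rfl

include hK hKc hG hz in
/-- The sum of the orders of the centralizers over a subgroup `N` containing `-1`. -/
lemma sum_card_centralizer_subgroup (hzK : z ∈ K) (N : Subgroup G) [Fintype N] (hzN : z ∈ N) :
    ∑ g : N, Nat.card (Subgroup.centralizer ({(g : G)} : Set G)) =
      2 * Nat.card G + (Nat.card (N ⊓ K : Subgroup G) - 2) * Nat.card K +
        (Nat.card N - Nat.card (N ⊓ K : Subgroup G)) * 4 := by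
  classical
  obtain ⟨hz1, hzz, hzc⟩ := ne_one_of_eq_neg_one hf hz
  let F : G → ℕ := fun g => Nat.card (Subgroup.centralizer ({g} : Set G))
  have h1 : ∑ g : N, Nat.card (Subgroup.centralizer ({(g : G)} : Set G)) =
      ∑ g ∈ Finset.univ.filter (fun g : G => g ∈ N), F g := by
    rw [Finset.sum_subtype (F := ‹Fintype N›) (p := fun g => g ∈ N)
        (Finset.univ.filter fun g : G => g ∈ N) (fun g => by simp) F]
  have hcardN : (Finset.univ.filter (fun g : G => g ∈ N)).card = Nat.card N := by
    rw [Nat.card_eq_fintype_card, Fintype.card_subtype]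
  have hcardNK : (Finset.univ.filter (fun g : G => g ∈ N ∧ g ∈ K)).card =
      Nat.card (N ⊓ K : Subgroup G) := by
    rw [← Fintype.card_subtype, ← Nat.card_eq_fintype_card]
    rfl
  have hsplit := Finset.sum_filter_add_sum_filter_not
    (Finset.univ.filter (fun g : G => g ∈ N)) (fun g => g ∈ K) F
  have hcsplit := Finset.card_filter_add_card_filter_not
    (s := Finset.univ.filter (fun g : G => g ∈ N)) (fun g => g ∈ K)
  rw [Finset.filter_filter, Finset.filter_filter] at hsplit hcsplit
  rw [hcardN, hcardNK] at hcsplit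
  -- The elements `1`, `-1` contribute `|G|` each, the other elements of `N ∩ K` contribute `|K|`,
  -- and those outside `K` contribute `4`.
  rw [h1, ← hsplit]
  congr 1
  · have hsub : ({1, z} : Finset G) ⊆ Finset.univ.filter (fun g : G => g ∈ N ∧ g ∈ K) := by
      intro g hg
      simp only [Finset.mem_insert, Finset.mem_singleton] at hg
      rcases hg with rfl | rfl
      · simp [one_mem]
      · simp [hzN, hzK]
    rw [← Finset.sum_sdiff hsub, add_comm]
    congr 1
    · rw [Finset.sum_pair hz1.symm]
      have hcen : ∀ g : G, (∀ x, x * g = g * x) → F g = Nat.card G := by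
        intro g hg
        simp only [F]
        have : Subgroup.centralizer ({g} : Set G) = ⊤ := by
          rw [eq_top_iff]
          intro x _
          rw [Subgroup.mem_centralizer_singleton_iff]
          exact hg x
        rw [this]
        exact Subgroup.card_top
      rw [hcen 1 (by simp), hcen z hzc, two_mul]
    · rw [Finset.sum_congr rfl (g := fun _ => Nat.card K), Finset.sum_const, smul_eq_mul,
        Finset.card_sdiff_of_subset hsub, hcardNK, Finset.card_pair hz1.symm]
      intro g hg
      rw [Finset.mem_sdiff, Finset.mem_filter, Finset.mem_insert, Finset.mem_singleton] at hg
      simp only [F]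
      rw [centralizer_eq_of_mem hf hK hKc hG hg.1.2.2]
      intro ht
      exact hg.2 (eq_one_or_eq_of_tr_sq hf hz ht)
  · rw [Finset.sum_congr rfl (g := fun _ => 4), Finset.sum_const, smul_eq_mul]
    · congr 1
      omega
    · intro g hg
      rw [Finset.mem_filter] at hg
      exact card_centralizer_of_notMem hf hK hKc hG hz hzK hg.2.2

end DihedralCentralizers

end McKaySlodowy

namespace McKaySlodowy

open Representation Module

/-! ### Irreducible modules of finite groups -/

section Irreducibility

variable {H W : Type*} [Group H] [AddCommGroup W] [Module ℂ W]

/-- A module whose character has norm one is irreducible: the projection to a proper submodule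
along an invariant complement would be a non-scalar endomorphism. -/
theorem isIrreducible_of_norm_eq_one [Fintype H] [FiniteDimensional ℂ W]
    (ρ : Representation ℂ H W)
    (h : ∑ g, ρ.character g * ρ.character g⁻¹ = Nat.card H) : ρ.IsIrreducible := by
  have hc : (Nat.card H : ℂ) ≠ 0 := Nat.cast_ne_zero.2 Nat.card_pos.ne'
  have : NeZero (Nat.card H : ℂ) := ⟨hc⟩
  have : Invertible (Nat.card H : ℂ) := invertibleOfNonzero hc
  -- The norm of the character is the dimension of the endomorphism algebra.
  have h1 := card_inv_mul_sum_char_mul_char_eq_finrank ρ ρ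
  rw [h, inv_mul_cancel₀ hc] at h1
  have hfin : finrank ℂ (IntertwiningMap ρ ρ) = 1 := by exact_mod_cast h1.symm
  have hW : Nontrivial W := by
    by_contra hW
    rw [not_nontrivial_iff_subsingleton] at hW
    have : Subsingleton (IntertwiningMap ρ ρ) :=
      ⟨fun S T => IntertwiningMap.toLinearMap_injective _ _ (Subsingleton.elim _ _)⟩
    rw [finrank_zero_of_subsingleton] at hfin
    exact zero_ne_one hfin
  rw [isIrreducible_iff]
  refine ⟨hW, fun p hp => ?_⟩
  let P : Subrepresentation ρ := ⟨p, hp⟩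
  obtain ⟨Q, hQ⟩ := exists_isCompl P
  have hPQ : IsCompl p Q.toSubmodule := by
    constructor
    · rw [disjoint_iff]
      exact congrArg Subrepresentation.toSubmodule hQ.inf_eq_bot
    · rw [codisjoint_iff]
      exact congrArg Subrepresentation.toSubmodule hQ.sup_eq_top
  let π : IntertwiningMap ρ ρ := ⟨p.projection Q.toSubmodule hPQ, fun g => by
    refine LinearMap.ext fun w => ?_
    obtain ⟨u, hu, v, hv, rfl⟩ := Submodule.mem_sup.1
      (show w ∈ p ⊔ Q.toSubmodule by rw [hPQ.sup_eq_top]; trivial)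
    rw [LinearMap.comp_apply, LinearMap.comp_apply, map_add, map_add, map_add,
      Submodule.projection_apply_of_mem_left hPQ (hp g hu),
      (Submodule.projection_apply_eq_zero_iff hPQ).2 (Q.apply_mem_toSubmodule g hv),
      Submodule.projection_apply_of_mem_left hPQ hu,
      (Submodule.projection_apply_eq_zero_iff hPQ).2 hv, add_zero, add_zero]⟩
  have hid : (IntertwiningMap.id ρ) ≠ 0 := fun h => by
    obtain ⟨w, hw⟩ := exists_ne (0 : W)
    exact hw (LinearMap.congr_fun (congrArg IntertwiningMap.toLinearMap h) w)
  -- All endomorphisms being scalar, so is the projection onto `p`.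
  obtain ⟨c, hcπ⟩ := (finrank_eq_one_iff_of_nonzero' _ hid).1 hfin π
  have hcw : ∀ w, c • w = p.projection Q.toSubmodule hPQ w := fun w =>
    LinearMap.congr_fun (congrArg IntertwiningMap.toLinearMap hcπ) w
  by_cases hc0 : c = 0
  · left
    rw [eq_bot_iff]
    intro w hw
    have := hcw w
    rw [hc0, zero_smul, Submodule.projection_apply_of_mem_left hPQ hw] at this
    exact (Submodule.mem_bot ℂ).2 this.symm
  · right
    rw [eq_top_iff]
    intro w _
    have h2 : c • w ∈ p := by
      rw [hcw]
      exact Submodule.projection_apply_mem hPQ w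
    exact (Submodule.smul_mem_iff _ hc0).1 h2

/-- A minimal invariant subspace is irreducible. -/
lemma exists_irreducible_subrepresentation [FiniteDimensional ℂ W] [Nontrivial W]
    (ρ : Representation ℂ H W) : ∃ (q : Submodule ℂ W) (hq : ∀ g, q ≤ q.comap (ρ g)),
      (ρ.subrepresentation q hq).IsIrreducible := by
  obtain ⟨q, -, hq, hq0, hmin⟩ := exists_minimal_invariant ρ (p := ⊤) (fun g v _ => trivial)
    top_ne_bot
  refine ⟨q, hq, ?_⟩
  rw [isIrreducible_iff]
  refine ⟨Submodule.nontrivial_iff_ne_bot.2 hq0, fun p hp => ?_⟩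
  rcases hmin (p.map q.subtype) (Submodule.map_subtype_le _ _) (by
    rintro g _ ⟨v, hv, rfl⟩
    exact ⟨_, hp g hv, rfl⟩) with h | h
  · left
    apply Submodule.map_injective_of_injective q.subtype_injective
    rw [h, Submodule.map_bot]
  · right
    apply Submodule.map_injective_of_injective q.subtype_injective
    rw [h, Submodule.map_top, Submodule.range_subtype]

/-- If a group has a commutative subgroup of index two, its irreducible modules have dimension at
most two. -/
theorem finrank_le_two [FiniteDimensional ℂ W] {ρ : Representation ℂ H W}
    (hρ : ρ.IsIrreducible) {K : Subgroup H} (hK : K.index = 2)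
    (hKc : ∀ x ∈ K, ∀ y ∈ K, x * y = y * x) : finrank ℂ W ≤ 2 := by
  have hW := ((isIrreducible_iff ρ).1 hρ).1
  obtain ⟨q, hq, hirr⟩ := exists_irreducible_subrepresentation (res K ρ)
  have hcomm : IsMulCommutative K := ⟨⟨fun x y => Subtype.ext (hKc x x.2 y y.2)⟩⟩
  have hq1 := IsIrreducible.finrank_eq_one_of_isMulCommutative
    ((res K ρ).subrepresentation q hq)
  obtain ⟨t, ht⟩ : ∃ t, t ∉ K := by
    by_contra! hall
    rw [(Subgroup.eq_top_iff' K).2 hall, Subgroup.index_top] at hK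
    omega
  have hqK : ∀ k ∈ K, ∀ v ∈ q, ρ k v ∈ q := fun k hk v hv => hq ⟨k, hk⟩ hv
  have hmul : ∀ g k v, ρ g (ρ k v) = ρ (g * k) v := fun g k v => by
    rw [map_mul, Module.End.mul_apply]
  have hnorm : K.Normal := Subgroup.normal_of_index_eq_two hK
  -- Here `q` is a line invariant under `K`; for `t ∉ K` the subspace `q + t q` is invariant under
  -- the whole group.
  have hinv : ∀ g, q ⊔ q.map (ρ t) ≤ (q ⊔ q.map (ρ t)).comap (ρ g) := by
    intro g
    by_cases hg : g ∈ K
    · rw [sup_le_iff]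
      constructor
      · intro v hv
        exact Submodule.mem_sup_left (hqK g hg v hv)
      · rintro _ ⟨v, hv, rfl⟩
        apply Submodule.mem_sup_right
        refine ⟨ρ (t⁻¹ * g * t) v, hqK _ ?_ v hv, ?_⟩
        · have := hnorm.conj_mem g hg t⁻¹
          rwa [inv_inv] at this
        · rw [hmul, hmul]
          congr 2
          group
    · rw [sup_le_iff]
      constructor
      · intro v hv
        apply Submodule.mem_sup_right
        refine ⟨ρ (t⁻¹ * g) v, hqK _ ?_ v hv, ?_⟩
        · exact (Subgroup.mul_mem_iff_of_index_two hK).2 (iff_of_false (by rwa [inv_mem_iff]) hg)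
        · rw [hmul]
          congr 2
          group
      · rintro _ ⟨v, hv, rfl⟩
        apply Submodule.mem_sup_left
        rw [hmul]
        exact hqK _ ((Subgroup.mul_mem_iff_of_index_two hK).2 (iff_of_false hg ht)) v hv
  have hq0 : q ≠ ⊥ := by
    rintro rfl
    rw [finrank_bot] at hq1
    exact zero_ne_one hq1
  rcases ((isIrreducible_iff ρ).1 hρ).2 _ hinv with h | h
  · exact absurd (le_bot_iff.1 (h ▸ le_sup_left)) hq0
  · have h1 := Submodule.finrank_add_le_finrank_add_finrank q (q.map (ρ t))
    rw [h, finrank_top, hq1] at h1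
    have h2 := Submodule.finrank_map_le (ρ t) q
    omega

/-- Every finite-dimensional module is isomorphic to one on a coordinate space. -/
lemma exists_equiv_fin [FiniteDimensional ℂ W] {m : ℕ} (hm : finrank ℂ W = m)
    (ρ : Representation ℂ H W) :
    ∃ π : Representation ℂ H (Fin m → ℂ), Nonempty (ρ.Equiv π) := by
  let e : W ≃ₗ[ℂ] (Fin m → ℂ) := (finBasisOfFinrankEq ℂ W hm).equivFun
  let π : Representation ℂ H (Fin m → ℂ) :=
    { toFun := fun g => e.conj (ρ g)
      map_one' := by rw [map_one]; exact e.conj_id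
      map_mul' := fun g k => by rw [map_mul]; exact e.conj_comp _ _ }
  exact ⟨π, ⟨Representation.Equiv.mk e fun g => by
    ext x
    simp [π, LinearEquiv.conj_apply]⟩⟩

end Irreducibility

/-! ### Irreducible symmetric powers -/

section SymmetricPowers

/-- The Clebsch-Gordan rule for characters. -/
lemma coeff_molien_add (y : ℂ) (m k : ℕ) :
    PowerSeries.coeff (m + k + 2) (molien y) =
      PowerSeries.coeff (m + 1) (molien y) * PowerSeries.coeff (k + 1) (molien y) -
        PowerSeries.coeff m (molien y) * PowerSeries.coeff k (molien y) := by
  induction k using Nat.twoStepInduction with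
  | zero =>
    rw [add_zero, coeff_molien_add_two, coeff_zero_molien, zero_add, coeff_one_molien]
    ring
  | one =>
    rw [coeff_molien_add_two, show m + 1 + 1 = m + 2 by ring, coeff_molien_add_two,
      coeff_molien_add_two (k := 0), zero_add, coeff_one_molien, coeff_zero_molien]
    ring
  | more k ih1 ih2 =>
    rw [show k + 1 + 1 = k + 2 by ring] at ih2
    rw [show m + (k + 2) + 2 = (m + k + 2) + 2 by ring, coeff_molien_add_two,
      show m + k + 2 + 1 = m + (k + 1) + 2 by ring, ih1, ih2,
      show k + 2 + 1 = k + 1 + 2 by ring, coeff_molien_add_two y (k + 1),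
      show k + 1 + 1 = k + 2 by ring, coeff_molien_add_two y k]
    ring

/-- The character form of `S^k ⊗ S^k = S^0 ⊕ S^2 ⊕ ⋯ ⊕ S^{2k}`. -/
lemma sq_coeff_molien (y : ℂ) (k : ℕ) : PowerSeries.coeff k (molien y) ^ 2 =
    ∑ j ∈ Finset.range (k + 1), PowerSeries.coeff (2 * j) (molien y) := by
  induction k with
  | zero => simp [coeff_zero_molien]
  | succ k ih =>
    rw [Finset.sum_range_succ, ← ih, show 2 * (k + 1) = k + k + 2 by ring, coeff_molien_add]
    ring

lemma finrank_homogeneous (k : ℕ) :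
    finrank ℂ (MvPolynomial.homogeneousSubmodule (Fin 2) ℂ k) = k + 1 := by
  obtain ⟨b, -⟩ := exists_basis_homogeneous k
  rw [finrank_eq_card_basis b, Fintype.card_coe, Finset.Nat.card_antidiagonal]

variable {H : Type*} [Group H] [Fintype H] {f : H →* SL2}

/-- The symmetric power `S^k(V)` on a coordinate space, with its character read off from `1 / (1 -
tr g · t + t²)`. -/
lemma exists_symPow (f : H →* SL2) (k : ℕ) : ∃ π : Representation ℂ H (Fin (k + 1) → ℂ),
    ∀ g, π.character g = PowerSeries.coeff k (molien (tr (f g))) := by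
  obtain ⟨π, ⟨e⟩⟩ := exists_equiv_fin (finrank_homogeneous k)
    ((symPow k).comp f : Representation ℂ H _)
  refine ⟨π, fun g => ?_⟩
  rw [← char_iso e]
  exact character_symPow (isOfFinOrder_map f g) k

/-- The norm of `S^k(V)` counts the invariants in `S^0, S^2, …, S^{2k}`. -/
lemma sum_sq_coeff_molien (k : ℕ) :
    ∑ g, PowerSeries.coeff k (molien (tr (f g))) * PowerSeries.coeff k (molien (tr (f g⁻¹))) =
      ∑ j ∈ Finset.range (k + 1), PowerSeries.coeff (2 * j) (∑ g, molien (tr (f g))) := by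
  simp only [map_inv, tr_inv, ← pow_two, sq_coeff_molien, map_sum]
  rw [Finset.sum_comm]

/-- The Molien series is `(1 + t^h) / ((1 - t^a) (1 - t^b))`. -/
lemma HasDegrees.sum_molien {a b h : ℕ} (hd : HasDegrees f a b h) :
    (∑ g, molien (tr (f g))) * ((1 - PowerSeries.X ^ a) * (1 - PowerSeries.X ^ b)) =
      PowerSeries.C (Nat.card H : ℂ) * (1 + PowerSeries.X ^ h) := by
  obtain ⟨q, hq, hs⟩ := hd.quot
  have h2 := congrArg (Polynomial.coeToPowerSeries.ringHom (R := ℂ)) hs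
  rw [map_sum] at h2
  simp only [Polynomial.coeToPowerSeries.ringHom_apply, Polynomial.coe_mul, Polynomial.coe_add,
    Polynomial.coe_one, Polynomial.coe_pow, Polynomial.coe_X, Polynomial.coe_C] at h2
  rw [← h2, Finset.sum_mul]
  exact Finset.sum_congr rfl fun g _ => by rw [coe_quot (hq g), mul_comm]

lemma coeff_zero_sum_molien : PowerSeries.coeff 0 (∑ g, molien (tr (f g))) = Nat.card H := by
  rw [map_sum]
  simp only [coeff_zero_molien]
  simp

/-- The Molien series is determined recursively by the degrees. -/
lemma HasDegrees.coeff_sum_molien {a b h : ℕ} (hd : HasDegrees f a b h) {k : ℕ} (hk : 0 < k)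
    (hkh : k < h) : PowerSeries.coeff k (∑ g, molien (tr (f g))) =
      (if a ≤ k then PowerSeries.coeff (k - a) (∑ g, molien (tr (f g))) else 0) +
      (if b ≤ k then PowerSeries.coeff (k - b) (∑ g, molien (tr (f g))) else 0) := by
  have h1 := hd.sum_molien
  set M := ∑ g, molien (tr (f g))
  have h2 : M = PowerSeries.C (Nat.card H : ℂ) * (1 + PowerSeries.X ^ h) +
      M * PowerSeries.X ^ a + M * PowerSeries.X ^ b - M * PowerSeries.X ^ (a + b) := by
    linear_combination h1
  have h3 := congrArg (PowerSeries.coeff k) h2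
  have hab := hd.add
  rw [map_sub, map_add, map_add, PowerSeries.coeff_C_mul, map_add, PowerSeries.coeff_one,
    PowerSeries.coeff_X_pow, PowerSeries.coeff_mul_X_pow', PowerSeries.coeff_mul_X_pow',
    PowerSeries.coeff_mul_X_pow', if_neg hk.ne', if_neg (ne_of_lt hkh),
    if_neg (show ¬ a + b ≤ k by omega)] at h3
  rw [h3]
  ring

/-- Below the degrees `a` and `b` there are no invariants, so `S^k(V)` has norm one, hence is
irreducible, as long as `2 k < a` and `2 k < b`. -/
lemma HasDegrees.exists_irreducible {a b h : ℕ} (hd : HasDegrees f a b h) {k : ℕ}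
    (ha : 2 * k < a) (hb : 2 * k < b) :
    ∃ π : Representation ℂ H (Fin (k + 1) → ℂ), π.IsIrreducible ∧
      ∀ g, π.character g = PowerSeries.coeff k (molien (tr (f g))) := by
  obtain ⟨π, hπ⟩ := exists_symPow f k
  refine ⟨π, isIrreducible_of_norm_eq_one π ?_, hπ⟩
  simp only [hπ]
  have hab := hd.add
  rw [sum_sq_coeff_molien, Finset.sum_range_succ', mul_zero, coeff_zero_sum_molien,
    Finset.sum_eq_zero, zero_add]
  intro j hj
  rw [Finset.mem_range] at hj
  rw [hd.coeff_sum_molien (by omega) (by omega), if_neg (by omega), if_neg (by omega), add_zero]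

end SymmetricPowers

/-! ### Dimensions and norms of restricted modules -/

section Lists

variable {G : Type*} [Group G] {τ : Type*} {r : τ → ℕ}

lemma Equiv_res_top {W U : Type*} [AddCommGroup W] [Module ℂ W] [AddCommGroup U] [Module ℂ U]
    {ρ : Representation ℂ G W} {σ : Representation ℂ G U}
    (h : Nonempty ((res (⊤ : Subgroup G) ρ).Equiv (res ⊤ σ))) : Nonempty (ρ.Equiv σ) := by
  obtain ⟨e⟩ := h
  exact ⟨Representation.Equiv.mk e.toLinearEquiv fun g =>
    e.toIntertwiningMap.isIntertwining' (⟨g, trivial⟩ : (⊤ : Subgroup G))⟩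

lemma Equiv.res {W U : Type*} [AddCommGroup W] [Module ℂ W] [AddCommGroup U] [Module ℂ U]
    {ρ : Representation ℂ G W} {σ : Representation ℂ G U} (N : Subgroup G)
    (e : ρ.Equiv σ) : Nonempty ((res N ρ).Equiv (res N σ)) :=
  ⟨Representation.Equiv.mk e.toLinearEquiv fun g => e.toIntertwiningMap.isIntertwining' (g : G)⟩

lemma IsIrrepList.isRestrictionList {φ : ∀ i, Representation ℂ G (Fin (r i) → ℂ)}
    (hφ : IsIrrepList φ) : IsRestrictionList (⊤ : Subgroup G) φ where
  irreducible := hφ.irreducible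
  inequivalent i j h := hφ.inequivalent i j (Equiv_res_top h)
  complete n π hπ := by
    obtain ⟨i, ⟨e⟩⟩ := hφ.complete n π hπ
    exact ⟨i, Equiv.res ⊤ e⟩

lemma IsRestrictionList.isIrrepList {N : Subgroup G} (hN : N = ⊤)
    {ρ : ∀ i, Representation ℂ G (Fin (r i) → ℂ)} (hρ : IsRestrictionList N ρ) :
    IsIrrepList fun i => res N (ρ i) := by
  subst hN
  refine ⟨fun i => isIrreducible_of_surjective (hρ.irreducible i) _ fun g => ⟨⟨g, trivial⟩, rfl⟩,
    hρ.inequivalent, fun n π hπ => ?_⟩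
  exact hρ.complete n (π.comp (Subgroup.topEquiv (G := G)).symm.toMonoidHom)
    (isIrreducible_of_surjective hπ _ (Subgroup.topEquiv (G := G)).symm.surjective)

variable [Fintype G] {N : Subgroup G} [N.Normal] [Fintype N] [Fintype τ]
  {ρ : ∀ i, Representation ℂ G (Fin (r i) → ℂ)}

/-- For the restrictions to `N` of irreducible modules of `G`: bounds for their norms `n i`, the
mass formula, and their number. -/
theorem IsRestrictionList.exists_norms (hab : ∀ x y : G, x⁻¹ * y⁻¹ * x * y ∈ N)
    (hρ : IsRestrictionList N ρ) : ∃ n : τ → ℕ,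
      (∀ i, 0 < n i ∧ n i ≤ r i ^ 2 ∧ n i ≤ N.index) ∧
      (∀ i, ∑ g : N, (ρ i).character g * (ρ i).character ((g : G)⁻¹) = Nat.card N * n i) ∧
      ∑ i, (r i : ℚ) ^ 2 / n i = Nat.card N ∧
      Fintype.card τ * Nat.card G =
        ∑ g : N, Nat.card (Subgroup.centralizer ({(g : G)} : Set G)) := by
  classical
  have hnt : ∀ i, Nontrivial (Fin (r i) → ℂ) := fun i =>
    ((isIrreducible_iff _).1 (hρ.irreducible i)).1
  choose n hn0 hn1 hn2 hn3 using fun i => exists_finrank_norm (res N (ρ i))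
  have hnorm : ∀ i, ∑ g : N, (ρ i).character g * (ρ i).character ((g : G)⁻¹) =
      Nat.card N * n i := hn1
  -- Irreducible modules of `G` whose restrictions are not disjoint have isomorphic restrictions,
  -- since `G / N` is commutative.
  have horth : ∀ i j, i ≠ j → ∑ g : N, (ρ i).character g * (ρ j).character ((g : G)⁻¹) = 0 := by
    intro i j hij
    by_contra h
    obtain ⟨T, hT⟩ := exists_intertwining_of_sum_ne_zero (res N (ρ j)) (res N (ρ i)) h
    exact hij (hρ.inequivalent j i (nonempty_res_equiv N hab (hρ.irreducible j)
      (hρ.irreducible i) T hT)).symm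
  have hsecond := hρ.sum_character_mul hn0 hnorm horth
  have hcG : (Nat.card G : ℂ) ≠ 0 := Nat.cast_ne_zero.2 Nat.card_pos.ne'
  have hcN : (Nat.card N : ℂ) ≠ 0 := Nat.cast_ne_zero.2 Nat.card_pos.ne'
  refine ⟨n, fun i => ⟨hn0 i, ?_, ?_⟩, hnorm, ?_, ?_⟩
  · have := hn2 i
    rwa [finrank_fin_fun] at this
  · -- the sum of `|χ|²` over `N` is at most that over `G`
    obtain ⟨m, -, hm1, -, hm3⟩ := exists_finrank_norm (ρ i)
    rw [hm3 (hρ.irreducible i), Nat.cast_one, mul_one] at hm1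
    have hsq : ∀ g, (ρ i).character g * (ρ i).character g⁻¹ =
        ((Complex.normSq ((ρ i).character g) : ℝ) : ℂ) := by
      intro g
      rw [char_inv_eq_star, Complex.star_def, Complex.mul_conj]
    have e1 : (∑ g : N, Complex.normSq ((ρ i).character (g : G))) = Nat.card N * n i := by
      have := hnorm i
      simp only [hsq] at this
      exact_mod_cast this
    have e2 : (∑ g : G, Complex.normSq ((ρ i).character g)) = Nat.card G := by
      simp only [hsq] at hm1
      exact_mod_cast hm1
    have e3 : (∑ g : N, Complex.normSq ((ρ i).character (g : G))) ≤
        ∑ g : G, Complex.normSq ((ρ i).character g) := by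
      refine (Finset.sum_map Finset.univ (Function.Embedding.subtype (· ∈ N))
        fun g : G => Complex.normSq ((ρ i).character g)).symm.le.trans ?_
      exact Finset.sum_le_sum_of_subset_of_nonneg (Finset.subset_univ _)
        fun g _ _ => Complex.normSq_nonneg _
    rw [e1, e2, ← N.card_mul_index] at e3
    have e4 : Nat.card N * n i ≤ Nat.card N * N.index := by exact_mod_cast e3
    exact Nat.le_of_mul_le_mul_left e4 Nat.card_pos
  · -- The mass formula is the second orthogonality relation at the identity.
    have h1 := hsecond 1
    have hcen : Nat.card (Subgroup.centralizer ({((1 : N) : G)} : Set G)) = Nat.card G := by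
      have : Subgroup.centralizer ({((1 : N) : G)} : Set G) = ⊤ := by
        rw [eq_top_iff]
        intro x _
        rw [Subgroup.mem_centralizer_singleton_iff]
        simp
      rw [this]
      exact Subgroup.card_top
    rw [hcen, mul_comm (Nat.card N : ℂ)] at h1
    have h2 := mul_left_cancel₀ hcG h1
    simp only [OneMemClass.coe_one, inv_one, char_one, finrank_fin_fun] at h2
    have h3 : ((∑ i, (r i : ℚ) ^ 2 / n i : ℚ) : ℂ) = ((Nat.card N : ℚ) : ℂ) := by
      push_cast
      rw [← h2]
      exact Finset.sum_congr rfl fun i _ => by rw [pow_two]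
    exact_mod_cast h3
  · -- The number of modules comes from the sum of the second orthogonality relation over `N`.
    have h1 : ∑ g : N, (Nat.card G : ℂ) *
        ∑ i, (ρ i).character g * (ρ i).character ((g : G)⁻¹) / n i =
        Nat.card N * (Nat.card G * Fintype.card τ) := by
      rw [← Finset.mul_sum, Finset.sum_comm]
      simp only [← Finset.sum_div, hnorm]
      have : ∀ i, (Nat.card N * n i / n i : ℂ) = Nat.card N := fun i =>
        mul_div_cancel_right₀ _ (Nat.cast_ne_zero.2 (hn0 i).ne')
      simp only [this, Finset.sum_const, Finset.card_univ, nsmul_eq_mul]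
      ring
    simp only [hsecond] at h1
    rw [← Finset.mul_sum] at h1
    have h2 := mul_left_cancel₀ hcN h1
    rw [mul_comm]
    exact_mod_cast h2.symm

omit [N.Normal] [Fintype τ] in
/-- The dimension and the norm of the restriction of any irreducible module of `G` occur in a
restriction list. -/
lemma IsRestrictionList.exists_index (hρ : IsRestrictionList N ρ) {n : τ → ℕ}
    (hn : ∀ i, ∑ g : N, (ρ i).character g * (ρ i).character ((g : G)⁻¹) = Nat.card N * n i)
    {m k : ℕ} {π : Representation ℂ G (Fin m → ℂ)} (hπ : π.IsIrreducible)
    (hk : ∑ g : N, π.character g * π.character ((g : G)⁻¹) = Nat.card N * k) :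
    ∃ i, r i = m ∧ n i = k := by
  obtain ⟨i, ⟨e⟩⟩ := hρ.complete m π hπ
  have hch : ∀ g : N, π.character g = (ρ i).character g := fun g => congrFun (char_iso e) g
  have hch' : ∀ g : N, π.character ((g : G)⁻¹) = (ρ i).character ((g : G)⁻¹) := fun g => hch g⁻¹
  refine ⟨i, ?_, ?_⟩
  · have := hch 1
    simp only [OneMemClass.coe_one, char_one, finrank_fin_fun] at this
    exact_mod_cast this.symm
  · simp only [hch, hch'] at hk
    rw [hn] at hk
    have hcN : (Nat.card N : ℂ) ≠ 0 := Nat.cast_ne_zero.2 Nat.card_pos.ne'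
    exact_mod_cast mul_left_cancel₀ hcN hk

/-- The sum of the squares of the dimensions is the group order, and the number of irreducible
modules is the number of conjugacy classes, in the form given by the centralizers. -/
theorem IsIrrepList.card_eq {φ : ∀ i, Representation ℂ G (Fin (r i) → ℂ)} (hφ : IsIrrepList φ) :
    ∑ i, r i ^ 2 = Nat.card G ∧ Fintype.card τ * Nat.card G =
      ∑ g : G, Nat.card (Subgroup.centralizer ({g} : Set G)) := by
  have := Fintype.ofFinite (⊤ : Subgroup G)
  obtain ⟨n, hn, -, h1, h2⟩ := hφ.isRestrictionList.exists_norms fun _ _ => Subgroup.mem_top _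
  -- For `N = G` all norms are one, being bounded by the index.
  have hn1 : ∀ i, n i = 1 := fun i => by
    obtain ⟨h3, -, h4⟩ := hn i
    rw [Subgroup.index_top] at h4
    omega
  constructor
  · simp only [hn1, Nat.cast_one, div_one, Subgroup.card_top] at h1
    exact_mod_cast h1
  · rw [h2]
    exact Fintype.sum_equiv Subgroup.topEquiv.toEquiv _ _ fun g => rfl

end Lists

/-! ### Dimensions of the irreducible modules -/

section Dimensions

variable {H : Type*} [Group H] [Fintype H] {f : H →* SL2} {κ : Type*} [Fintype κ] {e : κ → ℕ}
  {φ : ∀ i, Representation ℂ H (Fin (e i) → ℂ)}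

lemma sum_eq_sum_add_sum_compl [DecidableEq κ] {p : ℕ} (j : Fin p ↪ κ) {M : Type*}
    [AddCommMonoid M] (F : κ → M) :
    ∑ i, F i = ∑ k, F (j k) + ∑ i ∈ (Finset.univ.map j)ᶜ, F i := by
  rw [← Finset.sum_add_sum_compl (Finset.univ.map j), Finset.sum_map]

omit [Fintype κ] in
/-- If positive integers have sum of squares `s`, each square leaves at least one for every other
member. -/
lemma sq_add_card_le {R : Finset κ} {s : ℕ} (he : ∀ i, 0 < e i) (hs : ∑ i ∈ R, e i ^ 2 = s)
    {i : κ} (hi : i ∈ R) : e i ^ 2 + (R.card - 1) ≤ s := by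
  classical
  rw [← hs, ← Finset.add_sum_erase R _ hi, ← Finset.card_erase_of_mem hi, Finset.card_eq_sum_ones]
  exact Nat.add_le_add_left (Finset.sum_le_sum fun k _ => Nat.one_le_pow _ _ (he k)) _

omit [Fintype H] [Fintype κ] in
lemma IsIrrepList.pos (hφ : IsIrrepList φ) (i : κ) : 0 < e i :=
  finrank_pos_of_irreducible (hφ.irreducible i)

omit [Fintype κ] in
/-- The symmetric powers `S^k`, `2 k < a`, give irreducible modules of dimensions `1, …, a / 2`. -/
lemma IsIrrepList.exists_embedding (hφ : IsIrrepList φ) {a b h p : ℕ} (hd : HasDegrees f a b h)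
    (ha : 2 * p = a) (hb : a ≤ b ∨ p = 1) : ∃ j : Fin p ↪ κ, ∀ k, e (j k) = k + 1 := by
  have hex : ∀ k : Fin p, ∃ i, e i = k + 1 := by
    intro k
    have hbp := hd.b_pos
    obtain ⟨π, hπ, -⟩ := hd.exists_irreducible (k := k) (by omega) (by omega)
    obtain ⟨i, ⟨E⟩⟩ := hφ.complete _ π hπ
    refine ⟨i, ?_⟩
    have := congrFun (char_iso E) 1
    rw [char_one, char_one, finrank_fin_fun, finrank_fin_fun] at this
    exact_mod_cast this.symm
  choose j hj using hex
  exact ⟨⟨j, fun k l hkl => Fin.ext (by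
    have h1 := hj k
    rw [hkl, hj l] at h1
    omega)⟩, hj⟩

/-- The degree `a` is twice the largest dimension of an irreducible module, and `h` is the sum of
the dimensions. -/
theorem HasType.dimensions {a b h : ℕ} (hT : HasType f a b h) (hφ : IsIrrepList φ) :
    a = 2 * Finset.univ.sup e ∧ h = ∑ i, e i := by
  classical
  obtain ⟨hd, hT⟩ := hT
  obtain ⟨hsq, hcard⟩ := hφ.card_eq
  have hpos := hφ.pos
  have hcpos : 0 < Nat.card H := Nat.card_pos
  have hsup : ∀ {p : ℕ} (j : Fin p ↪ κ), 0 < p → (∀ k, e (j k) = k + 1) → (∀ i, e i ≤ p) →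
      Finset.univ.sup e = p := by
    intro p j hp hj hle
    apply le_antisymm (Finset.sup_le fun i _ => hle i)
    have := hj ⟨p - 1, by omega⟩
    simp only at this
    rw [show p - 1 + 1 = p by omega] at this
    rw [← this]
    exact Finset.le_sup (Finset.mem_univ _)
  -- the remaining dimensions, after those of the symmetric powers
  have hcompl : ∀ {p : ℕ} (j : Fin p ↪ κ),
      ((Finset.univ.map j)ᶜ).card + p = Fintype.card κ := by
    intro p j
    have := Finset.card_compl_add_card (Finset.univ.map j)
    rwa [Finset.card_map, Finset.card_univ (α := Fin p), Fintype.card_fin] at this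
  have hout : ∀ {p : ℕ} (j : Fin p ↪ κ), (∀ k, e (j k) = k + 1) →
      (∀ i ∈ (Finset.univ.map j)ᶜ, e i ≤ p) → ∀ i, e i ≤ p := by
    intro p j hj hle i
    by_cases hi : i ∈ (Finset.univ.map j)ᶜ
    · exact hle i hi
    · rw [Finset.mem_compl, not_not, Finset.mem_map] at hi
      obtain ⟨k, -, rfl⟩ := hi
      rw [hj]
      exact k.2
  rcases hT with ⟨rfl, hc⟩ | ⟨m, hm, hm4, rfl, rfl, rfl, ⟨K, hK, hKc⟩, hs⟩ |
    ⟨h24, rfl, rfl, rfl, hs⟩ | ⟨h48, rfl, rfl, rfl, hs⟩ | ⟨h120, rfl, rfl, rfl, hs⟩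
  · obtain ⟨j, hj⟩ := hφ.exists_embedding hd (p := 1) rfl (Or.inr rfl)
    have he : ∀ i, e i = 1 := by
      intro i
      have := hφ.irreducible i
      have hcomm : IsMulCommutative H := ⟨⟨hc⟩⟩
      have := IsIrreducible.finrank_eq_one_of_isMulCommutative (φ i)
      rwa [finrank_fin_fun] at this
    refine ⟨by rw [hsup j one_pos hj fun i => (he i).le], ?_⟩
    have hadd := hd.add
    have hmul := hd.mul
    simp only [he, one_pow] at hsq ⊢
    omega
  · obtain ⟨j, hj⟩ := hφ.exists_embedding hd (p := 2) rfl (Or.inl (by omega))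
    have he : ∀ i, e i ≤ 2 := by
      intro i
      have := finrank_le_two (hφ.irreducible i) hK hKc
      rwa [finrank_fin_fun] at this
    -- As `e ∈ {1, 2}`, `(e - 1) (e - 2) = 0`, so the sum follows from the number of the dimensions
    -- and the sum of their squares.
    refine ⟨by rw [hsup j two_pos hj he], ?_⟩
    have h1 : ∑ i, (e i ^ 2 + 2) = ∑ i, 3 * e i := by
      refine Finset.sum_congr rfl fun i _ => ?_
      have h2 := he i
      have h3 := hpos i
      interval_cases e i <;> rfl
    rw [Finset.sum_add_distrib, ← Finset.mul_sum, hsq, Finset.sum_const, Finset.card_univ,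
      smul_eq_mul] at h1
    rw [hs, mul_comm] at hcard
    have h4 := Nat.eq_of_mul_eq_mul_left hcpos hcard
    omega
  · -- Besides `1, 2, 3` there are four dimensions with sum of squares `10`.
    obtain ⟨j, hj⟩ := hφ.exists_embedding hd (p := 3) rfl (Or.inl (by omega))
    rw [hs, mul_comm] at hcard
    have hκ := Nat.eq_of_mul_eq_mul_left hcpos hcard
    have hR := hcompl j
    have h1 := sum_eq_sum_add_sum_compl j fun i => e i ^ 2
    have h2 := sum_eq_sum_add_sum_compl j e
    simp only [hj, Fin.sum_univ_succ, Fin.sum_univ_zero] at h1 h2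
    rw [hsq, h24] at h1
    norm_num [Fin.val_succ] at h1 h2
    set R := (Finset.univ.map j)ᶜ
    have hle : ∀ i ∈ R, e i ≤ 2 := by
      intro i hi
      have := sq_add_card_le hpos (s := 10) (by omega) hi
      rw [show R.card = 4 by omega] at this
      by_contra! h3
      nlinarith
    refine ⟨by rw [hsup j (by norm_num) hj (hout j hj fun i hi => (hle i hi).trans (by norm_num))],
      ?_⟩
    -- Again `(e - 1) (e - 2) = 0`.
    have h3 : ∑ i ∈ R, (e i ^ 2 + 2) = ∑ i ∈ R, 3 * e i := by
      refine Finset.sum_congr rfl fun i hi => ?_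
      have h2 := hle i hi
      have h3 := hpos i
      interval_cases e i <;> rfl
    rw [Finset.sum_add_distrib, ← Finset.mul_sum, Finset.sum_const, smul_eq_mul] at h3
    omega
  · -- Besides `1, …, 4` there are four dimensions with sum of squares `18`.
    obtain ⟨j, hj⟩ := hφ.exists_embedding hd (p := 4) rfl (Or.inl (by omega))
    rw [hs, mul_comm] at hcard
    have hκ := Nat.eq_of_mul_eq_mul_left hcpos hcard
    have hR := hcompl j
    have h1 := sum_eq_sum_add_sum_compl j fun i => e i ^ 2
    have h2 := sum_eq_sum_add_sum_compl j e
    simp only [hj, Fin.sum_univ_succ, Fin.sum_univ_zero] at h1 h2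
    rw [hsq, h48] at h1
    norm_num [Fin.val_succ] at h1 h2
    set R := (Finset.univ.map j)ᶜ
    have hle : ∀ i ∈ R, e i ≤ 3 := by
      intro i hi
      have := sq_add_card_le hpos (s := 18) (by omega) hi
      rw [show R.card = 4 by omega] at this
      by_contra! h3
      nlinarith
    refine ⟨by rw [hsup j (by norm_num) hj (hout j hj fun i hi => (hle i hi).trans (by norm_num))],
      ?_⟩
    -- As `0 ≤ (e - 2)² ≤ 1`, the sum of the four dimensions is `8`.
    have h3 : ∑ i ∈ R, 4 * e i ≤ ∑ i ∈ R, (e i ^ 2 + 4) := by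
      refine Finset.sum_le_sum fun i hi => ?_
      have h2 := hle i hi
      interval_cases e i <;> norm_num
    have h4 : ∑ i ∈ R, (e i ^ 2 + 4) ≤ ∑ i ∈ R, (4 * e i + 1) := by
      refine Finset.sum_le_sum fun i hi => ?_
      have h2 := hle i hi
      have h3 := hpos i
      interval_cases e i <;> norm_num
    simp only [Finset.sum_add_distrib, ← Finset.mul_sum, Finset.sum_const, smul_eq_mul] at h3 h4
    omega
  · -- Besides `1, …, 6` there are three dimensions with sum of squares `29`.
    obtain ⟨j, hj⟩ := hφ.exists_embedding hd (p := 6) rfl (Or.inl (by omega))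
    rw [hs, mul_comm] at hcard
    have hκ := Nat.eq_of_mul_eq_mul_left hcpos hcard
    have hR := hcompl j
    have h1 := sum_eq_sum_add_sum_compl j fun i => e i ^ 2
    have h2 := sum_eq_sum_add_sum_compl j e
    simp only [hj, Fin.sum_univ_succ, Fin.sum_univ_zero] at h1 h2
    rw [hsq, h120] at h1
    norm_num [Fin.val_succ] at h1 h2
    set R := (Finset.univ.map j)ᶜ
    have hle : ∀ i ∈ R, e i ≤ 5 := by
      intro i hi
      have := sq_add_card_le hpos (s := 29) (by omega) hi
      rw [show R.card = 3 by omega] at this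
      by_contra! h3
      nlinarith
    refine ⟨by rw [hsup j (by norm_num) hj (hout j hj fun i hi => (hle i hi).trans (by norm_num))],
      ?_⟩
    -- As `0 ≤ (e - 3)² ≤ 4`, the sum of the three dimensions is `8` or `9`.
    have h3 : ∑ i ∈ R, 6 * e i ≤ ∑ i ∈ R, (e i ^ 2 + 9) := by
      refine Finset.sum_le_sum fun i hi => ?_
      have h2 := hle i hi
      interval_cases e i <;> norm_num
    have h4 : ∑ i ∈ R, (e i ^ 2 + 9) ≤ ∑ i ∈ R, (6 * e i + 4) := by
      refine Finset.sum_le_sum fun i hi => ?_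
      have h2 := hle i hi
      have h3 := hpos i
      interval_cases e i <;> norm_num
    -- the two possibilities left are separated by parity
    have h5 : Even (∑ i ∈ R, (e i ^ 2 + e i)) := by
      refine Finset.even_sum _ fun i _ => ?_
      rw [pow_two, ← Nat.mul_succ]
      exact Nat.even_mul_succ_self _
    obtain ⟨u, hu⟩ := h5
    simp only [Finset.sum_add_distrib, ← Finset.mul_sum, Finset.sum_const, smul_eq_mul] at h3 h4 hu
    omega

end Dimensions

/-! ### Recognizing the class of a finite subgroup -/

section Types

variable {H : Type*} [Group H] [Fintype H] {f : H →* SL2} {a b h : ℕ}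

/-- In the non-commutative classes the module `V` is irreducible of dimension two, so the degrees of
a commutative group are those of the first class. -/
lemma HasType.of_comm (hT : HasType f a b h) (hc : ∀ x y : H, x * y = y * x) :
    a = 2 ∧ b = Nat.card H ∧ h = Nat.card H := by
  have hadd := hT.1.add
  have hmul := hT.1.mul
  suffices h2 : a = 2 by subst h2; omega
  by_contra h2
  have hab : 2 * 1 < a ∧ 2 * 1 < b := by rcases hT.2 with ⟨rfl, -⟩ | h3 | h3 | h3 | h3 <;> omega
  obtain ⟨π, hπ, -⟩ := hT.1.exists_irreducible hab.1 hab.2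
  have hcomm : IsMulCommutative H := ⟨⟨hc⟩⟩
  have := IsIrreducible.finrank_eq_one_of_isMulCommutative π
  rw [finrank_fin_fun] at this
  omega

/-- Only the binary dihedral groups are non-commutative with a commutative subgroup of index two:
in the polyhedral cases `S²(V)` is irreducible of dimension three. -/
lemma HasType.dihedral (hT : HasType f a b h) {K : Subgroup H} (hK : K.index = 2)
    (hKc : ∀ x ∈ K, ∀ y ∈ K, x * y = y * x) (hH : ∃ x y : H, x * y ≠ y * x) :
    ∃ m, 2 ≤ m ∧ Nat.card H = 4 * m ∧ a = 4 ∧ b = 2 * m ∧ h = 2 * m + 2 := by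
  obtain ⟨hd, hT⟩ := hT
  obtain ⟨x, y, hxy⟩ := hH
  by_cases hab : 2 * 2 < a ∧ 2 * 2 < b
  · obtain ⟨π, hπ, -⟩ := hd.exists_irreducible hab.1 hab.2
    have := finrank_le_two hπ hK hKc
    rw [finrank_fin_fun] at this
    omega
  · rcases hT with ⟨-, hc⟩ | ⟨m, hm, h1, h2, h3, h4, -⟩ | h3 | h3 | h3
    · exact absurd (hc x y) hxy
    · exact ⟨m, hm, h1, h2, h3, h4⟩
    all_goals omega

/-- If the squares do not commute, there is no commutative subgroup of index two. -/
lemma HasType.polyhedral (hT : HasType f a b h)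
    (hH : ∃ x y : H, x ^ 2 * y ^ 2 ≠ y ^ 2 * x ^ 2) :
    (Nat.card H = 24 ∧ a = 6 ∧ b = 8 ∧ h = 12) ∨ (Nat.card H = 48 ∧ a = 8 ∧ b = 12 ∧ h = 18) ∨
      (Nat.card H = 120 ∧ a = 12 ∧ b = 20 ∧ h = 30) := by
  obtain ⟨x, y, hxy⟩ := hH
  rcases hT.2 with ⟨-, hc⟩ | ⟨m, -, -, -, -, -, ⟨K, hK, hKc⟩, -⟩ | h3 | h3 | h3
  · exact absurd (hc _ _) hxy
  · exact absurd (hKc _ (Subgroup.sq_mem_of_index_two hK x) _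
      (Subgroup.sq_mem_of_index_two hK y)) hxy
  all_goals omega

/-- Only for cyclic groups of odd order is `h` odd. -/
lemma HasType.even_h (hT : HasType f a b h) (he : Even (Nat.card H)) : Even h := by
  have hadd := hT.1.add
  have hmul := hT.1.mul
  rcases hT.2 with ⟨rfl, -⟩ | ⟨m, -, -, -, -, rfl, -⟩ | h3 | h3 | h3
  · obtain ⟨k, hk⟩ := he
    exact ⟨k, by omega⟩
  · exact ⟨m + 1, by ring⟩
  · exact ⟨6, by omega⟩
  · exact ⟨9, by omega⟩
  · exact ⟨15, by omega⟩

/-- Groups of order at most four are commutative. -/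
lemma commutator_mem_of_index {G : Type*} [Group G] {N : Subgroup G} [N.Normal]
    (hN : N.index = 1 ∨ N.index = 2 ∨ N.index = 3 ∨ N.index = 4) (x y : G) :
    x⁻¹ * y⁻¹ * x * y ∈ N := by
  have hc : ∀ u v : G ⧸ N, u * v = v * u := by
    rw [Subgroup.index_eq_card] at hN
    have hcyc : ∀ p, p.Prime → Nat.card (G ⧸ N) = p → ∀ u v : G ⧸ N, u * v = v * u := by
      intro p hp h
      have : Fact p.Prime := ⟨hp⟩
      have := isCyclic_of_prime_card h
      exact (IsCyclic.isMulCommutative (α := G ⧸ N)).is_comm.comm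
    rcases hN with h | h | h | h
    · have := (Nat.card_eq_one_iff_unique.1 h).1
      exact fun u v => Subsingleton.elim _ _
    · exact hcyc 2 Nat.prime_two h
    · exact hcyc 3 Nat.prime_three h
    · have : Fact (Nat.Prime 2) := ⟨Nat.prime_two⟩
      exact (IsPGroup.isMulCommutative_of_card_eq_prime_sq (p := 2) h).is_comm.comm
  rw [← QuotientGroup.eq_one_iff]
  simp only [QuotientGroup.mk_mul, QuotientGroup.mk_inv]
  rw [hc (x : G ⧸ N)⁻¹]
  group

end Types

/-! ### Dimensions for the distinguished pairs -/

section Pairs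

variable {G : Type*} [Group G] [Fintype G] {f : G →* SL2} (hf : Function.Injective f)
  {N : Subgroup G} [N.Normal] [Fintype N] {τ : Type*} [Fintype τ] {r : τ → ℕ}
  {ρ : ∀ i, Representation ℂ G (Fin (r i) → ℂ)} {a b h : ℕ}

lemma injective_comp_subtype {G : Type*} [Group G] {f : G →* SL2} (hf : Function.Injective f)
    (N : Subgroup G) : Function.Injective (f.comp N.subtype) :=
  hf.comp N.subtype_injective

omit [Fintype G] in
/-- Two subgroups of even order both contain `-1`, the only involution of `SL₂(ℂ)`. -/
lemma exists_common_neg_one [Finite G] (hf : Function.Injective f) {K L : Subgroup G}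
    (hK : Even (Nat.card K)) (hL : Even (Nat.card L)) : ∃ z ∈ K, z ∈ L ∧ (f z).1 = -1 := by
  have := Fintype.ofFinite K
  have := Fintype.ofFinite L
  obtain ⟨z, hz⟩ := exists_neg_one (injective_comp_subtype hf K) hK
  obtain ⟨w, hw⟩ := exists_neg_one (injective_comp_subtype hf L) hL
  have : (z : G) = w := hf (Subtype.ext (hz.trans hw.symm))
  exact ⟨z, z.2, this ▸ w.2, hz⟩

omit [N.Normal] [Fintype τ] in
/-- An irreducible symmetric power of `G` occurs in a restriction list; its norm on `N` counts the
invariants of `N` in `S^0, S^2, …, S^{2k}`. -/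
lemma IsRestrictionList.exists_symPow_index (hρ : IsRestrictionList N ρ) {n : τ → ℕ}
    (hn : ∀ i, ∑ g : N, (ρ i).character g * (ρ i).character ((g : G)⁻¹) = Nat.card N * n i)
    (hd : HasDegrees f a b h) {k m : ℕ} (ha : 2 * k < a) (hb : 2 * k < b)
    (hm : ∑ j ∈ Finset.range (k + 1), PowerSeries.coeff (2 * j)
      (∑ g : N, molien (tr ((f.comp N.subtype) g))) = Nat.card N * m) :
    ∃ i, r i = k + 1 ∧ n i = m := by
  obtain ⟨π, hπ, hch⟩ := hd.exists_irreducible ha hb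
  refine hρ.exists_index hn hπ ?_
  rw [← hm, ← sum_sq_coeff_molien]
  exact Finset.sum_congr rfl fun g _ => by rw [hch, hch]; rfl

omit [N.Normal] [Fintype τ] in
/-- The trivial module occurs in a restriction list. -/
lemma IsRestrictionList.exists_one (hρ : IsRestrictionList N ρ) {n : τ → ℕ}
    (hn : ∀ i, ∑ g : N, (ρ i).character g * (ρ i).character ((g : G)⁻¹) = Nat.card N * n i)
    (hd : HasDegrees f a b h) : ∃ i, r i = 1 := by
  obtain ⟨i, hi, -⟩ := hρ.exists_symPow_index hn hd (k := 0) (m := 1) (by simpa using hd.a_pos)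
    (by simpa using hd.b_pos) (by
      rw [Finset.sum_range_one, mul_zero, coeff_zero_sum_molien, Nat.cast_one, mul_one])
  exact ⟨i, by simpa using hi⟩

omit [N.Normal] [Fintype N] [Fintype τ] [Fintype G] in
lemma IsRestrictionList.pos (hρ : IsRestrictionList N ρ) (i : τ) : 0 < r i :=
  finrank_pos_of_irreducible (hρ.irreducible i)

/-- Counting the dimensions and norms of a restriction list when they are at most two. -/
lemma exists_count {n : τ → ℕ}
    (h2 : ∀ i, (r i = 1 ∧ n i = 1) ∨ (r i = 2 ∧ n i = 1) ∨ (r i = 2 ∧ n i = 2)) :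
    ∃ s u v : ℕ, Fintype.card τ = s + u + v ∧ ∑ i, (r i : ℚ) ^ 2 / n i = s + 4 * u + 2 * v ∧
      ∑ i, r i = s + 2 * u + 2 * v ∧ ((∃ i, r i = 1) → 0 < s) ∧
      ((∀ i, n i = 1 → r i = 1) → u = 0) := by
  classical
  -- The numbers `s`, `u`, `v` count the members with dimension and norm `(1, 1)`, `(2, 1)`, `(2,
  -- 2)`.
  refine ⟨∑ i, if r i = 1 then 1 else 0, ∑ i, if r i = 2 ∧ n i = 1 then 1 else 0,
    ∑ i, if r i = 2 ∧ n i = 2 then 1 else 0, ?_, ?_, ?_, ?_, ?_⟩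
  · rw [← Finset.sum_add_distrib, ← Finset.sum_add_distrib, Fintype.card_eq_sum_ones]
    refine Finset.sum_congr rfl fun i _ => ?_
    rcases h2 i with h | h | h <;> simp [h]
  · push_cast
    rw [Finset.mul_sum, Finset.mul_sum, ← Finset.sum_add_distrib, ← Finset.sum_add_distrib]
    refine Finset.sum_congr rfl fun i _ => ?_
    rcases h2 i with h | h | h <;> simp [h] <;> norm_num
  · rw [Finset.mul_sum, Finset.mul_sum, ← Finset.sum_add_distrib, ← Finset.sum_add_distrib]
    refine Finset.sum_congr rfl fun i _ => ?_
    rcases h2 i with h | h | h <;> simp [h]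
  · rintro ⟨i, hi⟩
    exact lt_of_lt_of_le (by simp [hi])
      (Finset.single_le_sum (f := fun i => if r i = 1 then 1 else 0) (fun _ _ => Nat.zero_le _)
        (Finset.mem_univ i))
  · intro h1
    refine Finset.sum_eq_zero fun i _ => if_neg fun h => ?_
    have := h1 i h.2
    omega

include hf

/-- The pairs `D_n ⊲ D_{2n}`. -/
theorem HasType.sum_dim_dihedral_dihedral (hρ : IsRestrictionList N ρ)
    (hT : HasType (f.comp N.subtype) a b h) {K : Subgroup G} (hK : K.index = 2)
    (hKc : ∀ x ∈ K, ∀ y ∈ K, x * y = y * x) (hN : ∃ x ∈ N, ∃ y ∈ N, x * y ≠ y * x)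
    (hi : N.index = 2) : h = ∑ i, r i := by
  obtain ⟨x, hx, y, hy, hxy⟩ := hN
  have hKn := Subgroup.normal_of_index_eq_two hK
  -- `N` is not contained in `K`, as it is not commutative.
  have hrel : K.relIndex N = 2 := by
    have h1 := Subgroup.relIndex_dvd_index_of_normal K N
    rw [hK] at h1
    refine ((Nat.dvd_prime Nat.prime_two).1 h1).resolve_left fun h2 => ?_
    rw [Subgroup.relIndex_eq_one] at h2
    exact hxy (hKc x (h2 hx) y (h2 hy))
  obtain ⟨m, hm, hcN, -, -, rfl⟩ := hT.dihedral (K := K.subgroupOf N) hrel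
    (fun u hu v hv => Subtype.ext (hKc u hu v hv))
    ⟨⟨x, hx⟩, ⟨y, hy⟩, fun h => hxy (congrArg Subtype.val h)⟩
  have hcG := N.card_mul_index
  have hcK := K.card_mul_index
  rw [hi, hcN] at hcG
  rw [hK, ← hcG] at hcK
  have hcNK : Nat.card (N ⊓ K : Subgroup G) = 2 * m := by
    have h1 := (K.subgroupOf N).card_mul_index
    rw [show (K.subgroupOf N).index = 2 from hrel, hcN] at h1
    rw [inf_comm, ← Subgroup.subgroupOf_map_subtype,
      Subgroup.card_map_of_injective N.subtype_injective]
    omega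
  obtain ⟨z, hzK, hzN, hz⟩ := exists_common_neg_one hf (K := K) (L := N)
    ⟨2 * m, by omega⟩ ⟨2 * m, by omega⟩
  obtain ⟨n, hn, hnorm, hsum, hcard⟩ := hρ.exists_norms
    (commutator_mem_of_index (by omega))
  rw [sum_card_centralizer_subgroup hf hK hKc ⟨x, y, hxy⟩ hz hzK N hzN, hcNK, hcN,
    show Nat.card K = 4 * m by omega, ← hcG] at hcard
  have hcardτ : Fintype.card τ = m + 2 := by
    obtain ⟨k, rfl⟩ : ∃ k, m = k + 1 := ⟨m - 1, by omega⟩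
    rw [show 2 * (k + 1) - 2 = 2 * k by omega,
      show 4 * (k + 1) - 2 * (k + 1) = 2 * (k + 1) by omega] at hcard
    apply Nat.eq_of_mul_eq_mul_right (show 0 < 4 * (k + 1) * 2 by omega)
    rw [hcard]
    ring
  obtain ⟨aG, bG, hG, hTG⟩ := exists_hasType hf
  have hr : ∀ i, r i ≤ 2 := fun i => by
    have := finrank_le_two (hρ.irreducible i) hK hKc
    rwa [finrank_fin_fun] at this
  -- The equations `s + u + v = m + 2` and `s + 4 u + 2 v = 4 m` give `s = 2 (u - m + 2)` and `v = 3
  -- (m - u) - 2`, so that `s > 0` and `v ≥ 0` force `u = m - 1`, `s = 2`, `v = 1`.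
  obtain ⟨s, u, v, h1, h2, h3, h4, -⟩ := exists_count (r := r) (n := n) fun i => by
    have h1 := hr i
    obtain ⟨h2, h3, h4⟩ := hn i
    have h5 := hρ.pos i
    rw [hi] at h4
    interval_cases r i <;> omega
  have hs := h4 (hρ.exists_one hnorm hTG.1)
  rw [h2, hcN] at hsum
  have hsum' : s + 4 * u + 2 * v = 4 * m := by exact_mod_cast hsum
  omega

/-- The pairs `C_{2n} ⊲ D_n`. -/
theorem HasType.sum_dim_cyclic_dihedral (hρ : IsRestrictionList N ρ)
    (hT : HasType (f.comp N.subtype) a b h) (hNc : ∀ x ∈ N, ∀ y ∈ N, x * y = y * x)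
    (hG : ∃ x y : G, x * y ≠ y * x) (he : Even (Nat.card N))
    (hi : N.index = 2) : h = ∑ i, r i := by
  obtain ⟨m, hm⟩ := he
  obtain ⟨-, -, rfl⟩ := hT.of_comm fun x y => Subtype.ext (hNc x x.2 y y.2)
  have hcG := N.card_mul_index
  rw [hi, hm] at hcG
  obtain ⟨z, hzK, hzN, hz⟩ := exists_common_neg_one hf (K := N) (L := N) ⟨m, hm⟩ ⟨m, hm⟩
  obtain ⟨n, hn, hnorm, hsum, hcard⟩ := hρ.exists_norms
    (commutator_mem_of_index (by omega))
  have hmpos : 0 < m := by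
    have := Nat.card_pos (α := N)
    omega
  rw [sum_card_centralizer_subgroup hf hi hNc hG hz hzK N hzN, inf_idem, Nat.sub_self, hm,
    ← hcG] at hcard
  have hcardτ : Fintype.card τ = m + 1 := by
    obtain ⟨k, rfl⟩ : ∃ k, m = k + 1 := ⟨m - 1, by omega⟩
    rw [show k + 1 + (k + 1) - 2 = 2 * k by omega] at hcard
    apply Nat.eq_of_mul_eq_mul_right (show 0 < (k + 1 + (k + 1)) * 2 by omega)
    rw [hcard]
    ring
  have hr : ∀ i, r i ≤ 2 := fun i => by
    have := finrank_le_two (hρ.irreducible i) hi hNc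
    rwa [finrank_fin_fun] at this
  -- A member with norm one is irreducible for the commutative group `N`, so `u = 0`; then `s + v =
  -- m + 1` and `s + 2 v = 2 m` determine `s` and `v`.
  obtain ⟨s, u, v, h1, h2, h3, -, h5⟩ := exists_count (r := r) (n := n) fun i => by
    have h1 := hr i
    obtain ⟨h2, h3, h4⟩ := hn i
    have h5 := hρ.pos i
    rw [hi] at h4
    interval_cases r i <;> omega
  have hu : u = 0 := h5 fun i hi => by
    have h6 := hnorm i
    rw [hi, Nat.cast_one, mul_one] at h6
    have h7 := isIrreducible_of_norm_eq_one (res N (ρ i)) h6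
    have hcomm : IsMulCommutative N := ⟨⟨fun x y => Subtype.ext (hNc x x.2 y y.2)⟩⟩
    have := IsIrreducible.finrank_eq_one_of_isMulCommutative (res N (ρ i))
    rwa [finrank_fin_fun] at this
  rw [h2, hm] at hsum
  have hsum' : s + 4 * u + 2 * v = m + m := by exact_mod_cast hsum
  omega

omit hf [Fintype τ] [Fintype N] [Fintype G] [N.Normal] in
/-- If `N` is generated by a commutator of `G`, then it acts trivially in all modules of dimension
one, so these have the same restriction. -/
lemma IsRestrictionList.eq_of_dim_one (hρ : IsRestrictionList N ρ) {u v : G}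
    (hN : N ≤ Subgroup.zpowers (u * v * u⁻¹ * v⁻¹)) {i j : τ} (hi : r i = 1) (hj : r j = 1) :
    i = j := by
  have htriv : ∀ k, r k = 1 → ∀ g ∈ N, ρ k g = 1 := by
    intro k hk g hg
    have hfin : finrank ℂ (Fin (r k) → ℂ) = 1 := by rw [finrank_fin_fun, hk]
    have hcomm : ∀ S T : Module.End ℂ (Fin (r k) → ℂ), S * T = T * S := by
      intro S T
      obtain ⟨c, hc, -⟩ := LinearMap.existsUnique_eq_smul_id_of_finrank_eq_one hfin S
      rw [hc]
      ext x
      simp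
    have h1 : ρ k (u * v * u⁻¹ * v⁻¹) = 1 := by
      rw [map_mul, map_mul, map_mul, hcomm (ρ k u), mul_assoc (ρ k v), ← map_mul, mul_inv_cancel,
        map_one, mul_one, ← map_mul, mul_inv_cancel, map_one]
    obtain ⟨l, rfl⟩ := Subgroup.mem_zpowers_iff.1 (hN hg)
    have h2 : (u * v * u⁻¹ * v⁻¹) ∈ (ρ k).ker := h1
    exact Subgroup.zpow_mem _ h2 l
  have hdim : r i = r j := hi.trans hj.symm
  refine hρ.inequivalent i j ⟨Representation.Equiv.mk
    (LinearEquiv.funCongrLeft ℂ ℂ (finCongr hdim.symm)) fun g => ?_⟩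
  change _ ∘ₗ (ρ i g) = (ρ j g) ∘ₗ _
  rw [htriv i hi g g.2, htriv j hj g g.2]
  rfl

/-- The pairs `C_{2n} ⊲ D_{2n}`: here `N` is generated by a commutator of `G`. -/
theorem HasType.sum_dim_cyclic_dihedral_four (hρ : IsRestrictionList N ρ)
    (hT : HasType (f.comp N.subtype) a b h) {K : Subgroup G} (hK : K.index = 2)
    (hKc : ∀ x ∈ K, ∀ y ∈ K, x * y = y * x) (hG : ∃ x y : G, x * y ≠ y * x) (hNK : N ≤ K)
    (he : Even (Nat.card N)) {u v : G} (hN : N ≤ Subgroup.zpowers (u * v * u⁻¹ * v⁻¹))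
    (hi : N.index = 4) : h + 1 = ∑ i, r i := by
  obtain ⟨m, hm⟩ := he
  obtain ⟨-, -, rfl⟩ := hT.of_comm fun x y => Subtype.ext (hKc x (hNK x.2) y (hNK y.2))
  have hcG := N.card_mul_index
  have hcK := K.card_mul_index
  rw [hi, hm] at hcG
  rw [hK, ← hcG] at hcK
  obtain ⟨z, hzK, hzN, hz⟩ := exists_common_neg_one hf (K := K) (L := N) ⟨m + m, by omega⟩ ⟨m, hm⟩
  obtain ⟨n, hn, hnorm, hsum, hcard⟩ := hρ.exists_norms
    (commutator_mem_of_index (by omega))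
  have hmpos : 0 < m := by
    have := Nat.card_pos (α := N)
    omega
  rw [sum_card_centralizer_subgroup hf hK hKc hG hz hzK N hzN, inf_eq_left.2 hNK, Nat.sub_self, hm,
    show Nat.card K = 4 * m by omega, ← hcG] at hcard
  have hcardτ : Fintype.card τ = m + 1 := by
    obtain ⟨k, rfl⟩ : ∃ k, m = k + 1 := ⟨m - 1, by omega⟩
    rw [show k + 1 + (k + 1) - 2 = 2 * k by omega] at hcard
    apply Nat.eq_of_mul_eq_mul_right (show 0 < (k + 1 + (k + 1)) * 4 by omega)
    rw [hcard]
    ring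
  have hr : ∀ i, r i ≤ 2 := fun i => by
    have := finrank_le_two (hρ.irreducible i) hK hKc
    rwa [finrank_fin_fun] at this
  obtain ⟨aG, bG, hG', hTG⟩ := exists_hasType hf
  obtain ⟨i₀, hi₀⟩ := hρ.exists_one hnorm hTG.1
  classical
  -- Only one member has dimension one.
  have hother : ∀ i ∈ Finset.univ.erase i₀, r i = 2 := by
    intro i hi
    have h1 := hr i
    have h2 := hρ.pos i
    have h3 : r i ≠ 1 := fun h => Finset.ne_of_mem_erase hi (hρ.eq_of_dim_one hN h hi₀)
    omega
  rw [← Finset.add_sum_erase _ _ (Finset.mem_univ i₀), hi₀, Finset.sum_congr rfl hother,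
    Finset.sum_const, Finset.card_erase_of_mem (Finset.mem_univ _), Finset.card_univ, hcardτ,
    smul_eq_mul, hm]
  omega

/-- The pair `T ⊲ O`. -/
theorem HasType.sum_dim_tetrahedral_octahedral (hρ : IsRestrictionList N ρ)
    (hT : HasType (f.comp N.subtype) a b h)
    (hN : ∃ x ∈ N, ∃ y ∈ N, x ^ 2 * y ^ 2 ≠ y ^ 2 * x ^ 2) (hcN : Nat.card N = 24)
    (hi : N.index = 2) : h = ∑ i, r i := by
  classical
  obtain ⟨x, hx, y, hy, hxy⟩ := hN
  have hcG := N.card_mul_index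
  rw [hi, hcN] at hcG
  obtain ⟨rfl, rfl, rfl⟩ : a = 6 ∧ b = 8 ∧ h = 12 := by
    rcases hT.polyhedral ⟨⟨x, hx⟩, ⟨y, hy⟩, fun h => hxy (congrArg Subtype.val h)⟩ with
      h1 | h1 | h1 <;> omega
  obtain ⟨a, b, h, hTG⟩ := exists_hasType hf
  obtain ⟨rfl, rfl, rfl⟩ : a = 8 ∧ b = 12 ∧ h = 18 := by
    rcases hTG.polyhedral ⟨x, y, hxy⟩ with h1 | h1 | h1 <;> omega
  obtain ⟨n, hn, hnorm, hsum, -⟩ := hρ.exists_norms (commutator_mem_of_index (by omega))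
  have h0 := coeff_zero_sum_molien (f := f.comp N.subtype)
  have h2 := hT.1.coeff_sum_molien (k := 2) (by norm_num) (by norm_num)
  have h4 := hT.1.coeff_sum_molien (k := 4) (by norm_num) (by norm_num)
  have h6 := hT.1.coeff_sum_molien (k := 6) (by norm_num) (by norm_num)
  generalize hM : ∑ g : N, molien (tr ((f.comp N.subtype) g)) = M at h0 h2 h4 h6
  norm_num at h2 h4 h6
  -- The powers `S^0, …, S^3` are irreducible for `G`, with norms `1, 1, 1, 2` on `N`.
  have hex : ∀ k : Fin 4, ∃ i, r i = k + 1 ∧ n i = if (k : ℕ) = 3 then 2 else 1 := by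
    intro k
    refine hρ.exists_symPow_index hnorm hTG.1 (by omega) (by omega) ?_
    rw [hM]
    rw [PowerSeries.coeff_zero_eq_constantCoeff_apply] at h0
    fin_cases k <;> simp [Finset.sum_range_succ, h0, h2, h4, h6, mul_two]
  choose j₀ hj₀ using hex
  let j : Fin 4 ↪ τ := ⟨j₀, fun k l hkl => Fin.ext (by
    have h1 := (hj₀ k).1
    rw [hkl, (hj₀ l).1] at h1
    omega)⟩
  have hj : ∀ k, r (j k) = k + 1 ∧ n (j k) = if (k : ℕ) = 3 then 2 else 1 := hj₀
  have h1 := sum_eq_sum_add_sum_compl j fun i => (r i : ℚ) ^ 2 / n i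
  have h3 := sum_eq_sum_add_sum_compl j r
  rw [hsum, hcN] at h1
  simp only [hj, Fin.sum_univ_succ, Fin.sum_univ_zero] at h1 h3
  norm_num [Fin.val_succ] at h1 h3
  set R := (Finset.univ.map j)ᶜ
  have hR : ∑ i ∈ R, (r i : ℚ) ^ 2 / n i = 2 := by linarith
  -- the dimension-to-norm ratios that are left are so small that they equal the dimensions
  have hle : ∀ i ∈ R, (r i : ℚ) ^ 2 / n i = r i := by
    intro i hiR
    have hle := Finset.single_le_sum (f := fun i => (r i : ℚ) ^ 2 / n i)
      (fun i _ => by positivity) hiR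
    rw [hR] at hle
    obtain ⟨hn1, hn2, hn3⟩ := hn i
    have hr := hρ.pos i
    rw [div_le_iff₀ (by exact_mod_cast hn1)] at hle
    have hle' : r i ^ 2 ≤ 2 * n i := by exact_mod_cast hle
    rw [hi] at hn3
    have hr2 : r i ≤ 2 := by nlinarith
    have : n i = r i := by interval_cases r i <;> omega
    have hr' : (r i : ℚ) ≠ 0 := by exact_mod_cast hr.ne'
    rw [this]
    field_simp
  rw [Finset.sum_congr rfl hle] at hR
  have hR' : ∑ i ∈ R, r i = 2 := by exact_mod_cast hR
  omega

/-- The pair `D_2 ⊲ T`. -/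
theorem HasType.sum_dim_dihedral_tetrahedral (hρ : IsRestrictionList N ρ)
    (hT : HasType (f.comp N.subtype) a b h)
    (hG : ∃ x y : G, x ^ 2 * y ^ 2 ≠ y ^ 2 * x ^ 2)
    (hN : ∃ x ∈ N, ∃ y ∈ N, x * y ≠ y * x) (hcN : Nat.card N = 8)
    (hi : N.index = 3) : h = ∑ i, r i := by
  classical
  obtain ⟨x, hx, y, hy, hxy⟩ := hN
  have hcG := N.card_mul_index
  rw [hi, hcN] at hcG
  obtain ⟨rfl, rfl, rfl⟩ : a = 4 ∧ b = 4 ∧ h = 6 := by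
    rcases hT.2 with ⟨-, hc⟩ | h1 | h1 | h1 | h1
    · exact absurd (congrArg Subtype.val (hc ⟨x, hx⟩ ⟨y, hy⟩)) hxy
    all_goals omega
  obtain ⟨a, b, h, hTG⟩ := exists_hasType hf
  obtain ⟨rfl, rfl, rfl⟩ : a = 6 ∧ b = 8 ∧ h = 12 := by
    rcases hTG.polyhedral hG with h1 | h1 | h1 <;> omega
  obtain ⟨n, hn, hnorm, hsum, -⟩ := hρ.exists_norms (commutator_mem_of_index (by omega))
  have h0 := coeff_zero_sum_molien (f := f.comp N.subtype)
  have h2 := hT.1.coeff_sum_molien (k := 2) (by norm_num) (by norm_num)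
  have h4 := hT.1.coeff_sum_molien (k := 4) (by norm_num) (by norm_num)
  generalize hM : ∑ g : N, molien (tr ((f.comp N.subtype) g)) = M at h0 h2 h4
  norm_num at h2 h4
  -- The powers `S^0, S^1, S^2` are irreducible for `G`, with norms `1, 1, 3` on `N`.
  have hex : ∀ k : Fin 3, ∃ i, r i = k + 1 ∧ n i = if (k : ℕ) = 2 then 3 else 1 := by
    intro k
    refine hρ.exists_symPow_index hnorm hTG.1 (by omega) (by omega) ?_
    rw [hM]
    rw [PowerSeries.coeff_zero_eq_constantCoeff_apply] at h0
    fin_cases k <;> simp [Finset.sum_range_succ, h0, h2, h4]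
    ring
  choose j₀ hj₀ using hex
  let j : Fin 3 ↪ τ := ⟨j₀, fun k l hkl => Fin.ext (by
    have h1 := (hj₀ k).1
    rw [hkl, (hj₀ l).1] at h1
    omega)⟩
  have hj : ∀ k, r (j k) = k + 1 ∧ n (j k) = if (k : ℕ) = 2 then 3 else 1 := hj₀
  have h1 := sum_eq_sum_add_sum_compl j fun i => (r i : ℚ) ^ 2 / n i
  have h3 := sum_eq_sum_add_sum_compl j r
  rw [hsum, hcN] at h1
  simp only [hj, Fin.sum_univ_succ, Fin.sum_univ_zero] at h1 h3
  norm_num [Fin.val_succ] at h1 h3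
  set R := (Finset.univ.map j)ᶜ
  -- the mass formula leaves nothing else
  have hR : R = ∅ := by
    by_contra! hne
    have := Finset.sum_pos (f := fun i => (r i : ℚ) ^ 2 / n i) (s := R) (fun i _ => by
      have h5 := hρ.pos i
      have h6 := (hn i).1
      positivity) hne
    linarith
  rw [hR, Finset.sum_empty] at h3
  omega

end Pairs

end McKaySlodowy

namespace McKaySlodowy

/-! ### Cyclic and binary dihedral groups -/

section ExplicitGroups

/-- If `x` normalizes `K` and `p` is the least power of `x` in `K`, a prime, then `K` has index `p`
in the group generated by `K` and `x`. -/
lemma card_zpowers_sup {Q : Type*} [Group Q] {K : Subgroup Q} {x : Q} {p : ℕ} (hp : p.Prime)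
    (hx : x ∈ Subgroup.normalizer (K : Set Q)) (hxp : x ^ p ∈ K) (hxK : x ∉ K) :
    Nat.card (Subgroup.zpowers x ⊔ K : Subgroup Q) = p * Nat.card K := by
  set L := Subgroup.zpowers x ⊔ K with hL
  have hKn : (K.subgroupOf L).Normal :=
    Subgroup.normal_subgroupOf_sup_of_le_normalizer (Subgroup.zpowers_le.2 hx)
  have hKL : K ≤ L := le_sup_right
  have hZL : Subgroup.zpowers x ≤ L := le_sup_left
  let x' : L := ⟨x, hZL (Subgroup.mem_zpowers x)⟩
  have hZ : (Subgroup.zpowers x).subgroupOf L = Subgroup.zpowers x' := by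
    apply Subgroup.map_injective L.subtype_injective
    rw [Subgroup.map_subgroupOf_eq_of_le hZL, MonoidHom.map_zpowers]
    rfl
  -- The quotient is generated by the image of `x`, which has order `p`.
  have hidx : (K.subgroupOf L).index = p := by
    rw [← Subgroup.relIndex_top_right, ← Subgroup.subgroupOf_self L]
    conv_lhs => rw [hL]
    rw [← hL, Subgroup.subgroupOf_sup hZL hKL, Subgroup.relIndex_sup_right, hZ,
      ← QuotientGroup.ker_mk' (K.subgroupOf L), Subgroup.relIndex_ker, MonoidHom.map_zpowers,
      Nat.card_zpowers]
    have := Fact.mk hp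
    apply orderOf_eq_prime
    · rw [← map_pow, ← MonoidHom.mem_ker, QuotientGroup.ker_mk']
      exact hxp
    · rw [Ne, ← MonoidHom.mem_ker, QuotientGroup.ker_mk']
      exact hxK
  rw [← (K.subgroupOf L).card_mul_index, hidx, mul_comm,
    Nat.card_congr (Subgroup.subgroupOfEquivOfLe hKL).toEquiv]

/-- For a finite subgroup it is enough that conjugation maps the generators into it. -/
lemma mem_normalizer_closure {Q : Type*} [Group Q] {s : Set Q} [Finite (Subgroup.closure s)] {x : Q}
    (hx : ∀ g ∈ s, x * g * x⁻¹ ∈ Subgroup.closure s) :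
    x ∈ Subgroup.normalizer (Subgroup.closure s : Set Q) := by
  have h : Subgroup.closure s ≤ (Subgroup.closure s).comap (MulAut.conj x).toMonoidHom :=
    (Subgroup.closure_le _).2 fun g hg => hx g hg
  have : Finite ((Subgroup.closure s : Subgroup Q) : Set Q) := ‹_›
  exact Subgroup.mem_normalizer_fintype fun n hn => h hn

lemma rot_add (θ η : ℝ) : rot (θ + η) = rot θ * rot η := by
  apply Subtype.ext
  rw [Matrix.SpecialLinearGroup.coe_mul]
  ext i j
  fin_cases i <;> fin_cases j <;> simp [rot, ← Complex.exp_add] <;> ring_nf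

lemma rot_zero : rot 0 = 1 := by
  apply Subtype.ext
  ext i j
  fin_cases i <;> fin_cases j <;> simp [rot]

lemma rot_pow (θ : ℝ) (k : ℕ) : rot θ ^ k = rot (k * θ) := by
  induction k with
  | zero => simp [rot_zero]
  | succ k ih => rw [pow_succ, ih, ← rot_add]; congr 1; push_cast; ring

lemma rot_inv (θ : ℝ) : (rot θ)⁻¹ = rot (-θ) := by
  rw [inv_eq_iff_mul_eq_one, ← rot_add, add_neg_cancel, rot_zero]

lemma rot_eq_one_iff (θ : ℝ) : rot θ = 1 ↔ Complex.exp (θ * Complex.I) = 1 := by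
  constructor
  · intro h
    have := congrFun (congrFun (congrArg Subtype.val h) 0) 0
    simpa [rot] using this
  · intro h
    apply Subtype.ext
    ext i j
    fin_cases i <;> fin_cases j <;> simp [rot, h, Complex.exp_neg]

lemma orderOf_rot {m : ℕ} (hm : m ≠ 0) : orderOf (rot (2 * Real.pi / m)) = m := by
  have hζ := Complex.isPrimitiveRoot_exp m hm
  have key : ∀ k : ℕ, rot (2 * Real.pi / m) ^ k = 1 ↔ m ∣ k := by
    intro k
    rw [rot_pow, rot_eq_one_iff, ← hζ.pow_eq_one_iff_dvd, ← Complex.exp_nat_mul]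
    push_cast
    rw [show (k : ℂ) * (2 * Real.pi / m) * Complex.I = k * (2 * Real.pi * Complex.I / m) by ring]
  exact Nat.dvd_antisymm (orderOf_dvd_of_pow_eq_one ((key m).2 dvd_rfl))
    ((key _).1 (pow_orderOf_eq_one _))

lemma card_cyclicSubgroup {m : ℕ} (hm : m ≠ 0) : Nat.card (cyclicSubgroup m) = m := by
  rw [cyclicSubgroup, Nat.card_zpowers, orderOf_rot hm]

lemma cyclicSubgroup_comm (m : ℕ) : ∀ x ∈ cyclicSubgroup m, ∀ y ∈ cyclicSubgroup m,
    x * y = y * x := by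
  intro x hx y hy
  obtain ⟨k, rfl⟩ := Subgroup.mem_zpowers_iff.1 hx
  obtain ⟨l, rfl⟩ := Subgroup.mem_zpowers_iff.1 hy
  exact ((Commute.refl _).zpow_zpow k l).eq

lemma cyclicSubgroup_two_mul (n : ℕ) :
    cyclicSubgroup (2 * n) = Subgroup.zpowers (rot (Real.pi / n)) := by
  rw [cyclicSubgroup]
  congr 2
  push_cast
  exact mul_div_mul_left _ _ two_ne_zero

lemma quatJ_mul_rot (θ : ℝ) : quatJ * rot θ = rot (-θ) * quatJ := by
  apply Subtype.ext
  rw [Matrix.SpecialLinearGroup.coe_mul, Matrix.SpecialLinearGroup.coe_mul]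
  simp [rot, quatJ]

lemma coe_rot_pi : (rot Real.pi).1 = -1 := by
  ext i j
  fin_cases i <;> fin_cases j <;> simp [rot, Complex.exp_neg]

lemma quatJ_sq : quatJ ^ 2 = rot Real.pi := by
  apply Subtype.ext
  rw [coe_rot_pi, pow_two, Matrix.SpecialLinearGroup.coe_mul]
  ext i j
  fin_cases i <;> fin_cases j <;> simp [quatJ]

/-- The cyclic groups consist of diagonal matrices. -/
lemma zero_of_mem_cyclicSubgroup {m : ℕ} {x : SL2} (hx : x ∈ cyclicSubgroup m) :
    x.1 0 1 = 0 ∧ x.1 0 0 ≠ 0 := by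
  have key : ∀ θ : ℝ, (rot θ).1 0 1 = 0 ∧ (rot θ).1 0 0 ≠ 0 := fun θ => by
    simp [rot, Complex.exp_ne_zero]
  obtain ⟨k, rfl⟩ := Subgroup.mem_zpowers_iff.1 hx
  obtain ⟨l, rfl | rfl⟩ := k.eq_nat_or_neg
  · rw [zpow_natCast, rot_pow]
    exact key _
  · rw [zpow_neg, zpow_natCast, rot_pow, rot_inv]
    exact key _

lemma quatJ_notMem (m : ℕ) : quatJ ∉ cyclicSubgroup m := fun h => by
  simpa [quatJ] using (zero_of_mem_cyclicSubgroup h).1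

lemma binaryDihedral_eq (n : ℕ) :
    binaryDihedral n = Subgroup.zpowers quatJ ⊔ cyclicSubgroup (2 * n) := by
  rw [cyclicSubgroup_two_mul, binaryDihedral, Subgroup.zpowers_eq_closure,
    Subgroup.zpowers_eq_closure, ← Subgroup.closure_union, Set.union_comm]
  rfl

lemma cyclicSubgroup_le (n : ℕ) : cyclicSubgroup (2 * n) ≤ binaryDihedral n := by
  rw [binaryDihedral_eq]
  exact le_sup_right

lemma rot_mem_binaryDihedral (n : ℕ) : rot (Real.pi / n) ∈ binaryDihedral n :=
  Subgroup.subset_closure (Or.inl rfl)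

lemma quatJ_mem_binaryDihedral (n : ℕ) : quatJ ∈ binaryDihedral n :=
  Subgroup.subset_closure (Or.inr rfl)

lemma card_binaryDihedral {n : ℕ} (hn : n ≠ 0) : Nat.card (binaryDihedral n) = 4 * n := by
  have hn' : (n : ℝ) ≠ 0 := Nat.cast_ne_zero.2 hn
  have hc : Nat.card (cyclicSubgroup (2 * n)) = 2 * n := card_cyclicSubgroup (by omega)
  have hfin : Finite (cyclicSubgroup (2 * n)) := Nat.finite_of_card_ne_zero (by omega)
  rw [binaryDihedral_eq, card_zpowers_sup Nat.prime_two _ _ (quatJ_notMem _), hc]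
  · ring
  · have hcl : cyclicSubgroup (2 * n) = Subgroup.closure {rot (Real.pi / n)} := by
      rw [cyclicSubgroup_two_mul, Subgroup.zpowers_eq_closure]
    rw [hcl] at hfin ⊢
    refine mem_normalizer_closure fun g hg => ?_
    rw [Set.mem_singleton_iff.1 hg, quatJ_mul_rot, mul_assoc, mul_inv_cancel, mul_one, ← rot_inv]
    exact inv_mem (Subgroup.subset_closure rfl)
  · rw [quatJ_sq, cyclicSubgroup_two_mul]
    refine Subgroup.mem_zpowers_iff.2 ⟨n, ?_⟩
    rw [zpow_natCast, rot_pow, mul_div_cancel₀ _ hn']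

/-- Conjugation by `quatJ` inverts the rotation, whose order is `2 n > 2`. -/
lemma rot_mul_quatJ_ne {n : ℕ} (hn : 2 ≤ n) :
    rot (Real.pi / n) * quatJ ≠ quatJ * rot (Real.pi / n) := by
  intro h
  rw [quatJ_mul_rot] at h
  have h1 := mul_right_cancel h
  rw [← rot_inv, eq_inv_iff_mul_eq_one, ← pow_two] at h1
  have hm : (2 * n : ℕ) ≠ 0 := by omega
  have h2 := orderOf_rot hm
  rw [show 2 * Real.pi / ((2 * n : ℕ) : ℝ) = Real.pi / n by
    push_cast; exact mul_div_mul_left _ _ two_ne_zero] at h2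
  have h3 := orderOf_dvd_of_pow_eq_one h1
  rw [h2] at h3
  have := Nat.le_of_dvd two_pos h3
  omega

lemma coe_rot_half : (rot (Real.pi / 2)).1 = !![Complex.I, 0; 0, -Complex.I] := by
  have : Complex.exp ((Real.pi / 2 : ℝ) * Complex.I) = Complex.I := by
    push_cast
    exact Complex.exp_pi_div_two_mul_I
  simp only [rot]
  rw [Complex.exp_neg, this, Complex.inv_I]

lemma quatW_mul_rot : quatW * rot (Real.pi / 2) = quatJ * quatW := by
  apply Subtype.ext
  rw [Matrix.SpecialLinearGroup.coe_mul, Matrix.SpecialLinearGroup.coe_mul, coe_rot_half]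
  ext i j
  fin_cases i <;> fin_cases j <;> simp [quatW, quatJ] <;> ring_nf <;> simp <;> ring

lemma quatW_mul_quatJ : quatW * quatJ = rot (Real.pi / 2) * quatJ * quatW := by
  apply Subtype.ext
  rw [Matrix.SpecialLinearGroup.coe_mul, Matrix.SpecialLinearGroup.coe_mul,
    Matrix.SpecialLinearGroup.coe_mul, coe_rot_half]
  ext i j
  fin_cases i <;> fin_cases j <;> simp [quatW, quatJ] <;> ring_nf <;> simp <;> ring

lemma quatW_pow_three : quatW ^ 3 = rot Real.pi := by
  apply Subtype.ext
  rw [coe_rot_pi, pow_succ, pow_two, Matrix.SpecialLinearGroup.coe_mul,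
    Matrix.SpecialLinearGroup.coe_mul]
  ext i j
  fin_cases i <;> fin_cases j <;> simp [quatW, Matrix.mul_apply, Fin.sum_univ_two] <;>
    ring_nf <;> simp <;> ring

end ExplicitGroups

/-! ### Binary tetrahedral and octahedral groups -/

section Polyhedral

lemma binaryDihedral_two :
    binaryDihedral 2 = Subgroup.closure {rot (Real.pi / 2), quatJ} := by
  rw [binaryDihedral, Nat.cast_ofNat]

lemma card_binaryDihedral_two : Nat.card (binaryDihedral 2) = 8 :=
  card_binaryDihedral two_ne_zero

lemma binaryTetrahedral_eq :
    binaryTetrahedral = Subgroup.zpowers quatW ⊔ binaryDihedral 2 := by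
  rw [binaryDihedral_two, binaryTetrahedral, Subgroup.zpowers_eq_closure, ← Subgroup.closure_union]
  congr 1
  ext x
  simp only [Set.mem_insert_iff, Set.mem_singleton_iff, Set.mem_union]
  tauto

lemma quatW_mem_normalizer : quatW ∈ Subgroup.normalizer (binaryDihedral 2 : Set SL2) := by
  have hfin : Finite (binaryDihedral 2) :=
    Nat.finite_of_card_ne_zero (by rw [card_binaryDihedral_two]; norm_num)
  rw [binaryDihedral_two] at hfin ⊢
  have hr : rot (Real.pi / 2) ∈ Subgroup.closure {rot (Real.pi / 2), quatJ} :=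
    Subgroup.subset_closure (Or.inl rfl)
  have hJ : quatJ ∈ Subgroup.closure {rot (Real.pi / 2), quatJ} :=
    Subgroup.subset_closure (Or.inr rfl)
  refine mem_normalizer_closure fun g hg => ?_
  rcases hg with rfl | rfl
  · rw [quatW_mul_rot, mul_inv_cancel_right]
    exact hJ
  · rw [quatW_mul_quatJ, mul_inv_cancel_right]
    exact mul_mem hr hJ

lemma rot_half_mem : rot (Real.pi / 2) ∈ binaryDihedral 2 := by
  simpa using rot_mem_binaryDihedral 2

lemma quatW_pow_mem : quatW ^ 3 ∈ binaryDihedral 2 := by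
  rw [quatW_pow_three, show Real.pi = (2 : ℕ) * (Real.pi / 2) by push_cast; ring, ← rot_pow]
  exact pow_mem rot_half_mem 2

/-- As `quatW ^ 3 = -1`, an eighth power equal to one would make `quatW` scalar. -/
lemma quatW_notMem : quatW ∉ binaryDihedral 2 := by
  intro h
  have h8 : quatW ^ 8 = 1 := by
    have := congrArg Subtype.val (pow_card_eq_one' (x := (⟨quatW, h⟩ : binaryDihedral 2)))
    rw [card_binaryDihedral_two] at this
    exact this
  have h1 : quatW = rot Real.pi ^ 3 * (quatW ^ 8)⁻¹ := by
    rw [← quatW_pow_three]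
    group
  have h2 := congrFun (congrFun (congrArg Subtype.val h1) 0) 1
  rw [h8, inv_one, mul_one, rot_pow] at h2
  have h3 := congrArg Complex.re h2
  simp [quatW, rot] at h3

lemma card_binaryTetrahedral : Nat.card binaryTetrahedral = 24 := by
  rw [binaryTetrahedral_eq, card_zpowers_sup Nat.prime_three quatW_mem_normalizer quatW_pow_mem
    quatW_notMem, card_binaryDihedral_two]

lemma binaryDihedral_two_le : binaryDihedral 2 ≤ binaryTetrahedral := by
  rw [binaryTetrahedral_eq]
  exact le_sup_right

lemma quatW_mem : quatW ∈ binaryTetrahedral :=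
  Subgroup.subset_closure (Or.inr (Or.inr rfl))

/-- `D_2` is normal of index three in `T`. -/
lemma pow_three_mem {x : SL2} (hx : x ∈ binaryTetrahedral) : x ^ 3 ∈ binaryDihedral 2 := by
  have hn : ((binaryDihedral 2).subgroupOf binaryTetrahedral).Normal := by
    rw [binaryTetrahedral_eq]
    exact Subgroup.normal_subgroupOf_sup_of_le_normalizer
      (Subgroup.zpowers_le.2 quatW_mem_normalizer)
  have hi : ((binaryDihedral 2).subgroupOf binaryTetrahedral).index = 3 := by
    have := ((binaryDihedral 2).subgroupOf binaryTetrahedral).card_mul_index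
    rw [Nat.card_congr (Subgroup.subgroupOfEquivOfLe binaryDihedral_two_le).toEquiv,
      card_binaryDihedral_two, card_binaryTetrahedral] at this
    omega
  have := Subgroup.pow_index_mem ((binaryDihedral 2).subgroupOf binaryTetrahedral) ⟨x, hx⟩
  rw [hi] at this
  exact this

lemma binaryOctahedral_eq :
    binaryOctahedral = Subgroup.zpowers (rot (Real.pi / 4)) ⊔ binaryTetrahedral := by
  rw [binaryOctahedral, binaryTetrahedral, Subgroup.zpowers_eq_closure, ← Subgroup.closure_union]
  apply le_antisymm
  · refine Subgroup.closure_mono fun x hx => ?_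
    simp only [Set.mem_insert_iff, Set.mem_singleton_iff, Set.mem_union] at hx ⊢
    tauto
  · rw [Subgroup.closure_le]
    have h4 : rot (Real.pi / 4) ∈
        Subgroup.closure {rot (Real.pi / 4), quatJ, quatW} := Subgroup.subset_closure (Or.inl rfl)
    rintro x (rfl | rfl | rfl | rfl)
    · exact h4
    · rw [show Real.pi / 2 = Real.pi / 4 + Real.pi / 4 by ring, rot_add]
      exact mul_mem h4 h4
    · exact Subgroup.subset_closure (Or.inr (Or.inl rfl))
    · exact Subgroup.subset_closure (Or.inr (Or.inr rfl))

/-- The relation by which `rot (π / 4)` normalizes the binary tetrahedral group. -/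
lemma quatW_mul_rot_mul_quatW :
    quatW * rot (Real.pi / 4) * quatW = rot (Real.pi / 2) * rot (Real.pi / 4) := by
  have hz : Complex.exp (-((Real.pi / 4 : ℝ) * Complex.I)) =
      -Complex.I * Complex.exp ((Real.pi / 4 : ℝ) * Complex.I) := by
    have h : Complex.exp ((Real.pi / 4 : ℝ) * Complex.I) *
        Complex.exp ((Real.pi / 4 : ℝ) * Complex.I) = Complex.I := by
      rw [← Complex.exp_add, show ((Real.pi / 4 : ℝ) * Complex.I + (Real.pi / 4 : ℝ) * Complex.I) =
        Real.pi / 2 * Complex.I by push_cast; ring, Complex.exp_pi_div_two_mul_I]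
    rw [Complex.exp_neg]
    apply inv_eq_of_mul_eq_one_left
    linear_combination (-Complex.I) * h - Complex.I_sq
  have h4 : (rot (Real.pi / 4)).1 = !![Complex.exp ((Real.pi / 4 : ℝ) * Complex.I), 0; 0,
      -Complex.I * Complex.exp ((Real.pi / 4 : ℝ) * Complex.I)] := by
    rw [← hz]
    rfl
  apply Subtype.ext
  rw [Matrix.SpecialLinearGroup.coe_mul, Matrix.SpecialLinearGroup.coe_mul,
    Matrix.SpecialLinearGroup.coe_mul, coe_rot_half, h4]
  generalize Complex.exp ((Real.pi / 4 : ℝ) * Complex.I) = z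
  have hI := Complex.I_sq
  ext i j
  fin_cases i <;> fin_cases j <;> simp [quatW, Matrix.mul_apply, Fin.sum_univ_two] <;>
    grind

lemma rot_mem_normalizer : rot (Real.pi / 4) ∈
    Subgroup.normalizer (binaryTetrahedral : Set SL2) := by
  have hfin : Finite binaryTetrahedral :=
    Nat.finite_of_card_ne_zero (by rw [card_binaryTetrahedral]; norm_num)
  have hr : rot (Real.pi / 2) ∈ binaryTetrahedral := Subgroup.subset_closure (Or.inl rfl)
  have hJ : quatJ ∈ binaryTetrahedral := Subgroup.subset_closure (Or.inr (Or.inl rfl))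
  have hW : quatW ∈ binaryTetrahedral := quatW_mem
  rw [binaryTetrahedral] at hfin ⊢
  refine mem_normalizer_closure fun g hg => ?_
  rw [← binaryTetrahedral]
  rcases hg with rfl | rfl | rfl
  · rw [← rot_add, add_comm, rot_add, mul_inv_cancel_right]
    exact hr
  · rw [rot_inv, mul_assoc, quatJ_mul_rot, neg_neg, ← mul_assoc, ← rot_add]
    rw [show Real.pi / 4 + Real.pi / 4 = Real.pi / 2 by ring]
    exact mul_mem hr hJ
  · have h : rot (Real.pi / 4) * quatW * (rot (Real.pi / 4))⁻¹ =
        quatW⁻¹ * rot (Real.pi / 2) := by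
      rw [eq_inv_mul_iff_mul_eq, ← mul_assoc, ← mul_assoc, quatW_mul_rot_mul_quatW,
        mul_inv_cancel_right]
    rw [h]
    exact mul_mem (inv_mem hW) hr

/-- Otherwise `rot (π / 4)` lies in `D_2`, as its square and its cube do; but it has order eight,
and `D_2` is not cyclic. -/
lemma rot_notMem : rot (Real.pi / 4) ∉ binaryTetrahedral := by
  intro h
  have h3 := pow_three_mem h
  have h2 : rot (Real.pi / 4) ^ 2 ∈ binaryDihedral 2 := by
    rw [rot_pow, show ((2 : ℕ) : ℝ) * (Real.pi / 4) = Real.pi / 2 by push_cast; ring]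
    exact rot_half_mem
  have h1 : rot (Real.pi / 4) ∈ binaryDihedral 2 := by
    have := mul_mem h3 (inv_mem h2)
    rwa [show rot (Real.pi / 4) ^ 3 * (rot (Real.pi / 4) ^ 2)⁻¹ = rot (Real.pi / 4) by group]
      at this
  have hcyc : cyclicSubgroup 8 = Subgroup.zpowers (rot (Real.pi / 4)) := by
    rw [cyclicSubgroup]
    congr 2
    push_cast
    ring
  have hle : cyclicSubgroup 8 ≤ binaryDihedral 2 := by
    rw [hcyc]
    exact Subgroup.zpowers_le.2 h1
  have hfin : Finite (binaryDihedral 2) :=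
    Nat.finite_of_card_ne_zero (by rw [card_binaryDihedral_two]; norm_num)
  have heq := Subgroup.eq_of_le_of_card_ge hle
    (by rw [card_binaryDihedral_two, card_cyclicSubgroup (by norm_num)])
  refine quatJ_notMem 8 ?_
  rw [heq]
  exact quatJ_mem_binaryDihedral 2

lemma card_binaryOctahedral : Nat.card binaryOctahedral = 48 := by
  rw [binaryOctahedral_eq, card_zpowers_sup Nat.prime_two rot_mem_normalizer _ rot_notMem,
    card_binaryTetrahedral]
  rw [rot_pow, show ((2 : ℕ) : ℝ) * (Real.pi / 4) = Real.pi / 2 by push_cast; ring]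
  exact Subgroup.subset_closure (Or.inl rfl)

/-- The squares in the binary tetrahedral group do not all commute. -/
lemma quatW_sq_ne : quatW ^ 2 * (quatW * quatJ) ^ 2 ≠ (quatW * quatJ) ^ 2 * quatW ^ 2 := by
  intro h
  have h1 := congrFun (congrFun (congrArg Subtype.val h) 0) 1
  simp only [pow_two, Matrix.SpecialLinearGroup.coe_mul] at h1
  have h2 := congrArg Complex.re h1
  simp [quatW, quatJ, Matrix.mul_apply, Fin.sum_univ_two] at h2
  norm_num at h2

lemma exists_sq_ne : ∃ x ∈ binaryTetrahedral, ∃ y ∈ binaryTetrahedral,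
    x ^ 2 * y ^ 2 ≠ y ^ 2 * x ^ 2 :=
  ⟨quatW, quatW_mem, quatW * quatJ,
    mul_mem quatW_mem (Subgroup.subset_closure (Or.inr (Or.inl rfl))), quatW_sq_ne⟩

end Polyhedral

/-! ### The distinguished pairs -/

section Transport

variable {G : Subgroup SL2} {N : Subgroup G} {G₀ N₀ : Subgroup SL2}

/-- A pair that is conjugate to a standard pair is mapped onto it by an injective homomorphism. -/
lemma IsConjPair.exists_hom (hc : IsConjPair G N G₀ N₀) :
    ∃ F : G →* SL2, Function.Injective F ∧ F.range = G₀ ∧ N.map F = N₀ := by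
  obtain ⟨g, hG, hN⟩ := hc
  refine ⟨(MulAut.conj g).toMonoidHom.comp G.subtype,
    (MulAut.conj g).injective.comp G.subtype_injective, ?_, ?_⟩
  · rw [MonoidHom.range_comp, Subgroup.range_subtype, hG]
  · rw [← Subgroup.map_map, hN]

lemma card_comap_of_le_range {P Q : Type*} [Group P] [Group Q] {F : P →* Q}
    (hF : Function.Injective F) {K : Subgroup Q} (hK : K ≤ F.range) :
    Nat.card (K.comap F) = Nat.card K := by
  rw [← Subgroup.card_map_of_injective hF, Subgroup.map_comap_eq_self hK]

lemma index_eq_of_card {P : Type*} [Group P] [Finite P] {K : Subgroup P} {m : ℕ}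
    (h : Nat.card P = m * Nat.card K) : K.index = m := by
  have := K.card_mul_index
  rw [h, mul_comm] at this
  exact Nat.eq_of_mul_eq_mul_right Nat.card_pos this

lemma comap_comm {P Q : Type*} [Group P] [Group Q] {F : P →* Q}
    (hF : Function.Injective F) {K : Subgroup Q} (hK : ∀ x ∈ K, ∀ y ∈ K, x * y = y * x) :
    ∀ x ∈ K.comap F, ∀ y ∈ K.comap F, x * y = y * x := fun x hx y hy =>
  hF (by rw [map_mul, map_mul]; exact hK _ hx _ hy)

variable [Finite G] [N.Normal] [Fintype G] [Fintype N] {τ : Type*} [Fintype τ] {r : τ → ℕ}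
  {ρ : ∀ i, Representation ℂ G (Fin (r i) → ℂ)} {a b h : ℕ}

/-- The sum of the dimensions of the restricted modules, and the properties of the pairs that are
needed otherwise. -/
theorem IsDistinguishedPair.sum_dim (hNG : IsDistinguishedPair G N) (hρ : IsRestrictionList N ρ)
    (hT : HasType (incl N) a b h) :
    (N.index ≠ 4 → h = ∑ i, r i) ∧ (N.index = 4 → h + 1 = ∑ i, r i) ∧
      (N.index = 1 ∨ N.index = 2 ∨ N.index = 3 ∨ N.index = 4) ∧ (N = ⊤ ∨ Even (Nat.card N)) := by
  have hf : Function.Injective G.subtype := G.subtype_injective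
  rcases hNG with hN | ⟨n, hn, hc⟩ | ⟨n, hn, hc⟩ | ⟨n, hn, hc⟩ | hc | hc
  · have hi : N.index = 1 := Subgroup.index_eq_one.2 hN
    exact ⟨fun _ => (hT.dimensions (hρ.isIrrepList hN)).2, fun h4 => by omega, Or.inl hi,
      Or.inl hN⟩
  -- In the other cases, elements of the standard groups are pulled back along the conjugation.
  all_goals
    obtain ⟨F, hF, hG₀, hN₀⟩ := hc.exists_hom
    have hcN := Subgroup.card_map_of_injective hF (K := N)
    have hcG := Nat.card_congr (MonoidHom.ofInjective hF).toEquiv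
    rw [hN₀] at hcN
    rw [hG₀] at hcG
    have hex : ∀ x ∈ N.map F, ∃ x' ∈ N, F x' = x := fun x hx => hx
    have hexG : ∀ x ∈ F.range, ∃ x', F x' = x := fun x hx => hx
    rw [hN₀] at hex
    rw [hG₀] at hexG
  · rw [card_binaryDihedral (by omega)] at hcG hcN
    have hi : N.index = 2 := index_eq_of_card (by omega)
    have hK : cyclicSubgroup (2 * (2 * n)) ≤ F.range := by
      rw [hG₀]
      exact cyclicSubgroup_le _
    have hKi : ((cyclicSubgroup (2 * (2 * n))).comap F).index = 2 := index_eq_of_card (by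
      rw [card_comap_of_le_range hF hK, card_cyclicSubgroup (by omega)]
      omega)
    obtain ⟨x, hx, hxe⟩ := hex _ (rot_mem_binaryDihedral n)
    obtain ⟨y, hy, hye⟩ := hex _ (quatJ_mem_binaryDihedral n)
    have := hT.sum_dim_dihedral_dihedral hf hρ hKi (comap_comm hF (cyclicSubgroup_comm _))
      ⟨x, hx, y, hy, fun h => rot_mul_quatJ_ne hn (by rw [← hxe, ← hye, ← map_mul, h, map_mul])⟩ hi
    exact ⟨fun _ => this, fun h4 => by omega, Or.inr (Or.inl hi), Or.inr ⟨2 * n, by omega⟩⟩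
  · rw [card_binaryDihedral (by omega)] at hcG
    rw [card_cyclicSubgroup (by omega)] at hcN
    have hi : N.index = 2 := index_eq_of_card (by omega)
    have he : Even (Nat.card N) := ⟨n, by omega⟩
    obtain ⟨x, hxe⟩ := hexG _ (rot_mem_binaryDihedral n)
    obtain ⟨y, hye⟩ := hexG _ (quatJ_mem_binaryDihedral n)
    have hNc : ∀ x ∈ N, ∀ y ∈ N, x * y = y * x := fun x hx y hy =>
      comap_comm hF (cyclicSubgroup_comm (2 * n)) x (hN₀ ▸ Subgroup.mem_map_of_mem F hx) y
        (hN₀ ▸ Subgroup.mem_map_of_mem F hy)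
    have := hT.sum_dim_cyclic_dihedral hf hρ hNc
      ⟨x, y, fun h => rot_mul_quatJ_ne hn (by rw [← hxe, ← hye, ← map_mul, h, map_mul])⟩ he hi
    exact ⟨fun _ => this, fun h4 => by omega, Or.inr (Or.inl hi), Or.inr he⟩
  · rw [card_binaryDihedral (by omega)] at hcG
    rw [card_cyclicSubgroup (by omega)] at hcN
    have hi : N.index = 4 := index_eq_of_card (by omega)
    have he : Even (Nat.card N) := ⟨n, by omega⟩
    have hK : cyclicSubgroup (2 * (2 * n)) ≤ F.range := by
      rw [hG₀]
      exact cyclicSubgroup_le _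
    have hKi : ((cyclicSubgroup (2 * (2 * n))).comap F).index = 2 := index_eq_of_card (by
      rw [card_comap_of_le_range hF hK, card_cyclicSubgroup (by omega)]
      omega)
    obtain ⟨x, hxe⟩ := hexG _ (rot_mem_binaryDihedral (2 * n))
    obtain ⟨y, hye⟩ := hexG _ (quatJ_mem_binaryDihedral (2 * n))
    have hn' : (n : ℝ) ≠ 0 := Nat.cast_ne_zero.2 (by omega)
    -- The commutator of the generators of `D_{2n}` is `rot (π / 2n)² = rot (π / n)`, a generator of
    -- `C_{2n}`.
    have hcomm : F (x * y * x⁻¹ * y⁻¹) = rot (Real.pi / n) := by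
      rw [map_mul, map_mul, map_mul, map_inv, map_inv, hxe, hye, mul_assoc (rot _), rot_inv,
        quatJ_mul_rot, neg_neg, ← mul_assoc, mul_inv_cancel_right, ← rot_add]
      congr 1
      push_cast
      field_simp
      norm_num
    have hNz : N ≤ Subgroup.zpowers (x * y * x⁻¹ * y⁻¹) := by
      intro g hg
      have h1 := Subgroup.mem_map_of_mem F hg
      rw [hN₀, cyclicSubgroup_two_mul, ← hcomm, ← MonoidHom.map_zpowers,
        Subgroup.mem_map_iff_mem hF] at h1
      exact h1
    have hNK : N ≤ (cyclicSubgroup (2 * (2 * n))).comap F := by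
      rw [← Subgroup.map_le_iff_le_comap, hN₀, cyclicSubgroup_two_mul, cyclicSubgroup_two_mul,
        Subgroup.zpowers_le]
      refine Subgroup.mem_zpowers_iff.2 ⟨(2 : ℕ), ?_⟩
      rw [zpow_natCast, rot_pow]
      congr 1
      push_cast
      field_simp
    have := hT.sum_dim_cyclic_dihedral_four hf hρ hKi (comap_comm hF (cyclicSubgroup_comm _))
      ⟨x, y, fun h => rot_mul_quatJ_ne (n := 2 * n) (by omega)
        (by rw [← hxe, ← hye, ← map_mul, h, map_mul])⟩ hNK he hNz hi
    exact ⟨fun h4 => absurd hi h4, fun _ => this, Or.inr (Or.inr (Or.inr hi)), Or.inr he⟩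
  · rw [card_binaryOctahedral] at hcG
    rw [card_binaryTetrahedral] at hcN
    have hi : N.index = 2 := index_eq_of_card (by omega)
    obtain ⟨x₀, hx₀, y₀, hy₀, hne⟩ := exists_sq_ne
    obtain ⟨x, hx, rfl⟩ := hex _ hx₀
    obtain ⟨y, hy, rfl⟩ := hex _ hy₀
    have := hT.sum_dim_tetrahedral_octahedral hf hρ ⟨x, hx, y, hy, fun h => hne (by
      rw [← map_pow, ← map_pow, ← map_mul, h, map_mul])⟩ hcN.symm hi
    exact ⟨fun _ => this, fun h4 => by omega, Or.inr (Or.inl hi), Or.inr ⟨12, by omega⟩⟩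
  · rw [card_binaryTetrahedral] at hcG
    rw [card_binaryDihedral_two] at hcN
    have hi : N.index = 3 := index_eq_of_card (by omega)
    obtain ⟨x₀, hx₀, y₀, hy₀, hne⟩ := exists_sq_ne
    obtain ⟨x, rfl⟩ := hexG _ hx₀
    obtain ⟨y, rfl⟩ := hexG _ hy₀
    obtain ⟨u, hu, hue⟩ := hex _ (rot_mem_binaryDihedral 2)
    obtain ⟨v, hv, hve⟩ := hex _ (quatJ_mem_binaryDihedral 2)
    have := hT.sum_dim_dihedral_tetrahedral hf hρ ⟨x, y, fun h => hne (by
        rw [← map_pow, ← map_pow, ← map_mul, h, map_mul])⟩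
      ⟨u, hu, v, hv, fun h => rot_mul_quatJ_ne le_rfl (by
        rw [← hue, ← hve, ← map_mul, h, map_mul])⟩ hcN.symm hi
    exact ⟨fun _ => this, fun h4 => by omega, Or.inr (Or.inr (Or.inl hi)), Or.inr ⟨4, by omega⟩⟩

end Transport

/-! ### Absence of loops -/

section Loops

variable {H : Type*} [Group H] [Fintype H] {f : H →* SL2} {ι : Type*} [Fintype ι] {B : Matrix ι ι ℕ}
  {o : ι} {x : ℕ → ι → ℕ} {ψ : ι → H → ℂ} {n : ι → ℕ} {c : ℕ} {a b h : ℕ}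

lemma HasType.even_card_or (hT : HasType f a b h) :
    Even (Nat.card H) ∨ ∀ x y : H, x * y = y * x := by
  rcases hT.2 with ⟨-, hc⟩ | ⟨m, -, h4, -⟩ | h3 | h3 | h3
  · exact Or.inr hc
  · exact Or.inl ⟨2 * m, by omega⟩
  · exact Or.inl ⟨12, by omega⟩
  · exact Or.inl ⟨24, by omega⟩
  · exact Or.inl ⟨60, by omega⟩

/-- Away from the special vertex there are no loops: if `-1` is in the group by parity, otherwise
because the group is commutative and has no invariants in `V`. -/
lemma IsCharacterSystem.no_loops (S : IsCharacterSystem f B o x ψ n c)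
    (hf : Function.Injective f) (hT : HasType f a b h)
    (hψ : Even (Nat.card H) ∨
      ((∀ x y : H, x * y = y * x) → ∀ i, ∃ s, ∀ g, ψ i g * ψ i g⁻¹ = s)) :
    ∀ i, i ≠ o → B i i = 0 := by
  intro i hi
  have hor : Even (Nat.card H) ∨
      (∀ x y : H, x * y = y * x) ∧ ∀ i, ∃ s, ∀ g, ψ i g * ψ i g⁻¹ = s := by
    have := hT.even_card_or
    tauto
  rcases hor with he | ⟨hc, hψ⟩
  · obtain ⟨z, hz⟩ := exists_neg_one hf he
    exact S.loop_eq_zero hz i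
  · -- In the commutative case the weight `|ψ i|²` is constant, so the loops at `i` are counted by
    -- the invariants in `V`.
    obtain ⟨s, hs⟩ := hψ i
    obtain ⟨rfl, -, hh⟩ := hT.of_comm hc
    refine S.loop_eq_zero_of_norm hs ?_
    -- On a trivial group `ψ i` and `ψ o` could not be orthogonal.
    have hcard : 1 < h := by
      rw [hh]
      by_contra! hle
      have hsub : Subsingleton H := (Finite.card_le_one_iff_subsingleton).1 hle
      have h1 := S.orth i o hi
      have h2 : ∀ g, ψ i g * ψ o g⁻¹ = ψ i 1 * c := fun g => by
        rw [S.const, Subsingleton.elim g 1]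
      simp only [h2, Finset.sum_const, nsmul_eq_mul] at h1
      have hcpos : (c : ℂ) ≠ 0 := Nat.cast_ne_zero.2 S.c_pos.ne'
      exact mul_ne_zero (Nat.cast_ne_zero.2 (Finset.card_ne_zero.2 Finset.univ_nonempty))
        (mul_ne_zero (S.one_ne_zero i) hcpos) h1
    have hadd := hT.1.add
    -- `V` has no invariants, both degrees and `h` being larger than one.
    have h1 := hT.1.coeff_sum_molien one_pos hcard
    rw [if_neg (by norm_num), if_neg (by omega), add_zero, map_sum, S.sum_molien_eq, S.x_one] at h1
    have hcpos : (Nat.card H : ℂ) ≠ 0 := Nat.cast_ne_zero.2 Nat.card_pos.ne'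
    exact_mod_cast (mul_eq_zero.1 h1).resolve_left hcpos

end Loops

end McKaySlodowy

theorem mainTheorem3
    (G : Subgroup McKaySlodowy.SL2) [Finite G] (N : Subgroup G) [N.Normal]
    (hNG : McKaySlodowy.IsDistinguishedPair G N)
    {κ : Type*} [Fintype κ] (e : κ → ℕ) (φ : ∀ i, Representation ℂ N (Fin (e i) → ℂ))
    (hφ : McKaySlodowy.IsIrrepList φ)
    {τ : Type*} [Fintype τ] (r : τ → ℕ) (ρ : ∀ i, Representation ℂ G (Fin (r i) → ℂ))
    (hρ : McKaySlodowy.IsRestrictionList N ρ)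
    {ι : Type*} [Fintype ι] [DecidableEq ι] (A : Matrix ι ι ℤ) (o : ι) (x : ℕ → ι → ℕ)
    (hA : McKaySlodowy.IsRestrictedRealization N A o x ∨
      McKaySlodowy.IsInducedRealization N A o x)
    (h : ℕ) (hh : h = McKaySlodowy.coxeterNumber (McKaySlodowy.finitePart A o))
    (a : ℕ) (ha : a = 2 * Finset.univ.sup e) :
    (N.index ≠ 4 → h = ∑ i, r i) ∧
    (N.index = 4 → h + 1 = ∑ i, r i) ∧
    ∃ b : ℕ, a + b = h + 2 ∧
      a * b = 2 * Nat.card N ∧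
      (N = ⊤ → a * b = 2 * Nat.card G) ∧
      (Even (Nat.card N) →
        ∃ g : ℕ, h = 2 * g ∧
        (∃ P₁ P₂ : Finset ι, McKaySlodowy.IsBipartition A o P₁ P₂) ∧
        (∃ ε : ι → ℚ, McKaySlodowy.IsSymmetrizer A ε) ∧
        ∀ P₁ P₂ : Finset ι, McKaySlodowy.IsBipartition A o P₁ P₂ →
          (∀ ε : ι → ℚ, McKaySlodowy.IsSymmetrizer A ε →
            ∑ i ∈ Finset.range (g + 2),
              Polynomial.C (McKaySlodowy.cCoeff A o P₁ P₂ ε g (i : ℤ) -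
                McKaySlodowy.cCoeff A o P₁ P₂ ε g ((i : ℤ) - 1)) * Polynomial.X ^ (2 * i) =
              (1 - Polynomial.X ^ a) * (1 - Polynomial.X ^ b)) ∧
          ∀ j : ι,
            PowerSeries.mk (fun k => (x k j : ℤ)) *
                ((1 - PowerSeries.X ^ a) * (1 - PowerSeries.X ^ b)) =
              ∑ i ∈ Finset.range (h + 1),
                PowerSeries.C (McKaySlodowy.zVec A o P₁ P₂ h i j) * PowerSeries.X ^ i) := by
  open McKaySlodowy in
  have := Fintype.ofFinite G
  have := Fintype.ofFinite N
  -- the degrees of `N`, to be identified with `a`, `b`, `h` below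
  obtain ⟨a', b, h', hT⟩ := exists_hasType (incl_injective N)
  obtain ⟨hs, hs4, hidx, heven⟩ := hNG.sum_dim hρ hT
  -- both realizations are the same linear algebra over functions on `N`; constancy of `|ψ i|²` is
  -- what excludes loops when `N = G` is commutative of odd order
  obtain ⟨B, ψ, n, c, hAB, S, hψ⟩ : ∃ (B : Matrix ι ι ℕ) (ψ : ι → N → ℂ) (n : ι → ℕ) (c : ℕ),
      (∀ i j, A i j = (if i = j then 2 else 0) - (B j i : ℤ)) ∧
      IsCharacterSystem (incl N) B o x ψ n c ∧
      (N = ⊤ → (∀ x y : N, x * y = y * x) → ∀ i, ∃ s, ∀ g, ψ i g * ψ i g⁻¹ = s) := by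
    rcases hA with hA | hA
    · exact hA.exists_system N (commutator_mem_of_index hidx)
    · exact hA.exists_system N
  have hcox := S.coxeterNumber_eq (incl_injective N) hT.1 hAB
    (S.no_loops (incl_injective N) hT (heven.symm.imp_right hψ))
  obtain rfl : h = h' := hh.trans hcox
  obtain rfl : a = a' := ha.trans (hT.dimensions hφ).1.symm
  refine ⟨hs, hs4, b, hT.1.add, hT.1.mul, fun hN => ?_, fun he => ?_⟩
  · rw [hT.1.mul, hN, Subgroup.card_top]
  · obtain ⟨g, hg⟩ := hT.even_h he
    -- the parity under `-1` divides the vertices into two sets and leaves no loops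
    obtain ⟨z, hz⟩ := exists_neg_one (incl_injective N) he
    have hB := S.loop_eq_zero hz
    exact ⟨g, by omega, S.exists_isBipartition hz hAB, ⟨_, S.isSymmetrizer hAB⟩, fun P₁ P₂ hP =>
      ⟨fun ε hε => S.sum_cCoeff hT.1 hAB hB hP (by omega) hε,
        fun j => S.series_eq hT.1 hAB hB hP j⟩⟩
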